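/- Let $\mathcal F,\mathcal F'$ be germs at $0\in\mathbb C^2$ of nondegenerate reduced holomorphic foliations, i.e. each is defined, in suitable coordinates, by a $1$-form with linear part $\lambda_1y\,dx+\lambda_2x\,dy$ with $\lambda_1\lambda_2\neq0$ and $\lambda_2/\lambda_1\notin\mathbb Q_{<0}$. Label their separatrices $S_1,S_2$ and $S_1',S_2'$. Let $\mathcal L,\mathcal L'$ be germs of regular holomorphic foliations whose leaves through $0$ are transverse to both separatrices of $\mathcal F$, resp. of $\mathcal F'$. Write $\mathrm{CS}(\mathcal F)$ for the Camacho–Sad index of $\mathcal F$ along $S_1$ (equal to $-\lambda_2/\lambda_1$ if $S_1$ is tangent to $\{x=0\}$ and $S_2$ to $\{y=0\}$), and $\mathrm{CS}(\mathcal F')$ for that of $\mathcal F'$ along $S_1'$. Let $T$ be the tangency curve of $\mathcal F$ and $\mathcal L$, which is smooth and transverse to $S_1$ and $S_2$. After blowing up $0$, let $p_1,p_2,p$ be the points of the exceptional line $D\cong\mathbb{CP}^1$ given by the directions of $S_1,S_2,T$, and let $\gamma$ be a generator of $\pi_1(D\setminus\{p_1,p_2\},p)\cong\mathbb Z$. The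 holonomy of the blown-up foliation along $\gamma$ on the strict transform of $T$ induces a germ $h_\gamma\in\mathrm{Diff}(T,0)$. With $\pi_{S_1}:T\to S_1$ the projection along the leaves of $\mathcal L$, the sliding of $\mathcal F$ and $\mathcal L$ on $S_1$ is $g_{S_1}(\mathcal F,\mathcal L)=\pi_{S_1}\circ h_\gamma\circ\pi_{S_1}^{-1}$. The sliding $g_{S_1'}(\mathcal F',\mathcal L')$ is defined in the same way, using the generator $\gamma'$ that turns around the direction of $S_1'$ in the same sense as $\gamma$ turns around that of $S_1$. The slidings are well-defined germs of diffeomorphisms (biholomorphisms), and the following hold. 1. If $\Phi$ is a germ of diffeomorphism of $(\mathbb C^2,0)$ sending $\mathcal F$ to $\mathcal F'$, $\mathcal L$ to $\mathcal L'$ and $S_1$ to $S_1'$, then $\Phi$ restricts to a germ of diffeomorphism $\Phi_{|S_1}:S_1\to S_1'$ and $$\Phi_{|S_1}\circ g_{S_1}(\mathcal F,\mathcal L)=g_{S_1'}(\mathcal F',\mathcal L')\circ\Phi_{|S_1}.$$ 2. Conversely, if $\mathrm{CS}(\mathcal F)=\mathrm{CS}(\mathcal F')$ and $\phi:S_1\to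 S_1'$ is a germ of diffeomorphism (fixing $0$) with $$\phi\circ g_{S_1}(\mathcal F,\mathcal L)=g_{S_1'}(\mathcal F',\mathcal L')\circ\phi,$$ then there is exactly one germ of diffeomorphism $\Phi$ of $(\mathbb C^2,0)$ that sends $\mathcal F$ to $\mathcal F'$ and $\mathcal L$ to $\mathcal L'$ and satisfies $\Phi_{|S_1}=\phi$. -/

import Mathlib

open Filter Topology

namespace Sliding

/-- A holomorphic 1-form on (a neighbourhood of the origin in) `ℂ²`. -/
abbrev OneForm := ℂ × ℂ → (ℂ × ℂ →L[ℂ] ℂ)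

/-- Germ at the origin of a biholomorphism of `(ℂ, 0)`. -/
structure IsDiffeoGerm₁ (φ : ℂ → ℂ) : Prop where
  analytic : AnalyticAt ℂ φ 0
  map_zero : φ 0 = 0
  deriv_ne : deriv φ 0 ≠ 0

/-- Germ at the origin of a biholomorphism of `(ℂ², 0)`. -/
structure IsDiffeoGerm₂ (Φ : ℂ × ℂ → ℂ × ℂ) : Prop where
  analytic : AnalyticAt ℂ Φ 0
  map_zero : Φ 0 = 0
  invertible : (fderiv ℂ Φ 0).IsInvertible

/-- `c` is a parametrization of the germ of a smooth analytic curve through the origin of `ℂ²`. -/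
structure IsSmoothCurve (c : ℂ → ℂ × ℂ) : Prop where
  analytic : AnalyticAt ℂ c 0
  map_zero : c 0 = 0
  deriv_ne : deriv c 0 ≠ 0

/-- The germ of foliation `ω = 0` is reduced and nondegenerate: in suitable coordinates the linear
part of `ω` is `l₁ y dx + l₂ x dy` with `l₁, l₂ ≠ 0` and `l₂ / l₁` not a negative rational.
(As `ω 0 = 0`, a change of coordinates and multiplication of `ω` by a unit act on the linear part
only through the derivative of the former and the value of the latter at the origin, so linear
coordinates, with axes spanned by `a` and `b`, suffice.) -/
structure IsNondegenerateReduced (ω : OneForm) : Prop where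
  analytic : AnalyticAt ℂ ω 0
  map_zero : ω 0 = 0
  linear_part : ∃ (a b : ℂ × ℂ) (l₁ l₂ : ℂ), LinearIndependent ℂ ![a, b] ∧
    l₁ ≠ 0 ∧ l₂ ≠ 0 ∧ (∀ q : ℚ, q < 0 → l₂ / l₁ ≠ (q : ℂ)) ∧
    ∀ x y x' y' : ℂ, fderiv ℂ ω 0 (x • a + y • b) (x' • a + y' • b) = l₁ * y * x' + l₂ * x * y'

/-- The smooth curve parametrized by `s` is a separatrix (an invariant curve) of `ω = 0`. -/
structure IsSeparatrix (ω : OneForm) (s : ℂ → ℂ × ℂ) : Prop where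
  smooth : IsSmoothCurve s
  invariant : ∀ᶠ z in 𝓝 (0 : ℂ), ω (s z) (deriv s z) = 0

/-- A germ of regular foliation at the origin of `ℂ²`, given by a submersion `f`: its leaves are
the level sets of `f`. -/
structure IsRegularFoliation (f : ℂ × ℂ → ℂ) : Prop where
  analytic : AnalyticAt ℂ f 0
  submersion : fderiv ℂ f 0 ≠ 0

/-- `ω = 0` is a nondegenerate reduced foliation with its two separatrices labelled as `S₁`
(parametrized by `s₁`) and `S₂` (parametrized by `s₂`), and the level sets of `f` form a regular
foliation whose leaf through the origin is transverse to `S₁` and to `S₂`. -/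
structure IsPair (ω : OneForm) (f : ℂ × ℂ → ℂ) (s₁ s₂ : ℂ → ℂ × ℂ) : Prop where
  reduced : IsNondegenerateReduced ω
  regular : IsRegularFoliation f
  sep₁ : IsSeparatrix ω s₁
  sep₂ : IsSeparatrix ω s₂
  distinct : LinearIndependent ℂ ![deriv s₁ 0, deriv s₂ 0]
  transverse₁ : fderiv ℂ f 0 (deriv s₁ 0) ≠ 0
  transverse₂ : fderiv ℂ f 0 (deriv s₂ 0) ≠ 0

/-- The Camacho-Sad index along `S₁`. In coordinates with `S₁` tangent to `x = 0` and `S₂` tangent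
to `y = 0`, the linear part of `ω` is `l₁ y dx + l₂ x dy` and the index is `- l₂ / l₁`. -/
noncomputable def csIndex (ω : OneForm) (s₁ s₂ : ℂ → ℂ × ℂ) : ℂ :=
  - (fderiv ℂ ω 0 (deriv s₂ 0) (deriv s₁ 0) / fderiv ℂ ω 0 (deriv s₁ 0) (deriv s₂ 0))

/-- The coefficient of `dx ∧ dy` in `α ∧ β`. -/
noncomputable def wedge (α β : ℂ × ℂ →L[ℂ] ℂ) : ℂ := α (1, 0) * β (0, 1) - α (0, 1) * β (1, 0)

/-- `t` parametrizes the tangent curve of `ω = 0` and of the foliation by the level sets of `f`,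
that is, the smooth curve `ω ∧ df = 0`. -/
structure IsTangentCurve (ω : OneForm) (f : ℂ × ℂ → ℂ) (t : ℂ → ℂ × ℂ) : Prop where
  smooth : IsSmoothCurve t
  tangent : ∀ᶠ z in 𝓝 (0 : ℂ), wedge (ω (t z)) (fderiv ℂ f (t z)) = 0

/-- `h` is, in the parameter of the curve `T` parametrized by `t`, the holonomy germ on `T` of the
foliation `ω = 0` lifted to the blowing-up of the origin, along the loop of directions
`γ θ = [α e₁ + exp (2 π i ε θ) β e₂]`, `θ ∈ [0, 1]`, where `e₁`, `e₂` are the tangent vectors of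
`S₁`, `S₂`, and `γ 0 = [α e₁ + β e₂]` is the direction of `T`. The loop is a generator of the
fundamental group of the exceptional line minus the two points `[e₁]`, `[e₂]`; it turns once
around `[e₁]`, positively if `ε = 1` and negatively if `ε = -1`.

Here `K θ z ≠ 0` and `z • K θ z` encode the point `(z • K θ z, [K θ z])` of the blowing-up. For
`z = 0` this point runs through the loop `γ` in the exceptional line, and for `z ≠ 0` it runs
through a path, depending continuously on `z`, inside a leaf, which joins the point of parameter
`z` on `T` to the point of parameter `h z`. -/
def IsHolonomy (ω : OneForm) (s₁ s₂ t : ℂ → ℂ × ℂ) (ε : ℤˣ) (h : ℂ → ℂ) : Prop :=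
  IsDiffeoGerm₁ h ∧
  ∃ (α β : ℂ) (r : ℝ) (K : ℝ → ℂ → ℂ × ℂ),
    α ≠ 0 ∧ β ≠ 0 ∧ 0 < r ∧
    deriv t 0 = α • deriv s₁ 0 + β • deriv s₂ 0 ∧
    ContinuousOn (Function.uncurry K) (Set.Icc 0 1 ×ˢ Metric.ball 0 r) ∧
    (∀ θ ∈ Set.Icc (0 : ℝ) 1, ∀ z ∈ Metric.ball (0 : ℂ) r, K θ z ≠ 0) ∧
    (∀ θ ∈ Set.Icc (0 : ℝ) 1, ∃ κ : ℂ, K θ 0 = κ •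
      (α • deriv s₁ 0 +
        (Complex.exp (2 * Real.pi * Complex.I * ((ε : ℤ) : ℂ) * θ) * β) • deriv s₂ 0)) ∧
    ∀ z ∈ Metric.ball (0 : ℂ) r,
      z • K 0 z = t z ∧ z • K 1 z = t (h z) ∧
      ∀ θ ∈ Set.Icc (0 : ℝ) 1, ∃ w : ℂ × ℂ,
        HasDerivWithinAt (fun θ' : ℝ => z • K θ' z) w (Set.Icc 0 1) θ ∧ ω (z • K θ z) w = 0

/-- `p` is, in the parameters of `T` and `S₁`, the projection from `T` to `S₁` along the leaves of
the regular foliation by the level sets of `f`. -/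
structure IsLeafProjection (f : ℂ × ℂ → ℂ) (t s₁ : ℂ → ℂ × ℂ) (p : ℂ → ℂ) : Prop where
  diffeo : IsDiffeoGerm₁ p
  same_leaf : ∀ᶠ z in 𝓝 (0 : ℂ), f (t z) = f (s₁ (p z))

/-- `g` is, in the parameter of `S₁`, the sliding on `S₁` of the foliation `ω = 0` and of the
regular foliation by the level sets of `f`: the germ `g = p ∘ h ∘ p⁻¹`, where `h` is the holonomy
on the tangent curve and `p` the projection from the tangent curve to `S₁` along the leaves of the
regular foliation. -/
def IsSliding (ω : OneForm) (f : ℂ × ℂ → ℂ) (s₁ s₂ : ℂ → ℂ × ℂ) (ε : ℤˣ) (g : ℂ → ℂ) : Prop :=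
  IsDiffeoGerm₁ g ∧
  ∃ (t : ℂ → ℂ × ℂ) (h p : ℂ → ℂ),
    IsTangentCurve ω f t ∧ IsHolonomy ω s₁ s₂ t ε h ∧ IsLeafProjection f t s₁ p ∧
    ∀ᶠ z in 𝓝 (0 : ℂ), g (p z) = p (h z)

/-- The germ of biholomorphism `Φ` sends the foliation `ω = 0` to the foliation `ω' = 0` and the
foliation by the level sets of `f` to the foliation by the level sets of `f'`. -/
structure IsConjugacy (ω : OneForm) (f : ℂ × ℂ → ℂ) (ω' : OneForm) (f' : ℂ × ℂ → ℂ)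
    (Φ : ℂ × ℂ → ℂ × ℂ) : Prop where
  diffeo : IsDiffeoGerm₂ Φ
  map_form : ∃ u : ℂ × ℂ → ℂ, AnalyticAt ℂ u 0 ∧ u 0 ≠ 0 ∧
    ∀ᶠ q in 𝓝 (0 : ℂ × ℂ), (ω' (Φ q)).comp (fderiv ℂ Φ q) = u q • ω q
  map_regular : ∃ k : ℂ → ℂ, AnalyticAt ℂ k (f 0) ∧ deriv k (f 0) ≠ 0 ∧
    ∀ᶠ q in 𝓝 (0 : ℂ × ℂ), f' (Φ q) = k (f q)

/-- `Φ` sends the curve germ parametrized by `s` into the one parametrized by `s'`. -/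
def MapsCurve (Φ : ℂ × ℂ → ℂ × ℂ) (s s' : ℂ → ℂ × ℂ) : Prop :=
  ∀ U ∈ 𝓝 (0 : ℂ), ∀ᶠ z in 𝓝 (0 : ℂ), Φ (s z) ∈ s' '' U

/-- The restriction of `Φ` to the curve parametrized by `s` is the map that sends the point of
parameter `z` to the point of parameter `φ z` on the curve parametrized by `s'`. -/
def RestrictsTo (Φ : ℂ × ℂ → ℂ × ℂ) (s s' : ℂ → ℂ × ℂ) (φ : ℂ → ℂ) : Prop :=
  ∀ᶠ z in 𝓝 (0 : ℂ), Φ (s z) = s' (φ z)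

end Sliding

open Sliding

/-! Take coordinates in which `S₁` is `x = 0`, `S₂` is `y = 0` and the leaves of the regular
foliation are the levels of `x + y`. The singular foliation becomes `y dx + x B dy = 0`, where `B 0
= lam` is minus the Camacho-Sad index (`IsPair.exists_normalForm`). The covering chart `x / y = exp
ζ / lam` puts the direction of the tangent curve `T` at `ζ = 0` and turns the loop into the
translation by `turn ε`, that is, `2πi` or `-2πi`. Over a large disc in `ζ` the foliation has a
first integral `H` equal to `y` on `ζ = 0` (`exists_flowData`). Write `rho c` for its value at the
point of `T` on the level `c`, and `mono y` for its value at `(turn ε, y)`. Constancy of `H` along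
the lifted paths shows that the sliding `g` is exactly the germ with `mono ∘ rho ∘ g = rho`.
Existence and uniqueness of the sliding follow. Statement 1 is then naturality: a conjugacy carries
tangent curves, holonomies and projections to the same objects for the second pair
(`IsSliding.map`).

For statement 2, reparametrizing `S₁'` by `φ` makes the two slidings equal, and equality of the
indices makes the two values of `lam` equal. A conjugacy of the normal forms is sought as `(x, y) ↦
(x + e, y - e)`, which preserves each level of `x + y`. Let `J = rho⁻¹ ∘ H`; on `T` it equals the
level, and its monodromy is governed by `g`. The map has to send `J` to the corresponding `J'`. Away
from the direction of `T` the levels are transverse to the leaves, and the implicit function theorem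
gives one solution close to the identity (`exists_transport_of_ne`). At `T` both integrals,
restricted to the level `c`, have a nondegenerate critical point with critical value `c`, so a
Morse-type change of parameter solves the problem (`exists_transport_zero`). Because `J` and `J'`
have the same `g`, the local solutions agree after a turn and glue along the circle `|x / y| =
|lam⁻¹|` (`exists_transport`).

The solution still has to be extended from a neighbourhood of this circle in the blowing-up to a
neighbourhood of the origin. Write `e = y n` and expand `n` in powers of `y`. The coefficient of `y
^ N`, restricted to the circle, solves a linear differential equation whose right side has Fourier
modes `0, ..., N + 2`. Outside that range the recurrence on Fourier coefficients has factors `(1 +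
lam) j - N`, nonzero because `lam` is not a negative rational; so the coefficients are constant on
both tails, hence zero there (`exists_trigonometric`). Thus `y ^ (N + 1)` times the coefficient is a
homogeneous polynomial in `(x, y)`, and Cauchy estimates make the sum of these polynomials converge
(`exists_resummation`).

Uniqueness uses the same linearization: the homogeneous equation has a regular singular point at `ζ
= 0` with exponent `-1`, so it has no nonzero analytic solution (`eventually_eq_zero_of_defect`). -/

namespace Sliding

/-! ### Cauchy integrals in two variables and Osgood's lemma. -/

open scoped BoundedContinuousFunction

/-- Integration over the torus as a functional on bounded continuous functions. -/
noncomputable def torusIntegral₂ : (ℝ × ℝ →ᵇ ℂ) →L[ℂ] ℂ :=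
  LinearMap.mkContinuous
    { toFun := fun φ => ∫ s in (0 : ℝ)..2 * Real.pi, ∫ t in (0 : ℝ)..2 * Real.pi, φ (s, t)
      map_add' := by
        intro φ ψ
        have h1 : ∀ (φ : ℝ × ℝ →ᵇ ℂ) (s : ℝ), IntervalIntegrable (fun t => φ (s, t))
            MeasureTheory.volume 0 (2 * Real.pi) := fun φ s =>
          Continuous.intervalIntegrable (by fun_prop) _ _
        have h2 : ∀ (φ : ℝ × ℝ →ᵇ ℂ), IntervalIntegrable
            (fun s => ∫ t in (0 : ℝ)..2 * Real.pi, φ (s, t))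
            MeasureTheory.volume 0 (2 * Real.pi) := fun φ =>
          Continuous.intervalIntegrable
            (intervalIntegral.continuous_parametric_intervalIntegral_of_continuous' (by
              exact φ.continuous.comp continuous_id) _ _) _ _
        simp only [BoundedContinuousFunction.coe_add, Pi.add_apply]
        rw [← intervalIntegral.integral_add (h2 φ) (h2 ψ)]
        refine intervalIntegral.integral_congr fun s _ => ?_
        exact intervalIntegral.integral_add (h1 φ s) (h1 ψ s)
      map_smul' := by
        intro c φ
        simp [intervalIntegral.integral_const_mul] } ((2 * Real.pi) * (2 * Real.pi)) (by
    intro φ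
    have hp : (0 : ℝ) ≤ 2 * Real.pi := by positivity
    have h1 : ∀ s : ℝ, ‖∫ t in (0 : ℝ)..2 * Real.pi, φ (s, t)‖ ≤ ‖φ‖ * (2 * Real.pi) := by
      intro s
      have := intervalIntegral.norm_integral_le_of_norm_le_const (a := 0) (b := 2 * Real.pi)
        (f := fun t => φ (s, t)) (C := ‖φ‖) (fun t _ => φ.norm_coe_le_norm _)
      rwa [sub_zero, abs_of_nonneg hp] at this
    have := intervalIntegral.norm_integral_le_of_norm_le_const (a := 0) (b := 2 * Real.pi)
        (f := fun s => ∫ t in (0 : ℝ)..2 * Real.pi, φ (s, t)) (fun s _ => h1 s)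
    rw [sub_zero, abs_of_nonneg hp] at this
    simp only [LinearMap.coe_mk, AddHom.coe_mk]
    linarith)

theorem torusIntegral₂_apply (φ : ℝ × ℝ →ᵇ ℂ) : torusIntegral₂ φ =
    ∫ s in (0 : ℝ)..2 * Real.pi, ∫ t in (0 : ℝ)..2 * Real.pi, φ (s, t) := rfl

/-- A doubly periodic continuous function takes all its values on a compact square. This places the
ingredients of the Cauchy kernel in a Banach algebra. -/
theorem exists_bcf_of_periodic (g : ℝ × ℝ → ℂ) (hg : Continuous g)
    (h1 : ∀ s t, g (s + 2 * Real.pi, t) = g (s, t))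
    (h2 : ∀ s t, g (s, t + 2 * Real.pi) = g (s, t)) :
    ∃ φ : ℝ × ℝ →ᵇ ℂ, ∀ t, φ t = g t := by
  have hK : IsCompact (Set.Icc (0 : ℝ) (2 * Real.pi) ×ˢ Set.Icc (0 : ℝ) (2 * Real.pi)) :=
    isCompact_Icc.prod isCompact_Icc
  obtain ⟨C, hC⟩ := hK.exists_bound_of_continuousOn hg.continuousOn
  have hpi : 0 < 2 * Real.pi := by positivity
  refine ⟨BoundedContinuousFunction.ofNormedAddCommGroup g hg C ?_, fun t => rfl⟩
  rintro ⟨s, t⟩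
  have e1 : Function.Periodic (fun s => g (s, t)) (2 * Real.pi) := fun s => h1 s t
  obtain ⟨s', hs', es⟩ := e1.exists_mem_Ico₀ hpi s
  have e2 : Function.Periodic (fun t => g (s', t)) (2 * Real.pi) := fun t => h2 s' t
  obtain ⟨t', ht', et⟩ := e2.exists_mem_Ico₀ hpi t
  change ‖g (s, t)‖ ≤ C
  rw [show g (s, t) = g (s', t) from es, show g (s', t) = g (s', t') from et]
  exact hC _ ⟨⟨hs'.1, hs'.2.le⟩, ⟨ht'.1, ht'.2.le⟩⟩

/-- An inverse in the algebra of bounded continuous functions depends analytically on a shift. -/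
theorem analyticAt_inverse_sub_const (X : ℝ × ℝ →ᵇ ℂ) (c : ℂ) (Y : ℝ × ℝ →ᵇ ℂ)
    (hY : ∀ t, (X t - c) * Y t = 1) :
    AnalyticAt ℂ (fun z : ℂ => Ring.inverse (X - algebraMap ℂ (ℝ × ℝ →ᵇ ℂ) z)) c ∧
    ∀ᶠ z in 𝓝 c, ∀ t, Ring.inverse (X - algebraMap ℂ (ℝ × ℝ →ᵇ ℂ) z) t = (X t - z)⁻¹ := by
  have h1 : (X - algebraMap ℂ (ℝ × ℝ →ᵇ ℂ) c) * Y = 1 := by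
    ext t; exact hY t
  let u : (ℝ × ℝ →ᵇ ℂ)ˣ := ⟨X - algebraMap ℂ (ℝ × ℝ →ᵇ ℂ) c, Y, h1, by rw [mul_comm]; exact h1⟩
  have hlin : AnalyticAt ℂ (fun z : ℂ => X - algebraMap ℂ (ℝ × ℝ →ᵇ ℂ) z) c :=
    analyticAt_const.sub ((Algebra.linearMap ℂ (ℝ × ℝ →ᵇ ℂ)).toContinuousLinearMap.analyticAt c)
  constructor
  · exact AnalyticAt.fun_comp_of_eq (g := Ring.inverse) (analyticAt_inverse (𝕜 := ℂ) u) hlin rfl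
  · have hu : ∀ᶠ z in 𝓝 c, IsUnit (X - algebraMap ℂ (ℝ × ℝ →ᵇ ℂ) z) :=
      hlin.continuousAt.eventually (Units.isOpen.mem_nhds ⟨u, rfl⟩)
    filter_upwards [hu] with z hz t
    have := congrArg (fun φ : ℝ × ℝ →ᵇ ℂ => φ t) (Ring.mul_inverse_cancel _ hz)
    exact eq_inv_of_mul_eq_one_right this

/-- The point `q` enters only through the inverses of two elements of the Banach algebra of bounded
continuous functions. Inversion is analytic there, and the integral is a continuous linear
functional, so no differentiation under the integral sign is needed. -/
theorem analyticAt_cauchyKernel {g : ℂ × ℂ → ℂ} {p : ℂ × ℂ} {r : ℝ} (hr : 0 < r)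
    (hg : Continuous fun t : ℝ × ℝ => g (circleMap p.1 r t.1, circleMap p.2 r t.2)) :
    AnalyticAt ℂ (fun q : ℂ × ℂ => ∮ ξ in C(p.1, r), ∮ η in C(p.2, r),
      (ξ - q.1)⁻¹ * ((η - q.2)⁻¹ * g (ξ, η))) p := by
  have hc : ∀ c : ℂ, ∀ t, circleMap c r (t + 2 * Real.pi) = circleMap c r t :=
    fun c t => periodic_circleMap c r t
  have hd : ∀ c : ℂ, ∀ t, deriv (circleMap c r) (t + 2 * Real.pi) = deriv (circleMap c r) t := by
    intro c t
    rw [deriv_circleMap, deriv_circleMap, hc]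
  have hne : ∀ c : ℂ, ∀ t, circleMap c r t - c ≠ 0 := by
    intro c t
    rw [sub_ne_zero]; exact circleMap_ne_center hr.ne'
  have hcont : ∀ c : ℂ, Continuous (circleMap c r) := fun c => continuous_circleMap c r
  obtain ⟨F, hF⟩ := exists_bcf_of_periodic (fun t : ℝ × ℝ => deriv (circleMap p.1 r) t.1 *
    deriv (circleMap p.2 r) t.2 * g (circleMap p.1 r t.1, circleMap p.2 r t.2)) (by
      simp only [deriv_circleMap]
      have := hcont 0
      exact (((this.comp continuous_fst).mul continuous_const).mul
        ((this.comp continuous_snd).mul continuous_const)).mul hg) (by intro s t; simp only [hd, hc]) (by intro s t; simp only [hd, hc])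
  obtain ⟨X₁, hX₁⟩ := exists_bcf_of_periodic (fun t : ℝ × ℝ => circleMap p.1 r t.1)
    (by have := hcont p.1; fun_prop) (by intro s t; simp only [hc]) (by intro s t; rfl)
  obtain ⟨X₂, hX₂⟩ := exists_bcf_of_periodic (fun t : ℝ × ℝ => circleMap p.2 r t.2)
    (by have := hcont p.2; fun_prop) (by intro s t; rfl) (by intro s t; simp only [hc])
  obtain ⟨Y₁, hY₁⟩ := exists_bcf_of_periodic (fun t : ℝ × ℝ => (circleMap p.1 r t.1 - p.1)⁻¹)
    (by
      refine Continuous.inv₀ (by have := hcont p.1; fun_prop) fun t => hne _ _)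
    (by intro s t; simp only [hc]) (by intro s t; rfl)
  obtain ⟨Y₂, hY₂⟩ := exists_bcf_of_periodic (fun t : ℝ × ℝ => (circleMap p.2 r t.2 - p.2)⁻¹)
    (by
      refine Continuous.inv₀ (by have := hcont p.2; fun_prop) fun t => hne _ _)
    (by intro s t; rfl) (by intro s t; simp only [hc])
  obtain ⟨ha₁, he₁⟩ := analyticAt_inverse_sub_const X₁ p.1 Y₁
    (fun t => by rw [hX₁, hY₁]; exact mul_inv_cancel₀ (hne _ _))
  obtain ⟨ha₂, he₂⟩ := analyticAt_inverse_sub_const X₂ p.2 Y₂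
    (fun t => by rw [hX₂, hY₂]; exact mul_inv_cancel₀ (hne _ _))
  have hA : AnalyticAt ℂ (fun q : ℂ × ℂ => torusIntegral₂ (F *
      (Ring.inverse (X₁ - algebraMap ℂ (ℝ × ℝ →ᵇ ℂ) q.1) *
        Ring.inverse (X₂ - algebraMap ℂ (ℝ × ℝ →ᵇ ℂ) q.2)))) p := by
    refine (torusIntegral₂.analyticAt _).fun_comp (analyticAt_const.mul ?_)
    exact (AnalyticAt.fun_comp (g := fun z : ℂ => Ring.inverse (X₁ - algebraMap ℂ (ℝ × ℝ →ᵇ ℂ) z))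
      ha₁ analyticAt_fst).mul (AnalyticAt.fun_comp
        (g := fun z : ℂ => Ring.inverse (X₂ - algebraMap ℂ (ℝ × ℝ →ᵇ ℂ) z)) ha₂ analyticAt_snd)
  refine hA.congr ?_
  filter_upwards [continuousAt_fst.eventually he₁, continuousAt_snd.eventually he₂] with q h₁ h₂
  rw [torusIntegral₂_apply]
  simp only [circleIntegral, smul_eq_mul]
  refine intervalIntegral.integral_congr fun s _ => ?_
  rw [← intervalIntegral.integral_const_mul]
  refine intervalIntegral.integral_congr fun t _ => ?_
  simp only [BoundedContinuousFunction.coe_mul, Pi.mul_apply, hF, h₁, h₂, hX₁, hX₂]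
  ring

/-- Cauchy's formula in each variable in turn; separate differentiability is enough. -/
theorem cauchy_two_variables {f : ℂ × ℂ → ℂ} {p : ℂ × ℂ} {r : ℝ}
    (h1 : ∀ w ∈ Metric.closedBall p.2 r, ∀ z ∈ Metric.closedBall p.1 r,
      DifferentiableAt ℂ (fun z => f (z, w)) z)
    (h2 : ∀ z ∈ Metric.closedBall p.1 r, ∀ w ∈ Metric.closedBall p.2 r,
      DifferentiableAt ℂ (fun w => f (z, w)) w)
    {q : ℂ × ℂ} (hq1 : q.1 ∈ Metric.ball p.1 r) (hq2 : q.2 ∈ Metric.ball p.2 r) :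
    (2 * Real.pi * Complex.I : ℂ)⁻¹ * ((2 * Real.pi * Complex.I : ℂ)⁻¹ * ∮ ξ in C(p.1, r),
      ∮ η in C(p.2, r), (ξ - q.1)⁻¹ * ((η - q.2)⁻¹ * f (ξ, η))) = f q := by
  have hr : 0 < r := Metric.pos_of_mem_ball hq1
  have d1 : DiffContOnCl ℂ (fun z => f (z, q.2)) (Metric.ball p.1 r) := by
    refine DifferentiableOn.diffContOnCl ?_
    rw [closure_ball _ hr.ne']
    exact fun z hz => (h1 _ (Metric.ball_subset_closedBall hq2) z hz).differentiableWithinAt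
  have e1 := d1.two_pi_i_inv_smul_circleIntegral_sub_inv_smul hq1
  have e2 : ∀ z ∈ Metric.sphere p.1 r, (∮ η in C(p.2, r), (η - q.2)⁻¹ * f (z, η)) =
      (2 * Real.pi * Complex.I : ℂ) * f (z, q.2) := by
    intro z hz
    have d2 : DiffContOnCl ℂ (fun w => f (z, w)) (Metric.ball p.2 r) := by
      refine DifferentiableOn.diffContOnCl ?_
      rw [closure_ball _ hr.ne']
      exact fun w hw => (h2 _ (Metric.sphere_subset_closedBall hz) w hw).differentiableWithinAt
    have := d2.two_pi_i_inv_smul_circleIntegral_sub_inv_smul hq2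
    simp only [smul_eq_mul] at this
    rw [← this, ← mul_assoc, mul_inv_cancel₀ Complex.two_pi_I_ne_zero, one_mul]
  have e3 : (∮ ξ in C(p.1, r), ∮ η in C(p.2, r), (ξ - q.1)⁻¹ * ((η - q.2)⁻¹ * f (ξ, η))) =
      ∮ ξ in C(p.1, r), (2 * Real.pi * Complex.I : ℂ) * ((ξ - q.1)⁻¹ • f (ξ, q.2)) := by
    refine circleIntegral.integral_congr hr.le fun z hz => ?_
    rw [circleIntegral.integral_const_mul, e2 z hz]
    simp only [smul_eq_mul]; ring
  rw [e3, circleIntegral.integral_const_mul, ← mul_assoc (2 * Real.pi * Complex.I : ℂ)⁻¹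
    (2 * Real.pi * Complex.I : ℂ), inv_mul_cancel₀ Complex.two_pi_I_ne_zero, one_mul]
  exact e1

/-- **Osgood's lemma**: a locally bounded, separately holomorphic function of two complex variables
is analytic. -/
theorem analyticOnNhd_of_separately {f : ℂ × ℂ → ℂ} {U : Set (ℂ × ℂ)} (hU : IsOpen U)
    (hb : ∀ p ∈ U, ∃ M : ℝ, ∀ᶠ q in 𝓝 p, ‖f q‖ ≤ M)
    (h1 : ∀ p ∈ U, DifferentiableAt ℂ (fun z => f (z, p.2)) p.1)
    (h2 : ∀ p ∈ U, DifferentiableAt ℂ (fun w => f (p.1, w)) p.2) : AnalyticOnNhd ℂ f U := by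
  have hcont : ContinuousOn f U := by
    intro p hp
    refine ContinuousAt.continuousWithinAt ?_
    obtain ⟨M, hM⟩ := hb p hp
    obtain ⟨r, hr, hrU⟩ := Metric.eventually_nhds_iff_ball.mp (hM.and (hU.mem_nhds hp))
    have hM0 : 0 ≤ M := (norm_nonneg _).trans (hrU p (Metric.mem_ball_self hr)).1
    -- Schwarz's lemma: a function bounded by `M` on the ball differs by at most `2 M` from its
    -- value at the centre, so it is Lipschitz there with a constant independent of the function.
    -- Applied to the slices, this yields joint continuity.
    have key : ∀ (φ : ℂ → ℂ) (c : ℂ), (∀ z ∈ Metric.ball c r, DifferentiableAt ℂ φ z) →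
        (∀ z ∈ Metric.ball c r, ‖φ z‖ ≤ M) → ∀ z ∈ Metric.ball c r,
        dist (φ z) (φ c) ≤ (2 * M + 1) / r * dist z c := by
      intro φ c hd hbd z hz
      refine Complex.dist_le_div_mul_dist_of_mapsTo_ball (R₁ := r)
        (fun z hz => (hd z hz).differentiableWithinAt) ?_ hz
      intro w hw
      rw [Metric.mem_closedBall, dist_eq_norm]
      have := hbd w hw
      have h' := hbd c (Metric.mem_ball_self hr)
      linarith [norm_sub_le (φ w) (φ c)]
    have hbound : ∀ q ∈ Metric.ball p r, dist (f q) (f p) ≤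
        (2 * M + 1) / r * (dist q.1 p.1 + dist q.2 p.2) := by
      rintro ⟨z, w⟩ hq
      rw [← ball_prod_same] at hrU hq
      obtain ⟨hz, hw⟩ := hq
      have b1 := key (fun w' => f (z, w')) p.2 (fun w' hw' => h2 (z, w') (hrU (z, w') ⟨hz, hw'⟩).2)
        (fun w' hw' => (hrU (z, w') ⟨hz, hw'⟩).1) w hw
      have b2 := key (fun z' => f (z', p.2)) p.1
        (fun z' hz' => h1 (z', p.2) (hrU (z', p.2) ⟨hz', Metric.mem_ball_self hr⟩).2)
        (fun z' hz' => (hrU (z', p.2) ⟨hz', Metric.mem_ball_self hr⟩).1) z hz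
      simp only at b1 b2 ⊢
      have := dist_triangle (f (z, w)) (f (z, p.2)) (f p)
      rw [mul_add]
      linarith
    rw [ContinuousAt, tendsto_iff_dist_tendsto_zero]
    refine squeeze_zero' (Eventually.of_forall fun _ => dist_nonneg)
      (Filter.eventually_of_mem (Metric.ball_mem_nhds p hr) hbound) ?_
    have : ContinuousAt (fun q : ℂ × ℂ => (2 * M + 1) / r * (dist q.1 p.1 + dist q.2 p.2)) p := by
      fun_prop
    simpa [ContinuousAt] using this
  intro p hp
  obtain ⟨r, hr, hrU⟩ := Metric.nhds_basis_closedBall.mem_iff.mp (hU.mem_nhds hp)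
  rw [← closedBall_prod_same] at hrU
  have hA := analyticAt_cauchyKernel (g := f) (p := p) hr (by
    refine hcont.comp_continuous (f := fun t : ℝ × ℝ =>
      (circleMap p.1 r t.1, circleMap p.2 r t.2)) ?_ ?_
    · have h1 := continuous_circleMap p.1 r
      have h2 := continuous_circleMap p.2 r
      fun_prop
    · intro t
      exact hrU ⟨circleMap_mem_closedBall _ hr.le _, circleMap_mem_closedBall _ hr.le _⟩)
  refine ((analyticAt_const (v := (2 * Real.pi * Complex.I : ℂ)⁻¹)).mul
    ((analyticAt_const (v := (2 * Real.pi * Complex.I : ℂ)⁻¹)).mul hA)).congr ?_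
  have : Metric.ball p.1 r ×ˢ Metric.ball p.2 r ∈ 𝓝 p := by
    rw [ball_prod_same]; exact Metric.ball_mem_nhds _ hr
  filter_upwards [this] with q hq
  exact cauchy_two_variables (fun w hw z hz => h1 (z, w) (hrU ⟨hz, hw⟩))
    (fun z hz w hw => h2 (z, w) (hrU ⟨hz, hw⟩)) hq.1 hq.2

/-! ### Cancellation of a coordinate and difference quotients in `y`. -/

theorem dense_snd_ne : Dense {p : ℂ × ℂ | p.2 ≠ 0} := by
  have : {p : ℂ × ℂ | p.2 ≠ 0} = Set.univ ×ˢ {(0 : ℂ)}ᶜ := by ext; simp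
  rw [this]
  exact dense_univ.prod (dense_compl_singleton _)

theorem dense_fst_ne : Dense {p : ℂ × ℂ | p.1 ≠ 0} := by
  have : {p : ℂ × ℂ | p.1 ≠ 0} = {(0 : ℂ)}ᶜ ×ˢ Set.univ := by ext; simp
  rw [this]
  exact (dense_compl_singleton _).prod dense_univ

/-- Continuity is required at all points near `p`, so that density of `S` can be used at each of
them. The typical use is to divide an identity of germs by a coordinate. -/
theorem eventuallyEq_of_dense {X : Type*} [TopologicalSpace X] {S : Set X} (hS : Dense S)
    {f g : X → ℂ} {p : X}
    (hf : ∀ᶠ q in 𝓝 p, ContinuousAt f q) (hg : ∀ᶠ q in 𝓝 p, ContinuousAt g q)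
    (h : ∀ᶠ q in 𝓝 p, q ∈ S → f q = g q) : f =ᶠ[𝓝 p] g := by
  filter_upwards [hf, hg, eventually_eventually_nhds.mpr h] with q h1 h2 h3
  have hne : (𝓝[S] q).NeBot := mem_closure_iff_nhdsWithin_neBot.mp (hS q)
  have h4 : f =ᶠ[𝓝[S] q] g := eventually_nhdsWithin_iff.mpr h3
  exact tendsto_nhds_unique ((h1.mono_left nhdsWithin_le_nhds).congr' h4)
    (h2.mono_left nhdsWithin_le_nhds)

theorem AnalyticAt.eventually_continuousAt' {E F : Type*} [NormedAddCommGroup E] [NormedSpace ℂ E]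
    [NormedAddCommGroup F] [NormedSpace ℂ F] [CompleteSpace F] {f : E → F} {p : E}
    (hf : AnalyticAt ℂ f p) : ∀ᶠ q in 𝓝 p, ContinuousAt f q :=
  hf.eventually_analyticAt.mono fun _ h => h.continuousAt

theorem eventuallyEq_of_snd_mul {f g : ℂ × ℂ → ℂ} {p : ℂ × ℂ} (hf : AnalyticAt ℂ f p)
    (hg : AnalyticAt ℂ g p) (h : ∀ᶠ q in 𝓝 p, q.2 * f q = q.2 * g q) : f =ᶠ[𝓝 p] g :=
  eventuallyEq_of_dense dense_snd_ne (AnalyticAt.eventually_continuousAt' hf)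
    (AnalyticAt.eventually_continuousAt' hg)
    (h.mono fun _ hq hS => mul_left_cancel₀ hS hq)

theorem eventuallyEq_of_fst_mul {f g : ℂ × ℂ → ℂ} {p : ℂ × ℂ} (hf : AnalyticAt ℂ f p)
    (hg : AnalyticAt ℂ g p) (h : ∀ᶠ q in 𝓝 p, q.1 * f q = q.1 * g q) : f =ᶠ[𝓝 p] g :=
  eventuallyEq_of_dense dense_fst_ne (AnalyticAt.eventually_continuousAt' hf)
    (AnalyticAt.eventually_continuousAt' hg)
    (h.mono fun _ hq hS => mul_left_cancel₀ hS hq)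

theorem AnalyticAt.prodMk_left {f : ℂ × ℂ → ℂ} {p : ℂ × ℂ} (hf : AnalyticAt ℂ f p) :
    AnalyticAt ℂ (fun z => f (z, p.2)) p.1 :=
  AnalyticAt.fun_comp_of_eq hf (analyticAt_id.prod analyticAt_const) rfl

theorem AnalyticAt.prodMk_right {f : ℂ × ℂ → ℂ} {p : ℂ × ℂ} (hf : AnalyticAt ℂ f p) :
    AnalyticAt ℂ (fun w => f (p.1, w)) p.2 :=
  AnalyticAt.fun_comp_of_eq hf (analyticAt_const.prod analyticAt_id) rfl

/-- The difference quotient of a function of two variables in the second variable at `0`. -/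
noncomputable def dsl (f : ℂ × ℂ → ℂ) : ℂ × ℂ → ℂ := fun p => dslope (fun y => f (p.1, y)) 0 p.2

theorem dsl_mul (f : ℂ × ℂ → ℂ) (p : ℂ × ℂ) : p.2 * dsl f p = f p - f (p.1, 0) := by
  have := sub_smul_dslope (fun y => f (p.1, y)) 0 p.2
  simpa [dsl] using this

theorem dsl_zero (f : ℂ × ℂ → ℂ) (z : ℂ) : dsl f (z, 0) = deriv (fun y => f (z, y)) 0 := by
  simp [dsl]

theorem deriv_snd_eq {f : ℂ × ℂ → ℂ} {p : ℂ × ℂ} (hf : AnalyticAt ℂ f p) :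
    HasDerivAt (fun y => f (p.1, y)) (fderiv ℂ f p (0, 1)) p.2 := by
  have h := hf.differentiableAt.hasFDerivAt
  exact h.comp_hasDerivAt p.2 ((hasDerivAt_const p.2 p.1).prodMk (hasDerivAt_id p.2))

theorem deriv_fst_eq {f : ℂ × ℂ → ℂ} {p : ℂ × ℂ} (hf : AnalyticAt ℂ f p) :
    HasDerivAt (fun z => f (z, p.2)) (fderiv ℂ f p (1, 0)) p.1 := by
  have h := hf.differentiableAt.hasFDerivAt
  exact h.comp_hasDerivAt p.1 ((hasDerivAt_id p.1).prodMk (hasDerivAt_const p.1 p.2))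

theorem analyticAt_fderiv_apply {f : ℂ × ℂ → ℂ} {p : ℂ × ℂ} (hf : AnalyticAt ℂ f p) (w : ℂ × ℂ) :
    AnalyticAt ℂ (fun q => fderiv ℂ f q w) p :=
  ((ContinuousLinearMap.apply ℂ ℂ w).analyticAt _).fun_comp hf.fderiv

/-- Off `y = 0` this is a quotient of analytic functions. Near `y = 0` Osgood's lemma applies: the
mean value inequality bounds the quotient, its restriction to `y = 0` is a partial derivative of
`f`, and in `y` the singularity is removable. -/
theorem analyticAt_dsl {f : ℂ × ℂ → ℂ} {p : ℂ × ℂ} (hf : AnalyticAt ℂ f p)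
    (hf0 : AnalyticAt ℂ f (p.1, 0)) : AnalyticAt ℂ (dsl f) p := by
  have hrestr : ∀ p : ℂ × ℂ, AnalyticAt ℂ f (p.1, 0) → AnalyticAt ℂ (fun q : ℂ × ℂ => f (q.1, 0)) p :=
    fun p hp => AnalyticAt.fun_comp_of_eq hp (analyticAt_fst.prod analyticAt_const) rfl
  have hne : ∀ p : ℂ × ℂ, p.2 ≠ 0 → AnalyticAt ℂ f p → AnalyticAt ℂ f (p.1, 0) →
      AnalyticAt ℂ (dsl f) p := by
    intro p hp hf hf0
    refine (((hf.sub (hrestr p hf0)).div analyticAt_snd hp)).congr ?_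
    filter_upwards [continuousAt_snd.eventually_ne hp] with q hq
    have := dsl_mul f q
    simp only [Pi.div_apply, Pi.sub_apply]
    rw [← this, mul_div_cancel_left₀ _ hq]
  by_cases hp : p.2 = 0
  swap
  · exact hne p hp hf hf0
  obtain ⟨z₀, y₀⟩ := p
  simp only at hp
  subst hp
  have hfd : ContinuousAt (fun q => ‖fderiv ℂ f q (0, 1)‖) (z₀, 0) :=
    (analyticAt_fderiv_apply hf (0, 1)).continuousAt.norm
  have hbd := hfd.eventually_lt (continuousAt_const (y := ‖fderiv ℂ f (z₀, 0) (0, 1)‖ + 1)) (by simp)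
  obtain ⟨r, hr, hU⟩ := Metric.eventually_nhds_iff_ball.mp (hf.eventually_analyticAt.and hbd)
  rw [← ball_prod_same] at hU
  refine analyticOnNhd_of_separately (U := Metric.ball z₀ r ×ˢ Metric.ball 0 r)
    (Metric.isOpen_ball.prod Metric.isOpen_ball) ?_ ?_ ?_ _
    ⟨Metric.mem_ball_self hr, Metric.mem_ball_self hr⟩
  · intro p hp
    refine ⟨‖fderiv ℂ f (z₀, 0) (0, 1)‖ + 1, ?_⟩
    filter_upwards [(Metric.isOpen_ball.prod Metric.isOpen_ball).mem_nhds hp] with q hq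
    by_cases hq2 : q.2 = 0
    · have h0 := deriv_snd_eq (hU q hq).1
      obtain ⟨z, y⟩ := q
      simp only at hq2
      subst hq2
      rw [dsl_zero, h0.deriv]
      exact (hU _ hq).2.le
    · have hm := Convex.norm_image_sub_le_of_norm_hasDerivWithin_le (𝕜 := ℂ)
        (f := fun y => f (q.1, y)) (f' := fun y => fderiv ℂ f (q.1, y) (0, 1))
        (s := Metric.ball (0 : ℂ) r) (C := ‖fderiv ℂ f (z₀, 0) (0, 1)‖ + 1)
        (x := 0) (y := q.2)
        (fun y hy => (deriv_snd_eq (hU (q.1, y) ⟨hq.1, hy⟩).1).hasDerivWithinAt)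
        (fun y hy => (hU (q.1, y) ⟨hq.1, hy⟩).2.le) (convex_ball _ _) (Metric.mem_ball_self hr) hq.2
      rw [sub_zero] at hm
      have h2 := dsl_mul f q
      have h3 : ‖q.2‖ * ‖dsl f q‖ ≤ (‖fderiv ℂ f (z₀, 0) (0, 1)‖ + 1) * ‖q.2‖ := by
        rw [← norm_mul, h2]; exact hm
      rw [mul_comm] at h3
      exact le_of_mul_le_mul_right h3 (norm_pos_iff.mpr hq2)
  · intro p hp
    by_cases hp2 : p.2 = 0
    · have h1 : AnalyticAt ℂ (fun z => fderiv ℂ f (z, p.2) (0, 1)) p.1 :=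
        AnalyticAt.prodMk_left (analyticAt_fderiv_apply (hU p hp).1 (0, 1))
      refine (h1.congr ?_).differentiableAt
      filter_upwards [Metric.isOpen_ball.mem_nhds hp.1] with z hz
      have := deriv_snd_eq (hU (z, p.2) ⟨hz, hp.2⟩).1
      rw [hp2] at this ⊢
      rw [dsl_zero, this.deriv]
    · exact (AnalyticAt.prodMk_left (hne p hp2 (hU p hp).1
        (hU (p.1, 0) ⟨hp.1, Metric.mem_ball_self hr⟩).1)).differentiableAt
  · intro p hp
    have : DifferentiableOn ℂ (dslope (fun y => f (p.1, y)) 0) (Metric.ball 0 r) := by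
      rw [Complex.differentiableOn_dslope (Metric.ball_mem_nhds _ hr)]
      exact fun y hy => (deriv_snd_eq (hU (p.1, y) ⟨hp.1, hy⟩).1).differentiableAt.differentiableWithinAt
    exact this.differentiableAt (Metric.isOpen_ball.mem_nhds hp.2)

/-! ### Neighbourhoods of `K × {0}`, gluing of germs, implicit functions. -/

theorem exists_tube {K : Set ℂ} (hK : IsCompact K) {P : ℂ × ℂ → Prop}
    (h : ∀ z ∈ K, ∀ᶠ p in 𝓝 ((z, 0) : ℂ × ℂ), P p) :
    ∃ V : Set ℂ, IsOpen V ∧ K ⊆ V ∧ ∃ δ > 0, ∀ z ∈ V, ∀ y : ℂ, ‖y‖ < δ → P (z, y) := by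
  have hsub : K ×ˢ {(0 : ℂ)} ⊆ interior {p | P p} := by
    rintro ⟨z, y⟩ ⟨hz, hy⟩
    rw [Set.mem_singleton_iff] at hy
    simp only at hy hz
    subst hy
    exact mem_interior_iff_mem_nhds.mpr (h z hz)
  obtain ⟨V, W, hV, hW, hKV, h0W, hVW⟩ :=
    generalized_tube_lemma hK isCompact_singleton isOpen_interior hsub
  obtain ⟨δ, hδ, hδW⟩ := Metric.isOpen_iff.mp hW 0 (h0W rfl)
  exact ⟨V, hV, hKV, δ, hδ, fun z hz y hy =>
    interior_subset (hVW ⟨hz, hδW (mem_ball_zero_iff.mpr hy)⟩)⟩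

/-- Gluing of germs at the points of `K × {0}`, for a property `R z` that determines the germ at
`(z, 0)`, with the possible exception of the point `z₀`. -/
theorem exists_glue {K : Set ℂ} (hK : IsCompact K) (R : ℂ → (ℂ × ℂ → ℂ) → Prop) (z₀ : ℂ)
    (hR : ∀ z m m', m =ᶠ[𝓝 ((z, 0) : ℂ × ℂ)] m' → R z m → R z m')
    (loc : ∀ z ∈ K, ∃ m, AnalyticAt ℂ m (z, 0) ∧ ∀ᶠ z' in 𝓝 z, R z' m)
    (uniq : ∀ z m m', z ≠ z₀ → AnalyticAt ℂ m (z, 0) → AnalyticAt ℂ m' (z, 0) → R z m → R z m' →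
      m =ᶠ[𝓝 ((z, 0) : ℂ × ℂ)] m') :
    ∃ m : ℂ × ℂ → ℂ, ∀ z ∈ K, AnalyticAt ℂ m (z, 0) ∧ ∀ᶠ z' in 𝓝 z, R z' m := by
  choose! m hma hmR using loc
  have hr : ∀ z ∈ K, ∃ r > 0, (∀ p ∈ Metric.ball z r ×ˢ Metric.ball (0 : ℂ) r,
      AnalyticAt ℂ (m z) p) ∧ ∀ z' ∈ Metric.ball z r, R z' (m z) := by
    intro z hz
    obtain ⟨r₁, hr₁, h₁⟩ := Metric.eventually_nhds_iff_ball.mp (hma z hz).eventually_analyticAt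
    obtain ⟨r₂, hr₂, h₂⟩ := Metric.eventually_nhds_iff_ball.mp (hmR z hz)
    refine ⟨min r₁ r₂, lt_min hr₁ hr₂, fun p hp => h₁ p ?_, fun z' hz' =>
      h₂ z' (Metric.ball_subset_ball (min_le_right _ _) hz')⟩
    rw [← ball_prod_same]
    exact ⟨Metric.ball_subset_ball (min_le_left _ _) hp.1,
      Metric.ball_subset_ball (min_le_left _ _) hp.2⟩
  choose! r hr0 hrA hrR using hr
  obtain ⟨t, htK, htc⟩ := hK.elim_nhds_subcover (fun z => Metric.ball z (r z))
    fun z hz => Metric.ball_mem_nhds z (hr0 z hz)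
  rcases t.eq_empty_or_nonempty with rfl | hne
  · refine ⟨0, fun z hz => absurd (htc hz) (by simp)⟩
  obtain ⟨zm, hzm, hmin⟩ := t.exists_min_image r hne
  -- The smallest of the finitely many radii, so that all the local functions are analytic for `|y|
  -- < δ`.
  set δ := r zm with hδ
  have hδ0 : 0 < δ := hr0 zm (htK zm hzm)
  -- The intersection of two balls is open, so it contains a point other than `z₀`, where the germ
  -- is determined. It is also convex, so the identity theorem spreads the equality to the whole
  -- overlap, `z₀` included.
  have hov : ∀ i ∈ t, ∀ j ∈ t, ∀ z ∈ Metric.ball i (r i), z ∈ Metric.ball j (r j) →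
      ∀ y ∈ Metric.ball (0 : ℂ) δ, m i (z, y) = m j (z, y) := by
    intro i hi j hj z hzi hzj y hy
    set W := Metric.ball i (r i) ∩ Metric.ball j (r j) with hW
    have hWo : IsOpen W := Metric.isOpen_ball.inter Metric.isOpen_ball
    obtain ⟨z₁, hz₁, hz₁ne⟩ : ∃ z₁ ∈ W, z₁ ≠ z₀ := by
      obtain ⟨w, hw, hne⟩ := ((infinite_of_mem_nhds z (hWo.mem_nhds ⟨hzi, hzj⟩)).sdiff
        (Set.finite_singleton z₀)).nonempty
      exact ⟨w, hw, hne⟩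
    have hcv : IsPreconnected (W ×ˢ Metric.ball (0 : ℂ) δ) :=
      (((convex_ball i (r i)).inter (convex_ball j (r j))).isPreconnected).prod
        (convex_ball (0 : ℂ) δ).isPreconnected
    have hAi : AnalyticOnNhd ℂ (m i) (W ×ˢ Metric.ball (0 : ℂ) δ) := fun p hp =>
      hrA i (htK i hi) p ⟨hp.1.1, Metric.ball_subset_ball (hmin i hi) hp.2⟩
    have hAj : AnalyticOnNhd ℂ (m j) (W ×ˢ Metric.ball (0 : ℂ) δ) := fun p hp =>
      hrA j (htK j hj) p ⟨hp.1.2, Metric.ball_subset_ball (hmin j hj) hp.2⟩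
    have h0 : ((z₁, 0) : ℂ × ℂ) ∈ W ×ˢ Metric.ball (0 : ℂ) δ := ⟨hz₁, Metric.mem_ball_self hδ0⟩
    have := hAi.eqOn_of_preconnected_of_eventuallyEq hAj hcv h0
      (uniq z₁ _ _ hz₁ne (hAi _ h0) (hAj _ h0) (hrR i (htK i hi) z₁ hz₁.1)
        (hrR j (htK j hj) z₁ hz₁.2))
    exact this ⟨⟨hzi, hzj⟩, hy⟩
  classical
  let c : ℂ → ℂ := fun z => if h : ∃ i ∈ t, z ∈ Metric.ball i (r i) then h.choose else 0
  have hc : ∀ j ∈ t, ∀ z ∈ Metric.ball j (r j), c z ∈ t ∧ z ∈ Metric.ball (c z) (r (c z)) := by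
    intro j hj z hz
    have h : ∃ i ∈ t, z ∈ Metric.ball i (r i) := ⟨j, hj, hz⟩
    have : c z = h.choose := dif_pos h
    rw [this]
    exact h.choose_spec
  have key : ∀ j ∈ t, ∀ z ∈ Metric.ball j (r j),
      m j =ᶠ[𝓝 ((z, 0) : ℂ × ℂ)] fun p => m (c p.1) p := by
    intro j hj z hz
    have : Metric.ball j (r j) ×ˢ Metric.ball (0 : ℂ) δ ∈ 𝓝 ((z, 0) : ℂ × ℂ) :=
      (Metric.isOpen_ball.prod Metric.isOpen_ball).mem_nhds ⟨hz, Metric.mem_ball_self hδ0⟩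
    filter_upwards [this] with p hp
    obtain ⟨h1, h2⟩ := hc j hj p.1 hp.1
    exact hov j hj _ h1 p.1 hp.1 h2 p.2 hp.2
  refine ⟨fun p => m (c p.1) p, fun z hz => ?_⟩
  obtain ⟨j, hj, hzj⟩ : ∃ j ∈ t, z ∈ Metric.ball j (r j) := by simpa using htc hz
  refine ⟨(hrA j (htK j hj) (z, 0) ⟨hzj, Metric.mem_ball_self (hr0 j (htK j hj))⟩).congr
    (key j hj z hzj), ?_⟩
  filter_upwards [Metric.isOpen_ball.mem_nhds hzj] with z' hz'
  exact hR z' _ _ (key j hj z' hz') (hrR j (htK j hj) z' hz')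

open scoped ContDiff in
/-- The analytic implicit function theorem for one unknown. -/
theorem exists_implicit {E : Type*} [NormedAddCommGroup E] [NormedSpace ℂ E] [CompleteSpace E]
    {G : E × ℂ → ℂ} {x₀ : E} {w₀ : ℂ} (hG : AnalyticAt ℂ G (x₀, w₀)) (h0 : G (x₀, w₀) = 0)
    {d : ℂ} (hd : HasDerivAt (fun w => G (x₀, w)) d w₀) (hd0 : d ≠ 0) :
    ∃ φ : E → ℂ, AnalyticAt ℂ φ x₀ ∧ φ x₀ = w₀ ∧
      (∀ᶠ v in 𝓝 (x₀, w₀), G v = 0 ↔ φ v.1 = v.2) ∧ ∀ᶠ x in 𝓝 x₀, G (x, φ x) = 0 := by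
  have cdf : ContDiffAt ℂ ω G (x₀, w₀) := hG.contDiffAt
  have hinv : (fderiv ℂ G (x₀, w₀) ∘L .inr ℂ E ℂ).IsInvertible := by
    have h1 : HasDerivAt (fun w => G (x₀, w)) (fderiv ℂ G (x₀, w₀) (0, 1)) w₀ :=
      hG.differentiableAt.hasFDerivAt.comp_hasDerivAt w₀
        ((hasDerivAt_const w₀ x₀).prodMk (hasDerivAt_id w₀))
    have h2 := h1.unique hd
    refine ⟨ContinuousLinearEquiv.unitsEquivAut ℂ (Units.mk0 d hd0), ?_⟩
    ext
    simp [h2]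
  refine ⟨cdf.implicitFunction (by simp) hinv, ?_, ?_, ?_, ?_⟩
  · exact (cdf.contDiffAt_implicitFunction (by simp) hinv).analyticAt
  · exact cdf.implicitFunction_apply_self (by simp) hinv
  · filter_upwards [cdf.eventually_apply_eq_iff_implicitFunction (by simp) hinv] with v hv
    rw [h0] at hv
    exact hv
  · filter_upwards [cdf.eventually_apply_implicitFunction (by simp) hinv] with v hv
    rw [h0] at hv
    exact hv

/-! ### Primitives with a parameter and the flow of a holomorphic differential equation. -/

/-- The primitive in the first variable that vanishes for `p.1 = 0`. -/
noncomputable def prim (F : ℂ × ℂ → ℂ) (p : ℂ × ℂ) : ℂ :=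
  p.1 * ∫ s in (0 : ℝ)..1, F (s * p.1, p.2)

section prim
variable {F G : ℂ × ℂ → ℂ} {R δ : ℝ}

theorem ofReal_mul_mem_ball {z : ℂ} (hz : z ∈ Metric.ball (0 : ℂ) R) {s : ℝ}
    (hs : s ∈ Set.Icc (0 : ℝ) 1) : (s : ℂ) * z ∈ Metric.ball (0 : ℂ) R := by
  rw [mem_ball_zero_iff] at hz ⊢
  rw [norm_mul, Complex.norm_real, Real.norm_of_nonneg hs.1]
  calc s * ‖z‖ ≤ 1 * ‖z‖ := by gcongr; exact hs.2
    _ < R := by rwa [one_mul]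

theorem continuousOn_prim_integrand
    (hF : AnalyticOnNhd ℂ F (Metric.ball 0 R ×ˢ Metric.ball 0 δ)) {p : ℂ × ℂ}
    (hp : p ∈ Metric.ball (0 : ℂ) R ×ˢ Metric.ball (0 : ℂ) δ) :
    ContinuousOn (fun s : ℝ => F (s * p.1, p.2)) (Set.uIcc 0 1) := by
  rw [Set.uIcc_of_le zero_le_one]
  refine hF.continuousOn.comp (by fun_prop) fun s hs => ⟨ofReal_mul_mem_ball hp.1 hs, hp.2⟩

/-- On a disc the slice has a holomorphic primitive `g`, and the integral along the segment from `0`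
computes `g z - g 0`. -/
theorem hasDerivAt_prim (hF : AnalyticOnNhd ℂ F (Metric.ball 0 R ×ˢ Metric.ball 0 δ)) {p : ℂ × ℂ}
    (hp : p ∈ Metric.ball (0 : ℂ) R ×ˢ Metric.ball (0 : ℂ) δ) :
    HasDerivAt (fun z => prim F (z, p.2)) (F p) p.1 := by
  have hd : DifferentiableOn ℂ (fun z => F (z, p.2)) (Metric.ball 0 R) := fun z hz =>
    (AnalyticAt.prodMk_left (hF (z, p.2) ⟨hz, hp.2⟩)).differentiableAt.differentiableWithinAt
  obtain ⟨g, hg⟩ := hd.isExactOn_ball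
  have key : ∀ z ∈ Metric.ball (0 : ℂ) R, prim F (z, p.2) = g z - g 0 := by
    intro z hz
    have h1 : ∀ s ∈ Set.uIcc (0 : ℝ) 1, HasDerivAt (fun s : ℝ => g (s * z)) (z * F (s * z, p.2)) s := by
      intro s hs
      rw [Set.uIcc_of_le zero_le_one] at hs
      have h2 := hg _ (ofReal_mul_mem_ball hz hs)
      have h3 : HasDerivAt (fun s : ℝ => (s : ℂ) * z) z s := by
        simpa using (Complex.ofRealCLM.hasDerivAt (x := s)).mul_const z
      have := h2.scomp s h3
      simpa [Function.comp_def] using this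
    have h2 := intervalIntegral.integral_eq_sub_of_hasDerivAt h1
      (ContinuousOn.intervalIntegrable (continuousOn_const.mul
        (continuousOn_prim_integrand hF (p := (z, p.2)) ⟨hz, hp.2⟩)))
    rw [intervalIntegral.integral_const_mul] at h2
    simpa [prim] using h2
  have := (hg p.1 hp.1).sub_const (g 0)
  refine this.congr_of_eventuallyEq ?_
  filter_upwards [Metric.isOpen_ball.mem_nhds hp.1] with z hz using key z hz

theorem norm_prim_sub_le (hF : AnalyticOnNhd ℂ F (Metric.ball 0 R ×ˢ Metric.ball 0 δ))
    (hG : AnalyticOnNhd ℂ G (Metric.ball 0 R ×ˢ Metric.ball 0 δ)) {C : ℝ}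
    (h : ∀ p ∈ Metric.ball (0 : ℂ) R ×ˢ Metric.ball (0 : ℂ) δ, ‖F p - G p‖ ≤ C) {p : ℂ × ℂ}
    (hp : p ∈ Metric.ball (0 : ℂ) R ×ˢ Metric.ball (0 : ℂ) δ) :
    ‖prim F p - prim G p‖ ≤ R * C := by
  have h1 : prim F p - prim G p = p.1 * ∫ s in (0 : ℝ)..1, (F (s * p.1, p.2) - G (s * p.1, p.2)) := by
    rw [intervalIntegral.integral_sub (continuousOn_prim_integrand hF hp).intervalIntegrable
      (continuousOn_prim_integrand hG hp).intervalIntegrable, prim, prim, mul_sub]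
  have hC : 0 ≤ C := (norm_nonneg _).trans (h p hp)
  have h2 : ‖∫ s in (0 : ℝ)..1, (F (s * p.1, p.2) - G (s * p.1, p.2))‖ ≤ C * |1 - 0| := by
    refine intervalIntegral.norm_integral_le_of_norm_le_const fun s hs => ?_
    rw [Set.uIoc_of_le zero_le_one] at hs
    exact h (s * p.1, p.2) ⟨ofReal_mul_mem_ball hp.1 ⟨hs.1.le, hs.2⟩, hp.2⟩
  rw [h1, norm_mul]
  have h3 : ‖p.1‖ ≤ R := (mem_ball_zero_iff.mp hp.1).le
  have hR : 0 ≤ R := (norm_nonneg _).trans h3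
  simp only [sub_zero, abs_one, mul_one] at h2
  gcongr

/-- Differentiation under the integral sign, dominated by the maximum of the partial derivative on a
compact set. -/
theorem differentiableAt_prim_snd (hF : AnalyticOnNhd ℂ F (Metric.ball 0 R ×ˢ Metric.ball 0 δ))
    {p : ℂ × ℂ} (hp : p ∈ Metric.ball (0 : ℂ) R ×ˢ Metric.ball (0 : ℂ) δ) :
    DifferentiableAt ℂ (fun y => prim F (p.1, y)) p.2 := by
  obtain ⟨r, hr, hrs⟩ := Metric.nhds_basis_closedBall.mem_iff.mp (Metric.isOpen_ball.mem_nhds hp.2)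
  have hcont : ContinuousOn (fun q : ℝ × ℂ => fderiv ℂ F (q.1 * p.1, q.2) (0, 1))
      (Set.Icc 0 1 ×ˢ Metric.closedBall p.2 r) := by
    have h1 : ContinuousOn (fun q => fderiv ℂ F q (0, 1)) (Metric.ball 0 R ×ˢ Metric.ball 0 δ) :=
      fun q hq => (analyticAt_fderiv_apply (hF q hq) (0, 1)).continuousAt.continuousWithinAt
    refine h1.comp (f := fun q : ℝ × ℂ => ((q.1 : ℂ) * p.1, q.2)) (by fun_prop) ?_
    rintro ⟨s, y⟩ ⟨hs, hy⟩
    exact ⟨ofReal_mul_mem_ball hp.1 hs, hrs hy⟩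
  obtain ⟨C, hC⟩ := (isCompact_Icc.prod (isCompact_closedBall p.2 r)).exists_bound_of_continuousOn hcont
  have hII : ∀ s ∈ Set.uIoc (0 : ℝ) 1, s ∈ Set.Icc (0 : ℝ) 1 := by
    intro s hs
    rw [Set.uIoc_of_le zero_le_one] at hs
    exact ⟨hs.1.le, hs.2⟩
  have hmeas : ∀ y ∈ Metric.ball (0 : ℂ) δ, IntervalIntegrable (fun s : ℝ => F (s * p.1, y))
      MeasureTheory.volume 0 1 := fun y hy =>
    (continuousOn_prim_integrand hF (p := (p.1, y)) ⟨hp.1, hy⟩).intervalIntegrable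
  have := intervalIntegral.hasDerivAt_integral_of_dominated_loc_of_deriv_le
    (μ := MeasureTheory.volume) (a := 0) (b := 1) (x₀ := p.2)
    (F := fun y (s : ℝ) => F (s * p.1, y)) (F' := fun y (s : ℝ) => fderiv ℂ F (s * p.1, y) (0, 1))
    (bound := fun _ => C) (Metric.closedBall_mem_nhds p.2 hr) ?_ (hmeas _ hp.2) ?_ ?_ ?_ ?_
  · exact (this.2.differentiableAt).const_mul p.1
  · filter_upwards [Metric.isOpen_ball.mem_nhds hp.2] with y hy
    exact (intervalIntegrable_iff.mp (hmeas y hy)).aestronglyMeasurable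
  · have : ContinuousOn (fun s : ℝ => fderiv ℂ F (s * p.1, p.2) (0, 1)) (Set.uIcc 0 1) := by
      rw [Set.uIcc_of_le zero_le_one]
      exact hcont.comp (f := fun s : ℝ => (s, p.2)) (by fun_prop)
        fun s hs => ⟨hs, Metric.mem_closedBall_self hr.le⟩
    exact (intervalIntegrable_iff.mp
      (this.intervalIntegrable (μ := MeasureTheory.volume))).aestronglyMeasurable
  · refine Eventually.of_forall fun s hs y hy => hC (s, y) ⟨hII s hs, hy⟩
  · exact intervalIntegrable_const
  · refine Eventually.of_forall fun s hs y hy => ?_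
    exact deriv_snd_eq (hF (s * p.1, y) ⟨ofReal_mul_mem_ball hp.1 (hII s hs), hrs hy⟩)

theorem analyticOnNhd_prim (hF : AnalyticOnNhd ℂ F (Metric.ball 0 R ×ˢ Metric.ball 0 δ)) {C : ℝ}
    (hC : ∀ p ∈ Metric.ball (0 : ℂ) R ×ˢ Metric.ball (0 : ℂ) δ, ‖F p‖ ≤ C) :
    AnalyticOnNhd ℂ (prim F) (Metric.ball 0 R ×ˢ Metric.ball 0 δ) := by
  refine analyticOnNhd_of_separately (Metric.isOpen_ball.prod Metric.isOpen_ball) ?_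
    (fun p hp => (hasDerivAt_prim hF hp).differentiableAt)
    (fun p hp => differentiableAt_prim_snd hF hp)
  intro p hp
  refine ⟨R * C, ?_⟩
  filter_upwards [(Metric.isOpen_ball.prod Metric.isOpen_ball).mem_nhds hp] with q hq
  have := norm_prim_sub_le hF (G := fun _ => 0) (fun _ _ => analyticAt_const) (C := C)
    (by simpa using hC) hq
  simpa [prim] using this

end prim

/-- Weierstrass's theorem in each variable separately, then Osgood's lemma. -/
theorem exists_analytic_limit {u : ℕ → ℂ × ℂ → ℂ} {U : ℂ × ℂ → ℂ} {A B : Set ℂ} (hA : IsOpen A)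
    (hB : IsOpen B) (hu : ∀ k, AnalyticOnNhd ℂ (u k) (A ×ˢ B)) {M : ℝ}
    (hM : ∀ p ∈ A ×ˢ B, ‖U p‖ ≤ M) (hlim : TendstoUniformlyOn u U atTop (A ×ˢ B)) :
    AnalyticOnNhd ℂ U (A ×ˢ B) := by
  refine analyticOnNhd_of_separately (hA.prod hB) ?_ ?_ ?_
  · intro p hp
    refine ⟨M, ?_⟩
    filter_upwards [(hA.prod hB).mem_nhds hp] with q hq using hM q hq
  · intro p hp
    have h1 : TendstoUniformlyOn (fun k z => u k (z, p.2)) (fun z => U (z, p.2)) atTop A := by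
      rw [Metric.tendstoUniformlyOn_iff] at hlim ⊢
      intro e he
      filter_upwards [hlim e he] with k hk z hz using hk (z, p.2) ⟨hz, hp.2⟩
    have := h1.tendstoLocallyUniformlyOn.differentiableOn (Eventually.of_forall fun k z hz =>
      (AnalyticAt.prodMk_left (hu k (z, p.2) ⟨hz, hp.2⟩)).differentiableAt.differentiableWithinAt) hA
    exact this.differentiableAt (hA.mem_nhds hp.1)
  · intro p hp
    have h1 : TendstoUniformlyOn (fun k y => u k (p.1, y)) (fun y => U (p.1, y)) atTop B := by
      rw [Metric.tendstoUniformlyOn_iff] at hlim ⊢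
      intro e he
      filter_upwards [hlim e he] with k hk z hz using hk (p.1, z) ⟨hp.1, hz⟩
    have := h1.tendstoLocallyUniformlyOn.differentiableOn (Eventually.of_forall fun k z hz =>
      (AnalyticAt.prodMk_right (hu k (p.1, z) ⟨hp.1, hz⟩)).differentiableAt.differentiableWithinAt) hB
    exact this.differentiableAt (hB.mem_nhds hp.2)


/-- The solutions of `dy/dζ = - y β(ζ, y)`, in the form `y = η exp (- a ζ) U(ζ, η)` where `η` is the
value for `ζ = 0`. -/
theorem exists_flow {β : ℂ × ℂ → ℂ} {a : ℂ} {R R' δ₀ : ℝ} (hR : 0 < R) (hRR' : R < R')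
    (hδ₀ : 0 < δ₀) (hβ : AnalyticOnNhd ℂ β (Metric.ball 0 R' ×ˢ Metric.ball 0 δ₀))
    (hβ0 : ∀ z ∈ Metric.ball (0 : ℂ) R', β (z, 0) = a) :
    ∃ δ > 0, ∃ U : ℂ × ℂ → ℂ, AnalyticOnNhd ℂ U (Metric.ball 0 R ×ˢ Metric.ball 0 δ) ∧
      (∀ y ∈ Metric.ball (0 : ℂ) δ, U (0, y) = 1) ∧
      (∀ z ∈ Metric.ball (0 : ℂ) R, U (z, 0) = 1) ∧
      ∀ p ∈ Metric.ball (0 : ℂ) R ×ˢ Metric.ball (0 : ℂ) δ,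
        U p ≠ 0 ∧ ‖p.2 * Complex.exp (-(a * p.1)) * U p‖ < δ₀ ∧
        HasDerivAt (fun z => p.2 * Complex.exp (-(a * z)) * U (z, p.2))
          (-(p.2 * Complex.exp (-(a * p.1)) * U p) *
            β (p.1, p.2 * Complex.exp (-(a * p.1)) * U p)) p.1 := by
  -- Lipschitz constant of `β` in the second variable
  obtain ⟨C, hC⟩ : ∃ C : ℝ, ∀ p ∈ Metric.closedBall (0 : ℂ) R ×ˢ Metric.closedBall (0 : ℂ) (δ₀ / 2),
      ‖fderiv ℂ β p (0, 1)‖ ≤ C := by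
    refine ((isCompact_closedBall 0 R).prod
      (isCompact_closedBall 0 (δ₀ / 2))).exists_bound_of_continuousOn fun p hp => ?_
    exact (analyticAt_fderiv_apply (hβ p ⟨Metric.closedBall_subset_ball hRR' hp.1,
      Metric.closedBall_subset_ball (by linarith) hp.2⟩) (0, 1)).continuousAt.continuousWithinAt
  have hC0 : 0 ≤ C := (norm_nonneg _).trans (hC (0, 0)
    ⟨Metric.mem_closedBall_self hR.le, Metric.mem_closedBall_self (by linarith)⟩)
  have hLip : ∀ z ∈ Metric.ball (0 : ℂ) R, ∀ y ∈ Metric.ball (0 : ℂ) (δ₀ / 2),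
      ∀ y' ∈ Metric.ball (0 : ℂ) (δ₀ / 2), ‖β (z, y) - β (z, y')‖ ≤ C * ‖y - y'‖ := by
    intro z hz y hy y' hy'
    refine Convex.norm_image_sub_le_of_norm_hasDerivWithin_le (𝕜 := ℂ)
      (f := fun y => β (z, y)) (f' := fun y => fderiv ℂ β (z, y) (0, 1))
      (s := Metric.ball (0 : ℂ) (δ₀ / 2)) (fun w hw => ?_) (fun w hw => ?_) (convex_ball _ _) hy' hy
    · exact (deriv_snd_eq (hβ (z, w) ⟨Metric.ball_subset_ball hRR'.le hz,
        Metric.ball_subset_ball (by linarith) hw⟩)).hasDerivWithinAt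
    · exact hC (z, w) ⟨Metric.ball_subset_closedBall hz, Metric.ball_subset_closedBall hw⟩
  set A : ℝ := Real.exp (‖a‖ * R) with hA
  have hA0 : 0 < A := Real.exp_pos _
  have hAz : ∀ z ∈ Metric.ball (0 : ℂ) R, ‖Complex.exp (-(a * z))‖ ≤ A := by
    intro z hz
    rw [Complex.norm_exp]
    refine Real.exp_le_exp.mpr ((Complex.re_le_norm _).trans ?_)
    rw [norm_neg, norm_mul]
    exact mul_le_mul_of_nonneg_left (mem_ball_zero_iff.mp hz).le (norm_nonneg _)
  -- The first condition keeps the solutions in `|y| < δ₀ / 2` as long as `|U| ≤ 2`. The second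
  -- makes the Picard operator a contraction of ratio `1 / 2`: `4 C A δ` is the Lipschitz constant
  -- of `N` and integration costs a factor `R`.
  obtain ⟨δ, hδ, hδ1, hδ2⟩ : ∃ δ > 0, 2 * (A * δ) < δ₀ / 2 ∧ R * (4 * (C * (A * δ))) ≤ 1 / 2 := by
    have h1 : Tendsto (fun δ : ℝ => 2 * (A * δ)) (𝓝[>] 0) (𝓝 0) := by
      refine tendsto_nhdsWithin_of_tendsto_nhds (Continuous.tendsto' (by fun_prop) _ _ (by simp))
    have h2 : Tendsto (fun δ : ℝ => R * (4 * (C * (A * δ)))) (𝓝[>] 0) (𝓝 0) := by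
      refine tendsto_nhdsWithin_of_tendsto_nhds (Continuous.tendsto' (by fun_prop) _ _ (by simp))
    obtain ⟨δ, ⟨h3, h4⟩, h5⟩ := ((h1.eventually_lt_const (half_pos hδ₀)).and
      (h2.eventually_le_const (by norm_num : (0 : ℝ) < 1 / 2))).and self_mem_nhdsWithin |>.exists
    exact ⟨δ, h5, h3, h4⟩
  set W : Set (ℂ × ℂ) := Metric.ball (0 : ℂ) R ×ˢ Metric.ball (0 : ℂ) δ with hW
  let Y : (ℂ × ℂ → ℂ) → ℂ × ℂ → ℂ := fun F p => p.2 * Complex.exp (-(a * p.1)) * F p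
  -- For `y = η exp (-a ζ) U` the equation becomes `dU/dζ = -U (β - a)`. Since `β - a` vanishes on
  -- `y = 0`, its right side is small when `η` is.
  let N : (ℂ × ℂ → ℂ) → ℂ × ℂ → ℂ := fun F p => F p * (β (p.1, Y F p) - a)
  have hYdiff : ∀ F G : ℂ × ℂ → ℂ, ∀ p ∈ W, ‖Y F p - Y G p‖ ≤ A * δ * ‖F p - G p‖ := by
    intro F G p hp
    have h1 : Y F p - Y G p = p.2 * Complex.exp (-(a * p.1)) * (F p - G p) := by
      simp only [Y]; ring
    rw [h1, norm_mul, norm_mul]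
    have h2 := hAz p.1 hp.1
    have h3 := (mem_ball_zero_iff.mp hp.2).le
    rw [mul_comm A δ]
    gcongr
  have hYb : ∀ F : ℂ × ℂ → ℂ, ∀ p ∈ W, ‖F p‖ ≤ 2 → ‖Y F p‖ ≤ A * δ * 2 := by
    intro F p hp h
    have := hYdiff F 0 p hp
    simp only [Y, Pi.zero_apply, mul_zero, sub_zero] at this ⊢
    exact this.trans (by gcongr)
  have hYball : ∀ F : ℂ × ℂ → ℂ, ∀ p ∈ W, ‖F p‖ ≤ 2 → Y F p ∈ Metric.ball (0 : ℂ) (δ₀ / 2) := by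
    intro F p hp h
    rw [mem_ball_zero_iff]
    linarith [hYb F p hp h]
  have hNb : ∀ F : ℂ × ℂ → ℂ, ∀ p ∈ W, ‖F p‖ ≤ 2 → ‖β (p.1, Y F p) - a‖ ≤ C * (A * δ * 2) := by
    intro F p hp h
    rw [← hβ0 p.1 (Metric.ball_subset_ball hRR'.le hp.1)]
    refine (hLip p.1 hp.1 _ (hYball F p hp h) 0 (Metric.mem_ball_self (by linarith))).trans ?_
    rw [sub_zero]
    exact mul_le_mul_of_nonneg_left (hYb F p hp h) hC0
  have hNdiff : ∀ F G : ℂ × ℂ → ℂ, ∀ p ∈ W, ‖F p‖ ≤ 2 → ‖G p‖ ≤ 2 →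
      ‖N F p - N G p‖ ≤ 4 * (C * (A * δ)) * ‖F p - G p‖ := by
    intro F G p hp hF hG
    have h1 : N F p - N G p = (F p - G p) * (β (p.1, Y F p) - a) +
        G p * (β (p.1, Y F p) - β (p.1, Y G p)) := by
      simp only [N]; ring
    have h2 := hLip p.1 hp.1 _ (hYball F p hp hF) _ (hYball G p hp hG)
    have h3 := hYdiff F G p hp
    have h4 := hNb F p hp hF
    calc ‖N F p - N G p‖ ≤ ‖F p - G p‖ * ‖β (p.1, Y F p) - a‖ +
        ‖G p‖ * ‖β (p.1, Y F p) - β (p.1, Y G p)‖ := by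
          rw [h1, ← norm_mul, ← norm_mul]; exact norm_add_le _ _
      _ ≤ ‖F p - G p‖ * (C * (A * δ * 2)) + 2 * (C * (A * δ * ‖F p - G p‖)) := by
          gcongr
          exact h2.trans (by gcongr)
      _ = _ := by ring
  have hNan : ∀ F : ℂ × ℂ → ℂ, AnalyticOnNhd ℂ F W → (∀ p ∈ W, ‖F p‖ ≤ 2) →
      AnalyticOnNhd ℂ (N F) W := by
    intro F hF hF2 p hp
    have hY : AnalyticAt ℂ (Y F) p := by
      refine (analyticAt_snd.mul ?_).mul (hF p hp)
      exact (analyticAt_const.mul analyticAt_fst).neg.cexp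
    refine (hF p hp).mul (AnalyticAt.sub ?_ analyticAt_const)
    refine AnalyticAt.fun_comp_of_eq (hβ (p.1, Y F p) ⟨Metric.ball_subset_ball hRR'.le hp.1,
      Metric.ball_subset_ball (by linarith) (hYball F p hp (hF2 p hp))⟩) (analyticAt_fst.prod hY) rfl
  -- Picard iteration from the constant `1`, with `U = 1` at `ζ = 0` as initial condition. The
  -- iterates stay within `1 / 2` of `1`, so they are bounded by `2` and their limit has no zero.
  let u : ℕ → ℂ × ℂ → ℂ := fun k => Nat.rec (fun _ => 1) (fun _ F p => 1 - prim (N F) p) k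
  have hu_succ : ∀ k p, u (k + 1) p = 1 - prim (N (u k)) p := fun k p => rfl
  have hN0 : AnalyticOnNhd ℂ (fun _ : ℂ × ℂ => (0 : ℂ)) W := fun _ _ => analyticAt_const
  have hprim0 : ∀ p, prim (fun _ => 0) p = 0 := by intro p; simp [prim]
  have hstep : ∀ F : ℂ × ℂ → ℂ, (∀ p ∈ W, ‖F p‖ ≤ 2) → ∀ p ∈ W, ‖N F p‖ ≤ 4 * (C * (A * δ)) := by
    intro F hF p hp
    have h1 := hNb F p hp (hF p hp)
    calc ‖N F p‖ = ‖F p‖ * ‖β (p.1, Y F p) - a‖ := norm_mul _ _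
      _ ≤ 2 * (C * (A * δ * 2)) := by gcongr; exact hF p hp
      _ = _ := by ring
  have hu2 : ∀ k, AnalyticOnNhd ℂ (u k) W ∧ ∀ p ∈ W, ‖u k p - 1‖ ≤ 1 / 2 := by
    intro k
    induction k with
    | zero => exact ⟨fun _ _ => analyticAt_const, fun p hp => by simp [u]⟩
    | succ k ih =>
      have hF2 : ∀ p ∈ W, ‖u k p‖ ≤ 2 := by
        intro p hp
        have := norm_le_norm_add_norm_sub' (u k p) 1
        have h2 := ih.2 p hp
        rw [norm_one] at this
        linarith
      have hNa := hNan _ ih.1 hF2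
      refine ⟨fun p hp => analyticAt_const.sub
        (analyticOnNhd_prim hNa (hstep _ hF2) p hp), fun p hp => ?_⟩
      have := norm_prim_sub_le hNa hN0 (C := 4 * (C * (A * δ))) (fun q hq => by
        rw [sub_zero]; exact hstep _ hF2 q hq) hp
      rw [hprim0, sub_zero] at this
      rw [hu_succ, sub_sub_cancel_left, norm_neg]
      linarith
  have hF2 : ∀ k, ∀ p ∈ W, ‖u k p‖ ≤ 2 := by
    intro k p hp
    have := norm_le_norm_add_norm_sub' (u k p) 1
    have h2 := (hu2 k).2 p hp
    rw [norm_one] at this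
    linarith
  have hgeo : ∀ k, ∀ p ∈ W, ‖u k p - u (k + 1) p‖ ≤ 1 / 2 * (1 / 2) ^ k := by
    intro k
    induction k with
    | zero =>
      intro p hp
      have := (hu2 1).2 p hp
      rw [norm_sub_rev] at this
      simpa [u] using this
    | succ k ih =>
      intro p hp
      have h1 : u (k + 1) p - u (k + 1 + 1) p = -(prim (N (u k)) p - prim (N (u (k + 1))) p) := by
        rw [hu_succ k, hu_succ (k + 1)]; ring
      rw [h1, norm_neg]
      have h2 := norm_prim_sub_le (hNan _ (hu2 k).1 (hF2 k)) (hNan _ (hu2 (k + 1)).1 (hF2 (k + 1)))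
        (C := 4 * (C * (A * δ)) * (1 / 2 * (1 / 2) ^ k)) (fun q hq => by
          refine (hNdiff _ _ q hq (hF2 k q hq) (hF2 (k + 1) q hq)).trans ?_
          gcongr
          exact ih q hq) hp
      refine h2.trans ?_
      rw [← mul_assoc, pow_succ]
      have : R * (4 * (C * (A * δ))) * (1 / 2 * (1 / 2) ^ k) ≤ 1 / 2 * (1 / 2 * (1 / 2) ^ k) := by
        gcongr
      linarith
  have hlim : ∀ p ∈ W, Tendsto (fun k => u k p) atTop (𝓝 (limUnder atTop fun k => u k p)) := by
    intro p hp
    refine (cauchySeq_of_le_geometric (1 / 2) (1 / 2) (by norm_num) fun k => ?_).tendsto_limUnder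
    rw [dist_eq_norm]
    exact hgeo k p hp
  set U : ℂ × ℂ → ℂ := fun p => limUnder atTop fun k => u k p with hU
  have hdist : ∀ k, ∀ p ∈ W, ‖u k p - U p‖ ≤ (1 / 2) ^ k := by
    intro k p hp
    have := dist_le_of_le_geometric_of_tendsto (1 / 2) (1 / 2) (by norm_num)
      (fun k => by rw [dist_eq_norm]; exact hgeo k p hp) (hlim p hp) k
    rw [dist_eq_norm] at this
    refine this.trans (le_of_eq ?_)
    norm_num
  have hU1 : ∀ p ∈ W, ‖U p - 1‖ ≤ 1 / 2 := fun p hp =>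
    le_of_tendsto ((hlim p hp).sub_const 1).norm (Eventually.of_forall fun k => (hu2 k).2 p hp)
  have hU2 : ∀ p ∈ W, ‖U p‖ ≤ 2 := by
    intro p hp
    have := norm_le_norm_add_norm_sub' (U p) 1
    have h2 := hU1 p hp
    rw [norm_one] at this
    linarith
  have hpow : Tendsto (fun k : ℕ => (1 / 2 : ℝ) ^ k) atTop (𝓝 0) :=
    tendsto_pow_atTop_nhds_zero_of_lt_one (by norm_num) (by norm_num)
  have hunif : TendstoUniformlyOn u U atTop W := by
    rw [Metric.tendstoUniformlyOn_iff]
    intro e he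
    filter_upwards [hpow.eventually_lt_const he] with k hk p hp
    rw [dist_comm, dist_eq_norm]
    exact (hdist k p hp).trans_lt hk
  have hUan : AnalyticOnNhd ℂ U W := exists_analytic_limit Metric.isOpen_ball Metric.isOpen_ball
    (fun k => (hu2 k).1) hU2 hunif
  have hNU := hNan U hUan hU2
  have hfix : ∀ p ∈ W, U p = 1 - prim (N U) p := by
    intro p hp
    have h1 : Tendsto (fun k => u (k + 1) p) atTop (𝓝 (U p)) := (hlim p hp).comp (tendsto_add_atTop_nat 1)
    refine tendsto_nhds_unique h1 ?_
    rw [tendsto_iff_norm_sub_tendsto_zero]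
    have h2 : Tendsto (fun k : ℕ => R * (4 * (C * (A * δ)) * (1 / 2 : ℝ) ^ k)) atTop (𝓝 0) := by
      simpa using (hpow.const_mul (4 * (C * (A * δ)))).const_mul R
    refine squeeze_zero (fun _ => norm_nonneg _) (fun k => ?_) h2
    have h3 : u (k + 1) p - (1 - prim (N U) p) = -(prim (N (u k)) p - prim (N U) p) := by
      rw [hu_succ]; ring
    rw [h3, norm_neg]
    refine norm_prim_sub_le (hNan _ (hu2 k).1 (hF2 k)) hNU (fun q hq => ?_) hp
    refine (hNdiff _ _ q hq (hF2 k q hq) (hU2 q hq)).trans ?_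
    gcongr
    exact hdist k q hq
  refine ⟨δ, hδ, U, hUan, fun y hy => ?_, fun z hz => ?_, fun p hp => ⟨?_, ?_, ?_⟩⟩
  · rw [hfix (0, y) ⟨Metric.mem_ball_self hR, hy⟩]
    simp [prim]
  · rw [hfix (z, 0) ⟨hz, Metric.mem_ball_self hδ⟩]
    have : ∫ s in (0 : ℝ)..1, N U (s * z, 0) = ∫ s in (0 : ℝ)..1, (0 : ℂ) := by
      refine intervalIntegral.integral_congr fun s hs => ?_
      rw [Set.uIcc_of_le zero_le_one] at hs
      simp only [N, Y, zero_mul]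
      rw [hβ0 _ (Metric.ball_subset_ball hRR'.le (ofReal_mul_mem_ball hz hs))]
      simp
    simp only [prim]
    rw [this]
    simp
  · intro h0
    have := hU1 p hp
    rw [h0] at this
    norm_num at this
  · have := mem_ball_zero_iff.mp (hYball U p hp (hU2 p hp))
    change ‖Y U p‖ < δ₀
    linarith
  · have h1 : HasDerivAt (fun z => U (z, p.2)) (-(N U p)) p.1 := by
      refine ((hasDerivAt_prim hNU hp).const_sub 1).congr_of_eventuallyEq ?_
      filter_upwards [Metric.isOpen_ball.mem_nhds hp.1] with z hz using hfix (z, p.2) ⟨hz, hp.2⟩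
    have h2 : HasDerivAt (fun z => Complex.exp (-(a * z))) (Complex.exp (-(a * p.1)) * -(a * 1)) p.1 :=
      ((hasDerivAt_id p.1).const_mul a).neg.cexp
    have h3 := (h2.const_mul p.2).mul h1
    refine h3.congr_deriv ?_
    simp only [N, Y]
    ring

/-! ### The covering chart and a first integral over a large disc. -/

/-- The chart `(ζ, y) ↦ (x, y)` with `x / y = exp ζ / lam`. -/
noncomputable def chart (lam : ℂ) (p : ℂ × ℂ) : ℂ × ℂ := (lam⁻¹ * Complex.exp p.1 * p.2, p.2)

/-- In the chart, the leaves of `y dx + x B dy = 0` are the solutions of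
`dy / dζ = - y * beta B lam (ζ, y)`. -/
noncomputable def beta (B : ℂ × ℂ → ℂ) (lam : ℂ) (p : ℂ × ℂ) : ℂ := (1 + B (chart lam p))⁻¹

/-- `J` is a first integral of `y dx + x B dy = 0` near the point `p₀` of the chart. -/
def IsFirstIntegralAt (B : ℂ × ℂ → ℂ) (lam : ℂ) (J : ℂ × ℂ → ℂ) (p₀ : ℂ × ℂ) : Prop :=
  ∀ᶠ p in 𝓝 p₀, fderiv ℂ J p (1, -(p.2 * beta B lam p)) = 0

/-- The value at `ζ` of the solution with value `η` at `0`. -/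
noncomputable def leaf (lam : ℂ) (U : ℂ × ℂ → ℂ) (p : ℂ × ℂ) : ℂ :=
  p.2 * Complex.exp (-((1 + lam)⁻¹ * p.1)) * U p

theorem analyticAt_chart (lam : ℂ) (p : ℂ × ℂ) : AnalyticAt ℂ (chart lam) p :=
  ((analyticAt_const.mul analyticAt_fst.cexp).mul analyticAt_snd).prod analyticAt_snd

theorem chart_zero (lam z : ℂ) : chart lam (z, 0) = 0 := by simp [chart]

/-- A nondegenerate coefficient `B` of a form `y dx + x B dy`. -/
structure IsCoeff (B : ℂ × ℂ → ℂ) (lam : ℂ) : Prop where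
  analytic : AnalyticAt ℂ B 0
  map_zero : B 0 = lam
  ne_zero : lam ≠ 0
  one_add_ne : 1 + lam ≠ 0

section
variable {B : ℂ × ℂ → ℂ} {lam : ℂ}

theorem IsCoeff.analyticAt_comp_chart (hB : IsCoeff B lam) (z : ℂ) :
    AnalyticAt ℂ (fun p => B (chart lam p)) (z, 0) :=
  AnalyticAt.fun_comp_of_eq hB.analytic (analyticAt_chart lam _) (chart_zero lam z)

theorem IsCoeff.analyticAt_beta (hB : IsCoeff B lam) (z : ℂ) :
    AnalyticAt ℂ (beta B lam) (z, 0) := by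
  refine (analyticAt_const.add (hB.analyticAt_comp_chart z)).inv ?_
  change 1 + B (chart lam (z, 0)) ≠ 0
  rw [chart_zero, hB.map_zero]
  exact hB.one_add_ne

theorem IsCoeff.beta_zero (hB : IsCoeff B lam) (z : ℂ) : beta B lam (z, 0) = (1 + lam)⁻¹ := by
  rw [beta, chart_zero, hB.map_zero]

theorem IsCoeff.eventually_beta (hB : IsCoeff B lam) (z : ℂ) :
    ∀ᶠ p in 𝓝 ((z, 0) : ℂ × ℂ), 1 + B (chart lam p) ≠ 0 := by
  refine (analyticAt_const.add (hB.analyticAt_comp_chart z)).continuousAt.eventually_ne ?_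
  change 1 + B (chart lam (z, 0)) ≠ 0
  rw [chart_zero, hB.map_zero]
  exact hB.one_add_ne

/-- The solutions of `dy / dζ = - y * beta B lam (ζ, y)`, and a first integral `H` with value `y` for
`ζ = 0`. -/
structure FlowData (B : ℂ × ℂ → ℂ) (lam : ℂ) (δ : ℝ) (U H : ℂ × ℂ → ℂ) : Prop where
  pos : 0 < δ
  analytic : AnalyticOnNhd ℂ U (Metric.ball 0 19 ×ˢ Metric.ball 0 δ)
  ne_zero : ∀ p ∈ Metric.ball (0 : ℂ) 19 ×ˢ Metric.ball (0 : ℂ) δ, U p ≠ 0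
  zero_left : ∀ y ∈ Metric.ball (0 : ℂ) δ, U (0, y) = 1
  zero_right : ∀ z ∈ Metric.ball (0 : ℂ) 19, U (z, 0) = 1
  one_add_ne : ∀ p ∈ Metric.ball (0 : ℂ) 19 ×ˢ Metric.ball (0 : ℂ) δ,
    1 + B (chart lam (p.1, leaf lam U p)) ≠ 0
  hasDerivAt_leaf : ∀ p ∈ Metric.ball (0 : ℂ) 19 ×ˢ Metric.ball (0 : ℂ) δ,
    HasDerivAt (fun z => leaf lam U (z, p.2))
      (-(leaf lam U p * beta B lam (p.1, leaf lam U p))) p.1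
  analytic' : ∀ z ∈ Metric.ball (0 : ℂ) 18, AnalyticAt ℂ H (z, 0)
  leaf_H : ∀ z ∈ Metric.ball (0 : ℂ) 18, ∀ᶠ p in 𝓝 ((z, 0) : ℂ × ℂ), leaf lam U (p.1, H p) = p.2
  H_leaf : ∀ z ∈ Metric.ball (0 : ℂ) 18, ∀ᶠ p in 𝓝 ((z, 0) : ℂ × ℂ), H (p.1, leaf lam U p) = p.2

theorem analyticAt_leaf {U : ℂ × ℂ → ℂ} {p : ℂ × ℂ} (hU : AnalyticAt ℂ U p) :
    AnalyticAt ℂ (leaf lam U) p :=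
  (analyticAt_snd.mul (analyticAt_const.mul analyticAt_fst).neg.cexp).mul hU

theorem leaf_zero (lam : ℂ) (U : ℂ × ℂ → ℂ) (z : ℂ) : leaf lam U (z, 0) = 0 := by simp [leaf]

theorem hasDerivAt_leaf_snd {U : ℂ × ℂ → ℂ} {z : ℂ} (hU : AnalyticAt ℂ U (z, 0)) (h1 : U (z, 0) = 1) :
    HasDerivAt (fun w => leaf lam U (z, w)) (Complex.exp (-((1 + lam)⁻¹ * z))) 0 := by
  have h2 : HasDerivAt (fun w => U (z, w)) (deriv (fun w => U (z, w)) 0) 0 :=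
    (AnalyticAt.prodMk_right hU).differentiableAt.hasDerivAt
  have h3 : HasDerivAt (fun w : ℂ => w * Complex.exp (-((1 + lam)⁻¹ * z)))
      (1 * Complex.exp (-((1 + lam)⁻¹ * z))) 0 := (hasDerivAt_id (0 : ℂ)).mul_const _
  refine (h3.mul h2).congr_deriv ?_
  simp [h1]

/-- Implicit function theorem in the initial value: on `y = 0` the derivative of `leaf` with respect
to it is an exponential. The last clause, local uniqueness, is what gluing requires. -/
theorem exists_inverse_leaf {U : ℂ × ℂ → ℂ} {z : ℂ} (hU : AnalyticAt ℂ U (z, 0))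
    (h1 : U (z, 0) = 1) : ∃ φ : ℂ × ℂ → ℂ, AnalyticAt ℂ φ (z, 0) ∧ (∀ᶠ z' in 𝓝 z, φ (z', 0) = 0) ∧
      (∀ᶠ p in 𝓝 ((z, 0) : ℂ × ℂ), leaf lam U (p.1, φ p) = p.2) ∧
      (∀ᶠ p in 𝓝 ((z, 0) : ℂ × ℂ), φ (p.1, leaf lam U p) = p.2) ∧
      ∀ m : ℂ × ℂ → ℂ, AnalyticAt ℂ m (z, 0) → m (z, 0) = 0 →
        (∀ᶠ p in 𝓝 ((z, 0) : ℂ × ℂ), leaf lam U (p.1, m p) = p.2) → m =ᶠ[𝓝 (z, 0)] φ := by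
  have hG : AnalyticAt ℂ (fun q : (ℂ × ℂ) × ℂ => leaf lam U (q.1.1, q.2) - q.1.2) ((z, 0), 0) := by
    refine AnalyticAt.sub ?_ (analyticAt_snd.fun_comp_of_eq analyticAt_fst rfl)
    exact AnalyticAt.fun_comp_of_eq (analyticAt_leaf hU)
      ((analyticAt_fst.fun_comp_of_eq analyticAt_fst rfl).prod analyticAt_snd) rfl
  obtain ⟨φ, hφ, hφ0, hiff, hsol⟩ := exists_implicit hG (by simp [leaf_zero])
    ((hasDerivAt_leaf_snd hU h1).sub_const 0) (Complex.exp_ne_zero _)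
  refine ⟨φ, hφ, ?_, ?_, ?_, ?_⟩
  · have hc : Tendsto (fun z' : ℂ => (((z', 0), 0) : (ℂ × ℂ) × ℂ)) (𝓝 z) (𝓝 ((z, 0), 0)) :=
      Continuous.tendsto' (by fun_prop) _ _ rfl
    filter_upwards [hc.eventually hiff] with z' hz'
    exact hz'.mp (by simp [leaf_zero])
  · exact hsol.mono fun p hp => sub_eq_zero.mp hp
  · have hc : Tendsto (fun p : ℂ × ℂ => (((p.1, leaf lam U p), p.2) : (ℂ × ℂ) × ℂ)) (𝓝 (z, 0))
        (𝓝 ((z, 0), 0)) := by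
      have hcl := (analyticAt_leaf (lam := lam) hU).continuousAt
      have : ContinuousAt (fun p : ℂ × ℂ => (((p.1, leaf lam U p), p.2) : (ℂ × ℂ) × ℂ)) (z, 0) := by
        fun_prop
      simpa [ContinuousAt, leaf_zero] using this
    filter_upwards [hc.eventually hiff] with p hp
    exact hp.mp (by simp)
  · intro m hm hm0 hml
    have hc : Tendsto (fun p : ℂ × ℂ => ((p, m p) : (ℂ × ℂ) × ℂ)) (𝓝 (z, 0)) (𝓝 ((z, 0), 0)) := by
      have hcl := hm.continuousAt
      have : ContinuousAt (fun p : ℂ × ℂ => ((p, m p) : (ℂ × ℂ) × ℂ)) (z, 0) := by fun_prop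
      simpa [ContinuousAt, hm0] using this
    filter_upwards [hc.eventually hiff, hml] with p hp hp2
    exact (hp.mp (by simp [hp2])).symm

/-- The coefficient `beta` is controlled on the disc of radius `20`, the flow on `19` and the first
integral on `18`. This leaves room for a full turn: a turn has modulus `2π < 7`, so it moves the
disc of radius `10` into that of radius `18`. -/
theorem exists_flowData (hB : IsCoeff B lam) : ∃ δ U H, FlowData B lam δ U H := by
  obtain ⟨V, hV, hKV, δ₀, hδ₀, hP⟩ := exists_tube (isCompact_closedBall (0 : ℂ) 20)
    (P := fun p => AnalyticAt ℂ (beta B lam) p ∧ 1 + B (chart lam p) ≠ 0)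
    (fun z _ => (hB.analyticAt_beta z).eventually_analyticAt.and (hB.eventually_beta z))
  have hP' : ∀ p ∈ Metric.ball (0 : ℂ) 20 ×ˢ Metric.ball (0 : ℂ) δ₀,
      AnalyticAt ℂ (beta B lam) p ∧ 1 + B (chart lam p) ≠ 0 := fun p hp =>
    hP p.1 (hKV (Metric.ball_subset_closedBall hp.1)) p.2 (mem_ball_zero_iff.mp hp.2)
  obtain ⟨δ, hδ, U, hU, hU0, hU1, hU2⟩ := exists_flow (β := beta B lam) (a := (1 + lam)⁻¹)
    (R := 19) (R' := 20) (by norm_num) (by norm_num) hδ₀ (fun p hp => (hP' p hp).1)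
    (fun z _ => hB.beta_zero z)
  have hUz : ∀ z ∈ Metric.ball (0 : ℂ) 19, AnalyticAt ℂ U (z, 0) := fun z hz =>
    hU (z, 0) ⟨hz, Metric.mem_ball_self hδ⟩
  have h18 : ∀ z ∈ Metric.closedBall (0 : ℂ) 18, z ∈ Metric.ball (0 : ℂ) 19 := fun z hz =>
    Metric.closedBall_subset_ball (by norm_num) hz
  -- Local inverses are unique at every point, so the choice of `0` as exceptional point is
  -- arbitrary.
  obtain ⟨H, hH⟩ := exists_glue (isCompact_closedBall (0 : ℂ) 18)
    (fun z m => z ∈ Metric.ball (0 : ℂ) 19 ∧ m (z, 0) = 0 ∧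
      ∀ᶠ p in 𝓝 ((z, 0) : ℂ × ℂ), leaf lam U (p.1, m p) = p.2) 0
    (by
      rintro z m m' hmm ⟨h0, h1, h2⟩
      refine ⟨h0, hmm.eq_of_nhds ▸ h1, ?_⟩
      filter_upwards [hmm, h2] with p hp hp2
      rw [← hp, hp2])
    (by
      intro z hz
      obtain ⟨φ, hφ, hφ0, hφ1, hφ2, -⟩ := exists_inverse_leaf (lam := lam) (hUz z (h18 z hz))
        (hU1 z (h18 z hz))
      refine ⟨φ, hφ, ?_⟩
      have hc : Tendsto (fun z' : ℂ => ((z', 0) : ℂ × ℂ)) (𝓝 z) (𝓝 (z, 0)) :=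
        Continuous.tendsto' (by fun_prop) _ _ rfl
      filter_upwards [hφ0, hc.eventually (eventually_eventually_nhds.mpr hφ1),
        Metric.isOpen_ball.mem_nhds (h18 z hz)] with z' h1 h2 h3
      exact ⟨h3, h1, h2⟩)
    (by
      rintro z m m' - hm hm' ⟨hz, h1, h2⟩ ⟨-, h1', h2'⟩
      obtain ⟨φ, -, -, -, -, hu⟩ := exists_inverse_leaf (lam := lam) (hUz z hz) (hU1 z hz)
      exact (hu m hm h1 h2).trans (hu m' hm' h1' h2').symm)
  refine ⟨δ, U, H, hδ, hU, fun p hp => (hU2 p hp).1, hU0, hU1, fun p hp => ?_, fun p hp => ?_,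
    fun z hz => (hH z (Metric.ball_subset_closedBall hz)).1, fun z hz => ?_, fun z hz => ?_⟩
  · exact (hP' (p.1, leaf lam U p) ⟨Metric.ball_subset_ball (by norm_num) hp.1,
      mem_ball_zero_iff.mpr (hU2 p hp).2.1⟩).2
  · refine (hU2 p hp).2.2.congr_deriv ?_
    simp only [leaf]; ring
  · exact ((hH z (Metric.ball_subset_closedBall hz)).2.self_of_nhds).2.2
  · obtain ⟨h1, h2⟩ := hH z (Metric.ball_subset_closedBall hz)
    obtain ⟨h3, h4, h5⟩ := h2.self_of_nhds
    obtain ⟨φ, -, -, -, hφ, hu⟩ := exists_inverse_leaf (lam := lam) (hUz z h3) (hU1 z h3)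
    have hm := hu H h1 h4 h5
    have hc : Tendsto (fun p : ℂ × ℂ => (p.1, leaf lam U p)) (𝓝 (z, 0)) (𝓝 (z, 0)) := by
      have hcl := (analyticAt_leaf (lam := lam) (hUz z h3)).continuousAt
      have : ContinuousAt (fun p : ℂ × ℂ => (p.1, leaf lam U p)) (z, 0) := by fun_prop
      simpa [ContinuousAt, leaf_zero] using this
    filter_upwards [hφ, hc.eventually hm] with p hp hp2
    rw [hp2, hp]

variable {δ : ℝ} {U H : ℂ × ℂ → ℂ}

theorem FlowData.analyticAt_U (h : FlowData B lam δ U H) {z : ℂ} (hz : z ∈ Metric.ball (0 : ℂ) 19) :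
    AnalyticAt ℂ U (z, 0) := h.analytic (z, 0) ⟨hz, Metric.mem_ball_self h.pos⟩

theorem FlowData.tendsto_leaf (h : FlowData B lam δ U H) {z : ℂ} (hz : z ∈ Metric.ball (0 : ℂ) 19) :
    Tendsto (fun p : ℂ × ℂ => (p.1, leaf lam U p)) (𝓝 (z, 0)) (𝓝 (z, 0)) := by
  have hcl := (analyticAt_leaf (lam := lam) (h.analyticAt_U hz)).continuousAt
  have : ContinuousAt (fun p : ℂ × ℂ => (p.1, leaf lam U p)) (z, 0) := by fun_prop
  simpa [ContinuousAt, leaf_zero] using this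

theorem FlowData.H_zero (h : FlowData B lam δ U H) {z : ℂ} (hz : z ∈ Metric.ball (0 : ℂ) 18) :
    H (z, 0) = 0 := by
  have := (h.H_leaf z hz).self_of_nhds
  simpa [leaf_zero] using this

theorem FlowData.tendsto_H (h : FlowData B lam δ U H) {z : ℂ} (hz : z ∈ Metric.ball (0 : ℂ) 18) :
    Tendsto (fun p : ℂ × ℂ => (p.1, H p)) (𝓝 (z, 0)) (𝓝 (z, 0)) := by
  have hcl := (h.analytic' z hz).continuousAt
  have : ContinuousAt (fun p : ℂ × ℂ => (p.1, H p)) (z, 0) := by fun_prop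
  simpa [ContinuousAt, h.H_zero hz] using this

theorem FlowData.eventually_mem (h : FlowData B lam δ U H) {z : ℂ}
    (hz : z ∈ Metric.ball (0 : ℂ) 19) :
    ∀ᶠ p in 𝓝 ((z, 0) : ℂ × ℂ), p ∈ Metric.ball (0 : ℂ) 19 ×ˢ Metric.ball (0 : ℂ) δ :=
  (Metric.isOpen_ball.prod Metric.isOpen_ball).mem_nhds ⟨hz, Metric.mem_ball_self h.pos⟩

/-- Derivative of a function along the leaves. -/
theorem FlowData.hasDerivAt_comp_leaf (h : FlowData B lam δ U H) {J : ℂ × ℂ → ℂ} {p : ℂ × ℂ}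
    (hp : p ∈ Metric.ball (0 : ℂ) 19 ×ˢ Metric.ball (0 : ℂ) δ)
    (hJ : AnalyticAt ℂ J (p.1, leaf lam U p)) :
    HasDerivAt (fun z => J (z, leaf lam U (z, p.2))) (fderiv ℂ J (p.1, leaf lam U p)
      (1, -(leaf lam U p * beta B lam (p.1, leaf lam U p)))) p.1 :=
  hJ.differentiableAt.hasFDerivAt.comp_hasDerivAt p.1 ((hasDerivAt_id p.1).prodMk (h.hasDerivAt_leaf p hp))

/-- Differentiate `H (ζ, leaf (ζ, η)) = η` in `ζ`, then substitute `η = H p` to reach every nearby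
point. -/
theorem FlowData.isFirstIntegralAt (h : FlowData B lam δ U H) {z : ℂ}
    (hz : z ∈ Metric.ball (0 : ℂ) 18) : IsFirstIntegralAt B lam H (z, 0) := by
  have hz19 := Metric.ball_subset_ball (by norm_num : (18 : ℝ) ≤ 19) hz
  have h1 : ∀ᶠ p in 𝓝 ((z, 0) : ℂ × ℂ), fderiv ℂ H (p.1, leaf lam U p)
      (1, -(leaf lam U p * beta B lam (p.1, leaf lam U p))) = 0 := by
    filter_upwards [h.eventually_mem hz19, eventually_eventually_nhds.mpr (h.H_leaf z hz),
      (h.tendsto_leaf hz19).eventually (h.analytic' z hz).eventually_analyticAt] with p hp h2 h3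
    have h4 := h.hasDerivAt_comp_leaf hp h3
    have hc : Tendsto (fun z' : ℂ => ((z', p.2) : ℂ × ℂ)) (𝓝 p.1) (𝓝 p) :=
      Continuous.tendsto' (by fun_prop) _ _ rfl
    have h5 : (fun z' => H (z', leaf lam U (z', p.2))) =ᶠ[𝓝 p.1] fun _ => p.2 := hc.eventually h2
    exact (h4.congr_of_eventuallyEq h5.symm).unique (hasDerivAt_const p.1 p.2)
  filter_upwards [(h.tendsto_H hz).eventually h1, h.leaf_H z hz] with p hp h2
  simp only [h2] at hp
  exact hp

theorem FlowData.hasDerivAt_H_snd (h : FlowData B lam δ U H) {z : ℂ}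
    (hz : z ∈ Metric.ball (0 : ℂ) 18) :
    HasDerivAt (fun y => H (z, y)) (Complex.exp ((1 + lam)⁻¹ * z)) 0 := by
  have hz19 := Metric.ball_subset_ball (by norm_num : (18 : ℝ) ≤ 19) hz
  have h1 := hasDerivAt_leaf_snd (lam := lam) (h.analyticAt_U hz19) (h.zero_right z hz19)
  have h2 : HasDerivAt (fun y => H (z, y)) (deriv (fun y => H (z, y)) 0) 0 :=
    (AnalyticAt.prodMk_right (h.analytic' z hz)).differentiableAt.hasDerivAt
  have h3 := HasDerivAt.comp_of_eq (0 : ℂ) h2 h1 (leaf_zero _ _ _).symm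
  have hc : Tendsto (fun y : ℂ => ((z, y) : ℂ × ℂ)) (𝓝 0) (𝓝 (z, 0)) :=
    Continuous.tendsto' (by fun_prop) _ _ rfl
  have h4 : ((fun y => H (z, y)) ∘ fun w => leaf lam U (z, w)) =ᶠ[𝓝 0] id :=
    hc.eventually (h.H_leaf z hz)
  have h5 := (h3.congr_of_eventuallyEq h4.symm).unique (hasDerivAt_id (0 : ℂ))
  rw [Complex.exp_neg] at h5
  refine h2.congr_deriv ?_
  exact eq_of_mul_inv_eq_one h5

theorem FlowData.H_zero_left (h : FlowData B lam δ U H) : ∀ᶠ y in 𝓝 (0 : ℂ), H (0, y) = y := by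
  have hc : Tendsto (fun y : ℂ => ((0, y) : ℂ × ℂ)) (𝓝 0) (𝓝 (0, 0)) :=
    Continuous.tendsto' (by fun_prop) _ _ rfl
  filter_upwards [hc.eventually (h.H_leaf 0 (by simp)), Metric.ball_mem_nhds 0 h.pos] with y hy hy2
  simpa [leaf, h.zero_left y hy2] using hy

/-- A first integral is determined by its restriction to `ζ = 0`. -/
theorem FlowData.eventually_eq_zero (h : FlowData B lam δ U H) {J : ℂ × ℂ → ℂ} {r : ℝ} (hr : r ≤ 18)
    (hJ : ∀ z ∈ Metric.ball (0 : ℂ) r, AnalyticAt ℂ J (z, 0))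
    (hJ1 : ∀ z ∈ Metric.ball (0 : ℂ) r, IsFirstIntegralAt B lam J (z, 0))
    (hJ0 : ∀ᶠ y in 𝓝 (0 : ℂ), J (0, y) = 0) {z : ℂ} (hz : z ∈ Metric.ball (0 : ℂ) r) :
    ∀ᶠ p in 𝓝 ((z, 0) : ℂ × ℂ), J p = 0 := by
  obtain ⟨r₁, h1, h2⟩ := exists_between (mem_ball_zero_iff.mp hz)
  have hK : ∀ ζ ∈ Metric.closedBall (0 : ℂ) r₁, ζ ∈ Metric.ball (0 : ℂ) r := fun ζ hζ =>
    Metric.closedBall_subset_ball h2 hζ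
  have hr19 : ∀ ζ ∈ Metric.ball (0 : ℂ) r, ζ ∈ Metric.ball (0 : ℂ) 19 := fun ζ hζ =>
    Metric.ball_subset_ball (hr.trans (by norm_num)) hζ
  obtain ⟨V, -, hKV, δ', hδ', hP⟩ := exists_tube (isCompact_closedBall (0 : ℂ) r₁)
    (P := fun p => HasDerivAt (fun z => J (z, leaf lam U (z, p.2))) 0 p.1) (by
      intro ζ hζ
      have hζr := hK ζ hζ
      filter_upwards [h.eventually_mem (hr19 ζ hζr),
        (h.tendsto_leaf (hr19 ζ hζr)).eventually (hJ ζ hζr).eventually_analyticAt,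
        (h.tendsto_leaf (hr19 ζ hζr)).eventually (hJ1 ζ hζr)] with p hp h3 h4
      exact (h.hasDerivAt_comp_leaf hp h3).congr_deriv h4)
  -- Along each leaf `J` has zero derivative, so it keeps the value it has at `ζ = 0`.
  have hconst : ∀ ζ ∈ Metric.closedBall (0 : ℂ) r₁, ∀ η : ℂ, ‖η‖ < δ' →
      J (ζ, leaf lam U (ζ, η)) = J (0, leaf lam U (0, η)) := by
    intro ζ hζ η hη
    have := Convex.norm_image_sub_le_of_norm_hasDerivWithin_le (𝕜 := ℂ)
      (f := fun z => J (z, leaf lam U (z, η))) (f' := fun _ => 0) (C := 0)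
      (fun w hw => (hP w (hKV hw) η hη).hasDerivWithinAt) (fun w _ => by simp)
      (convex_closedBall (0 : ℂ) r₁)
      (Metric.mem_closedBall_self (by linarith [norm_nonneg z])) hζ
    rw [zero_mul] at this
    exact sub_eq_zero.mp (norm_le_zero_iff.mp this)
  have hz18 := Metric.ball_subset_ball hr hz
  have hH : Tendsto H (𝓝 (z, 0)) (𝓝 0) := by
    have := (h.analytic' z hz18).continuousAt
    rwa [ContinuousAt, h.H_zero hz18] at this
  have hz1 : ∀ᶠ p : ℂ × ℂ in 𝓝 (z, 0), p.1 ∈ Metric.ball (0 : ℂ) r₁ :=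
    continuousAt_fst.eventually (Metric.isOpen_ball.mem_nhds (mem_ball_zero_iff.mpr h1))
  filter_upwards [h.leaf_H z hz18, hH.eventually hJ0, hH.eventually (Metric.ball_mem_nhds 0 hδ'),
    hH.eventually (Metric.ball_mem_nhds 0 h.pos), hz1] with p h3 h4 h5 h6 h7
  have h8 := hconst p.1 (Metric.ball_subset_closedBall h7) (H p) (mem_ball_zero_iff.mp h5)
  rw [h3] at h8
  rw [h8, leaf, h.zero_left _ h6]
  simpa using h4

end

/-! ### Germs of biholomorphisms in one variable. -/

theorem IsDiffeoGerm₁.map_nhds {φ : ℂ → ℂ} (h : IsDiffeoGerm₁ φ) : map φ (𝓝 0) = 𝓝 0 := by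
  have := h.analytic.hasStrictDerivAt.map_nhds_eq h.deriv_ne
  rwa [h.map_zero] at this

theorem IsDiffeoGerm₁.tendsto {φ : ℂ → ℂ} (h : IsDiffeoGerm₁ φ) : Tendsto φ (𝓝 0) (𝓝 0) :=
  h.map_nhds.le

theorem IsDiffeoGerm₁.hasDerivAt {φ : ℂ → ℂ} (h : IsDiffeoGerm₁ φ) :
    HasDerivAt φ (deriv φ 0) 0 := h.analytic.differentiableAt.hasDerivAt

theorem isDiffeoGerm₁_id : IsDiffeoGerm₁ id :=
  ⟨analyticAt_id, rfl, by simp⟩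

theorem IsDiffeoGerm₁.comp {φ ψ : ℂ → ℂ} (hφ : IsDiffeoGerm₁ φ) (hψ : IsDiffeoGerm₁ ψ) :
    IsDiffeoGerm₁ (φ ∘ ψ) := by
  have hd := HasDerivAt.comp_of_eq (0 : ℂ) hφ.hasDerivAt hψ.hasDerivAt hψ.map_zero.symm
  refine ⟨AnalyticAt.comp_of_eq hφ.analytic hψ.analytic hψ.map_zero, ?_, ?_⟩
  · simp [hψ.map_zero, hφ.map_zero]
  · rw [hd.deriv]
    exact mul_ne_zero hφ.deriv_ne hψ.deriv_ne

theorem IsDiffeoGerm₁.exists_inverse {φ : ℂ → ℂ} (h : IsDiffeoGerm₁ φ) :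
    ∃ ψ, IsDiffeoGerm₁ ψ ∧ (∀ᶠ z in 𝓝 0, ψ (φ z) = z) ∧ ∀ᶠ z in 𝓝 0, φ (ψ z) = z := by
  have hs := h.analytic.hasStrictDerivAt
  have h1 : ∀ᶠ z in 𝓝 0, hs.localInverse _ _ _ h.deriv_ne (φ z) = z :=
    HasStrictFDerivAt.eventually_left_inverse _
  have h2 : ∀ᶠ z in 𝓝 (φ 0), φ (hs.localInverse _ _ _ h.deriv_ne z) = z :=
    HasStrictDerivAt.eventually_right_inverse ..
  have h3 := h.analytic.analyticAt_localInverse h.deriv_ne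
  have h4 : HasStrictDerivAt (hs.localInverse _ _ _ h.deriv_ne) (deriv φ 0)⁻¹ (φ 0) :=
    hs.to_localInverse h.deriv_ne
  rw [h.map_zero] at h2 h3 h4
  refine ⟨_, ⟨h3, ?_, ?_⟩, h1, h2⟩
  · have := h1.self_of_nhds
    rwa [h.map_zero] at this
  · rw [h4.hasDerivAt.deriv]
    exact inv_ne_zero h.deriv_ne

theorem IsDiffeoGerm₁.eventually_injective {α : Type*} {φ : ℂ → ℂ} (h : IsDiffeoGerm₁ φ)
    {u w : α → ℂ} {l : Filter α}
    (hu : Tendsto u l (𝓝 0)) (hw : Tendsto w l (𝓝 0)) (he : ∀ᶠ z in l, φ (u z) = φ (w z)) :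
    u =ᶠ[l] w := by
  obtain ⟨ψ, -, h1, -⟩ := h.exists_inverse
  filter_upwards [hu.eventually h1, hw.eventually h1, he] with z a b c
  rw [← a, ← b, c]

/-! ### The normal form: tangent curve, values of the first integral on it, monodromy. -/

/-- The form `y dx + x B dy`. -/
noncomputable def stdForm (B : ℂ × ℂ → ℂ) : OneForm := fun q =>
  q.2 • ContinuousLinearMap.fst ℂ ℂ ℂ + (q.1 * B q) • ContinuousLinearMap.snd ℂ ℂ ℂ

/-- The fibration `x + y`. -/
def stdLevel (q : ℂ × ℂ) : ℂ := q.1 + q.2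

theorem stdForm_apply (B : ℂ × ℂ → ℂ) (q w : ℂ × ℂ) :
    stdForm B q w = q.2 * w.1 + q.1 * B q * w.2 := by simp [stdForm]

theorem hasFDerivAt_stdLevel (q : ℂ × ℂ) : HasFDerivAt stdLevel
    (ContinuousLinearMap.fst ℂ ℂ ℂ + ContinuousLinearMap.snd ℂ ℂ ℂ) q :=
  hasFDerivAt_fst.add hasFDerivAt_snd

theorem wedge_std (B : ℂ × ℂ → ℂ) (q : ℂ × ℂ) :
    wedge (stdForm B q) (fderiv ℂ stdLevel q) = q.2 - q.1 * B q := by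
  simp [wedge, stdForm_apply, (hasFDerivAt_stdLevel q).fderiv]

/-- The ordinate of the point of the chart on the level `c`. -/
noncomputable def levelPt (lam : ℂ) (p : ℂ × ℂ) : ℂ × ℂ :=
  (p.1, p.2 / (1 + lam⁻¹ * Complex.exp p.1))

section
variable {B : ℂ × ℂ → ℂ} {lam : ℂ}

theorem IsCoeff.one_add_inv_ne (hB : IsCoeff B lam) : 1 + lam⁻¹ ≠ 0 := by
  have := hB.ne_zero
  have h2 := hB.one_add_ne
  intro h
  apply h2
  field_simp at h
  simpa [add_comm] using h

theorem IsCoeff.analyticAt_levelPt (hB : IsCoeff B lam) : AnalyticAt ℂ (levelPt lam) 0 := by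
  refine analyticAt_fst.prod (analyticAt_snd.div ?_ ?_)
  · exact analyticAt_const.add (analyticAt_const.mul analyticAt_fst.cexp)
  · simpa using hB.one_add_inv_ne

theorem IsCoeff.eventually_one_add (hB : IsCoeff B lam) :
    ∀ᶠ z in 𝓝 (0 : ℂ), 1 + lam⁻¹ * Complex.exp z ≠ 0 := by
  have : ContinuousAt (fun z => 1 + lam⁻¹ * Complex.exp z) 0 := by fun_prop
  exact this.eventually_ne (by simpa using hB.one_add_inv_ne)

/-- The tangent curve in the chart: on the level `c` it has abscissa `τ c`. -/
structure TangentData (B : ℂ × ℂ → ℂ) (lam : ℂ) (τ : ℂ → ℂ) : Prop where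
  analytic : AnalyticAt ℂ τ 0
  map_zero : τ 0 = 0
  tangent : ∀ᶠ c in 𝓝 0, lam⁻¹ * Complex.exp (τ c) * B (chart lam (levelPt lam (τ c, c))) = 1
  unique : ∀ᶠ q in 𝓝 (0 : ℂ × ℂ), q.2 = q.1 * B q →
    q = chart lam (levelPt lam (τ (stdLevel q), stdLevel q))

/-- On a level the tangency condition `y = x B` reads `lam⁻¹ exp ζ B = 1`. At the level `0` the left
side is `exp ζ`, of derivative `1` at `ζ = 0`, so the implicit function theorem gives the abscissa
as a function of the level. -/
theorem exists_tangentData (hB : IsCoeff B lam) : ∃ τ, TangentData B lam τ := by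
  have hne := hB.ne_zero
  have hL : AnalyticAt ℂ (fun q : ℂ × ℂ => levelPt lam (q.2, q.1)) (0, 0) :=
    AnalyticAt.fun_comp_of_eq hB.analyticAt_levelPt (analyticAt_snd.prod analyticAt_fst) rfl
  have hC : AnalyticAt ℂ (fun q : ℂ × ℂ => B (chart lam (levelPt lam (q.2, q.1)))) (0, 0) :=
    AnalyticAt.fun_comp_of_eq (g := fun p => B (chart lam p)) (hB.analyticAt_comp_chart 0) hL
      (by simp [levelPt])
  have hG : AnalyticAt ℂ (fun q : ℂ × ℂ => lam⁻¹ * Complex.exp q.2 *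
      B (chart lam (levelPt lam (q.2, q.1))) - 1) (0, 0) :=
    ((analyticAt_const.mul analyticAt_snd.cexp).mul hC).sub analyticAt_const
  have hd : HasDerivAt (fun w : ℂ => lam⁻¹ * Complex.exp w *
      B (chart lam (levelPt lam (w, 0))) - 1) 1 0 := by
    have h1 : (fun w : ℂ => lam⁻¹ * Complex.exp w *
      B (chart lam (levelPt lam (w, 0))) - 1) = fun w => lam⁻¹ * Complex.exp w * lam - 1 := by
      funext w
      simp [levelPt, chart_zero, hB.map_zero]
    rw [h1]
    have := (((Complex.hasDerivAt_exp 0).const_mul lam⁻¹).mul_const lam).sub_const 1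
    refine this.congr_deriv ?_
    simp [hne]
  obtain ⟨τ, hτ, hτ0, hiff, hsol⟩ := exists_implicit hG (by
    simp [levelPt, chart_zero, hB.map_zero, hne]) hd one_ne_zero
  refine ⟨τ, hτ, hτ0, hsol.mono fun c hc => sub_eq_zero.mp hc, ?_⟩
  have hlog : ContinuousAt (fun q => Complex.log (lam / B q)) 0 := by
    have h1 : ContinuousAt (fun q => lam / B q) 0 :=
      continuousAt_const.div hB.analytic.continuousAt (by rw [hB.map_zero]; exact hne)
    refine h1.clog ?_
    rw [hB.map_zero, div_self hne]
    exact Complex.one_mem_slitPlane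
  have hc : Tendsto (fun q : ℂ × ℂ => (stdLevel q, Complex.log (lam / B q))) (𝓝 0) (𝓝 (0, 0)) := by
    have h1 : ContinuousAt stdLevel 0 := (hasFDerivAt_stdLevel 0).continuousAt
    have : ContinuousAt (fun q : ℂ × ℂ => (stdLevel q, Complex.log (lam / B q))) 0 := by fun_prop
    simpa [ContinuousAt, hB.map_zero, hne, stdLevel] using this
  have hlog0 : Tendsto (fun q => Complex.log (lam / B q)) (𝓝 0) (𝓝 0) := by
    simpa [ContinuousAt, hB.map_zero, hne] using hlog
  filter_upwards [hc.eventually hiff, hB.analytic.continuousAt.eventually_ne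
    (by rw [hB.map_zero]; exact hne), hlog0.eventually hB.eventually_one_add] with q h1 h2 h3 hq
  -- A tangency point has `x / y = 1 / B`, so `log (lam / B)` is its abscissa in the chart; it is
  -- close to `0`, within reach of local uniqueness.
  have hexp : lam⁻¹ * Complex.exp (Complex.log (lam / B q)) = (B q)⁻¹ := by
    rw [Complex.exp_log (div_ne_zero hne h2)]
    field_simp
  have hq1 : q.1 = (B q)⁻¹ * q.2 := by rw [hq]; field_simp
  have hlev : levelPt lam (Complex.log (lam / B q), stdLevel q) =
      (Complex.log (lam / B q), q.2) := by
    rw [hexp] at h3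
    simp only [levelPt, hexp, stdLevel]
    congr 1
    rw [div_eq_iff h3, hq1]
    ring
  have hch : chart lam (levelPt lam (Complex.log (lam / B q), stdLevel q)) = q := by
    rw [hlev]
    simp only [chart, hexp]
    rw [← hq1]
  have h4 := h1.mp (by simp only [hch, hexp]; rw [inv_mul_cancel₀ h2, sub_self])
  rw [h4, hch]

variable {τ : ℂ → ℂ} {δ : ℝ} {U H : ℂ × ℂ → ℂ}

theorem TangentData.tendsto (hτ : TangentData B lam τ) : Tendsto τ (𝓝 0) (𝓝 0) := by
  have := hτ.analytic.continuousAt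
  rwa [ContinuousAt, hτ.map_zero] at this

theorem TangentData.analyticAt_pt (hB : IsCoeff B lam) (hτ : TangentData B lam τ) :
    AnalyticAt ℂ (fun c => levelPt lam (τ c, c)) 0 :=
  AnalyticAt.fun_comp_of_eq hB.analyticAt_levelPt (hτ.analytic.prod analyticAt_id)
    (by simp [hτ.map_zero])

theorem TangentData.pt_zero (hτ : TangentData B lam τ) : levelPt lam (τ 0, 0) = 0 := by
  simp [levelPt, hτ.map_zero]

theorem TangentData.tendsto_pt (hB : IsCoeff B lam) (hτ : TangentData B lam τ) :
    Tendsto (fun c => levelPt lam (τ c, c)) (𝓝 0) (𝓝 0) := by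
  have := (hτ.analyticAt_pt hB).continuousAt
  rwa [ContinuousAt, hτ.pt_zero] at this

theorem TangentData.hasDerivAt_pt_snd (hB : IsCoeff B lam) (hτ : TangentData B lam τ) :
    HasDerivAt (fun c => (levelPt lam (τ c, c)).2) (1 + lam⁻¹)⁻¹ 0 := by
  have hv := hB.one_add_inv_ne
  have h1 := (((hτ.analytic.differentiableAt.hasDerivAt.cexp).const_mul lam⁻¹).const_add 1)
  have h2 := (hasDerivAt_id (0 : ℂ)).div h1 (by simpa [hτ.map_zero] using hv)
  refine h2.congr_deriv ?_
  simp only [hτ.map_zero, Complex.exp_zero, mul_one, id, zero_mul, sub_zero, one_mul]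
  field_simp

/-- The value of the first integral on the tangent curve. -/
noncomputable def rho (lam : ℂ) (H : ℂ × ℂ → ℂ) (τ : ℂ → ℂ) (c : ℂ) : ℂ := H (levelPt lam (τ c, c))

/-- At the origin of the chart `∂H/∂ζ = 0`, because `H` vanishes on `y = 0`, and `∂H/∂y = 1`. Only
the derivative of the ordinate along the tangent curve remains. -/
theorem hasDerivAt_rho (hB : IsCoeff B lam) (hτ : TangentData B lam τ)
    (h : FlowData B lam δ U H) : HasDerivAt (rho lam H τ) (1 + lam⁻¹)⁻¹ 0 := by
  have hH := h.analytic' 0 (by simp)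
  have h0 : levelPt lam (τ 0, 0) = (0, 0) := hτ.pt_zero
  have h1 := (hτ.analyticAt_pt hB).differentiableAt.hasDerivAt
  have h2 := hH.differentiableAt.hasFDerivAt.comp_hasDerivAt_of_eq (0 : ℂ) h1 h0.symm
  have h3 : (deriv (fun c => levelPt lam (τ c, c)) 0).2 = (1 + lam⁻¹)⁻¹ :=
    (hasFDerivAt_snd.comp_hasDerivAt (0 : ℂ) h1).unique (hτ.hasDerivAt_pt_snd hB)
  have hy := (h.hasDerivAt_H_snd (z := 0) (by simp)).unique (deriv_snd_eq hH)
  have hz : fderiv ℂ H (0, 0) (1, 0) = 0 := by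
    have e1 := deriv_fst_eq hH
    refine e1.unique (((hasDerivAt_const (0 : ℂ) (0 : ℂ))).congr_of_eventuallyEq ?_)
    filter_upwards [Metric.ball_mem_nhds (0 : ℂ) (by norm_num : (0 : ℝ) < 18)] with z hz
    exact h.H_zero hz
  refine HasDerivAt.congr_deriv (f := rho lam H τ) h2 ?_
  have e2 : ∀ w : ℂ × ℂ, w = w.1 • ((1, 0) : ℂ × ℂ) + w.2 • ((0, 1) : ℂ × ℂ) := by
    intro w; simp
  rw [e2 (deriv (fun c => levelPt lam (τ c, c)) 0), map_add, map_smul, map_smul, hz, ← hy, h3]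
  simp

theorem isDiffeoGerm_rho (hB : IsCoeff B lam) (hτ : TangentData B lam τ)
    (h : FlowData B lam δ U H) : IsDiffeoGerm₁ (rho lam H τ) := by
  have h0 : levelPt lam (τ 0, 0) = (0, 0) := hτ.pt_zero
  refine ⟨AnalyticAt.fun_comp_of_eq (g := H) (h.analytic' 0 (by simp)) (hτ.analyticAt_pt hB) h0,
    by rw [rho, h0]; exact h.H_zero (by simp), ?_⟩
  rw [(hasDerivAt_rho hB hτ h).deriv]
  exact inv_ne_zero hB.one_add_inv_ne

/-- The translation of the chart along the loop. -/
noncomputable def turn (ε : ℤˣ) : ℂ := 2 * Real.pi * Complex.I * ((ε : ℤ) : ℂ)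

theorem exp_turn (ε : ℤˣ) : Complex.exp (turn ε) = 1 := by
  rw [turn, Complex.exp_eq_one_iff]
  exact ⟨(ε : ℤ), by ring⟩

theorem norm_turn (ε : ℤˣ) : ‖turn ε‖ = 2 * Real.pi := by
  have : ‖((ε : ℤ) : ℂ)‖ = 1 := by
    rcases Int.units_eq_one_or ε with rfl | rfl <;> simp
  rw [turn, norm_mul, this]
  simp [abs_of_pos Real.pi_pos]

theorem norm_turn_lt (ε : ℤˣ) : ‖turn ε‖ < 7 := by
  rw [norm_turn]
  linarith [Real.pi_lt_d2]

theorem chart_add_turn (ε : ℤˣ) (z y : ℂ) : chart lam (z + turn ε, y) = chart lam (z, y) := by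
  simp [chart, Complex.exp_add, exp_turn]

/-- The holonomy in terms of the first integral. -/
noncomputable def mono (H : ℂ × ℂ → ℂ) (ε : ℤˣ) (y : ℂ) : ℂ := H (turn ε, y)

theorem turn_mem (ε : ℤˣ) : turn ε ∈ Metric.ball (0 : ℂ) 18 :=
  mem_ball_zero_iff.mpr ((norm_turn_lt ε).trans (by norm_num))

theorem isDiffeoGerm_mono (h : FlowData B lam δ U H) (ε : ℤˣ) : IsDiffeoGerm₁ (mono H ε) := by
  refine ⟨AnalyticAt.prodMk_right (h.analytic' _ (turn_mem ε)), h.H_zero (turn_mem ε), ?_⟩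
  have := (h.hasDerivAt_H_snd (turn_mem ε)).deriv
  change deriv (fun y => H (turn ε, y)) 0 ≠ 0
  rw [this]
  exact Complex.exp_ne_zero _

theorem add_turn_mem (ε : ℤˣ) {z : ℂ} (hz : z ∈ Metric.ball (0 : ℂ) 10) :
    z + turn ε ∈ Metric.ball (0 : ℂ) 18 := by
  rw [mem_ball_zero_iff] at hz ⊢
  linarith [norm_add_le z (turn ε), norm_turn_lt ε]

theorem tendsto_add_turn (ε : ℤˣ) (z : ℂ) : Tendsto (fun p : ℂ × ℂ => p + (turn ε, 0)) (𝓝 (z, 0))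
    (𝓝 (z + turn ε, 0)) := Continuous.tendsto' (by fun_prop) _ _ (by simp)

/-- The foliation in the chart depends on `ζ` only through `exp ζ`, so the translation by a turn
preserves it. -/
theorem IsFirstIntegralAt.add_turn {J : ℂ × ℂ → ℂ} {ε : ℤˣ} {z : ℂ}
    (h : IsFirstIntegralAt B lam J (z + turn ε, 0)) :
    IsFirstIntegralAt B lam (fun p => J (p + (turn ε, 0))) (z, 0) := by
  filter_upwards [(tendsto_add_turn ε z).eventually h] with p hp
  rw [fderiv_comp_add_right]
  have : beta B lam (p + (turn ε, 0)) = beta B lam p := by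
    rw [beta, beta, show p + (turn ε, 0) = (p.1 + turn ε, p.2) by ext <;> simp, chart_add_turn]
  rw [this] at hp
  simpa using hp

theorem IsFirstIntegralAt.comp {J : ℂ × ℂ → ℂ} {φ : ℂ → ℂ} {p₀ : ℂ × ℂ}
    (h : IsFirstIntegralAt B lam J p₀) (hJ : AnalyticAt ℂ J p₀) (hφ : AnalyticAt ℂ φ (J p₀)) :
    IsFirstIntegralAt B lam (fun p => φ (J p)) p₀ := by
  filter_upwards [h, hJ.eventually_analyticAt,
    hJ.continuousAt.eventually hφ.eventually_analyticAt] with p h1 h2 h3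
  have := h3.differentiableAt.hasFDerivAt.comp p h2.differentiableAt.hasFDerivAt
  have e : fderiv ℂ (fun p => φ (J p)) p = _ := this.fderiv
  rw [e]
  simp [h1]

/-- Both sides are first integrals with the same restriction to `ζ = 0`, where `H` is the ordinate.
-/
theorem FlowData.add_turn (h : FlowData B lam δ U H) (ε : ℤˣ) {z : ℂ}
    (hz : z ∈ Metric.ball (0 : ℂ) 10) :
    ∀ᶠ p in 𝓝 ((z, 0) : ℂ × ℂ), H (p + (turn ε, 0)) = mono H ε (H p) := by
  have h18 : ∀ z ∈ Metric.ball (0 : ℂ) 10, z ∈ Metric.ball (0 : ℂ) 18 := fun z hz =>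
    Metric.ball_subset_ball (by norm_num) hz
  have a1 : ∀ z ∈ Metric.ball (0 : ℂ) 10, AnalyticAt ℂ (fun p => H (p + (turn ε, 0))) (z, 0) :=
    fun z hz => AnalyticAt.fun_comp_of_eq (h.analytic' _ (add_turn_mem ε hz))
      (analyticAt_id.add analyticAt_const) (by simp)
  have a2 : ∀ z ∈ Metric.ball (0 : ℂ) 10, AnalyticAt ℂ (fun p => mono H ε (H p)) (z, 0) :=
    fun z hz => AnalyticAt.fun_comp_of_eq (isDiffeoGerm_mono h ε).analytic (h.analytic' _ (h18 z hz))
      (h.H_zero (h18 z hz))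
  have := h.eventually_eq_zero (J := fun p => H (p + (turn ε, 0)) - mono H ε (H p)) (r := 10)
    (by norm_num) (fun z hz => (a1 z hz).sub (a2 z hz)) (fun z hz => ?_) ?_ hz
  · exact this.mono fun p hp => sub_eq_zero.mp hp
  · have i1 := (h.isFirstIntegralAt (add_turn_mem ε hz)).add_turn
    have i2 := (h.isFirstIntegralAt (h18 z hz)).comp (h.analytic' _ (h18 z hz)) (φ := mono H ε)
      (by rw [h.H_zero (h18 z hz)]; exact (isDiffeoGerm_mono h ε).analytic)
    filter_upwards [i1, i2, (a1 z hz).eventually_analyticAt, (a2 z hz).eventually_analyticAt]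
      with p h1 h2 h3 h4
    rw [fderiv_fun_sub h3.differentiableAt h4.differentiableAt, sub_apply, h1, h2,
      sub_zero]
  · filter_upwards [h.H_zero_left] with y hy
    rw [hy]
    simp [mono]

end

/-! ### The sliding of the normal form and the monodromy of the first integral. -/

section
variable {B : ℂ × ℂ → ℂ} {lam : ℂ} {τ : ℂ → ℂ} {δ : ℝ} {U H : ℂ × ℂ → ℂ} {ε : ℤˣ}

theorem TangentData.onCurve (hB : IsCoeff B lam) (hτ : TangentData B lam τ) :
    ∀ᶠ c in 𝓝 0, (chart lam (levelPt lam (τ c, c))).2 =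
      (chart lam (levelPt lam (τ c, c))).1 * B (chart lam (levelPt lam (τ c, c))) ∧
      stdLevel (chart lam (levelPt lam (τ c, c))) = c := by
  filter_upwards [hτ.tangent, hτ.tendsto.eventually hB.eventually_one_add] with c h1 h2
  constructor
  · simp only [chart, levelPt] at h1 ⊢
    linear_combination (-(c / (1 + lam⁻¹ * Complex.exp (τ c)))) * h1
  · simp only [stdLevel, chart, levelPt]
    generalize lam⁻¹ * Complex.exp (τ c) = v at h2 ⊢
    field_simp
    ring

/-- The first integral takes the same value at the endpoints of the paths of leaves over the loop. -/
theorem FlowData.holonomy_path (hB : IsCoeff B lam) (h : FlowData B lam δ U H) {r : ℝ} (hr : 0 < r)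
    {α β : ℂ} (hα : α ≠ 0) (hαβ : α = lam * β) {K : ℝ → ℂ → ℂ × ℂ}
    (hK : ContinuousOn (Function.uncurry K) (Set.Icc 0 1 ×ˢ Metric.ball 0 r))
    (hK0 : ∀ θ ∈ Set.Icc (0 : ℝ) 1, K θ 0 ≠ 0 ∧ ∃ κ : ℂ, K θ 0 =
      κ • (Complex.exp (turn ε * θ) * β, α))
    (hleaf : ∀ z ∈ Metric.ball (0 : ℂ) r, ∀ θ ∈ Set.Icc (0 : ℝ) 1, ∃ w : ℂ × ℂ,
        HasDerivWithinAt (fun θ' : ℝ => z • K θ' z) w (Set.Icc 0 1) θ ∧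
          stdForm B (z • K θ z) w = 0) :
    ∀ᶠ z in 𝓝 (0 : ℂ), H (Complex.log (lam * (K 0 z).1 / (K 0 z).2), z * (K 0 z).2) =
      H (turn ε + Complex.log (lam * (K 1 z).1 / (K 1 z).2), z * (K 1 z).2) := by
  have hlam := hB.ne_zero
  obtain ⟨V, -, hKV, δ', hδ', hP⟩ := exists_tube (isCompact_closedBall (0 : ℂ) 8)
    (P := fun p => AnalyticAt ℂ H p ∧ fderiv ℂ H p (1, -(p.2 * beta B lam p)) = 0 ∧
      1 + B (chart lam p) ≠ 0) (fun z hz => by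
      have hz18 : z ∈ Metric.ball (0 : ℂ) 18 := Metric.closedBall_subset_ball (by norm_num) hz
      exact (h.analytic' z hz18).eventually_analyticAt.and
        ((h.isFirstIntegralAt hz18).and (hB.eventually_beta z)))
  -- continuous extension of `K` in the first variable
  let L : ℝ × ℂ → ℂ × ℂ := fun q => K (Set.projIcc (0 : ℝ) 1 zero_le_one q.1) q.2
  have hLc : ∀ θ, ContinuousAt L (θ, 0) := by
    intro θ
    have h1 : ContinuousOn L (Set.univ ×ˢ Metric.ball 0 r) := by
      refine hK.comp (f := fun q : ℝ × ℂ => ((Set.projIcc (0 : ℝ) 1 zero_le_one q.1 : ℝ), q.2))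
        ?_ (fun q hq => ⟨Subtype.coe_prop _, hq.2⟩)
      exact Continuous.continuousOn (by fun_prop)
    exact h1.continuousAt ((isOpen_univ.prod Metric.isOpen_ball).mem_nhds
      ⟨trivial, Metric.mem_ball_self hr⟩)
  have hLK : ∀ θ ∈ Set.Icc (0 : ℝ) 1, ∀ z, L (θ, z) = K θ z := by
    intro θ hθ z
    simp [L, Set.projIcc_of_mem zero_le_one hθ]
  have hL2 : ∀ θ ∈ Set.Icc (0 : ℝ) 1, (L (θ, 0)).2 ≠ 0 ∧
      lam * (L (θ, 0)).1 / (L (θ, 0)).2 * Complex.exp (-(turn ε * θ)) = 1 := by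
    intro θ hθ
    rw [hLK θ hθ]
    obtain ⟨h1, κ, h2⟩ := hK0 θ hθ
    have hκ : κ ≠ 0 := by
      rintro rfl
      exact h1 (by simp [h2])
    have h3 : (K θ 0).2 = κ * α := by rw [h2]; simp
    have h4 : (K θ 0).1 = κ * (Complex.exp (turn ε * θ) * β) := by rw [h2]; simp
    refine ⟨by rw [h3]; exact mul_ne_zero hκ hα, ?_⟩
    rw [h3, h4, Complex.exp_neg]
    have hβ : β ≠ 0 := by
      rintro rfl
      exact hα (by simp [hαβ])
    have := Complex.exp_ne_zero (turn ε * θ)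
    rw [hαβ]
    field_simp
  -- At `z = 0` the ratio `lam x / y` is exactly `exp (turn ε * θ)`. By compactness of `[0, 1]` it
  -- stays close to it for small `z`, uniformly in `θ`, so the quotient of the two has a principal
  -- logarithm.
  have hev' : ∀ᶠ z in 𝓝 (0 : ℂ), ∀ θ ∈ Set.Icc (0 : ℝ) 1, (L (θ, z)).2 ≠ 0 ∧
      lam * (L (θ, z)).1 / (L (θ, z)).2 * Complex.exp (-(turn ε * θ)) ∈ Complex.slitPlane ∧
      ‖Complex.log (lam * (L (θ, z)).1 / (L (θ, z)).2 * Complex.exp (-(turn ε * θ)))‖ < 1 ∧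
      ‖z * (L (θ, z)).2‖ < δ' := by
    refine isCompact_Icc.eventually_forall_of_forall_eventually fun θ hθ => ?_
    have hsw : Tendsto (fun q : ℂ × ℝ => (q.2, q.1)) (𝓝 (0, θ)) (𝓝 (θ, 0)) :=
      Continuous.tendsto' (by fun_prop) _ _ rfl
    obtain ⟨h1, h2⟩ := hL2 θ hθ
    have c1 : ContinuousAt (fun q => (L q).1) (θ, 0) := (hLc θ).fst
    have c2 : ContinuousAt (fun q => (L q).2) (θ, 0) := (hLc θ).snd
    have c3 : ContinuousAt (fun q : ℝ × ℂ => lam * (L q).1 / (L q).2 *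
        Complex.exp (-(turn ε * q.1))) (θ, 0) :=
      ((continuousAt_const.mul c1).div c2 h1).mul (by fun_prop)
    have c4 := c3.clog (by rw [h2]; exact Complex.one_mem_slitPlane)
    have c5 : ContinuousAt (fun q : ℝ × ℂ => q.2 * (L q).2) (θ, 0) := continuousAt_snd.mul c2
    have e1 := c2.eventually_ne h1
    have e2 := c3.eventually_mem (Complex.isOpen_slitPlane.mem_nhds
      (by rw [h2]; exact Complex.one_mem_slitPlane))
    have e3 := c4.norm.eventually_lt (continuousAt_const (y := (1 : ℝ))) (by rw [h2]; simp)
    have e4 := c5.norm.eventually_lt (continuousAt_const (y := δ')) (by simpa using hδ')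
    filter_upwards [hsw.eventually e1, hsw.eventually e2, hsw.eventually e3, hsw.eventually e4]
      with q a1 a2 a3 a4
    exact ⟨a1, a2, a3, a4⟩
  have hev : ∀ᶠ z in 𝓝 (0 : ℂ), ∀ θ ∈ Set.Icc (0 : ℝ) 1, (K θ z).2 ≠ 0 ∧
      lam * (K θ z).1 / (K θ z).2 * Complex.exp (-(turn ε * θ)) ∈ Complex.slitPlane ∧
      ‖Complex.log (lam * (K θ z).1 / (K θ z).2 * Complex.exp (-(turn ε * θ)))‖ < 1 ∧
      ‖z * (K θ z).2‖ < δ' := by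
    filter_upwards [hev'] with z hz θ hθ
    have := hz θ hθ
    rwa [hLK θ hθ] at this
  filter_upwards [hev, Metric.ball_mem_nhds 0 hr] with z hz hzr
  -- On the exceptional line `x = y = 0`: the path is not seen in the coordinates, and both sides
  -- vanish because `H` does on `y = 0`.
  by_cases hz0 : z = 0
  · subst hz0
    have t1 : ‖Complex.log (lam * (K 0 0).1 / (K 0 0).2)‖ < 1 := by
      simpa using (hz 0 (by simp)).2.2.1
    have t2 : ‖Complex.log (lam * (K 1 0).1 / (K 1 0).2)‖ < 1 := by
      have := (hz 1 (by simp)).2.2.1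
      simpa [Complex.exp_neg, exp_turn] using this
    rw [zero_mul, zero_mul, h.H_zero, h.H_zero]
    · rw [mem_ball_zero_iff]
      linarith [norm_add_le (turn ε) (Complex.log (lam * (K 1 0).1 / (K 1 0).2)), norm_turn_lt ε]
    · rw [mem_ball_zero_iff]
      linarith
  -- The continuous determination of `log (lam x / y)` along the path. Its modulus is less than `7 +
  -- 1`, which explains the disc of radius `8` above.
  set ζ : ℝ → ℂ := fun θ => turn ε * θ +
    Complex.log (lam * (K θ z).1 / (K θ z).2 * Complex.exp (-(turn ε * θ))) with hζ
  have hderiv : ∀ θ ∈ Set.Icc (0 : ℝ) 1,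
      HasDerivWithinAt (fun θ => H (ζ θ, z * (K θ z).2)) 0 (Set.Icc 0 1) θ := by
    intro θ hθ
    obtain ⟨b1, b2, b3, b4⟩ := hz θ hθ
    obtain ⟨w, hw, hω⟩ := hleaf z hzr θ hθ
    have hx : HasDerivWithinAt (fun θ => z * (K θ z).1) w.1 (Set.Icc 0 1) θ := by
      have := (hasFDerivAt_fst (𝕜 := ℝ) (p := z • K θ z)).comp_hasDerivWithinAt θ hw
      simpa [Function.comp_def] using this
    have hy : HasDerivWithinAt (fun θ => z * (K θ z).2) w.2 (Set.Icc 0 1) θ := by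
      have := (hasFDerivAt_snd (𝕜 := ℝ) (p := z • K θ z)).comp_hasDerivWithinAt θ hw
      simpa [Function.comp_def] using this
    set x := z * (K θ z).1 with hxd
    set y := z * (K θ z).2 with hyd
    have hR0 := Complex.slitPlane_ne_zero b2
    have hK1 : (K θ z).1 ≠ 0 := by
      intro h0
      rw [h0] at hR0
      simp at hR0
    have hx0 : x ≠ 0 := mul_ne_zero hz0 hK1
    have hy0 : y ≠ 0 := mul_ne_zero hz0 b1
    have hE : Complex.exp (turn ε * θ) ≠ 0 := Complex.exp_ne_zero _
    have hlin : HasDerivWithinAt (fun θ : ℝ => turn ε * (θ : ℂ)) (turn ε) (Set.Icc 0 1) θ := by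
      have := ((Complex.ofRealCLM.hasDerivAt (x := θ)).const_mul (turn ε)).hasDerivWithinAt
        (s := Set.Icc 0 1)
      simpa using this
    have hexp : HasDerivWithinAt (fun θ : ℝ => Complex.exp (-(turn ε * (θ : ℂ))))
        (Complex.exp (-(turn ε * θ)) * -turn ε) (Set.Icc 0 1) θ := hlin.neg.cexp
    have hR : HasDerivWithinAt (fun θ => lam * (K θ z).1 / (K θ z).2 *
        Complex.exp (-(turn ε * θ))) (lam * x / y * Complex.exp (-(turn ε * θ)) *
          (w.1 / x - w.2 / y - turn ε)) (Set.Icc 0 1) θ := by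
      have h1 := (((hx.const_mul lam).div hy hy0).mul hexp)
      have h2 : (fun θ : ℝ => lam * (K θ z).1 / (K θ z).2 * Complex.exp (-(turn ε * θ))) =
          fun θ : ℝ => lam * (z * (K θ z).1) / (z * (K θ z).2) * Complex.exp (-(turn ε * θ)) := by
        funext θ
        congr 1
        rw [mul_left_comm, mul_div_mul_left _ _ hz0]
      rw [h2]
      refine h1.congr_deriv ?_
      simp only [Pi.div_apply, ← hxd, ← hyd]
      field_simp
      ring
    have hRxy : lam * (K θ z).1 / (K θ z).2 = lam * x / y := by
      rw [hxd, hyd, mul_left_comm, mul_div_mul_left _ _ hz0]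
    have hζd : HasDerivWithinAt ζ (w.1 / x - w.2 / y) (Set.Icc 0 1) θ := by
      refine (hlin.add (hR.clog_real b2)).congr_deriv ?_
      rw [hRxy, mul_div_cancel_left₀ _ (by rw [← hRxy]; exact hR0)]
      ring
    have hexpζ : Complex.exp (ζ θ) = lam * x / y := by
      rw [hζ]
      simp only
      rw [Complex.exp_add, Complex.exp_log hR0, hRxy, Complex.exp_neg]
      field_simp
    have hchart : chart lam (ζ θ, y) = (x, y) := by
      simp only [chart, hexpζ]
      congr 1
      field_simp
    have hζ8 : ζ θ ∈ Metric.closedBall (0 : ℂ) 8 := by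
      rw [mem_closedBall_zero_iff]
      have e1 : ‖turn ε * (θ : ℂ)‖ ≤ 7 := by
        rw [norm_mul, Complex.norm_real, Real.norm_of_nonneg hθ.1]
        nlinarith [norm_turn_lt ε, norm_nonneg (turn ε), hθ.2, hθ.1]
      have e2 := norm_add_le (turn ε * (θ : ℂ))
        (Complex.log (lam * (K θ z).1 / (K θ z).2 * Complex.exp (-(turn ε * θ))))
      simp only [hζ]
      linarith
    obtain ⟨p1, p2, p3⟩ := hP (ζ θ) (hKV hζ8) y b4
    have hcomp := (p1.differentiableAt.hasFDerivAt.restrictScalars ℝ).comp_hasDerivWithinAt θ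
      (hζd.prodMk hy)
    refine hcomp.congr_deriv ?_
    have hform : w.1 / x - w.2 / y = (w.1 / x - w.2 / y) * 1 := by ring
    have hω' : y * w.1 + x * B (x, y) * w.2 = 0 := by
      have := hω
      rw [stdForm_apply] at this
      exact this
    rw [hchart] at p3
    have hbeta : beta B lam (ζ θ, y) = (1 + B (x, y))⁻¹ := by rw [beta, hchart]
    have hvec : ((w.1 / x - w.2 / y, w.2) : ℂ × ℂ) = (w.1 / x - w.2 / y) •
        ((1, -(y * beta B lam (ζ θ, y))) : ℂ × ℂ) := by
      ext
      · simp
      · simp only [Prod.smul_mk, smul_eq_mul]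
        rw [hbeta]
        field_simp
        linear_combination hω'
    simp only [ContinuousLinearMap.coe_restrictScalars']
    rw [hvec, map_smul, p2, smul_zero]
  have hconst := Convex.norm_image_sub_le_of_norm_hasDerivWithin_le (𝕜 := ℝ)
    (f := fun θ => H (ζ θ, z * (K θ z).2)) (f' := fun _ => 0) (C := 0) hderiv
    (fun w _ => by simp) (convex_Icc (0 : ℝ) 1) (x := 0) (y := 1) (by simp) (by simp)
  rw [zero_mul] at hconst
  have := sub_eq_zero.mp (norm_le_zero_iff.mp hconst)
  simp only [hζ] at this
  simp only [Complex.ofReal_one, mul_one, Complex.ofReal_zero, mul_zero, Complex.exp_neg, exp_turn,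
    inv_one, zero_add, neg_zero, Complex.exp_zero] at this
  exact this.symm

end

section
variable {B : ℂ × ℂ → ℂ} {lam : ℂ} {τ : ℂ → ℂ} {δ : ℝ} {U H : ℂ × ℂ → ℂ} {ε : ℤˣ}

theorem chart_ratio (hlam : lam ≠ 0) {p : ℂ × ℂ} (hp : p.2 ≠ 0) :
    lam * (chart lam p).1 / (chart lam p).2 = Complex.exp p.1 := by
  simp only [chart]
  field_simp

theorem log_exp_of_norm_lt {z : ℂ} (hz : ‖z‖ < 1) : Complex.log (Complex.exp z) = z := by
  have h1 := (Complex.abs_im_le_norm z).trans_lt hz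
  have h2 := abs_lt.mp h1
  have h3 := Real.pi_gt_three
  exact Complex.log_exp (by linarith) (by linarith)

theorem TangentData.eventually_log (hB : IsCoeff B lam) (hτ : TangentData B lam τ) :
    ∀ᶠ c in 𝓝 0, c ≠ 0 → Complex.log (lam * (chart lam (levelPt lam (τ c, c))).1 /
      (chart lam (levelPt lam (τ c, c))).2) = τ c := by
  filter_upwards [hτ.tendsto.eventually hB.eventually_one_add,
    hτ.tendsto.eventually (Metric.ball_mem_nhds 0 one_pos)] with c h1 h2 hc
  rw [chart_ratio hB.ne_zero (by simpa [levelPt] using ⟨hc, h1⟩)]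
  exact log_exp_of_norm_lt (mem_ball_zero_iff.mp h2)

theorem deriv_axis_snd : deriv (fun y : ℂ => ((0, y) : ℂ × ℂ)) 0 = (0, 1) :=
  ((hasDerivAt_const (0 : ℂ) (0 : ℂ)).prodMk (hasDerivAt_id (0 : ℂ))).deriv

theorem deriv_axis_fst : deriv (fun x : ℂ => ((x, 0) : ℂ × ℂ)) 0 = (1, 0) :=
  ((hasDerivAt_id (0 : ℂ)).prodMk (hasDerivAt_const (0 : ℂ) (0 : ℂ))).deriv

/-- Differentiate `y = x B` along the curve at the origin. The direction of the tangent curve is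
thus that of `ζ = 0`. -/
theorem IsTangentCurve.slope (hB : IsCoeff B lam) {t : ℂ → ℂ × ℂ}
    (ht : IsTangentCurve (stdForm B) stdLevel t) : (deriv t 0).2 = lam * (deriv t 0).1 := by
  have h1 := ht.smooth.analytic.differentiableAt.hasDerivAt
  have h2 : HasDerivAt (fun z => (t z).1) (deriv t 0).1 0 :=
    (hasFDerivAt_fst (𝕜 := ℂ) (p := t 0)).comp_hasDerivAt (0 : ℂ) h1
  have h3 : HasDerivAt (fun z => (t z).2) (deriv t 0).2 0 :=
    (hasFDerivAt_snd (𝕜 := ℂ) (p := t 0)).comp_hasDerivAt (0 : ℂ) h1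
  have h4 : HasDerivAt (fun z => B (t z)) _ 0 :=
    hB.analytic.differentiableAt.hasFDerivAt.comp_hasDerivAt_of_eq _ h1 ht.smooth.map_zero.symm
  have h5 : (fun z => (t z).2) =ᶠ[𝓝 0] fun z => (t z).1 * B (t z) := by
    filter_upwards [ht.tangent] with z hz
    rw [wedge_std] at hz
    exact sub_eq_zero.mp hz
  have h6 := h3.unique ((h2.mul h4).congr_of_eventuallyEq h5)
  simpa [ht.smooth.map_zero, hB.map_zero, mul_comm] using h6

/-- A lifted path starts over `ζ = τ (p z)` on the level `p z` and ends over `turn ε + τ (p (η z))`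
on the level `p (η z) = g (p z)`. Equality of `H` at the ends is the assertion at `c = p z`. As the
relation no longer involves the auxiliary `t`, `η`, `p`, `K`, it determines the sliding. -/
theorem FlowData.mono_rho_of_isSliding (hB : IsCoeff B lam) (h : FlowData B lam δ U H)
    (hτ : TangentData B lam τ) {g : ℂ → ℂ}
    (hg : IsSliding (stdForm B) stdLevel (fun y => (0, y)) (fun x => (x, 0)) ε g) :
    ∀ᶠ c in 𝓝 0, mono H ε (rho lam H τ (g c)) = rho lam H τ c := by
  obtain ⟨hgd, t, η, p, ht, ⟨hη, α, β, r, K, hα, hβ, hr, ht0, hKc, hKne, hK0, hK⟩, ⟨hp, hpl⟩, hgp⟩ := hg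
  rw [deriv_axis_snd, deriv_axis_fst] at ht0
  simp only [deriv_axis_snd, deriv_axis_fst] at hK0
  have hs := ht.slope hB
  rw [ht0] at hs
  have hαβ : α = lam * β := by simpa using hs
  have hpath := h.holonomy_path (ε := ε) hB hr hα hαβ hKc (fun θ hθ => ⟨hKne θ hθ 0 (Metric.mem_ball_self hr),
    by
      obtain ⟨κ, hκ⟩ := hK0 θ hθ
      refine ⟨κ, ?_⟩
      rw [hκ, turn]
      simp⟩) (fun z hz => (hK z hz).2.2)
  have htt : Tendsto t (𝓝 0) (𝓝 0) := by
    have := ht.smooth.analytic.continuousAt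
    rwa [ContinuousAt, ht.smooth.map_zero] at this
  -- A point of the tangent curve is determined by its level. Here the level is `p z`, because the
  -- point `(0, y)` of `S₁` lies on the level `y`.
  have hpt : ∀ᶠ z in 𝓝 0, t z = chart lam (levelPt lam (τ (p z), p z)) := by
    filter_upwards [htt.eventually hτ.unique, ht.tangent, hpl] with z h1 h2 h3
    rw [wedge_std] at h2
    have h4 := h1 (sub_eq_zero.mp h2)
    rw [h3] at h4
    simpa [stdLevel] using h4
  have hp0 : ∀ᶠ z in 𝓝 0, p z = 0 → z = 0 := by
    obtain ⟨ψ, hψ, h1, -⟩ := hp.exists_inverse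
    filter_upwards [h1] with z hz h0
    rw [← hz, h0, hψ.map_zero]
  have hη0 : ∀ᶠ z in 𝓝 0, η z = 0 → z = 0 := by
    obtain ⟨ψ, hψ, h1, -⟩ := hη.exists_inverse
    filter_upwards [h1] with z hz h0
    rw [← hz, h0, hψ.map_zero]
  have hsnd : ∀ᶠ z in 𝓝 0, z ≠ 0 → ∀ k : ℂ × ℂ, z • k = t z →
      Complex.log (lam * k.1 / k.2) = τ (p z) ∧ z * k.2 = (levelPt lam (τ (p z), p z)).2 := by
    filter_upwards [hpt, hp0, hp.tendsto.eventually (hτ.eventually_log hB)] with z h1 h2 h3 hz k hk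
    rw [h1] at hk
    have h4 := h3 (fun h0 => hz (h2 h0))
    rw [← hk] at h4
    constructor
    · rw [← h4]
      simp only [Prod.smul_fst, Prod.smul_snd, smul_eq_mul]
      rw [mul_left_comm, mul_div_mul_left _ _ hz]
    · have := congrArg Prod.snd hk
      simpa [chart] using this
  have hmain : ∀ᶠ z in 𝓝 0, mono H ε (rho lam H τ (g (p z))) = rho lam H τ (p z) := by
    have hsnd' : ∀ᶠ z in 𝓝 0, η z ≠ 0 → ∀ k : ℂ × ℂ, z • k = t (η z) → z ≠ 0 →
      Complex.log (lam * k.1 / k.2) = τ (p (η z)) ∧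
        z * k.2 = (levelPt lam (τ (p (η z)), p (η z))).2 := by
      filter_upwards [hη.tendsto.eventually hpt, hη0, hη.tendsto.eventually hp0,
        hη.tendsto.eventually (hp.tendsto.eventually (hτ.eventually_log hB))]
        with z h1 h2 h2' h3 hz k hk hz0
      rw [h1] at hk
      have h4 := h3 (fun h0 => hz (h2' h0))
      rw [← hk] at h4
      constructor
      · rw [← h4]
        simp only [Prod.smul_fst, Prod.smul_snd, smul_eq_mul]
        rw [mul_left_comm, mul_div_mul_left _ _ hz0]
      · have := congrArg Prod.snd hk
        simpa [chart] using this
    have hturn : ∀ᶠ c in 𝓝 0, H (levelPt lam (τ c, c) + (turn ε, 0)) =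
        mono H ε (rho lam H τ c) := (hτ.tendsto_pt hB).eventually (h.add_turn ε (z := 0) (by simp))
    filter_upwards [hpath, hsnd, hsnd', hη0, hgp,
      (hp.tendsto.comp hη.tendsto).eventually hturn, Metric.ball_mem_nhds 0 hr]
      with z h1 h2 h3 h4 h5 h6 h7
    by_cases hz : z = 0
    · subst hz
      have := (isDiffeoGerm_rho hB hτ h).map_zero
      rw [hp.map_zero, hgd.map_zero, this, (isDiffeoGerm_mono h ε).map_zero]
    · obtain ⟨k0, k1, -⟩ := hK z h7
      obtain ⟨e1, e2⟩ := h2 hz _ k0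
      obtain ⟨e3, e4⟩ := h3 (fun h0 => hz (h4 h0)) _ k1 hz
      rw [e1, e2, e3, e4] at h1
      rw [h5]
      simp only [Function.comp_apply] at h6
      rw [← h6, rho]
      rw [show levelPt lam (τ (p (η z)), p (η z)) + (turn ε, 0) =
        (turn ε + τ (p (η z)), (levelPt lam (τ (p (η z)), p (η z))).2) by
          ext
          · simp [levelPt, add_comm]
          · simp]
      rw [← h1]
      rfl
  rw [← hp.map_nhds]
  exact hmain

/-- The sliding in terms of the first integral. -/
theorem FlowData.exists_mono_rho (hB : IsCoeff B lam) (h : FlowData B lam δ U H)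
    (hτ : TangentData B lam τ) (ε : ℤˣ) : ∃ g, IsDiffeoGerm₁ g ∧
      ∀ᶠ c in 𝓝 0, mono H ε (rho lam H τ (g c)) = rho lam H τ c := by
  have hρ := isDiffeoGerm_rho hB hτ h
  obtain ⟨ψ, hψ, -, h2⟩ := ((isDiffeoGerm_mono h ε).comp hρ).exists_inverse
  exact ⟨ψ ∘ rho lam H τ, hψ.comp hρ, hρ.tendsto.eventually h2⟩

/-- The holonomy is exhibited by explicit paths: over the level `c`, `ζ` runs along the segment from
`τ c` to `turn ε + τ (g c)`, on the leaf where `H = rho c`. The tangent curve is parametrized by its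
level, so the projection is the identity and the holonomy is `g` itself. -/
theorem FlowData.isSliding (hB : IsCoeff B lam) (h : FlowData B lam δ U H)
    (hτ : TangentData B lam τ) {g : ℂ → ℂ} (hg : IsDiffeoGerm₁ g)
    (hgρ : ∀ᶠ c in 𝓝 0, mono H ε (rho lam H τ (g c)) = rho lam H τ c) :
    IsSliding (stdForm B) stdLevel (fun y => (0, y)) (fun x => (x, 0)) ε g := by
  have hlam := hB.ne_zero
  have hρ := isDiffeoGerm_rho hB hτ h
  have hpt := hτ.analyticAt_pt hB
  have hv := hB.one_add_inv_ne
  set t : ℂ → ℂ × ℂ := fun c => chart lam (levelPt lam (τ c, c)) with ht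
  have hta : AnalyticAt ℂ t 0 := AnalyticAt.fun_comp_of_eq (g := chart lam) (analyticAt_chart lam 0)
    hpt hτ.pt_zero
  have ht0 : t 0 = 0 := by rw [ht]; simp only [hτ.pt_zero]; exact chart_zero lam 0
  have htd : deriv t 0 = (lam⁻¹ * (1 + lam⁻¹)⁻¹, (1 + lam⁻¹)⁻¹) := by
    have h1 := hτ.hasDerivAt_pt_snd hB
    have h2 := ((hτ.analytic.differentiableAt.hasDerivAt.cexp).const_mul lam⁻¹).mul h1
    have h3 := (h2.prodMk h1).deriv
    refine h3.trans ?_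
    simp [hτ.map_zero, levelPt]
  have htan : IsTangentCurve (stdForm B) stdLevel t := by
    refine ⟨⟨hta, ht0, ?_⟩, ?_⟩
    · rw [htd]
      intro h0
      exact inv_ne_zero hv (congrArg Prod.snd h0)
    · filter_upwards [hτ.onCurve hB] with c hc
      rw [wedge_std]
      exact sub_eq_zero.mpr hc.1
  refine ⟨hg, t, g, id, htan, ⟨hg, ?_⟩, ⟨isDiffeoGerm₁_id, ?_⟩, Eventually.of_forall fun _ => rfl⟩
  swap
  · filter_upwards [hτ.onCurve hB] with c hc
    simpa [stdLevel] using hc.2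
  -- Ordinates on the paths are `rho c` times a unit; dividing `rho c` by `c` lifts the paths to the
  -- blowing-up, including `c = 0`.
  set κ : ℂ → ℂ := dslope (rho lam H τ) 0 with hκ
  have hκ0 : κ 0 ≠ 0 := by rw [hκ, dslope_same]; exact hρ.deriv_ne
  have hκm : ∀ c, c * κ c = rho lam H τ c := by
    intro c
    have := sub_smul_dslope (rho lam H τ) 0 c
    simpa [hρ.map_zero] using this
  have hκa : AnalyticAt ℂ κ 0 := by
    obtain ⟨p, hp⟩ := hρ.analytic
    exact ⟨_, hp.has_fpower_series_dslope_fslope⟩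
  have hbase : Tendsto (fun c => levelPt lam (τ c, c)) (𝓝 0) (𝓝 (0, 0)) := hτ.tendsto_pt hB
  have hgt : Tendsto (fun c => levelPt lam (τ (g c), g c) + (turn ε, 0)) (𝓝 0) (𝓝 (turn ε, 0)) := by
    have := (tendsto_add_turn ε 0).comp (hbase.comp hg.tendsto)
    simpa [Function.comp_def] using this
  have hstart : ∀ᶠ c in 𝓝 0, leaf lam U (τ c, rho lam H τ c) = (levelPt lam (τ c, c)).2 :=
    hbase.eventually (h.leaf_H 0 (by simp))
  -- This is where the relation between `g` and `mono` makes the path end on the tangent curve.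
  have hend : ∀ᶠ c in 𝓝 0, leaf lam U (τ (g c) + turn ε, rho lam H τ c) =
      (levelPt lam (τ (g c), g c)).2 := by
    filter_upwards [hgt.eventually (h.leaf_H _ (turn_mem ε)), hgρ,
      (hbase.comp hg.tendsto).eventually (h.add_turn ε (z := 0) (by simp))] with c h1 h2 h3
    simp only [Function.comp_apply] at h3
    rw [h3] at h1
    change leaf lam U (_, mono H ε (rho lam H τ (g c))) = _ at h1
    rw [h2] at h1
    simpa [levelPt] using h1
  obtain ⟨r, hr, hball⟩ := Metric.eventually_nhds_iff_ball.mp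
    (hstart.and (hend.and ((hκa.continuousAt.eventually_ne hκ0).and
      (hκa.eventually_analyticAt.and (hτ.analytic.eventually_analyticAt.and
      ((hg.tendsto.eventually hτ.analytic.eventually_analyticAt).and (hg.analytic.eventually_analyticAt.and
      ((hτ.tendsto.eventually (Metric.ball_mem_nhds 0 one_pos)).and
      (((hτ.tendsto.comp hg.tendsto).eventually (Metric.ball_mem_nhds 0 one_pos)).and
      ((hρ.tendsto.eventually (Metric.ball_mem_nhds 0 h.pos)).and
        hρ.analytic.eventually_analyticAt))))))))))
  set ζ : ℝ → ℂ → ℂ := fun θ c => τ c + θ * (turn ε + τ (g c) - τ c) with hζ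
  have hζ19 : ∀ θ ∈ Set.Icc (0 : ℝ) 1, ∀ c ∈ Metric.ball (0 : ℂ) r, ζ θ c ∈ Metric.ball (0 : ℂ) 19 := by
    intro θ hθ c hc
    obtain ⟨-, -, -, -, -, -, -, a1, a2, -⟩ := hball c hc
    simp only [Function.comp_apply] at a2
    rw [dist_zero_right] at a1 a2
    rw [mem_ball_zero_iff]
    have e1 : ‖(θ : ℂ)‖ ≤ 1 := by rw [Complex.norm_real, Real.norm_of_nonneg hθ.1]; exact hθ.2
    have e2 : ‖turn ε + τ (g c) - τ c‖ ≤ 9 := by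
      linarith [norm_sub_le (turn ε + τ (g c)) (τ c), norm_add_le (turn ε) (τ (g c)), norm_turn_lt ε]
    have e3 : ‖(θ : ℂ) * (turn ε + τ (g c) - τ c)‖ ≤ 1 * 9 := by
      rw [norm_mul]
      exact mul_le_mul e1 e2 (norm_nonneg _) zero_le_one
    linarith [norm_add_le (τ c) ((θ : ℂ) * (turn ε + τ (g c) - τ c))]
  have hmem : ∀ θ ∈ Set.Icc (0 : ℝ) 1, ∀ c ∈ Metric.ball (0 : ℂ) r,
      (ζ θ c, rho lam H τ c) ∈ Metric.ball (0 : ℂ) 19 ×ˢ Metric.ball (0 : ℂ) δ :=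
    fun θ hθ c hc => ⟨hζ19 θ hθ c hc, (hball c hc).2.2.2.2.2.2.2.2.2.1⟩
  set k : ℝ → ℂ → ℂ := fun θ c => κ c * Complex.exp (-((1 + lam)⁻¹ * ζ θ c)) *
    U (ζ θ c, rho lam H τ c) with hk
  have hkleaf : ∀ θ c, c * k θ c = leaf lam U (ζ θ c, rho lam H τ c) := by
    intro θ c
    simp only [hk, leaf, ← hκm c]
    ring
  have hkne : ∀ θ ∈ Set.Icc (0 : ℝ) 1, ∀ c ∈ Metric.ball (0 : ℂ) r, k θ c ≠ 0 := by
    intro θ hθ c hc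
    exact mul_ne_zero (mul_ne_zero (hball c hc).2.2.1 (Complex.exp_ne_zero _))
      (h.ne_zero _ (hmem θ hθ c hc))
  set K : ℝ → ℂ → ℂ × ℂ := fun θ c => (lam⁻¹ * Complex.exp (ζ θ c) * k θ c, k θ c) with hKdef
  have hKchart : ∀ θ c, c • K θ c = chart lam (ζ θ c, leaf lam U (ζ θ c, rho lam H τ c)) := by
    intro θ c
    rw [← hkleaf]
    simp only [hKdef, chart, Prod.smul_mk, smul_eq_mul]
    congr 1
    ring
  have h0r : (0 : ℂ) ∈ Metric.ball (0 : ℂ) r := Metric.mem_ball_self hr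
  -- The components along `S₁` and `S₂` of the velocity of the tangent curve, parametrized by its
  -- level.
  refine ⟨(1 + lam⁻¹)⁻¹, lam⁻¹ * (1 + lam⁻¹)⁻¹, r, K, inv_ne_zero hv,
    mul_ne_zero (inv_ne_zero hlam) (inv_ne_zero hv), hr, ?_, ?_, ?_, ?_, ?_⟩
  · rw [htd, deriv_axis_snd, deriv_axis_fst]
    simp
  · have cτ : ContinuousOn τ (Metric.ball 0 r) := fun c hc =>
      (hball c hc).2.2.2.2.1.continuousAt.continuousWithinAt
    have cg : ContinuousOn (fun c => τ (g c)) (Metric.ball 0 r) := fun c hc =>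
      (((hball c hc).2.2.2.2.2.1.continuousAt).comp
        (hball c hc).2.2.2.2.2.2.1.continuousAt).continuousWithinAt
    have cκ : ContinuousOn κ (Metric.ball 0 r) := fun c hc =>
      (hball c hc).2.2.2.1.continuousAt.continuousWithinAt
    have cρ : ContinuousOn (rho lam H τ) (Metric.ball 0 r) := fun c hc =>
      (hball c hc).2.2.2.2.2.2.2.2.2.2.continuousAt.continuousWithinAt
    have hsn : Set.MapsTo (Prod.snd : ℝ × ℂ → ℂ) (Set.Icc 0 1 ×ˢ Metric.ball 0 r)
      (Metric.ball 0 r) := fun q hq => hq.2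
    have dτ := cτ.comp continuousOn_snd hsn
    have dg := cg.comp continuousOn_snd hsn
    have dκ := cκ.comp continuousOn_snd hsn
    have dρ := cρ.comp continuousOn_snd hsn
    have dθ : ContinuousOn (fun q : ℝ × ℂ => (q.1 : ℂ)) (Set.Icc 0 1 ×ˢ Metric.ball 0 r) :=
      (Complex.continuous_ofReal.comp continuous_fst).continuousOn
    have dζ : ContinuousOn (fun q : ℝ × ℂ => ζ q.1 q.2) (Set.Icc 0 1 ×ˢ Metric.ball 0 r) :=
      dτ.add (dθ.mul ((continuousOn_const.add dg).sub dτ))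
    have dU : ContinuousOn (fun q : ℝ × ℂ => U (ζ q.1 q.2, rho lam H τ q.2))
        (Set.Icc 0 1 ×ˢ Metric.ball 0 r) :=
      h.analytic.continuousOn.comp (dζ.prodMk dρ) (fun q hq => hmem q.1 hq.1 q.2 hq.2)
    have dk : ContinuousOn (fun q : ℝ × ℂ => k q.1 q.2) (Set.Icc 0 1 ×ˢ Metric.ball 0 r) :=
      (dκ.mul (continuousOn_const.mul dζ).neg.cexp).mul dU
    exact ((continuousOn_const.mul dζ.cexp).mul dk).prodMk dk
  · intro θ hθ c hc h0
    exact hkne θ hθ c hc (congrArg Prod.snd h0)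
  · intro θ hθ
    refine ⟨k θ 0 * (1 + lam⁻¹), ?_⟩
    have hz : ζ θ 0 = turn ε * θ := by simp [hζ, hτ.map_zero, hg.map_zero, mul_comm]
    rw [deriv_axis_snd, deriv_axis_fst]
    simp only [hKdef, hz]
    rw [show 2 * (Real.pi : ℂ) * Complex.I * ((ε : ℤ) : ℂ) * θ = turn ε * θ by rw [turn]]
    have hinv := mul_inv_cancel₀ hv
    ext
    · simp only [Prod.smul_mk, Prod.mk_add_mk, smul_eq_mul]
      linear_combination (-(lam⁻¹ * Complex.exp (turn ε * θ) * k θ 0)) * hinv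
    · simp only [Prod.smul_mk, Prod.mk_add_mk, smul_eq_mul]
      linear_combination (-(k θ 0)) * hinv
  · intro c hc
    obtain ⟨b1, b2, -⟩ := hball c hc
    refine ⟨?_, ?_, ?_⟩
    · rw [hKchart]
      simp only [hζ, Complex.ofReal_zero, zero_mul, add_zero, b1]
      rfl
    · rw [hKchart]
      have : ζ 1 c = τ (g c) + turn ε := by simp only [hζ, Complex.ofReal_one]; ring
      rw [this, b2, chart_add_turn]
      rfl
    · intro θ hθ
      have hm := hmem θ hθ c hc
      set y := leaf lam U (ζ θ c, rho lam H τ c) with hy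
      have d1 := h.hasDerivAt_leaf _ hm
      have d2 := ((Complex.hasDerivAt_exp (ζ θ c)).const_mul lam⁻¹).mul d1
      have d3 := d2.prodMk d1
      have dζ : HasDerivAt (fun θ' : ℝ => ζ θ' c) (turn ε + τ (g c) - τ c) θ := by
        have := ((Complex.ofRealCLM.hasDerivAt (x := θ)).mul_const
          (turn ε + τ (g c) - τ c)).const_add (τ c)
        exact this.congr_deriv (by simp)
      have d4 := d3.scomp θ dζ
      refine ⟨_, (d4.hasDerivWithinAt (s := Set.Icc 0 1)).congr_of_eventuallyEq ?_ ?_, ?_⟩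
      · exact Eventually.of_forall fun θ' => hKchart θ' c
      · exact hKchart θ c
      · rw [hKchart, stdForm_apply]
        have hne := h.one_add_ne _ hm
        simp only [← hy] at hne ⊢
        simp only [Prod.smul_mk, smul_eq_mul, beta]
        set b := B (chart lam (ζ θ c, y)) with hb
        simp only [chart]
        field_simp
        ring

end

/-! ### First integrals normalized on the tangent curve. -/

/-- The first integral of `y dx + x B dy` in the chart whose value at a point of the tangent curve is
the level of the point, and whose monodromy is therefore the sliding `g`. -/
structure IsSlidingIntegral (B : ℂ × ℂ → ℂ) (lam : ℂ) (τ : ℂ → ℂ) (ε : ℤˣ) (g : ℂ → ℂ)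
    (J : ℂ × ℂ → ℂ) : Prop where
  analytic : ∀ z ∈ Metric.ball (0 : ℂ) 18, AnalyticAt ℂ J (z, 0)
  map_zero : ∀ z ∈ Metric.ball (0 : ℂ) 18, J (z, 0) = 0
  firstIntegral : ∀ z ∈ Metric.ball (0 : ℂ) 18, IsFirstIntegralAt B lam J (z, 0)
  hasDerivAt_snd : ∀ z ∈ Metric.ball (0 : ℂ) 18,
    HasDerivAt (fun y => J (z, y)) ((1 + lam⁻¹) * Complex.exp ((1 + lam)⁻¹ * z)) 0
  tangent : ∀ᶠ c in 𝓝 0, J (levelPt lam (τ c, c)) = c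
  add_turn : ∀ z ∈ Metric.ball (0 : ℂ) 10,
    ∀ᶠ p in 𝓝 ((z, 0) : ℂ × ℂ), g (J (p + (turn ε, 0))) = J p

section
variable {B : ℂ × ℂ → ℂ} {lam : ℂ} {τ : ℂ → ℂ} {δ : ℝ} {U H : ℂ × ℂ → ℂ} {ε : ℤˣ}

/-- Compose `H` with the inverse of `rho`. The relation between `mono` and `g` then becomes the
monodromy relation. -/
theorem FlowData.exists_isSlidingIntegral (hB : IsCoeff B lam) (h : FlowData B lam δ U H)
    (hτ : TangentData B lam τ) {g : ℂ → ℂ} (hg : IsDiffeoGerm₁ g)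
    (hgρ : ∀ᶠ c in 𝓝 0, mono H ε (rho lam H τ (g c)) = rho lam H τ c) :
    ∃ J, IsSlidingIntegral B lam τ ε g J := by
  have hρ := isDiffeoGerm_rho hB hτ h
  obtain ⟨σ, hσ, hσρ, hρσ⟩ := hρ.exists_inverse
  have hσa : ∀ z ∈ Metric.ball (0 : ℂ) 18, AnalyticAt ℂ σ (H (z, 0)) := fun z hz => by
    rw [h.H_zero hz]; exact hσ.analytic
  have hHt : ∀ z ∈ Metric.ball (0 : ℂ) 18, Tendsto H (𝓝 (z, 0)) (𝓝 0) := fun z hz => by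
    have := (h.analytic' z hz).continuousAt
    rwa [ContinuousAt, h.H_zero hz] at this
  refine ⟨fun p => σ (H p), fun z hz => ?_, fun z hz => ?_, fun z hz => ?_, fun z hz => ?_, ?_,
    fun z hz => ?_⟩
  · exact (hσa z hz).fun_comp (h.analytic' z hz)
  · rw [h.H_zero hz, hσ.map_zero]
  · exact (h.isFirstIntegralAt hz).comp (h.analytic' z hz) (hσa z hz)
  · have h1 : HasDerivAt σ (1 + lam⁻¹) 0 := by
      have e1 := HasDerivAt.comp_of_eq (0 : ℂ) hσ.hasDerivAt (hasDerivAt_rho hB hτ h)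
        hρ.map_zero.symm
      have e2 := e1.unique ((hasDerivAt_id (0 : ℂ)).congr_of_eventuallyEq hσρ)
      have hv := hB.one_add_inv_ne
      have e3 : deriv σ 0 = 1 + lam⁻¹ := by
        rw [← div_eq_mul_inv, div_eq_iff hv, one_mul] at e2
        exact e2
      rw [← e3]
      exact hσ.hasDerivAt
    exact HasDerivAt.comp_of_eq (0 : ℂ) h1 (h.hasDerivAt_H_snd hz) (h.H_zero hz).symm
  · exact hσρ
  · have hz18 : z ∈ Metric.ball (0 : ℂ) 18 := Metric.ball_subset_ball (by norm_num) hz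
    have hz' := add_turn_mem ε hz
    have t1 := (hHt _ hz').comp (tendsto_add_turn ε z)
    have hMρ := (isDiffeoGerm_mono h ε).comp hρ
    have t2 := hσ.tendsto.comp t1
    -- It suffices to compare after applying the injective germ `mono ∘ rho`: both sides become `H`
    -- at the translated point.
    refine hMρ.eventually_injective (u := fun p => g (σ (H (p + (turn ε, 0)))))
      (w := fun p => σ (H p)) (hg.tendsto.comp t2) (hσ.tendsto.comp (hHt z hz18)) ?_
    filter_upwards [t2.eventually hgρ, t1.eventually hρσ, (hHt z hz18).eventually hρσ,
      h.add_turn ε hz] with p h1 h2 h3 h4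
    simp only [Function.comp_apply] at h1 h2 ⊢
    rw [h1, h2, h3, h4]

end

/-! ### Local solutions of the transport problem along the levels. -/

/-- The variation of `ζ` when `(x, y)` is moved to `(x + y n, y - y n)`. -/
noncomputable def logShift (lam z n : ℂ) : ℂ := Complex.log ((1 + lam * Complex.exp (-z) * n) / (1 - n))

/-- In the chart, `(x, y) ↦ (x + y n, y - y n)` sends the leaves with first integral `J` to those
with first integral `J'`. -/
def IsTransport (lam : ℂ) (J J' n : ℂ × ℂ → ℂ) (z : ℂ) : Prop :=
  ∀ᶠ p in 𝓝 ((z, 0) : ℂ × ℂ), J' (p.1 + logShift lam p.1 (n p), p.2 * (1 - n p)) = J p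

theorem logShift_zero (lam z : ℂ) : logShift lam z 0 = 0 := by simp [logShift]

theorem analyticAt_logShift (lam z : ℂ) :
    AnalyticAt ℂ (fun q : ℂ × ℂ => logShift lam q.1 q.2) (z, 0) := by
  refine AnalyticAt.clog (AnalyticAt.div ?_ ?_ (by simp)) (by simp)
  · exact analyticAt_const.add ((analyticAt_const.mul analyticAt_fst.neg.cexp).mul analyticAt_snd)
  · exact analyticAt_const.sub analyticAt_snd

theorem hasDerivAt_logShift (lam z : ℂ) :
    HasDerivAt (logShift lam z) (1 + lam * Complex.exp (-z)) 0 := by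
  have h1 : HasDerivAt (fun n : ℂ => 1 + lam * Complex.exp (-z) * n) (lam * Complex.exp (-z)) 0 := by
    simpa using ((hasDerivAt_id (0 : ℂ)).const_mul (lam * Complex.exp (-z))).const_add 1
  have h2 : HasDerivAt (fun n : ℂ => 1 - n) (-1) 0 := (hasDerivAt_id (0 : ℂ)).const_sub 1
  refine ((h1.div h2 (by simp)).clog (by simp)).congr_deriv ?_
  simp
  ring

section
variable {B B' : ℂ × ℂ → ℂ} {lam : ℂ} {τ τ' : ℂ → ℂ} {ε : ℤˣ} {g : ℂ → ℂ} {J J' : ℂ × ℂ → ℂ}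

theorem IsSlidingIntegral.dsl_zero (hJ : IsSlidingIntegral B lam τ ε g J) {z : ℂ}
    (hz : z ∈ Metric.ball (0 : ℂ) 18) :
    dsl J (z, 0) = (1 + lam⁻¹) * Complex.exp ((1 + lam)⁻¹ * z) := by
  rw [Sliding.dsl_zero, (hJ.hasDerivAt_snd z hz).deriv]

theorem IsSlidingIntegral.analyticAt_dsl (hJ : IsSlidingIntegral B lam τ ε g J) {z : ℂ}
    (hz : z ∈ Metric.ball (0 : ℂ) 18) : AnalyticAt ℂ (dsl J) (z, 0) :=
  Sliding.analyticAt_dsl (hJ.analytic z hz) (hJ.analytic z hz)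

/-- Divide `J' (moved point) = J` by `y` and solve for `n`. On `y = 0` the derivative in `n`
vanishes only if `exp z = 1`: away from the direction of the tangent curve, levels and leaves are
transverse. -/
theorem exists_transport_of_ne (hB : IsCoeff B lam) (hJ : IsSlidingIntegral B lam τ ε g J)
    (hJ' : IsSlidingIntegral B' lam τ' ε g J') {z : ℂ} (hz : z ∈ Metric.ball (0 : ℂ) 18)
    (hne : Complex.exp z ≠ 1) :
    ∃ φ : ℂ × ℂ → ℂ, AnalyticAt ℂ φ (z, 0) ∧ (∀ᶠ z' in 𝓝 z, φ (z', 0) = 0) ∧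
      IsTransport lam J J' φ z ∧ ∀ m : ℂ × ℂ → ℂ, AnalyticAt ℂ m (z, 0) → m (z, 0) = 0 →
        IsTransport lam J J' m z → m =ᶠ[𝓝 (z, 0)] φ := by
  have h1l := hB.one_add_ne
  have hl := hB.ne_zero
  have hC := hB.one_add_inv_ne
  have hbn := Metric.isOpen_ball.mem_nhds hz
  -- the shifted point
  let S : (ℂ × ℂ) × ℂ → ℂ × ℂ := fun q => (q.1.1 + logShift lam q.1.1 q.2, q.1.2 * (1 - q.2))
  have hS : AnalyticAt ℂ S ((z, 0), 0) := by
    have e1 : AnalyticAt ℂ (fun q : (ℂ × ℂ) × ℂ => q.1.1) ((z, 0), 0) :=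
      analyticAt_fst.fun_comp_of_eq analyticAt_fst rfl
    have e2 : AnalyticAt ℂ (fun q : (ℂ × ℂ) × ℂ => q.1.2) ((z, 0), 0) :=
      analyticAt_snd.fun_comp_of_eq analyticAt_fst rfl
    have e3 : AnalyticAt ℂ (fun q : (ℂ × ℂ) × ℂ => logShift lam q.1.1 q.2) ((z, 0), 0) :=
      AnalyticAt.fun_comp_of_eq (g := fun q : ℂ × ℂ => logShift lam q.1 q.2)
        (f := fun q : (ℂ × ℂ) × ℂ => (q.1.1, q.2)) (x := ((z, 0), 0)) (y := (z, 0))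
        (analyticAt_logShift lam z) (e1.prod analyticAt_snd) rfl
    have e4 : AnalyticAt ℂ (fun q : (ℂ × ℂ) × ℂ => 1 - q.2) ((z, 0), 0) :=
      analyticAt_const.sub analyticAt_snd
    exact (e1.add e3).prod (e2.mul e4)
  have hS0 : S ((z, 0), 0) = (z, 0) := by simp [S, logShift_zero]
  have hSt : Tendsto S (𝓝 ((z, 0), 0)) (𝓝 (z, 0)) := by
    have := hS.continuousAt
    rwa [ContinuousAt, hS0] at this
  -- The transport equation divided by `y`. The quotients of `J` and `J'` by `y` have the same
  -- restriction to `y = 0`, as `lam` is the same, so `n = 0` is a solution there.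
  let G : (ℂ × ℂ) × ℂ → ℂ := fun q => (1 - q.2) * dsl J' (S q) - dsl J q.1
  have hG : AnalyticAt ℂ G ((z, 0), 0) :=
    ((analyticAt_const.sub analyticAt_snd).mul (AnalyticAt.fun_comp_of_eq (g := dsl J')
      (hJ'.analyticAt_dsl hz) hS hS0)).sub
      (AnalyticAt.fun_comp_of_eq (g := dsl J) (hJ.analyticAt_dsl hz) analyticAt_fst rfl)
  have hG0 : ∀ z' ∈ Metric.ball (0 : ℂ) 18, G ((z', 0), 0) = 0 := by
    intro z' hz'
    simp [G, S, logShift_zero, hJ.dsl_zero hz', hJ'.dsl_zero hz']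
  have hGd : HasDerivAt (fun w => G ((z, 0), w)) ((1 + lam⁻¹) * Complex.exp ((1 + lam)⁻¹ * z) *
      ((1 + lam)⁻¹ * (1 + lam * Complex.exp (-z)) - 1)) 0 := by
    have hL := hasDerivAt_logShift lam z
    have e1 : HasDerivAt (fun w : ℂ => 1 - w) (-1) 0 := (hasDerivAt_id (0 : ℂ)).const_sub 1
    have e2 := (((hL.const_add z).const_mul (1 + lam)⁻¹).cexp).const_mul (1 + lam⁻¹)
    have e3 := (e1.mul e2).sub_const (dsl J (z, 0))
    have e4 : HasDerivAt (fun w : ℂ => (1 - w) * ((1 + lam⁻¹) *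
        Complex.exp ((1 + lam)⁻¹ * (z + logShift lam z w))) - dsl J (z, 0)) _ 0 := e3
    refine (e4.congr_of_eventuallyEq ?_).congr_deriv ?_
    · have hc : Tendsto (fun w => z + logShift lam z w) (𝓝 0) (𝓝 z) := by
        have := (hL.continuousAt.const_add z : ContinuousAt (fun w => z + logShift lam z w) 0)
        simpa [ContinuousAt, logShift_zero] using this
      filter_upwards [hc.eventually hbn] with w hw
      simp only [G, S, zero_mul]
      rw [hJ'.dsl_zero hw]
    · simp only [logShift_zero, add_zero, sub_zero]
      ring
  have hd : (1 + lam⁻¹) * Complex.exp ((1 + lam)⁻¹ * z) *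
      ((1 + lam)⁻¹ * (1 + lam * Complex.exp (-z)) - 1) ≠ 0 := by
    refine mul_ne_zero (mul_ne_zero hC (Complex.exp_ne_zero _)) fun h0 => hne ?_
    have e1 : 1 + lam * Complex.exp (-z) = 1 + lam := by
      field_simp at h0
      linear_combination h0
    have e2 : Complex.exp (-z) = 1 := by
      apply mul_left_cancel₀ hl
      linear_combination e1
    rw [Complex.exp_neg, inv_eq_one] at e2
    exact e2
  obtain ⟨φ, hφ, hφ0, hiff, hsol⟩ := exists_implicit hG (hG0 z hz) hGd hd
  have hgraph : ∀ m : ℂ × ℂ → ℂ, AnalyticAt ℂ m (z, 0) → m (z, 0) = 0 →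
      Tendsto (fun p : ℂ × ℂ => ((p, m p) : (ℂ × ℂ) × ℂ)) (𝓝 (z, 0)) (𝓝 ((z, 0), 0)) := by
    intro m hm hm0
    have := continuousAt_id.prodMk hm.continuousAt
    rwa [ContinuousAt, hm0] at this
  have hSb : ∀ m : ℂ × ℂ → ℂ, AnalyticAt ℂ m (z, 0) → m (z, 0) = 0 →
      ∀ᶠ p in 𝓝 ((z, 0) : ℂ × ℂ), (S (p, m p)).1 ∈ Metric.ball (0 : ℂ) 18 := fun m hm hm0 =>
    ((continuous_fst.tendsto _).comp (hSt.comp (hgraph m hm hm0))).eventually hbn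
  have hmul : ∀ (p : ℂ × ℂ) (w : ℂ), p.1 ∈ Metric.ball (0 : ℂ) 18 →
      (S (p, w)).1 ∈ Metric.ball (0 : ℂ) 18 → p.2 * G (p, w) = J' (S (p, w)) - J p := by
    intro p w h1 h2
    have e1 := dsl_mul J' (S (p, w))
    have e2 := dsl_mul J p
    rw [hJ'.map_zero _ h2, sub_zero] at e1
    rw [hJ.map_zero _ h1, sub_zero] at e2
    rw [← e1, ← e2]
    simp only [G, S]
    ring
  have hp1 : ∀ᶠ p in 𝓝 ((z, 0) : ℂ × ℂ), p.1 ∈ Metric.ball (0 : ℂ) 18 :=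
    continuousAt_fst.eventually hbn
  refine ⟨φ, hφ, ?_, ?_, ?_⟩
  · have hc : Tendsto (fun z' : ℂ => (((z', 0), 0) : (ℂ × ℂ) × ℂ)) (𝓝 z) (𝓝 ((z, 0), 0)) :=
      Continuous.tendsto' (by fun_prop) _ _ rfl
    filter_upwards [hc.eventually hiff, hbn] with z' h1 h2
    exact h1.mp (hG0 z' h2)
  · filter_upwards [hSb φ hφ hφ0, hp1, hsol] with p h1 h2 h3
    have := hmul p (φ p) h2 h1
    rw [h3, mul_zero] at this
    exact (sub_eq_zero.mp this.symm)
  · intro m hm hm0 hmt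
    have hga : AnalyticAt ℂ (fun p => G (p, m p)) (z, 0) :=
      AnalyticAt.fun_comp_of_eq (g := G) hG (analyticAt_id.prod hm) (by simp [hm0])
    have h0 : (fun p => G (p, m p)) =ᶠ[𝓝 (z, 0)] fun _ => 0 := by
      refine eventuallyEq_of_snd_mul hga analyticAt_const ?_
      filter_upwards [hSb m hm hm0, hp1, hmt] with p h1 h2 h3
      rw [hmul p (m p) h2 h1, mul_zero, sub_eq_zero]
      exact h3
    filter_upwards [(hgraph m hm hm0).eventually hiff, h0] with p h1 h2
    exact (h1.mp h2).symm

/-- The Taylor expansion of the first integral on a level along the tangent curve. -/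
theorem IsSlidingIntegral.exists_quadratic (hB : IsCoeff B lam) (hτ : TangentData B lam τ)
    (hJ : IsSlidingIntegral B lam τ ε g J) : ∃ V : ℂ × ℂ → ℂ, AnalyticAt ℂ V 0 ∧
      (∀ᶠ q in 𝓝 (0 : ℂ × ℂ), J (levelPt lam (τ q.1 + q.2, q.1)) = q.1 * (1 + q.2 ^ 2 * V q)) ∧
      ∀ᶠ s in 𝓝 (0 : ℂ), (1 + s ^ 2 * V (0, s)) * (1 + lam⁻¹ * Complex.exp s) =
        (1 + lam⁻¹) * Complex.exp ((1 + lam)⁻¹ * s) := by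
  let P : ℂ × ℂ → ℂ × ℂ := fun q => levelPt lam (τ q.1 + q.2, q.1)
  have hz0 : (0 : ℂ) ∈ Metric.ball (0 : ℂ) 18 := by simp
  have hτ1 : AnalyticAt ℂ (fun q : ℂ × ℂ => τ q.1) 0 :=
    AnalyticAt.fun_comp_of_eq hτ.analytic analyticAt_fst rfl
  have hP : AnalyticAt ℂ P 0 := AnalyticAt.fun_comp_of_eq (g := levelPt lam) hB.analyticAt_levelPt
    ((hτ1.add analyticAt_snd).prod analyticAt_fst) (by simp [hτ.map_zero])
  have hP0 : P 0 = (0, 0) := by simp [P, levelPt, hτ.map_zero]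
  have hPt : Tendsto P (𝓝 0) (𝓝 (0, 0)) := by
    have := hP.continuousAt
    rwa [ContinuousAt, hP0] at this
  let D : ℂ × ℂ → ℂ := fun q => 1 + lam⁻¹ * Complex.exp (τ q.1 + q.2)
  have hD : AnalyticAt ℂ D 0 := analyticAt_const.add (analyticAt_const.mul (hτ1.add analyticAt_snd).cexp)
  have hD0 : D 0 ≠ 0 := by simpa [D, hτ.map_zero] using hB.one_add_inv_ne
  let A : ℂ × ℂ → ℂ := fun q => dsl J (P q) / D q
  have hA : AnalyticAt ℂ A 0 :=
    (AnalyticAt.fun_comp_of_eq (g := dsl J) (hJ.analyticAt_dsl hz0) hP hP0).div hD hD0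
  have hA1 : AnalyticAt ℂ (dsl A) 0 := Sliding.analyticAt_dsl hA hA
  have hA2 : AnalyticAt ℂ (dsl (dsl A)) 0 := Sliding.analyticAt_dsl hA1 hA1
  have hAF : ∀ᶠ q in 𝓝 (0 : ℂ × ℂ), J (P q) = q.1 * A q := by
    have h1 : ∀ᶠ p in 𝓝 ((0, 0) : ℂ × ℂ), p.1 ∈ Metric.ball (0 : ℂ) 18 :=
      continuousAt_fst.eventually (Metric.isOpen_ball.mem_nhds hz0)
    filter_upwards [hPt.eventually h1] with q hq
    have e := dsl_mul J (P q)
    rw [hJ.map_zero _ hq, sub_zero] at e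
    rw [← e]
    simp only [A, P, levelPt, D]
    ring
  have hc : Tendsto (fun c : ℂ => ((c, 0) : ℂ × ℂ)) (𝓝 0) (𝓝 0) :=
    Continuous.tendsto' (by fun_prop) _ _ rfl
  have hcan : ∀ f : ℂ × ℂ → ℂ, ∀ a : ℂ, AnalyticAt ℂ f 0 → (∀ᶠ c in 𝓝 (0 : ℂ), c * f (c, 0) = c * a) →
      ∀ᶠ c in 𝓝 (0 : ℂ), f (c, 0) = a := by
    intro f a hf h
    have hf' : AnalyticAt ℂ (fun c : ℂ => f (c, 0)) 0 :=
      AnalyticAt.fun_comp_of_eq hf (analyticAt_id.prod analyticAt_const) rfl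
    exact eventuallyEq_of_dense (dense_compl_singleton 0) (AnalyticAt.eventually_continuousAt' hf')
      (Eventually.of_forall fun _ => continuousAt_const)
      (h.mono fun c hc hS => mul_left_cancel₀ hS hc)
  -- On the tangent curve the first integral equals the level `c`, and `J = c A` there.
  have hAc0 : ∀ᶠ c in 𝓝 (0 : ℂ), A (c, 0) = 1 := by
    refine hcan A 1 hA ?_
    filter_upwards [hc.eventually hAF, hJ.tangent] with c h1 h2
    rw [← h1, mul_one]
    simpa [P] using h2
  -- At a tangency point the level has the direction of the leaf, so the derivative of the first
  -- integral along the level is zero.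
  have hAc1 : ∀ᶠ c in 𝓝 (0 : ℂ), dsl A (c, 0) = 0 := by
    refine hcan (dsl A) 0 hA1 ?_
    have hFI := hJ.firstIntegral 0 hz0
    have hJa := (hJ.analytic 0 hz0).eventually_analyticAt
    filter_upwards [hc.eventually (eventually_eventually_nhds.mpr hAF), (hc.eventually
      hA.eventually_analyticAt), (hPt.comp hc).eventually (hFI.and hJa), hτ.tangent,
      hc.eventually (hD.continuousAt.eventually_ne hD0)] with c h1 h2 h3 h4 h5
    simp only [Function.comp_apply] at h3
    obtain ⟨h3, h6⟩ := h3
    have hPc : P (c, 0) = levelPt lam (τ c, c) := by simp [P]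
    simp only [D, add_zero] at h5
    have hPd : HasDerivAt (fun s => P (c, s))
        (1, -(c * (lam⁻¹ * Complex.exp (τ c)) / (1 + lam⁻¹ * Complex.exp (τ c)) ^ 2)) 0 := by
      have d1 : HasDerivAt (fun s : ℂ => τ c + s) 1 0 := (hasDerivAt_id (0 : ℂ)).const_add _
      have d2 := ((d1.cexp.const_mul lam⁻¹).const_add 1)
      have d3 := (hasDerivAt_const (0 : ℂ) c).div d2 (by simpa using h5)
      refine (d1.prodMk d3).congr_deriv ?_
      simp [neg_div]
    have hJd := h6.differentiableAt.hasFDerivAt.comp_hasDerivAt (0 : ℂ) hPd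
    have hbeta : (P (c, 0)).2 * beta B lam (P (c, 0)) =
        c * (lam⁻¹ * Complex.exp (τ c)) / (1 + lam⁻¹ * Complex.exp (τ c)) ^ 2 := by
      rw [hPc, beta]
      set b := B (chart lam (levelPt lam (τ c, c)))
      simp only [levelPt]
      generalize lam⁻¹ * Complex.exp (τ c) = v at h4 h5 ⊢
      have hv : v ≠ 0 := fun h => by simp [h] at h4
      have hb : b = v⁻¹ := by rw [eq_comm, inv_eq_of_mul_eq_one_right h4]
      have hw : 1 + v⁻¹ ≠ 0 := by
        intro h
        apply h5
        field_simp at h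
        linear_combination h
      have e : (1 + b)⁻¹ = v / (1 + v) := by
        rw [hb, eq_div_iff h5, show 1 + v = (1 + v⁻¹) * v by field_simp; ring, inv_mul_cancel_left₀ hw]
      rw [e, div_mul_div_comm, sq]
    rw [← hbeta, h3] at hJd
    have hAd : HasDerivAt (fun s => c * A (c, s)) (c * dsl A (c, 0)) 0 := by
      rw [Sliding.dsl_zero]
      exact ((AnalyticAt.prodMk_right h2).differentiableAt.hasDerivAt).const_mul c
    have hcs : Tendsto (fun s : ℂ => ((c, s) : ℂ × ℂ)) (𝓝 0) (𝓝 (c, 0)) :=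
      Continuous.tendsto' (by fun_prop) _ _ rfl
    have hcongr : (fun s => J (P (c, s))) =ᶠ[𝓝 0] fun s => c * A (c, s) := hcs.eventually h1
    rw [mul_zero]
    exact hAd.unique (hJd.congr_of_eventuallyEq hcongr.symm)
  have hexp : ∀ q : ℂ × ℂ, A (q.1, 0) = 1 → dsl A (q.1, 0) = 0 → A q = 1 + q.2 ^ 2 * dsl (dsl A) q := by
    intro q h1 h2
    have e1 := dsl_mul A q
    have e2 := dsl_mul (dsl A) q
    rw [h1] at e1
    rw [h2] at e2
    linear_combination -e1 - q.2 * e2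
  have hfst : Tendsto (fun q : ℂ × ℂ => q.1) (𝓝 0) (𝓝 0) := continuous_fst.tendsto' _ _ rfl
  refine ⟨dsl (dsl A), hA2, ?_, ?_⟩
  · filter_upwards [hAF, hfst.eventually hAc0, hfst.eventually hAc1] with q h1 h2 h3
    rw [← hexp q h2 h3]
    exact h1
  · filter_upwards [hB.eventually_one_add, Metric.ball_mem_nhds 0 (by norm_num : (0 : ℝ) < 18)]
      with s h1 h2
    rw [← hexp (0, s) hAc0.self_of_nhds hAc1.self_of_nhds]
    simp only [A, P, D, hτ.map_zero, zero_add, levelPt, zero_div]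
    rw [hJ.dsl_zero h2, div_mul_cancel₀ _ h1]

end

section
variable {B B' : ℂ × ℂ → ℂ} {lam : ℂ} {τ τ' : ℂ → ℂ} {ε : ℤˣ} {g : ℂ → ℂ} {J J' : ℂ × ℂ → ℂ}

/-- The function `(1 + lam⁻¹) exp ((1 + lam)⁻¹ s) - lam⁻¹ exp s` has second derivative `-(1 + lam)⁻¹
≠ 0` at `0`. The tangency is therefore of order exactly one, which makes the critical point
nondegenerate. -/
theorem IsCoeff.quadratic_ne_zero (hB : IsCoeff B lam) {V : ℂ → ℂ} (hV : AnalyticAt ℂ V 0)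
    (h : ∀ᶠ s in 𝓝 (0 : ℂ), (1 + s ^ 2 * V s) * (1 + lam⁻¹ * Complex.exp s) =
      (1 + lam⁻¹) * Complex.exp ((1 + lam)⁻¹ * s)) : V 0 ≠ 0 := by
  have hl := hB.ne_zero
  have h1l := hB.one_add_ne
  intro h0
  set X : ℂ → ℂ := fun s => V s * (1 + lam⁻¹ * Complex.exp s) with hX
  have hXa : AnalyticAt ℂ X 0 :=
    hV.mul (analyticAt_const.add (analyticAt_const.mul analyticAt_id.cexp))
  have hX0 : X 0 = 0 := by simp [hX, h0]
  have e1 : (fun s => s ^ 2 * X s) =ᶠ[𝓝 0] fun s =>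
      (1 + lam⁻¹) * Complex.exp ((1 + lam)⁻¹ * s) - (1 + lam⁻¹ * Complex.exp s) := by
    filter_upwards [h] with s hs
    rw [← hs, hX]
    ring
  have hE : ∀ s : ℂ, HasDerivAt (fun s : ℂ => Complex.exp ((1 + lam)⁻¹ * s))
      (Complex.exp ((1 + lam)⁻¹ * s) * (1 + lam)⁻¹) s := fun s => by
    simpa using (((hasDerivAt_id s).const_mul (1 + lam)⁻¹).cexp)
  have e2 : (fun s => 2 * s * X s + s ^ 2 * deriv X s) =ᶠ[𝓝 0] fun s =>
      (1 + lam⁻¹) * (Complex.exp ((1 + lam)⁻¹ * s) * (1 + lam)⁻¹) - lam⁻¹ * Complex.exp s := by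
    filter_upwards [eventually_eventually_nhds.mpr e1, hXa.eventually_analyticAt] with s hs hs2
    have d1 := ((hasDerivAt_id s).pow 2).mul hs2.differentiableAt.hasDerivAt
    have d2 := ((hE s).const_mul (1 + lam⁻¹)).sub
      (((Complex.hasDerivAt_exp s).const_mul lam⁻¹).const_add 1)
    have := d1.unique (d2.congr_of_eventuallyEq hs)
    simpa using this
  have hX1 := hXa.differentiableAt.hasDerivAt
  have hX2 := hXa.deriv.differentiableAt.hasDerivAt
  have d1 := (((hasDerivAt_id (0 : ℂ)).const_mul 2).mul hX1).add
    (((hasDerivAt_id (0 : ℂ)).pow 2).mul hX2)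
  have d2 := (((hE 0).mul_const (1 + lam)⁻¹).const_mul (1 + lam⁻¹)).sub
    ((Complex.hasDerivAt_exp 0).const_mul lam⁻¹)
  have e3 := d1.unique (d2.congr_of_eventuallyEq e2)
  simp [hX0] at e3
  field_simp at e3
  exact mul_ne_zero hl h1l (by linear_combination e3)

/-- Local solution near the tangent curve. -/
theorem exists_transport_zero (hB : IsCoeff B lam) (hB' : IsCoeff B' lam) (hτ : TangentData B lam τ)
    (hτ' : TangentData B' lam τ') (hJ : IsSlidingIntegral B lam τ ε g J)
    (hJ' : IsSlidingIntegral B' lam τ' ε g J') :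
    ∃ φ : ℂ × ℂ → ℂ, AnalyticAt ℂ φ (0, 0) ∧ (∀ᶠ z in 𝓝 0, φ (z, 0) = 0) ∧
      IsTransport lam J J' φ 0 := by
  have hl := hB.ne_zero
  obtain ⟨V, hV, hVJ, hV0⟩ := hJ.exists_quadratic hB hτ
  obtain ⟨V', hV', hVJ', hV0'⟩ := hJ'.exists_quadratic hB' hτ'
  have hVr : AnalyticAt ℂ (fun s : ℂ => V (0, s)) 0 := AnalyticAt.prodMk_right hV
  have hVr' : AnalyticAt ℂ (fun s : ℂ => V' (0, s)) 0 := AnalyticAt.prodMk_right hV'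
  -- At the level `0` both expansions are prescribed by `lam` alone. This will force `n = 0` on `y =
  -- 0`.
  have hVV : ∀ᶠ s in 𝓝 (0 : ℂ), V (0, s) = V' (0, s) := by
    refine eventuallyEq_of_dense (dense_compl_singleton 0) (AnalyticAt.eventually_continuousAt' hVr)
      (AnalyticAt.eventually_continuousAt' hVr') ?_
    filter_upwards [hV0, hV0', hB.eventually_one_add] with s h1 h2 h3 hs
    have := mul_right_cancel₀ h3 (h1.trans h2.symm)
    have hs2 : s ^ 2 ≠ 0 := pow_ne_zero 2 hs
    exact mul_left_cancel₀ hs2 (by linear_combination this)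
  have hVne : V' (0, 0) ≠ 0 := hB.quadratic_ne_zero hVr' hV0'
  -- With the new displacement from the tangent curve written `s μ`, the equation `s² V = (s μ)² V'`
  -- is divided by `s²`.
  let G : (ℂ × ℂ) × ℂ → ℂ := fun q => q.2 ^ 2 * V' (q.1.1, q.1.2 * q.2) - V q.1
  have hG : AnalyticAt ℂ G (0, 1) := by
    have e1 : AnalyticAt ℂ (fun q : (ℂ × ℂ) × ℂ => (q.1.1, q.1.2 * q.2)) (0, 1) :=
      (analyticAt_fst.fun_comp_of_eq analyticAt_fst rfl).prod
        ((analyticAt_snd.fun_comp_of_eq analyticAt_fst rfl).mul analyticAt_snd)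
    have e2 : AnalyticAt ℂ (fun q : (ℂ × ℂ) × ℂ => V' (q.1.1, q.1.2 * q.2)) (0, 1) :=
      AnalyticAt.fun_comp_of_eq (g := V') (f := fun q : (ℂ × ℂ) × ℂ => (q.1.1, q.1.2 * q.2))
        (x := (0, 1)) hV' e1 (by simp)
    have e3 : AnalyticAt ℂ (fun q : (ℂ × ℂ) × ℂ => V q.1) (0, 1) :=
      AnalyticAt.fun_comp_of_eq (g := V) (f := fun q : (ℂ × ℂ) × ℂ => q.1) (x := (0, 1)) hV
        analyticAt_fst rfl
    exact ((analyticAt_snd.pow 2).mul e2).sub e3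
  have hG0 : ∀ s, V (0, s) = V' (0, s) → G ((0, s), 1) = 0 := by
    intro s hs
    simp [G, hs]
  -- On the line `c = 0` the roots at the origin are `1` and `-1`; nondegeneracy makes them simple,
  -- and the root `1` is followed.
  have hGd : HasDerivAt (fun w => G (0, w)) (2 * V' (0, 0)) 1 := by
    have := (((hasDerivAt_id (1 : ℂ)).pow 2).mul_const (V' (0, 0))).sub_const (V 0)
    refine HasDerivAt.congr_deriv (f := fun w => G (0, w)) ?_ (by simp : (2 : ℂ) * 1 * V' (0, 0) = _)
    simpa [G] using this
  obtain ⟨μ, hμ, hμ0, hiff, hsol⟩ := exists_implicit hG (hG0 0 hVV.self_of_nhds) hGd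
    (mul_ne_zero two_ne_zero hVne)
  have hμ1 : ∀ᶠ s in 𝓝 (0 : ℂ), μ (0, s) = 1 := by
    have hc : Tendsto (fun s : ℂ => (((0, s), 1) : (ℂ × ℂ) × ℂ)) (𝓝 0) (𝓝 (0, 1)) :=
      Continuous.tendsto' (by fun_prop) _ _ rfl
    filter_upwards [hc.eventually hiff, hVV] with s h1 h2
    exact h1.mp (hG0 s h2)
  let v : ℂ × ℂ → ℂ := fun p => lam⁻¹ * Complex.exp p.1
  have hv : AnalyticAt ℂ v 0 := analyticAt_const.mul analyticAt_fst.cexp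
  have hv0 : v 0 = lam⁻¹ := by simp [v]
  let c : ℂ × ℂ → ℂ := fun p => p.2 * (1 + v p)
  have hc : AnalyticAt ℂ c 0 := analyticAt_snd.mul (analyticAt_const.add hv)
  have hc0 : c 0 = 0 := by simp [c]
  have hτc : AnalyticAt ℂ (fun p => τ (c p)) 0 :=
    AnalyticAt.fun_comp_of_eq hτ.analytic hc hc0
  have hτc' : AnalyticAt ℂ (fun p => τ' (c p)) 0 :=
    AnalyticAt.fun_comp_of_eq hτ'.analytic hc hc0
  let q : ℂ × ℂ → ℂ × ℂ := fun p => (c p, p.1 - τ (c p))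
  have hq : AnalyticAt ℂ q 0 := hc.prod (analyticAt_fst.sub hτc)
  have hq0 : q 0 = 0 := by simp [q, hc0, hτ.map_zero]
  let s' : ℂ × ℂ → ℂ := fun p => (q p).2 * μ (q p)
  have hs' : AnalyticAt ℂ s' 0 := (analyticAt_fst.sub hτc).mul
    (AnalyticAt.fun_comp_of_eq hμ hq hq0)
  have hs'0 : s' 0 = 0 := by simp [s', hq0]
  -- The required variation of `ζ`: from the displacement `ζ - τ c` off one tangent curve to the
  -- displacement `s'` off the other, on the same level.
  let L : ℂ × ℂ → ℂ := fun p => τ' (c p) + s' p - p.1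
  have hL : AnalyticAt ℂ L 0 := (hτc'.add hs').sub analyticAt_fst
  have hL0 : L 0 = 0 := by simp [L, hc0, hτ'.map_zero, hs'0]
  -- The solution `n` of `(1 + v⁻¹ n) / (1 - n) = exp L`, that is, of `logShift = L`.
  let φ : ℂ × ℂ → ℂ := fun p => v p * (Complex.exp (L p) - 1) / (1 + v p * Complex.exp (L p))
  have hD : AnalyticAt ℂ (fun p => 1 + v p * Complex.exp (L p)) 0 :=
    analyticAt_const.add (hv.mul hL.cexp)
  have hD0 : 1 + v 0 * Complex.exp (L 0) ≠ 0 := by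
    rw [hL0, hv0]
    simpa using hB.one_add_inv_ne
  have hφ : AnalyticAt ℂ φ 0 := (hv.mul (hL.cexp.sub analyticAt_const)).div hD hD0
  have hqt : Tendsto q (𝓝 0) (𝓝 0) := by
    have := hq.continuousAt
    rwa [ContinuousAt, hq0] at this
  have hqt' : Tendsto (fun p => (c p, s' p)) (𝓝 0) (𝓝 (0 : ℂ × ℂ)) := by
    have := hc.continuousAt.prodMk hs'.continuousAt
    rw [ContinuousAt, hc0, hs'0] at this
    exact this
  have hLt : Tendsto L (𝓝 0) (𝓝 0) := by
    have := hL.continuousAt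
    rwa [ContinuousAt, hL0] at this
  have hev : ∀ᶠ p in 𝓝 (0 : ℂ × ℂ), 1 + v p ≠ 0 :=
    (analyticAt_const.add hv).continuousAt.eventually_ne (by
      simpa [hv0] using hB.one_add_inv_ne)
  refine ⟨φ, hφ, ?_, ?_⟩
  · filter_upwards [hμ1] with z hz
    have : L (z, 0) = 0 := by simp [L, c, s', q, hτ.map_zero, hτ'.map_zero, hz]
    simp [φ, this]
  · change ∀ᶠ p in 𝓝 (0 : ℂ × ℂ), _
    filter_upwards [hqt.eventually hVJ, hqt'.eventually hVJ', hqt.eventually hsol,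
      hD.continuousAt.eventually_ne hD0, hev, hLt.eventually (Metric.ball_mem_nhds 0 one_pos)]
      with p h1 h2 h3 h4 h5 h6
    have hvne : v p ≠ 0 := mul_ne_zero (inv_ne_zero hl) (Complex.exp_ne_zero _)
    have hvinv : lam * Complex.exp (-p.1) = (v p)⁻¹ := by
      simp only [v]
      rw [mul_inv, inv_inv, Complex.exp_neg]
    have hE : Complex.exp (L p) ≠ 0 := Complex.exp_ne_zero _
    have h1n : 1 - φ p = (1 + v p) / (1 + v p * Complex.exp (L p)) := by
      simp only [φ]
      field_simp
      ring
    have hshift : logShift lam p.1 (φ p) = L p := by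
      rw [logShift, hvinv, h1n]
      have : (1 + (v p)⁻¹ * φ p) / ((1 + v p) / (1 + v p * Complex.exp (L p))) =
          Complex.exp (L p) := by
        rw [div_div_eq_mul_div, div_eq_iff h5]
        simp only [φ]
        field_simp
        ring
      rw [this]
      exact log_exp_of_norm_lt (mem_ball_zero_iff.mp h6)
    rw [hshift, h1n]
    have hpt : (p.1 + L p, p.2 * ((1 + v p) / (1 + v p * Complex.exp (L p)))) =
        levelPt lam (τ' (c p) + s' p, c p) := by
      have e : τ' (c p) + s' p = p.1 + L p := by simp only [L]; ring
      rw [e]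
      simp only [levelPt, c, v, Complex.exp_add]
      rw [mul_div_assoc, mul_assoc]
    have hpt2 : levelPt lam (τ (c p) + (q p).2, c p) = p := by
      simp only [levelPt, q, add_sub_cancel]
      ext
      · rfl
      · simp only [c]
        exact mul_div_cancel_right₀ _ h5
    rw [hpt, h2]
    have h1' : J p = c p * (1 + (q p).2 ^ 2 * V (q p)) := by
      rw [← h1, show (q p).1 = c p from rfl, hpt2]
    rw [h1']
    have h3' : μ (q p) ^ 2 * V' (c p, s' p) = V (q p) := sub_eq_zero.mp h3
    rw [← h3']
    simp only [s']
    ring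

end

/-! ### Gluing the local solutions around the loop. -/

/-- A function of `(x / y, y)` in the chart. -/
noncomputable def pull (lam : ℂ) (m : ℂ × ℂ → ℂ) (p : ℂ × ℂ) : ℂ := m (lam⁻¹ * Complex.exp p.1, p.2)

/-- The exponential is open, so that an equality of germs in the chart descends to the coordinate `x
/ y`. -/
theorem map_pull_nhds {lam : ℂ} (hl : lam ≠ 0) (z : ℂ) :
    map (fun p : ℂ × ℂ => (lam⁻¹ * Complex.exp p.1, p.2)) (𝓝 (z, 0)) =
      𝓝 (lam⁻¹ * Complex.exp z, 0) := by
  have h := ((Complex.hasStrictDerivAt_exp z).const_mul lam⁻¹).map_nhds_eq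
    (mul_ne_zero (inv_ne_zero hl) (Complex.exp_ne_zero _))
  rw [nhds_prod_eq, nhds_prod_eq, ← h]
  conv_rhs => rw [← Filter.map_id (f := 𝓝 (0 : ℂ))]
  rw [Filter.prod_map_map_eq]
  rfl

theorem pull_add_turn (lam : ℂ) (ε : ℤˣ) (m : ℂ × ℂ → ℂ) (p : ℂ × ℂ) :
    pull lam m (p + (turn ε, 0)) = pull lam m p := by
  simp [pull, Complex.exp_add, exp_turn]

theorem analyticAt_pull {lam : ℂ} {m : ℂ × ℂ → ℂ} {z : ℂ}
    (hm : AnalyticAt ℂ m (lam⁻¹ * Complex.exp z, 0)) : AnalyticAt ℂ (pull lam m) (z, 0) :=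
  AnalyticAt.fun_comp_of_eq (g := m) hm
    ((analyticAt_const.mul analyticAt_fst.cexp).prod analyticAt_snd) rfl

/-- Two logarithms of the same number in the disc of radius `5` differ by less than `10 < 4π`, hence
by at most one turn, in one sense or the other. -/
theorem exp_eq_of_ball (ε : ℤˣ) {z w : ℂ} (hz : z ∈ Metric.ball (0 : ℂ) 5)
    (hw : w ∈ Metric.ball (0 : ℂ) 5) (h : Complex.exp z = Complex.exp w) :
    z = w ∨ z = w + turn ε ∨ w = z + turn ε := by
  obtain ⟨k, hk⟩ := Complex.exp_eq_exp_iff_exists_int.mp h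
  rw [mem_ball_zero_iff] at hz hw
  have h1 : ‖z - w‖ < 10 := by linarith [norm_sub_le z w]
  have h2 : z - w = k * (2 * Real.pi * Complex.I) := by rw [hk]; ring
  rw [h2, norm_mul] at h1
  have h3 : ‖(2 * Real.pi * Complex.I : ℂ)‖ = 2 * Real.pi := by
    simp [abs_of_pos Real.pi_pos]
  have h4 : ‖(k : ℂ)‖ = |(k : ℝ)| := by
    rw [← Complex.ofReal_intCast, Complex.norm_real, Real.norm_eq_abs]
  rw [h3, h4] at h1
  have h5 : |(k : ℝ)| < 2 := by
    by_contra h6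
    push Not at h6
    nlinarith [Real.pi_gt_three]
  have h6 : |k| < 2 := by exact_mod_cast h5
  obtain ⟨h7, h8⟩ := abs_lt.mp h6
  have hkk : k = 0 ∨ k = 1 ∨ k = -1 := by omega
  rcases hkk with rfl | rfl | rfl
  · left; simpa using hk
  · rcases Int.units_eq_one_or ε with rfl | rfl
    · right; left; rw [hk, turn]; simp
    · right; right; rw [hk, turn]; simp
  · rcases Int.units_eq_one_or ε with rfl | rfl
    · right; right; rw [hk, turn]; simp
    · right; left; rw [hk, turn]; simp

section
variable {B B' : ℂ × ℂ → ℂ} {lam : ℂ} {τ τ' : ℂ → ℂ} {ε : ℤˣ} {g : ℂ → ℂ} {J J' : ℂ × ℂ → ℂ}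

theorem IsTransport.congr {n n' : ℂ × ℂ → ℂ} {z : ℂ} (h : IsTransport lam J J' n z)
    (hn : n =ᶠ[𝓝 (z, 0)] n') : IsTransport lam J J' n' z := by
  filter_upwards [h, hn] with p h1 h2
  rwa [← h2]

theorem tendsto_logShift_pt {n : ℂ × ℂ → ℂ} {z : ℂ} (hn : AnalyticAt ℂ n (z, 0)) (h0 : n (z, 0) = 0) :
    Tendsto (fun p : ℂ × ℂ => (p.1 + logShift lam p.1 (n p), p.2 * (1 - n p))) (𝓝 (z, 0))
      (𝓝 (z, 0)) := by
  have hg : Tendsto (fun p : ℂ × ℂ => (p.1, n p)) (𝓝 (z, 0)) (𝓝 (z, 0)) := by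
    have := continuousAt_fst.prodMk hn.continuousAt
    rwa [ContinuousAt, h0] at this
  have h1 : ContinuousAt (fun p : ℂ × ℂ => logShift lam p.1 (n p)) (z, 0) := by
    have := ((analyticAt_logShift lam z).continuousAt.tendsto).comp hg
    rw [ContinuousAt, h0]
    exact this
  have h2 : ContinuousAt (fun p : ℂ × ℂ => (p.1 + logShift lam p.1 (n p), p.2 * (1 - n p))) (z, 0) :=
    (continuousAt_fst.add h1).prodMk (continuousAt_snd.mul (continuousAt_const.sub hn.continuousAt))
  simpa [ContinuousAt, h0, logShift_zero] using h2

/-- Both `J` and `J'` satisfy the monodromy relation with the same `g`. Applying `g` to the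
transport equation one turn further gives the equation at `z`. -/
theorem IsTransport.sub_turn (hJ : IsSlidingIntegral B lam τ ε g J)
    (hJ' : IsSlidingIntegral B' lam τ' ε g J') {n : ℂ × ℂ → ℂ} {z : ℂ}
    (hz : z ∈ Metric.ball (0 : ℂ) 10) (hn : AnalyticAt ℂ n (z, 0)) (h0 : n (z, 0) = 0)
    (hper : ∀ p, n (p + (turn ε, 0)) = n p) (h : IsTransport lam J J' n (z + turn ε)) :
    IsTransport lam J J' n z := by
  filter_upwards [(tendsto_add_turn ε z).eventually h, hJ.add_turn z hz,
    (tendsto_logShift_pt (lam := lam) hn h0).eventually (hJ'.add_turn z hz)] with p h1 h2 h3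
  rw [hper] at h1
  rw [← h2, ← h3, ← h1]
  congr 2
  ext
  · simp [logShift, Complex.exp_neg, Complex.exp_add, exp_turn]
    ring
  · simp

/-- A germ at a point of the circle is tested at a logarithm in the disc of radius `5`; by
`IsTransport.sub_turn` the choice of the logarithm does not matter. Uniqueness is available except
at `lam⁻¹`, the direction of the tangent curve, which is the exceptional point permitted by the
gluing. -/
theorem exists_transport (hB : IsCoeff B lam) (hB' : IsCoeff B' lam) (hτ : TangentData B lam τ)
    (hτ' : TangentData B' lam τ') (hJ : IsSlidingIntegral B lam τ ε g J)
    (hJ' : IsSlidingIntegral B' lam τ' ε g J') :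
    ∃ m : ℂ × ℂ → ℂ, ∀ z : ℂ, z.re = 0 → AnalyticAt ℂ (pull lam m) (z, 0) ∧
      (∀ᶠ z' in 𝓝 z, pull lam m (z', 0) = 0) ∧ ∃ z₁ ∈ Metric.ball (0 : ℂ) 5,
        Complex.exp z₁ = Complex.exp z ∧ IsTransport lam J J' (pull lam m) z₁ := by
  have hl := hB.ne_zero
  have hchart : ∀ z : ℂ, Tendsto (fun z => lam⁻¹ * Complex.exp z) (𝓝 z) (𝓝 (lam⁻¹ * Complex.exp z)) :=
    fun z => Continuous.tendsto (by fun_prop) z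
  have hinl : ∀ z : ℂ, Tendsto (fun z' : ℂ => ((z', 0) : ℂ × ℂ)) (𝓝 z) (𝓝 (z, 0)) := fun z =>
    Continuous.tendsto' (by fun_prop) _ _ rfl
  obtain ⟨m, hm⟩ := exists_glue (isCompact_sphere (0 : ℂ) ‖lam⁻¹‖)
    (fun v m => (∀ᶠ v' in 𝓝 v, m (v', 0) = 0) ∧ ∃ z ∈ Metric.ball (0 : ℂ) 5,
      lam⁻¹ * Complex.exp z = v ∧ IsTransport lam J J' (pull lam m) z) lam⁻¹
    (by
      rintro v m m' hmm ⟨h1, z, hz, rfl, h2⟩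
      refine ⟨?_, z, hz, rfl, h2.congr ?_⟩
      · filter_upwards [h1, (hinl _).eventually hmm] with v' h3 h4
        rw [← h4, h3]
      · rw [← map_pull_nhds hl] at hmm
        exact hmm)
    (by
      intro v hv
      rw [mem_sphere_zero_iff_norm] at hv
      have hv0 : v ≠ 0 := by
        rintro rfl
        rw [norm_zero, eq_comm, norm_eq_zero] at hv
        exact inv_ne_zero hl hv
      have hlv : ‖lam * v‖ = 1 := by
        rw [norm_mul, hv, norm_inv, mul_inv_cancel₀ (norm_ne_zero_iff.mpr hl)]
      set z := Complex.log (lam * v) with hzdef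
      have hz : lam⁻¹ * Complex.exp z = v := by
        rw [Complex.exp_log (mul_ne_zero hl hv0), inv_mul_cancel_left₀ hl]
      have hz5 : z ∈ Metric.ball (0 : ℂ) 5 := by
        rw [mem_ball_zero_iff]
        have h1 := Complex.norm_le_abs_re_add_abs_im z
        rw [hzdef, Complex.log_re, hlv, Real.log_one, abs_zero, zero_add, Complex.log_im] at h1
        have h2 := Complex.abs_arg_le_pi (lam * v)
        linarith [Real.pi_lt_d2]
      have hloc : ∃ φ : ℂ × ℂ → ℂ, AnalyticAt ℂ φ (z, 0) ∧ (∀ᶠ z' in 𝓝 z, φ (z', 0) = 0) ∧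
          IsTransport lam J J' φ z := by
        by_cases h1 : Complex.exp z = 1
        · have h2 : z = 0 := by
            have : lam * v = 1 := by rw [← hz, h1, mul_one, mul_inv_cancel₀ hl]
            rw [hzdef, this, Complex.log_one]
          rw [h2]
          exact exists_transport_zero hB hB' hτ hτ' hJ hJ'
        · obtain ⟨φ, h2, h3, h4, -⟩ := exists_transport_of_ne hB hJ hJ'
            (Metric.ball_subset_ball (by norm_num) hz5) h1
          exact ⟨φ, h2, h3, h4⟩
      obtain ⟨φ, hφ, hφ0, hφt⟩ := hloc
      -- A branch of the logarithm near `v` with value `z` at `v`; it transfers the local solution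
      -- from the chart to the coordinate `x / y`.
      have hlog : AnalyticAt ℂ (fun w : ℂ => z + Complex.log (w / v)) v :=
        analyticAt_const.add ((analyticAt_id.div analyticAt_const hv0).clog (by simp [hv0]))
      have hlogv : z + Complex.log (v / v) = z := by simp [hv0]
      have hlogt : Tendsto (fun w : ℂ => z + Complex.log (w / v)) (𝓝 v) (𝓝 z) := by
        have := hlog.continuousAt
        rwa [ContinuousAt, hlogv] at this
      set m : ℂ × ℂ → ℂ := fun p => φ (z + Complex.log (p.1 / v), p.2) with hm
      have hpull : pull lam m =ᶠ[𝓝 (z, 0)] φ := by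
        have hc : Tendsto (fun p : ℂ × ℂ => p.1 - z) (𝓝 (z, 0)) (𝓝 0) :=
          Continuous.tendsto' (by fun_prop) _ _ (by simp)
        filter_upwards [hc.eventually (Metric.ball_mem_nhds 0 one_pos)] with p hp
        have : lam⁻¹ * Complex.exp p.1 / v = Complex.exp (p.1 - z) := by
          rw [Complex.exp_sub, ← hz, mul_div_mul_left _ _ (inv_ne_zero hl)]
        simp only [pull, hm, this]
        rw [log_exp_of_norm_lt (mem_ball_zero_iff.mp hp), add_sub_cancel]
      refine ⟨m, ?_, ?_⟩
      · exact AnalyticAt.fun_comp_of_eq (g := φ) hφ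
          ((AnalyticAt.fun_comp_of_eq hlog analyticAt_fst rfl).prod analyticAt_snd) (by simp [hv0])
      · have hT := eventually_eventually_nhds.mpr (hφt.congr hpull.symm)
        filter_upwards [hlogt.eventually ((hinl z).eventually hT), hlogt.eventually
          (Metric.isOpen_ball.mem_nhds hz5), eventually_eventually_nhds.mpr (hlogt.eventually hφ0),
          continuousAt_id.eventually_ne hv0] with w h1 h2 h3 h4
        refine ⟨h3, _, h2, ?_, h1⟩
        simp only [id] at h4
        rw [Complex.exp_add, Complex.exp_log (div_ne_zero h4 hv0), ← mul_assoc, hz]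
        field_simp)
    (by
      rintro v m m' hv hm hm' ⟨h1, z, hz, hzv, h2⟩ ⟨h1', z', hz', hzv', h2'⟩
      have hp : ∀ w ∈ Metric.ball (0 : ℂ) 5, lam⁻¹ * Complex.exp w = v →
          AnalyticAt ℂ (pull lam m) (w, 0) ∧ AnalyticAt ℂ (pull lam m') (w, 0) ∧
          pull lam m (w, 0) = 0 ∧ pull lam m' (w, 0) = 0 ∧ w ∈ Metric.ball (0 : ℂ) 10 := by
        rintro w hw rfl
        exact ⟨analyticAt_pull hm, analyticAt_pull hm', h1.self_of_nhds, h1'.self_of_nhds,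
          Metric.ball_subset_ball (by norm_num) hw⟩
      have key : ∀ w ∈ Metric.ball (0 : ℂ) 5, lam⁻¹ * Complex.exp w = v →
          IsTransport lam J J' (pull lam m) w → IsTransport lam J J' (pull lam m') w →
          m =ᶠ[𝓝 (v, 0)] m' := by
        intro w hw hwv a b
        obtain ⟨p1, p2, p3, p4, p5⟩ := hp w hw hwv
        have hne : Complex.exp w ≠ 1 := by
          intro h
          apply hv
          rw [← hwv, h, mul_one]
        obtain ⟨φ, -, -, -, hu⟩ := exists_transport_of_ne hB hJ hJ'
          (Metric.ball_subset_ball (by norm_num) hw) hne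
        have := (hu _ p1 p3 a).trans (hu _ p2 p4 b).symm
        rw [← hwv, ← map_pull_nhds hl]
        exact this
      have hexp : Complex.exp z = Complex.exp z' :=
        mul_left_cancel₀ (inv_ne_zero hl) (hzv.trans hzv'.symm)
      obtain ⟨p1, p2, p3, p4, p5⟩ := hp z hz hzv
      obtain ⟨q1, q2, q3, q4, q5⟩ := hp z' hz' hzv'
      rcases exp_eq_of_ball ε hz hz' hexp with h | h | h
      · rw [← h] at h2'
        exact key z hz hzv h2 h2'
      · rw [h] at h2
        exact key z' hz' hzv' (h2.sub_turn hJ hJ' q5 q1 q3 (pull_add_turn lam ε m)) h2'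
      · rw [h] at h2'
        exact key z hz hzv h2 (h2'.sub_turn hJ hJ' p5 p2 p4 (pull_add_turn lam ε m')))
  refine ⟨m, fun z hz => ?_⟩
  have hzs : lam⁻¹ * Complex.exp z ∈ Metric.sphere (0 : ℂ) ‖lam⁻¹‖ := by
    rw [mem_sphere_zero_iff_norm, norm_mul, Complex.norm_exp, hz, Real.exp_zero, mul_one]
  obtain ⟨h1, h2⟩ := hm _ hzs
  obtain ⟨h3, z₁, h4, h5, h6⟩ := h2.self_of_nhds
  exact ⟨analyticAt_pull h1, (hchart z).eventually h3, z₁, h4,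
    mul_left_cancel₀ (inv_ne_zero hl) h5, h6⟩

end

/-! ### The differential equation satisfied by the conjugacy. -/

/-- The derivative along `(1 + B) ∂ζ - y ∂y`. -/
noncomputable def along (B : ℂ × ℂ → ℂ) (lam : ℂ) (n : ℂ × ℂ → ℂ) (p : ℂ × ℂ) : ℂ :=
  (1 + B (chart lam p)) * fderiv ℂ n p (1, 0) - p.2 * fderiv ℂ n p (0, 1)

/-- The condition that `(x, y) ↦ (x + y n, y - y n)` sends the leaves of `y dx + x B dy` to those of
`y dx + x B' dy`. -/
noncomputable def pde (B B' : ℂ × ℂ → ℂ) (lam : ℂ) (n : ℂ × ℂ → ℂ) (p : ℂ × ℂ) : ℂ :=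
  (1 - n p) * (lam⁻¹ * Complex.exp p.1 * B (chart lam p) + along B lam n p - n p) -
    (lam⁻¹ * Complex.exp p.1 + n p) *
      B' (p.2 * (lam⁻¹ * Complex.exp p.1 + n p), p.2 * (1 - n p)) * (1 - n p + along B lam n p)

section
variable {B B' : ℂ × ℂ → ℂ} {lam : ℂ} {τ τ' : ℂ → ℂ} {ε : ℤˣ} {g : ℂ → ℂ} {J J' : ℂ × ℂ → ℂ}

theorem analyticAt_along (hB : IsCoeff B lam) {n : ℂ × ℂ → ℂ} {z : ℂ} (hn : AnalyticAt ℂ n (z, 0)) :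
    AnalyticAt ℂ (along B lam n) (z, 0) :=
  ((analyticAt_const.add (hB.analyticAt_comp_chart z)).mul (analyticAt_fderiv_apply hn _)).sub
    (analyticAt_snd.mul (analyticAt_fderiv_apply hn _))

theorem analyticAt_comp_moved (hB' : IsCoeff B' lam) {n : ℂ × ℂ → ℂ} {z : ℂ}
    (hn : AnalyticAt ℂ n (z, 0)) : AnalyticAt ℂ (fun p : ℂ × ℂ =>
      B' (p.2 * (lam⁻¹ * Complex.exp p.1 + n p), p.2 * (1 - n p))) (z, 0) := by
  have h1 : AnalyticAt ℂ (fun p : ℂ × ℂ =>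
      (p.2 * (lam⁻¹ * Complex.exp p.1 + n p), p.2 * (1 - n p))) (z, 0) :=
    (analyticAt_snd.mul ((analyticAt_const.mul analyticAt_fst.cexp).add hn)).prod
      (analyticAt_snd.mul (analyticAt_const.sub hn))
  exact AnalyticAt.fun_comp_of_eq (g := B') hB'.analytic h1 (by simp)

theorem analyticAt_pde (hB : IsCoeff B lam) (hB' : IsCoeff B' lam) {n : ℂ × ℂ → ℂ} {z : ℂ}
    (hn : AnalyticAt ℂ n (z, 0)) : AnalyticAt ℂ (pde B B' lam n) (z, 0) := by
  have hv : AnalyticAt ℂ (fun p : ℂ × ℂ => lam⁻¹ * Complex.exp p.1) (z, 0) :=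
    analyticAt_const.mul analyticAt_fst.cexp
  have h1 := analyticAt_comp_moved hB' hn
  have h2 := analyticAt_along hB hn
  have h3 : AnalyticAt ℂ (fun p => 1 - n p) (z, 0) := analyticAt_const.sub hn
  exact (h3.mul (((hv.mul (hB.analyticAt_comp_chart z)).add h2).sub hn)).sub
    (((hv.add hn).mul h1).mul (h3.add h2))

/-- Differentiate `J' (moved point) = J` along the leaves of the first foliation, where `J` is
constant: the image of the tangent direction must be tangent to the leaves of `J'`. Clearing
denominators and cancelling `y` yields the equation, which, unlike the transport property, is
periodic in `ζ`. -/
theorem IsTransport.pde_eq_zero (hB : IsCoeff B lam) (hB' : IsCoeff B' lam)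
    (hJ : IsSlidingIntegral B lam τ ε g J) (hJ' : IsSlidingIntegral B' lam τ' ε g J')
    {n : ℂ × ℂ → ℂ} {z : ℂ} (hz : z ∈ Metric.ball (0 : ℂ) 18) (hn : AnalyticAt ℂ n (z, 0))
    (h0 : n (z, 0) = 0) (h : IsTransport lam J J' n z) :
    ∀ᶠ p in 𝓝 ((z, 0) : ℂ × ℂ), pde B B' lam n p = 0 := by
  have hl := hB.ne_zero
  refine eventuallyEq_of_snd_mul (analyticAt_pde hB hB' hn) analyticAt_const ?_
  have hpt := tendsto_logShift_pt (lam := lam) hn h0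
  have hJy : ∀ᶠ q in 𝓝 ((z, 0) : ℂ × ℂ), fderiv ℂ J' q (0, 1) ≠ 0 := by
    refine (analyticAt_fderiv_apply (hJ'.analytic z hz) (0, 1)).continuousAt.eventually_ne ?_
    rw [← (hJ'.hasDerivAt_snd z hz).unique (deriv_snd_eq (hJ'.analytic z hz))]
    exact mul_ne_zero hB.one_add_inv_ne (Complex.exp_ne_zero _)
  have hratio : ∀ᶠ p in 𝓝 ((z, 0) : ℂ × ℂ), (1 - n p) ≠ 0 ∧ (1 + lam * Complex.exp (-p.1) * n p) ≠ 0 ∧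
      (1 + lam * Complex.exp (-p.1) * n p) / (1 - n p) ∈ Complex.slitPlane := by
    have c1 : ContinuousAt (fun p => 1 - n p) (z, 0) := continuousAt_const.sub hn.continuousAt
    have c2 : ContinuousAt (fun p : ℂ × ℂ => 1 + lam * Complex.exp (-p.1) * n p) (z, 0) := by
      have := hn.continuousAt
      fun_prop
    refine (c1.eventually_ne (by simp [h0])).and ((c2.eventually_ne (by simp [h0])).and ?_)
    exact (c2.div c1 (by simp [h0])).eventually_mem (Complex.isOpen_slitPlane.mem_nhds (by simp [h0]))
  filter_upwards [eventually_eventually_nhds.mpr h, hn.eventually_analyticAt, hpt.eventually hJy,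
    hpt.eventually (hJ'.firstIntegral z hz), hJ.firstIntegral z hz,
    (hJ.analytic z hz).eventually_analyticAt, hpt.eventually (hJ'.analytic z hz).eventually_analyticAt,
    hratio, hB.eventually_beta z, hpt.eventually (hB'.eventually_beta z)]
    with p a1 a2 a3 a4 a5 a6 a7 ⟨b1, b2, b3⟩ b4 b5
  rw [mul_zero]
  by_cases hy : p.2 = 0
  · rw [hy, zero_mul]
  set v := lam⁻¹ * Complex.exp p.1 with hv
  have hv0 : v ≠ 0 := mul_ne_zero (inv_ne_zero hl) (Complex.exp_ne_zero _)
  have hvinv : lam * Complex.exp (-p.1) = v⁻¹ := by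
    rw [hv, mul_inv, inv_inv, Complex.exp_neg]
  set b := B (chart lam p) with hb
  set w : ℂ × ℂ := (1, -(p.2 * beta B lam p)) with hw
  set dn := fderiv ℂ n p w with hdn
  have hσ : HasDerivAt (fun t : ℂ => p + t • w) w 0 := by
    simpa using ((hasDerivAt_id (0 : ℂ)).smul_const w).const_add p
  have hσ0 : p + (0 : ℂ) • w = p := by simp
  have hσt : Tendsto (fun t : ℂ => p + t • w) (𝓝 0) (𝓝 p) := by
    have := hσ.continuousAt
    rwa [ContinuousAt, hσ0] at this
  have d1 : HasDerivAt (fun t : ℂ => (p + t • w).1) 1 0 := by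
    exact (hasFDerivAt_fst (𝕜 := ℂ) (p := p + (0 : ℂ) • w)).comp_hasDerivAt (0 : ℂ) hσ
  have d2 : HasDerivAt (fun t : ℂ => (p + t • w).2) (-(p.2 * beta B lam p)) 0 := by
    exact (hasFDerivAt_snd (𝕜 := ℂ) (p := p + (0 : ℂ) • w)).comp_hasDerivAt (0 : ℂ) hσ
  have d3 : HasDerivAt (fun t : ℂ => n (p + t • w)) dn 0 :=
    a2.differentiableAt.hasFDerivAt.comp_hasDerivAt_of_eq (0 : ℂ) hσ hσ0.symm
  have d4 : HasDerivAt (fun t : ℂ => J (p + t • w)) 0 0 := by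
    have := a6.differentiableAt.hasFDerivAt.comp_hasDerivAt_of_eq (0 : ℂ) hσ hσ0.symm
    rw [a5] at this
    exact this
  have hN : 1 + v⁻¹ * n p ≠ 0 := by rwa [hvinv] at b2
  have hvn : v + n p ≠ 0 := by
    intro h
    apply hN
    field_simp
    simpa using h
  have d1' : HasDerivAt (fun t : ℂ => -(p + t • w).1) (-1) 0 := d1.neg
  have d5 : HasDerivAt (fun t : ℂ => 1 + lam * Complex.exp (-(p + t • w).1) * n (p + t • w)) _ 0 :=
    ((d1'.cexp.const_mul lam).mul d3).const_add 1
  have d6 := d3.const_sub 1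
  have d7 : HasDerivAt (fun t : ℂ => logShift lam (p + t • w).1 (n (p + t • w)))
      ((v⁻¹ * dn - v⁻¹ * n p) / (1 + v⁻¹ * n p) + dn / (1 - n p)) 0 := by
    refine ((d5.div d6 (by rw [hσ0]; exact b1)).clog (by
      simp only [Pi.div_apply, hσ0]
      exact b3)).congr_deriv ?_
    simp only [Pi.div_apply, hσ0, hvinv]
    have e : lam * (Complex.exp (-p.1) * -1) = -v⁻¹ := by rw [← hvinv]; ring
    rw [e]
    field_simp
    ring
  have d8 := (d1.add d7).prodMk (d2.mul d6)
  set q : ℂ × ℂ := (p.1 + logShift lam p.1 (n p), p.2 * (1 - n p)) with hq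
  have d9 := a7.differentiableAt.hasFDerivAt.comp_hasDerivAt_of_eq (0 : ℂ) d8 (by
    simp [hq])
  have d10 := d9.unique (d4.congr_of_eventuallyEq (hσt.eventually a1))
  have hlin : ∀ A c : ℂ, fderiv ℂ J' q (A, c) = A * fderiv ℂ J' q (1, 0) + c * fderiv ℂ J' q (0, 1) := by
    intro A c
    rw [← smul_eq_mul, ← smul_eq_mul, ← map_smul, ← map_smul, ← map_add]
    simp
  rw [hlin] at a4 d10
  have hbq : chart lam q = (p.2 * (v + n p), p.2 * (1 - n p)) := by
    simp only [chart, hq, logShift]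
    rw [Complex.exp_add, Complex.exp_log (div_ne_zero b2 b1), hvinv]
    congr 1
    have : lam⁻¹ * (Complex.exp p.1 * ((1 + v⁻¹ * n p) / (1 - n p))) * (p.2 * (1 - n p)) =
      v * ((1 + v⁻¹ * n p) / (1 - n p)) * (p.2 * (1 - n p)) := by rw [hv]; ring
    rw [this]
    field_simp
  have hβ' : beta B' lam q = (1 + B' (p.2 * (v + n p), p.2 * (1 - n p)))⁻¹ := by rw [beta, hbq]
  rw [hbq] at b5
  set b' := B' (p.2 * (v + n p), p.2 * (1 - n p)) with hb'
  have hβ : beta B lam p = (1 + b)⁻¹ := by rw [beta]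
  have hdnD : along B lam n p = (1 + b) * dn := by
    have e : w = (1 : ℂ) • ((1, 0) : ℂ × ℂ) + (-(p.2 * beta B lam p)) • ((0, 1) : ℂ × ℂ) := by
      simp [hw]
    rw [along, hdn, e, map_add, map_smul, map_smul, hβ, smul_eq_mul, smul_eq_mul, ← hb]
    field_simp
    ring
  rw [hvinv] at b2
  rw [hβ', one_mul] at a4
  simp only [hσ0, hβ] at d10
  -- Subtract from the derivative of `J'` a multiple of its vanishing derivative along its own
  -- leaves. What remains is a multiple of `∂J'/∂y`, which is not zero.
  have hX : p.2 * (-(1 - n p) / (1 + b) - dn + (1 + ((v⁻¹ * dn - v⁻¹ * n p) / (1 + v⁻¹ * n p) +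
      dn / (1 - n p))) * (1 - n p) / (1 + b')) = 0 := by
    refine (mul_eq_zero.mp (?_ : _ * fderiv ℂ J' q (0, 1) = 0)).resolve_right a3
    linear_combination d10 - (1 + ((v⁻¹ * dn - v⁻¹ * n p) / (1 + v⁻¹ * n p) +
      dn / (1 - n p))) * a4
  have hpde : pde B B' lam n p = (v + n p) * (1 + b) * (1 + b') *
      (-(1 - n p) / (1 + b) - dn + (1 + ((v⁻¹ * dn - v⁻¹ * n p) / (1 + v⁻¹ * n p) +
      dn / (1 - n p))) * (1 - n p) / (1 + b')) := by
    simp only [pde, ← hv, ← hb, ← hb', hdnD]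
    have e : (v⁻¹ * dn - v⁻¹ * n p) / (1 + v⁻¹ * n p) = (dn - n p) / (v + n p) := by
      rw [div_eq_div_iff b2 hvn]
      field_simp
    rw [e]
    field_simp
    ring
  rw [hpde]
  linear_combination (v + n p) * (1 + b) * (1 + b') * hX

theorem pde_pull_add (m : ℂ × ℂ → ℂ) {w : ℂ} (hw : Complex.exp w = 1) (p : ℂ × ℂ) :
    pde B B' lam (pull lam m) (p + (w, 0)) = pde B B' lam (pull lam m) p := by
  have h1 : ∀ p : ℂ × ℂ, pull lam m (p + (w, 0)) = pull lam m p := by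
    intro p
    simp [pull, Complex.exp_add, hw]
  have h2 : chart lam (p + (w, 0)) = chart lam p := by simp [chart, Complex.exp_add, hw]
  have h3 : fderiv ℂ (pull lam m) (p + (w, 0)) = fderiv ℂ (pull lam m) p := by
    rw [← fderiv_comp_add_right]
    congr 1
    funext p
    exact h1 p
  simp only [pde, along, h1, h2, h3]
  simp [Complex.exp_add, hw]

/-- The conjugacy, in the chart, over a neighbourhood of the loop. -/
theorem exists_pde_solution (hB : IsCoeff B lam) (hB' : IsCoeff B' lam) (hτ : TangentData B lam τ)
    (hτ' : TangentData B' lam τ') (hJ : IsSlidingIntegral B lam τ ε g J)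
    (hJ' : IsSlidingIntegral B' lam τ' ε g J') :
    ∃ m : ℂ × ℂ → ℂ, ∀ z : ℂ, z.re = 0 → AnalyticAt ℂ (pull lam m) (z, 0) ∧
      (∀ᶠ z' in 𝓝 z, pull lam m (z', 0) = 0) ∧
      ∀ᶠ p in 𝓝 ((z, 0) : ℂ × ℂ), pde B B' lam (pull lam m) p = 0 := by
  obtain ⟨m, hm⟩ := exists_transport hB hB' hτ hτ' hJ hJ'
  refine ⟨m, fun z hz => ?_⟩
  obtain ⟨h1, h2, z₁, h3, h4, h5⟩ := hm z hz
  refine ⟨h1, h2, ?_⟩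
  have hz1 : z₁.re = 0 := by
    have := congrArg norm h4
    rw [Complex.norm_exp, Complex.norm_exp, hz] at this
    exact Real.exp_injective this
  obtain ⟨h6, h7, -⟩ := hm z₁ hz1
  have h8 := h5.pde_eq_zero hB hB' hJ hJ' (Metric.ball_subset_ball (by norm_num) h3) h6
    h7.self_of_nhds
  have hw : Complex.exp (z₁ - z) = 1 := by rw [Complex.exp_sub, h4, div_self (Complex.exp_ne_zero _)]
  have hc : Tendsto (fun p : ℂ × ℂ => p + (z₁ - z, 0)) (𝓝 (z, 0)) (𝓝 (z₁, 0)) :=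
    Continuous.tendsto' (by fun_prop) _ _ (by simp)
  filter_upwards [hc.eventually h8] with p hp
  rwa [pde_pull_add m hw] at hp

end

/-! ### The linearized equation for the Taylor coefficients. -/

/-- The linearization of `pde` on the line `y = 0`, for variations of order `N` in `y`. -/
noncomputable def linPde (lam : ℂ) (N : ℕ) (κ : ℂ × ℂ → ℂ) (z : ℂ) : ℂ :=
  (1 - Complex.exp z) * ((1 + lam) * fderiv ℂ κ (z, 0) (1, 0) - N * κ (z, 0)) - (1 + lam) * κ (z, 0)

section
variable {B B' : ℂ × ℂ → ℂ} {lam : ℂ}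

/-- The component `-y ∂y` of the field acts on `y ^ N` as multiplication by `-N`. -/
theorem along_add_pow_mul {n κ : ℂ × ℂ → ℂ} {p : ℂ × ℂ} (hn : AnalyticAt ℂ n p)
    (hκ : AnalyticAt ℂ κ p) (N : ℕ) : along B lam (fun p => n p + p.2 ^ N * κ p) p =
      along B lam n p + p.2 ^ N * (along B lam κ p - N * κ p) := by
  have ha : AnalyticAt ℂ (fun p : ℂ × ℂ => n p + p.2 ^ N * κ p) p :=
    hn.add ((analyticAt_snd.pow N).mul hκ)
  have e1 := (deriv_fst_eq ha).unique ((deriv_fst_eq hn).add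
    ((deriv_fst_eq hκ).const_mul (p.2 ^ N)))
  have e2 := (deriv_snd_eq ha).unique ((deriv_snd_eq hn).add
    (((hasDerivAt_id p.2).pow N).mul (deriv_snd_eq hκ)))
  simp only [along]
  rw [e1, e2]
  rcases N with _ | N
  · simp; ring
  · simp
    ring

theorem along_congr {n n' : ℂ × ℂ → ℂ} {p : ℂ × ℂ} (h : n =ᶠ[𝓝 p] n') :
    along B lam n p = along B lam n' p := by rw [along, along, h.fderiv_eq]

theorem fderiv_fst_zero {n : ℂ × ℂ → ℂ} {z : ℂ} (hn : AnalyticAt ℂ n (z, 0))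
    (h0 : ∀ᶠ z' in 𝓝 z, n (z', 0) = 0) : fderiv ℂ n (z, 0) (1, 0) = 0 :=
  (deriv_fst_eq hn).unique ((hasDerivAt_const z (0 : ℂ)).congr_of_eventuallyEq h0)

theorem tendsto_line (z : ℂ) : Tendsto (fun y : ℂ => ((z, y) : ℂ × ℂ)) (𝓝[≠] 0) (𝓝 (z, 0)) :=
  (Continuous.tendsto' (by fun_prop) _ _ rfl).mono_left nhdsWithin_le_nhds

/-- Expand the difference in `y ^ N κ` and divide. The arguments of `B'` carry an extra factor `y`,
so the variation of `B'` is negligible compared with `y ^ N`; all other factors tend to their values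
on `y = 0`, where `B` and `B'` both equal `lam`. -/
theorem tendsto_pde_sub (hB : IsCoeff B lam) (hB' : IsCoeff B' lam) {n₁ n₂ κ : ℂ × ℂ → ℂ} {z : ℂ}
    (N : ℕ) (h₁ : AnalyticAt ℂ n₁ (z, 0)) (h₂ : AnalyticAt ℂ n₂ (z, 0)) (hκ : AnalyticAt ℂ κ (z, 0))
    (h₁0 : ∀ᶠ z' in 𝓝 z, n₁ (z', 0) = 0) (h₂0 : ∀ᶠ z' in 𝓝 z, n₂ (z', 0) = 0)
    (h : ∀ᶠ p in 𝓝 ((z, 0) : ℂ × ℂ), n₁ p = n₂ p + p.2 ^ N * κ p) :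
    Tendsto (fun y => (pde B B' lam n₁ (z, y) - pde B B' lam n₂ (z, y)) / y ^ N) (𝓝[≠] 0)
      (𝓝 (linPde lam N κ z)) := by
  have hl := hB.ne_zero
  set v := lam⁻¹ * Complex.exp z with hv
  have hlv : lam * v = Complex.exp z := by rw [hv, mul_inv_cancel_left₀ hl]
  let P : (ℂ × ℂ → ℂ) → ℂ × ℂ → ℂ × ℂ := fun n p =>
    (p.2 * (lam⁻¹ * Complex.exp p.1 + n p), p.2 * (1 - n p))
  have hPt : ∀ n : ℂ × ℂ → ℂ, AnalyticAt ℂ n (z, 0) → Tendsto (P n) (𝓝 (z, 0)) (𝓝 0) := by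
    intro n hn
    have h1 : ContinuousAt (P n) (z, 0) := by
      have := hn.continuousAt
      have : ContinuousAt (fun p : ℂ × ℂ => Complex.exp p.1) (z, 0) := by fun_prop
      exact (continuousAt_snd.mul ((continuousAt_const.mul this).add hn.continuousAt)).prodMk
        (continuousAt_snd.mul (continuousAt_const.sub hn.continuousAt))
    simp only [ContinuousAt, P, zero_mul] at h1
    exact h1
  have tl := tendsto_line z
  have tn : ∀ n : ℂ × ℂ → ℂ, AnalyticAt ℂ n (z, 0) →
      Tendsto (fun y => n (z, y)) (𝓝[≠] 0) (𝓝 (n (z, 0))) := fun n hn =>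
    hn.continuousAt.tendsto.comp tl
  have t1 := tn n₁ h₁
  have t2 := tn n₂ h₂
  have tκ := tn κ hκ
  have a1 := tn _ (analyticAt_along hB h₁)
  have a2 := tn _ (analyticAt_along hB h₂)
  have aκ := tn _ (analyticAt_along hB hκ)
  have hBt := tn _ (hB.analyticAt_comp_chart z)
  have hB1 := tn _ (analyticAt_comp_moved hB' h₁)
  have hB2 := tn _ (analyticAt_comp_moved hB' h₂)
  have hB0 : B (chart lam (z, 0)) = lam := by rw [chart_zero, hB.map_zero]
  have hB'0 : B' 0 = lam := hB'.map_zero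
  have al : ∀ n : ℂ × ℂ → ℂ, along B lam n (z, 0) = (1 + lam) * fderiv ℂ n (z, 0) (1, 0) := by
    intro n
    rw [along, hB0]
    simp
  rw [h₁0.self_of_nhds] at t1
  rw [h₂0.self_of_nhds] at t2
  rw [al, fderiv_fst_zero h₁ h₁0, mul_zero] at a1
  rw [al, fderiv_fst_zero h₂ h₂0, mul_zero] at a2
  rw [al] at aκ
  rw [hB0] at hBt
  simp only [zero_mul] at hB1 hB2
  rw [show ((0, 0) : ℂ × ℂ) = 0 from rfl, hB'0] at hB1 hB2
  -- the variation of the last coefficient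
  have hq : Tendsto (fun y => (B' (P n₁ (z, y)) - B' (P n₂ (z, y))) / y ^ N) (𝓝[≠] 0) (𝓝 0) := by
    obtain ⟨C, hC⟩ := (hB'.analytic.hasStrictFDerivAt.isBigO_sub).bound
    have hpair : Tendsto (fun p => (P n₁ p, P n₂ p)) (𝓝 (z, 0)) (𝓝 ((0 : ℂ × ℂ), (0 : ℂ × ℂ))) :=
      (hPt n₁ h₁).prodMk_nhds (hPt n₂ h₂)
    refine squeeze_zero_norm' (a := fun y => C * ‖y * κ (z, y)‖) ?_ ?_
    · filter_upwards [tl.eventually (hpair.eventually hC), tl.eventually h, self_mem_nhdsWithin]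
        with y h1 h2 h3
      have h3' : y ≠ 0 := h3
      have hd : P n₁ (z, y) - P n₂ (z, y) = (y ^ N * (y * κ (z, y)), -(y ^ N * (y * κ (z, y)))) := by
        simp only [P, h2]
        ext
        · simp; ring
        · simp; ring
      rw [hd, Prod.norm_mk, norm_neg, max_self, norm_mul, norm_pow] at h1
      rw [norm_div, norm_pow, div_le_iff₀ (by positivity)]
      calc _ ≤ _ := h1
        _ = _ := by ring
    · have : Tendsto (fun y => C * ‖y * κ (z, y)‖) (𝓝[≠] 0) (𝓝 (C * ‖(0 : ℂ) * κ (z, 0)‖)) :=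
        ((tendsto_id.mono_left nhdsWithin_le_nhds).mul tκ).norm.const_mul C
      simpa using this
  have hlim : Tendsto (fun y => (-κ (z, y)) * (v * B (chart lam (z, y)) + along B lam n₁ (z, y) -
      n₁ (z, y)) + (1 - n₂ (z, y)) * (along B lam κ (z, y) - N * κ (z, y) - κ (z, y)) -
      (κ (z, y) * B' (P n₁ (z, y)) * (1 - n₁ (z, y) + along B lam n₁ (z, y)) + (v + n₂ (z, y)) *
        ((B' (P n₁ (z, y)) - B' (P n₂ (z, y))) / y ^ N) * (1 - n₁ (z, y) + along B lam n₁ (z, y)) +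
        (v + n₂ (z, y)) * B' (P n₂ (z, y)) * (along B lam κ (z, y) - N * κ (z, y) - κ (z, y))))
      (𝓝[≠] 0) (𝓝 (linPde lam N κ z)) := by
    have c1 := (tκ.neg).mul (((hBt.const_mul v).add a1).sub t1)
    have c2 := (t2.const_sub 1).mul ((aκ.sub (tκ.const_mul (N : ℂ))).sub tκ)
    have c3 := (tκ.mul hB1).mul ((t1.const_sub 1).add a1)
    have c4 := ((t2.const_add v).mul hq).mul ((t1.const_sub 1).add a1)
    have c5 := ((t2.const_add v).mul hB2).mul ((aκ.sub (tκ.const_mul (N : ℂ))).sub tκ)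
    refine Tendsto.congr_dist ((c1.add c2).sub ((c3.add c4).add c5)) ?_ |>.trans ?_
    · simp [P]
    · rw [linPde, ← hlv]
      refine le_of_eq (congrArg 𝓝 ?_)
      ring
  refine hlim.congr' ?_
  filter_upwards [tl.eventually (eventually_eventually_nhds.mpr h),
    tl.eventually h₂.eventually_analyticAt, tl.eventually hκ.eventually_analyticAt,
    self_mem_nhdsWithin] with y h1 h2 h3 h4
  have hy : y ^ N ≠ 0 := pow_ne_zero N h4
  have e1 : along B lam n₁ (z, y) = along B lam n₂ (z, y) +
      y ^ N * (along B lam κ (z, y) - N * κ (z, y)) := by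
    rw [along_congr h1]
    exact along_add_pow_mul h2 h3 N
  have e2 := h1.self_of_nhds
  rw [eq_div_iff hy]
  simp only [pde, ← hv]
  simp only [P, ← hv]
  rw [e1, e2]
  field_simp
  ring

end

/-! ### The equation in the coordinates `(x, y)`. -/

/-- The derivative along `x B ∂x - y ∂y`. -/
noncomputable def alongXY (B e : ℂ × ℂ → ℂ) (q : ℂ × ℂ) : ℂ :=
  q.1 * B q * fderiv ℂ e q (1, 0) - q.2 * fderiv ℂ e q (0, 1)

/-- The value of the form `y dx + x B' dy` on the image of `x B ∂x - y ∂y` under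
`(x, y) ↦ (x + e, y - e)`. -/
noncomputable def defect (B B' e : ℂ × ℂ → ℂ) (q : ℂ × ℂ) : ℂ :=
  (q.2 - e q) * (q.1 * B q + alongXY B e q) -
    (q.1 + e q) * B' (q.1 + e q, q.2 - e q) * (q.2 + alongXY B e q)

section
variable {B B' : ℂ × ℂ → ℂ} {lam : ℂ}

/-- With `e = y n`, each factor of `defect` that involves `x`, `y` or `e` has a factor `y` in the
chart; the chain rule gives `y · along n = alongXY e + e`. -/
theorem defect_chart {e n : ℂ × ℂ → ℂ} {p : ℂ × ℂ} (he : AnalyticAt ℂ e (chart lam p))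
    (hn : AnalyticAt ℂ n p) (h : ∀ᶠ p' in 𝓝 p, p'.2 * n p' = e (chart lam p')) :
    p.2 ^ 2 * pde B B' lam n p = defect B B' e (chart lam p) := by
  have ha : AnalyticAt ℂ (fun p : ℂ × ℂ => p.2 * n p) p := analyticAt_snd.mul hn
  set q := chart lam p with hq
  set v := lam⁻¹ * Complex.exp p.1 with hv
  have hq1 : q.1 = v * p.2 := rfl
  have hq2 : q.2 = p.2 := rfl
  have hlin : ∀ A c : ℂ, fderiv ℂ e q (A, c) = A * fderiv ℂ e q (1, 0) + c * fderiv ℂ e q (0, 1) := by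
    intro A c
    rw [← smul_eq_mul, ← smul_eq_mul, ← map_smul, ← map_smul, ← map_add]
    simp
  have c1 : Tendsto (fun z => ((z, p.2) : ℂ × ℂ)) (𝓝 p.1) (𝓝 p) :=
    Continuous.tendsto' (by fun_prop) _ _ rfl
  have c2 : Tendsto (fun y => ((p.1, y) : ℂ × ℂ)) (𝓝 p.2) (𝓝 p) :=
    Continuous.tendsto' (by fun_prop) _ _ rfl
  have d1 : HasDerivAt (fun z => chart lam (z, p.2)) (v * p.2, 0) p.1 :=
    (((Complex.hasDerivAt_exp p.1).const_mul lam⁻¹).mul_const p.2).prodMk (hasDerivAt_const _ _)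
  have d2 : HasDerivAt (fun y => chart lam (p.1, y)) (v, 1) p.2 := by
    exact (((hasDerivAt_id p.2).const_mul v).prodMk (hasDerivAt_id p.2)).congr_deriv (by simp)
  have f1 := he.differentiableAt.hasFDerivAt.comp_hasDerivAt p.1 d1
  have f2 := HasFDerivAt.comp_hasDerivAt (f := fun y => chart lam (p.1, y)) p.2
    he.differentiableAt.hasFDerivAt d2
  have g1 := (((deriv_fst_eq hn).const_mul p.2)).unique (f1.congr_of_eventuallyEq (c1.eventually h))
  have g2 := (((hasDerivAt_id p.2).mul (deriv_snd_eq hn))).unique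
    (f2.congr_of_eventuallyEq (c2.eventually h))
  rw [hlin] at g1 g2
  simp only [id, one_mul, zero_mul, add_zero] at g1 g2
  have h0 := h.self_of_nhds
  rw [← hq] at h0
  have hD : p.2 * along B lam n p = alongXY B e q + e q := by
    rw [along, alongXY, ← hq, hq1, hq2, ← h0]
    linear_combination (1 + B q) * g1 - p.2 * g2
  have harg : ((p.2 * (v + n p), p.2 * (1 - n p)) : ℂ × ℂ) = (q.1 + e q, q.2 - e q) := by
    rw [hq1, hq2, ← h0]
    ext
    · simp only; ring
    · simp only; ring
  rw [pde, defect, ← hv, ← hq, harg, hq1, hq2]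
  have hD' : alongXY B e q = p.2 * along B lam n p - p.2 * n p := by rw [hD, h0]; ring
  rw [hD', ← h0]
  ring

theorem analyticAt_alongXY {e : ℂ × ℂ → ℂ} {q : ℂ × ℂ} (hB : AnalyticAt ℂ B q)
    (he : AnalyticAt ℂ e q) : AnalyticAt ℂ (alongXY B e) q :=
  ((analyticAt_fst.mul hB).mul (analyticAt_fderiv_apply he _)).sub
    (analyticAt_snd.mul (analyticAt_fderiv_apply he _))

theorem analyticAt_moved {e : ℂ × ℂ → ℂ} {q : ℂ × ℂ} (he : AnalyticAt ℂ e q) :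
    AnalyticAt ℂ (fun q : ℂ × ℂ => (q.1 + e q, q.2 - e q)) q :=
  (analyticAt_fst.add he).prod (analyticAt_snd.sub he)

theorem analyticAt_defect {e : ℂ × ℂ → ℂ} {q : ℂ × ℂ} (hB : AnalyticAt ℂ B q)
    (hB' : AnalyticAt ℂ B' (q.1 + e q, q.2 - e q))
    (he : AnalyticAt ℂ e q) : AnalyticAt ℂ (defect B B' e) q := by
  have h1 := analyticAt_alongXY hB he
  have h2 : AnalyticAt ℂ (fun q : ℂ × ℂ => B' (q.1 + e q, q.2 - e q)) q :=
    AnalyticAt.fun_comp_of_eq (g := B') hB' (analyticAt_moved he) rfl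
  exact ((analyticAt_snd.sub he).mul ((analyticAt_fst.mul hB).add h1)).sub
    (((analyticAt_fst.add he).mul h2).mul (analyticAt_snd.add h1))

theorem hasFDerivAt_moved {e : ℂ × ℂ → ℂ} {q : ℂ × ℂ} (he : AnalyticAt ℂ e q) :
    HasFDerivAt (fun q : ℂ × ℂ => (q.1 + e q, q.2 - e q))
      ((ContinuousLinearMap.fst ℂ ℂ ℂ + fderiv ℂ e q).prod
        (ContinuousLinearMap.snd ℂ ℂ ℂ - fderiv ℂ e q)) q :=
  (hasFDerivAt_fst.add he.differentiableAt.hasFDerivAt).prodMk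
    (hasFDerivAt_snd.sub he.differentiableAt.hasFDerivAt)

theorem stdForm_moved {e : ℂ × ℂ → ℂ} {q : ℂ × ℂ} (w : ℂ × ℂ) :
    stdForm B' (q.1 + e q, q.2 - e q) (((ContinuousLinearMap.fst ℂ ℂ ℂ + fderiv ℂ e q).prod
        (ContinuousLinearMap.snd ℂ ℂ ℂ - fderiv ℂ e q)) w) =
      (q.2 - e q) * (w.1 + fderiv ℂ e q w) +
        (q.1 + e q) * B' (q.1 + e q, q.2 - e q) * (w.2 - fderiv ℂ e q w) := by
  rw [stdForm_apply]
  simp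

theorem stdForm_moved_field {e : ℂ × ℂ → ℂ} {q : ℂ × ℂ} :
    stdForm B' (q.1 + e q, q.2 - e q) (((ContinuousLinearMap.fst ℂ ℂ ℂ + fderiv ℂ e q).prod
        (ContinuousLinearMap.snd ℂ ℂ ℂ - fderiv ℂ e q)) (q.1 * B q, -q.2)) = defect B B' e q := by
  have hlin : fderiv ℂ e q (q.1 * B q, -q.2) = alongXY B e q := by
    have : ((q.1 * B q, -q.2) : ℂ × ℂ) = (q.1 * B q) • ((1, 0) : ℂ × ℂ) + (-q.2) • ((0, 1) : ℂ × ℂ) := by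
      simp
    rw [this, map_add, map_smul, map_smul, alongXY, smul_eq_mul, smul_eq_mul]
    ring
  rw [stdForm_moved, hlin, defect]
  ring

/-- Zero defect says that the pulled-back form `A dx + C dy` annihilates `x B ∂x - y ∂y`, that is,
`x B A = y C`. On `y = 0` this forces `A = 0`, so `A = y u` and then `C = x B u`: the pulled-back
form is `u` times `y dx + x B dy`. As `e` has no linear part, `u 0 = 1`. -/
theorem isConjugacy_moved (hB : IsCoeff B lam) (hB' : IsCoeff B' lam) {e : ℂ × ℂ → ℂ}
    (he : AnalyticAt ℂ e 0) (he0 : e 0 = 0) (hde : fderiv ℂ e 0 = 0)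
    (hG : ∀ᶠ q in 𝓝 (0 : ℂ × ℂ), defect B B' e q = 0) :
    IsConjugacy (stdForm B) stdLevel (stdForm B') stdLevel (fun q => (q.1 + e q, q.2 - e q)) := by
  have hΘ0 : (((0 : ℂ × ℂ).1 + e 0, (0 : ℂ × ℂ).2 - e 0) : ℂ × ℂ) = 0 := by simp [he0]
  have hBm : AnalyticAt ℂ (fun q : ℂ × ℂ => B' (q.1 + e q, q.2 - e q)) 0 :=
    AnalyticAt.fun_comp_of_eq (g := B') hB'.analytic (analyticAt_moved he) hΘ0
  refine ⟨⟨analyticAt_moved he, hΘ0, ?_⟩, ?_, ⟨id, analyticAt_id, by simp, ?_⟩⟩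
  · rw [(hasFDerivAt_moved he).fderiv, hde]
    have : ((ContinuousLinearMap.fst ℂ ℂ ℂ + 0).prod (ContinuousLinearMap.snd ℂ ℂ ℂ - 0)) =
        ((ContinuousLinearEquiv.refl ℂ (ℂ × ℂ) : (ℂ × ℂ) ≃L[ℂ] (ℂ × ℂ)) : ℂ × ℂ →L[ℂ] ℂ × ℂ) := by
      ext <;> simp
    rw [this]
    exact ⟨_, rfl⟩
  · -- the coefficient of `dx` of the pulled back form, and its quotient by `y`
    let A : ℂ × ℂ → ℂ := fun q => (q.2 - e q) * (1 + fderiv ℂ e q (1, 0)) +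
      (q.1 + e q) * B' (q.1 + e q, q.2 - e q) * (0 - fderiv ℂ e q (1, 0))
    let C : ℂ × ℂ → ℂ := fun q => (q.2 - e q) * (0 + fderiv ℂ e q (0, 1)) +
      (q.1 + e q) * B' (q.1 + e q, q.2 - e q) * (1 - fderiv ℂ e q (0, 1))
    have hd := fun w : ℂ × ℂ => analyticAt_fderiv_apply he w
    have hA : AnalyticAt ℂ A 0 := ((analyticAt_snd.sub he).mul (analyticAt_const.add (hd _))).add
      (((analyticAt_fst.add he).mul hBm).mul (analyticAt_const.sub (hd _)))
    have hC : AnalyticAt ℂ C 0 := ((analyticAt_snd.sub he).mul (analyticAt_const.add (hd _))).add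
      (((analyticAt_fst.add he).mul hBm).mul (analyticAt_const.sub (hd _)))
    have hAC : ∀ᶠ q in 𝓝 (0 : ℂ × ℂ), q.1 * B q * A q = q.2 * C q := by
      filter_upwards [hG] with q hq
      rw [defect, alongXY] at hq
      simp only [A, C]
      linear_combination hq
    have hBne : ∀ᶠ q in 𝓝 (0 : ℂ × ℂ), B q ≠ 0 :=
      hB.analytic.continuousAt.eventually_ne (by rw [hB.map_zero]; exact hB.ne_zero)
    have hA0 : ∀ᶠ q in 𝓝 (0 : ℂ × ℂ), A (q.1, 0) = 0 := by
      have hr : AnalyticAt ℂ (fun q : ℂ × ℂ => A (q.1, 0)) 0 :=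
        AnalyticAt.fun_comp_of_eq hA (analyticAt_fst.prod analyticAt_const) rfl
      have hc : Tendsto (fun q : ℂ × ℂ => ((q.1, 0) : ℂ × ℂ)) (𝓝 0) (𝓝 0) :=
        Continuous.tendsto' (by fun_prop) _ _ rfl
      refine eventuallyEq_of_fst_mul hr analyticAt_const ?_
      filter_upwards [hc.eventually hAC, hc.eventually hBne] with q h1 h2
      simp only [zero_mul] at h1
      have : q.1 * A (q.1, 0) = 0 := by
        refine (mul_eq_zero.mp (?_ : B (q.1, 0) * _ = 0)).resolve_left h2
        linear_combination h1
      rw [this, mul_zero]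
    have hu : AnalyticAt ℂ (dsl A) 0 := analyticAt_dsl hA hA
    have hAu : ∀ᶠ q in 𝓝 (0 : ℂ × ℂ), A q = q.2 * dsl A q := by
      filter_upwards [hA0] with q hq
      rw [dsl_mul, hq, sub_zero]
    have hCu : ∀ᶠ q in 𝓝 (0 : ℂ × ℂ), C q = q.1 * B q * dsl A q := by
      refine eventuallyEq_of_snd_mul hC ((analyticAt_fst.mul hB.analytic).mul hu) ?_
      filter_upwards [hAu, hAC] with q h1 h2
      rw [← h2, h1]
      ring
    refine ⟨dsl A, hu, ?_, ?_⟩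
    · change dsl A (0, 0) ≠ 0
      rw [dsl_zero]
      have e1 : HasDerivAt (fun y => e (0, y)) 0 0 := by
        have := deriv_snd_eq he
        rw [hde] at this
        simpa using this
      have e2 : HasDerivAt (fun y => fderiv ℂ e (0, y) (1, 0)) _ 0 :=
        (AnalyticAt.prodMk_right (hd (1, 0))).differentiableAt.hasDerivAt
      have e3 : HasDerivAt (fun y => B' (0 + e (0, y), y - e (0, y))) _ 0 :=
        (AnalyticAt.prodMk_right hBm).differentiableAt.hasDerivAt
      have e4 := (((hasDerivAt_id (0 : ℂ)).sub e1).mul (e2.const_add 1)).add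
        ((((hasDerivAt_const (0 : ℂ) (0 : ℂ)).add e1).mul e3).mul (e2.const_sub 0))
      have e5 : HasDerivAt (fun y => A (0, y)) _ 0 := e4
      rw [e5.deriv]
      have z0 : e (0, 0) = 0 := he0
      have z1 : fderiv ℂ e (0, 0) = 0 := hde
      simp [z0, z1]
    · filter_upwards [hAu, hCu, he.eventually_analyticAt] with q h1 h2 h3
      rw [(hasFDerivAt_moved h3).fderiv]
      ext
      · simp only [ContinuousLinearMap.comp_apply, ContinuousLinearMap.inl_apply]
        rw [stdForm_moved, smul_apply, stdForm_apply]
        simp only [smul_eq_mul, mul_one, mul_zero, add_zero]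
        linear_combination h1
      · simp only [ContinuousLinearMap.comp_apply, ContinuousLinearMap.inr_apply]
        rw [stdForm_moved, smul_apply, stdForm_apply]
        simp only [smul_eq_mul, mul_one, mul_zero, zero_add]
        linear_combination h2
  · exact Eventually.of_forall fun q => by simp [stdLevel]

end

/-! ### Homogeneous parts of analytic functions and Fourier series. -/

theorem coeff_eq_of_tendsto (M : ℕ) : ∀ {f : ℂ → ℂ} {p : FormalMultilinearSeries ℂ ℂ ℂ} {ℓ : ℂ},
    HasFPowerSeriesAt f p 0 → Tendsto (fun y => f y / y ^ M) (𝓝[≠] 0) (𝓝 ℓ) → p.coeff M = ℓ := by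
  induction M with
  | zero =>
    intro f p ℓ hf h
    have h1 : Tendsto f (𝓝[≠] 0) (𝓝 (f 0)) := hf.continuousAt.tendsto.mono_left nhdsWithin_le_nhds
    have h2 := tendsto_nhds_unique h1 (by simpa using h)
    rw [← h2, ← hf.coeff_zero (v := 1)]
    rfl
  | succ M ih =>
    intro f p ℓ hf h
    have h1 : Tendsto f (𝓝[≠] 0) (𝓝 (f 0)) := hf.continuousAt.tendsto.mono_left nhdsWithin_le_nhds
    have h2 : Tendsto f (𝓝[≠] 0) (𝓝 0) := by
      have h3 : Tendsto (fun y : ℂ => y ^ (M + 1)) (𝓝[≠] 0) (𝓝 0) :=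
        (Continuous.tendsto' (by fun_prop) _ _ (by simp)).mono_left nhdsWithin_le_nhds
      have h4 := h.mul h3
      rw [mul_zero] at h4
      refine h4.congr' ?_
      filter_upwards [self_mem_nhdsWithin] with y hy
      have : y ^ (M + 1) ≠ 0 := pow_ne_zero _ hy
      field_simp
    have hf0 : f 0 = 0 := tendsto_nhds_unique h1 h2
    have h5 := ih hf.has_fpower_series_dslope_fslope (ℓ := ℓ) (h.congr' (by
      filter_upwards [self_mem_nhdsWithin] with y hy
      have hy' : y ≠ 0 := hy
      rw [dslope_of_ne _ hy', slope_def_field, hf0, sub_zero, sub_zero, pow_succ, div_div, mul_comm]))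
    rwa [FormalMultilinearSeries.coeff_fslope] at h5

/-- The homogeneous parts of an analytic function. -/
theorem exists_homogeneous_limit {G : ℂ × ℂ → ℂ} (hG : AnalyticAt ℂ G 0) (M : ℕ) :
    ∃ r : ℕ → ℂ, ∀ v ℓ : ℂ, Tendsto (fun y => G (v * y, y) / y ^ M) (𝓝[≠] 0) (𝓝 ℓ) →
      ℓ = ∑ k ∈ Finset.range (M + 1), r k * v ^ k := by
  classical
  obtain ⟨p, hp⟩ := hG
  -- The coefficient obtained by putting `(1, 0)` in the slots of `s` and `(0, 1)` in the others.
  -- Multilinear expansion at `v (1, 0) + (0, 1)` gives it the weight `v ^ s.card`.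
  let a : Finset (Fin M) → ℂ := fun s =>
    p M (s.piecewise (fun _ => ((1, 0) : ℂ × ℂ)) (fun _ => ((0, 1) : ℂ × ℂ)))
  refine ⟨fun k => ∑ s : Finset (Fin M) with s.card = k, a s, fun v ℓ h => ?_⟩
  let L : ℂ →L[ℂ] ℂ × ℂ := ContinuousLinearMap.toSpanSingleton ℂ ((v, 1) : ℂ × ℂ)
  have hL : ∀ y, L y = (v * y, y) := by
    intro y
    simp [L, ContinuousLinearMap.toSpanSingleton_apply, mul_comm]
  have hpL : HasFPowerSeriesAt (G ∘ L) (p.compContinuousLinearMap L) 0 :=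
    HasFPowerSeriesAt.compContinuousLinearMap (by simpa using hp)
  have h1 := coeff_eq_of_tendsto M hpL (ℓ := ℓ) (by simpa [hL] using h)
  rw [← h1, FormalMultilinearSeries.coeff, FormalMultilinearSeries.compContinuousLinearMap_apply]
  have h2 : (L ∘ (1 : Fin M → ℂ)) = (fun _ => v • ((1, 0) : ℂ × ℂ)) + fun _ => ((0, 1) : ℂ × ℂ) := by
    funext i
    simp [hL]
  rw [h2, ContinuousMultilinearMap.map_add_univ]
  have h3 : ∀ s : Finset (Fin M), p M (s.piecewise (fun _ => v • ((1, 0) : ℂ × ℂ))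
      (fun _ => ((0, 1) : ℂ × ℂ))) = a s * v ^ s.card := by
    intro s
    have := (p M).toMultilinearMap.map_piecewise_smul (fun _ => v)
      (s.piecewise (fun _ => ((1, 0) : ℂ × ℂ)) (fun _ => ((0, 1) : ℂ × ℂ))) s
    rw [Finset.prod_const, smul_eq_mul, mul_comm] at this
    refine Eq.trans (congrArg (p M) ?_) this
    funext i
    by_cases hi : i ∈ s <;> simp [hi]
  simp_rw [h3, Finset.sum_mul]
  rw [← Finset.sum_fiberwise_of_maps_to (s := Finset.univ) (t := Finset.range (M + 1))
    (g := fun s : Finset (Fin M) => s.card)]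
  · refine Finset.sum_congr rfl fun k _ => Finset.sum_congr rfl fun s hs => ?_
    rw [(Finset.mem_filter.mp hs).2]
  · intro s _
    rw [Finset.mem_range]
    have := Finset.card_le_univ s
    rw [Fintype.card_fin] at this
    omega

/-- The characters of the circle. -/
noncomputable def expI (k : ℤ) (θ : ℝ) : ℂ := Complex.exp (k * θ * Complex.I)

theorem norm_expI (k : ℤ) (θ : ℝ) : ‖expI k θ‖ = 1 := by
  rw [expI, Complex.norm_exp]
  simp

theorem expI_mul (j k : ℤ) (θ : ℝ) : expI j θ * expI k θ = expI (j + k) θ := by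
  rw [expI, expI, expI, ← Complex.exp_add]
  congr 1
  push_cast
  ring

theorem hasDerivAt_expI (k : ℤ) (θ : ℝ) : HasDerivAt (expI k) (k * Complex.I * expI k θ) θ := by
  have h1 : HasDerivAt (fun z : ℂ => Complex.exp (k * z * Complex.I))
      (Complex.exp (k * θ * Complex.I) * (k * Complex.I)) θ := by
    simpa using (((hasDerivAt_id (θ : ℂ)).const_mul (k : ℂ)).mul_const Complex.I).cexp
  exact h1.comp_ofReal.congr_deriv (mul_comm _ _)

theorem continuous_expI (k : ℤ) : Continuous (expI k) :=
  continuous_iff_continuousAt.mpr fun θ => (hasDerivAt_expI k θ).continuousAt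

theorem expI_zero_right (k : ℤ) : expI k 0 = 1 := by simp [expI]

theorem expI_two_pi (k : ℤ) : expI k (2 * Real.pi) = 1 := by
  rw [expI, Complex.exp_eq_one_iff]
  exact ⟨k, by push_cast; ring⟩

theorem integral_expI {k : ℤ} (hk : k ≠ 0) : ∫ θ in (0 : ℝ)..2 * Real.pi, expI k θ = 0 := by
  have hk' : (k : ℂ) * Complex.I ≠ 0 := mul_ne_zero (by exact_mod_cast hk) Complex.I_ne_zero
  have h1 : ∀ θ ∈ Set.uIcc 0 (2 * Real.pi), HasDerivAt (fun θ => expI k θ / (k * Complex.I))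
      (expI k θ) θ := fun θ _ => by
    refine ((hasDerivAt_expI k θ).div_const _).congr_deriv ?_
    field_simp
  rw [intervalIntegral.integral_eq_sub_of_hasDerivAt h1 ((continuous_expI k).intervalIntegrable _ _),
    expI_two_pi, expI_zero_right, sub_self]

/-- A periodic function with finitely many Fourier coefficients is a trigonometric polynomial. -/
theorem eq_sum_of_fourier_eq_zero {f : ℝ → ℂ} (hf : Continuous f)
    (hper : Function.Periodic f (2 * Real.pi)) {n : ℕ}
    (h : ∀ k : ℤ, (k < 0 ∨ (n : ℤ) ≤ k) → ∫ θ in (0 : ℝ)..2 * Real.pi, f θ * expI (-k) θ = 0) (θ : ℝ) :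
    f θ = ∑ k ∈ Finset.range n,
      (1 / (2 * Real.pi) : ℂ) * (∫ θ in (0 : ℝ)..2 * Real.pi, f θ * expI (-(k : ℤ)) θ) * expI k θ := by
  have : Fact (0 < 2 * Real.pi) := ⟨by positivity⟩
  let F : C(AddCircle (2 * Real.pi), ℂ) := ⟨hper.lift, continuous_coinduced_dom.mpr hf⟩
  have hF : ∀ x : ℝ, F (x : AddCircle (2 * Real.pi)) = f x := fun x => rfl
  have hfo : ∀ (k : ℤ) (x : ℝ), fourier k (x : AddCircle (2 * Real.pi)) = expI k x := by
    intro k x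
    rw [fourier_coe_apply, expI]
    congr 1
    have : (Real.pi : ℂ) ≠ 0 := by exact_mod_cast Real.pi_ne_zero
    push_cast
    field_simp
  have hc : ∀ k : ℤ, fourierCoeff F k = (1 / (2 * Real.pi) : ℂ) *
      ∫ θ in (0 : ℝ)..2 * Real.pi, f θ * expI (-k) θ := by
    intro k
    rw [fourierCoeff_eq_intervalIntegral F k 0, zero_add, Complex.real_smul]
    push_cast
    congr 1
    refine intervalIntegral.integral_congr fun x _ => ?_
    simp only [hfo, hF, smul_eq_mul]
    rw [mul_comm]
  let s : Finset ℤ := (Finset.range n).map ⟨fun k : ℕ => (k : ℤ), Nat.cast_injective⟩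
  have hs : ∀ k ∉ s, fourierCoeff F k = 0 := by
    intro k hk
    rw [hc, h k, mul_zero]
    by_contra hcon
    push Not at hcon
    apply hk
    rw [Finset.mem_map]
    exact ⟨k.toNat, by rw [Finset.mem_range]; omega, by simp [Int.toNat_of_nonneg hcon.1]⟩
  -- Finitely many nonzero coefficients are summable, so the Fourier series converges to the
  -- function at every point.
  have hsum : Summable (fourierCoeff F) := summable_of_ne_finset_zero hs
  have h1 := has_pointwise_sum_fourier_series_of_summable hsum (θ : AddCircle (2 * Real.pi))
  have h2 : HasSum (fun k => fourierCoeff F k • fourier k (θ : AddCircle (2 * Real.pi)))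
      (∑ k ∈ s, fourierCoeff F k • fourier k (θ : AddCircle (2 * Real.pi))) :=
    hasSum_sum_of_ne_finset_zero (fun k hk => by rw [hs k hk, zero_smul])
  have h3 := h1.unique h2
  rw [hF, Finset.sum_map] at h3
  rw [h3]
  refine Finset.sum_congr rfl fun k _ => ?_
  simp only [Function.Embedding.coeFn_mk]
  rw [hc, hfo, smul_eq_mul]

/-- The trigonometric solutions of the linearized equation on the loop. -/
theorem exists_trigonometric {f f' : ℝ → ℂ} (hf : ∀ θ, HasDerivAt f (f' θ) θ) (hf' : Continuous f')
    (hper : Function.Periodic f (2 * Real.pi)) {lam : ℂ} {N : ℕ}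
    (hlam : ∀ q : ℚ, q < 0 → lam ≠ q) (hN : 1 ≤ N) {r : ℕ → ℂ}
    (heq : ∀ θ : ℝ, (1 - expI 1 θ) * ((1 + lam) * (-Complex.I * f' θ) - N * f θ) - (1 + lam) * f θ =
      ∑ k ∈ Finset.range (N + 3), r k * expI k θ) :
    ∃ c : ℕ → ℂ, (∀ θ, f θ = ∑ k ∈ Finset.range (N + 2), c k * expI k θ) ∧
      ∀ k M, (∀ θ, ‖f θ‖ ≤ M) → ‖c k‖ ≤ M := by
  have hfc : Continuous f := continuous_iff_continuousAt.mpr fun θ => (hf θ).continuousAt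
  set A : ℤ → ℂ := fun k => ∫ θ in (0 : ℝ)..2 * Real.pi, f θ * expI (-k) θ with hA
  have hint : ∀ {u : ℝ → ℂ}, Continuous u → IntervalIntegrable u MeasureTheory.volume 0 (2 * Real.pi) :=
    fun hu => hu.intervalIntegrable _ _
  have hparts : ∀ k : ℤ, ∫ θ in (0 : ℝ)..2 * Real.pi, f' θ * expI (-k) θ = k * Complex.I * A k := by
    intro k
    have h1 := intervalIntegral.integral_deriv_mul_eq_sub (a := 0) (b := 2 * Real.pi)
      (u := f) (v := expI (-k)) (fun x _ => hf x) (fun x _ => hasDerivAt_expI (-k) x) (hint hf')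
      (hint (continuous_const.mul (continuous_expI _)))
    have h2 : f (2 * Real.pi) = f 0 := by simpa using hper 0
    rw [expI_two_pi, expI_zero_right, h2, sub_self, intervalIntegral.integral_add
      (f := fun θ => f' θ * expI (-k) θ)
      (g := fun θ => f θ * (((-k : ℤ) : ℂ) * Complex.I * expI (-k) θ)) (hint (hf'.mul (continuous_expI _)))
      (hint (hfc.mul (continuous_const.mul (continuous_expI _))))] at h1
    have h3 : ∫ θ in (0 : ℝ)..2 * Real.pi, f θ * (((-k : ℤ) : ℂ) * Complex.I * expI (-k) θ) =
        ((-k : ℤ) : ℂ) * Complex.I * A k := by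
      rw [hA, ← intervalIntegral.integral_const_mul]
      refine intervalIntegral.integral_congr fun x _ => ?_
      ring
    rw [h3] at h1
    push_cast at h1
    linear_combination h1
  -- Compare the Fourier coefficients of index `k`. The factor `1 - exp (iθ)` pairs `A k` with `A (k
  -- - 1)`, the term `-(1 + lam) f` makes the two multipliers equal, and the right side has only
  -- modes `0` to `N + 2`.
  have hrec : ∀ k : ℤ, (k < 0 ∨ (N : ℤ) + 2 < k) → ((1 + lam) * (k - 1) - N) * (A k - A (k - 1)) = 0 := by
    intro k hk
    have h1 : ∫ θ in (0 : ℝ)..2 * Real.pi, ((1 - expI 1 θ) * ((1 + lam) * (-Complex.I * f' θ) -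
        N * f θ) - (1 + lam) * f θ) * expI (-k) θ = 0 := by
      have e : ∀ θ : ℝ, ((1 - expI 1 θ) * ((1 + lam) * (-Complex.I * f' θ) - N * f θ) -
          (1 + lam) * f θ) * expI (-k) θ = ∑ j ∈ Finset.range (N + 3), r j * expI (j - k) θ := by
        intro θ
        rw [heq θ, Finset.sum_mul]
        refine Finset.sum_congr rfl fun j _ => ?_
        rw [mul_assoc, expI_mul, sub_eq_add_neg]
      simp_rw [e]
      rw [intervalIntegral.integral_finsetSum (f := fun j θ => r j * expI (j - k) θ)
        fun j _ => hint (continuous_const.mul (continuous_expI _))]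
      refine Finset.sum_eq_zero fun j hj => ?_
      rw [Finset.mem_range] at hj
      rw [intervalIntegral.integral_const_mul, integral_expI (by omega), mul_zero]
    have h2 : ∀ θ : ℝ, ((1 - expI 1 θ) * ((1 + lam) * (-Complex.I * f' θ) -
        N * f θ) - (1 + lam) * f θ) * expI (-k) θ =
        (1 + lam) * -Complex.I * (f' θ * expI (-k) θ) + (1 + lam) * Complex.I *
          (f' θ * expI (-(k - 1)) θ) + (-N - (1 + lam)) * (f θ * expI (-k) θ) +
          N * (f θ * expI (-(k - 1)) θ) := by
      intro θ
      have : expI (-(k - 1)) θ = expI 1 θ * expI (-k) θ := by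
        rw [expI_mul]
        congr 1
        ring
      rw [this]
      ring
    simp_rw [h2] at h1
    have i1 : ∀ j, IntervalIntegrable (fun θ => f' θ * expI j θ) MeasureTheory.volume 0 (2 * Real.pi) :=
      fun j => hint (hf'.mul (continuous_expI j))
    have i2 : ∀ j, IntervalIntegrable (fun θ => f θ * expI j θ) MeasureTheory.volume 0 (2 * Real.pi) :=
      fun j => hint (hfc.mul (continuous_expI j))
    rw [intervalIntegral.integral_add ((((i1 _).const_mul _).add ((i1 _).const_mul _)).add
      ((i2 _).const_mul _)) ((i2 _).const_mul _), intervalIntegral.integral_add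
      (((i1 _).const_mul _).add ((i1 _).const_mul _)) ((i2 _).const_mul _),
      intervalIntegral.integral_add ((i1 _).const_mul _) ((i1 _).const_mul _),
      intervalIntegral.integral_const_mul, intervalIntegral.integral_const_mul,
      intervalIntegral.integral_const_mul, intervalIntegral.integral_const_mul, hparts, hparts] at h1
    change _ + _ + _ * A k + _ * A (k - 1) = 0 at h1
    push_cast at h1
    have hI := Complex.I_mul_I
    linear_combination h1 + ((1 + lam) * (k * A k) - (1 + lam) * ((k - 1) * A (k - 1))) * hI
  -- If `(1 + lam) j = N` then `lam = N / j - 1`, a negative rational when `j < 0` or `j > N`. This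
  -- is where the hypothesis on `lam` enters the extension to the origin.
  have hD : ∀ j : ℤ, (j < 0 ∨ (N : ℤ) < j) → (1 + lam) * j - N ≠ 0 := by
    intro j hj h0
    have hN' : (0 : ℚ) < N := by exact_mod_cast hN
    have hjq : (N : ℚ) / j - 1 < 0 := by
      rcases hj with hj | hj
      · have : (j : ℚ) < 0 := by exact_mod_cast hj
        have := div_neg_of_pos_of_neg hN' this
        linarith
      · have h1 : (N : ℚ) < j := by exact_mod_cast hj
        have := (div_lt_one (hN'.trans h1)).mpr h1
        linarith
    apply hlam _ hjq
    have hj0 : (j : ℂ) ≠ 0 := by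
      have : j ≠ 0 := by omega
      exact_mod_cast this
    push_cast
    field_simp
    linear_combination h0
  have hbound : ∀ k : ℤ, |(k : ℝ)| * ‖A k‖ ≤ ∫ θ in (0 : ℝ)..2 * Real.pi, ‖f' θ‖ := by
    intro k
    have h1 := intervalIntegral.norm_integral_le_integral_norm (μ := MeasureTheory.volume)
      (f := fun θ => f' θ * expI (-k) θ) (by positivity : (0 : ℝ) ≤ 2 * Real.pi)
    rw [hparts] at h1
    simpa [norm_expI] using h1
  -- By the previous bound `A k` tends to `0`, so a coefficient constant along an unbounded sequence
  -- of indices is zero.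
  have hzero : ∀ (u : ℕ → ℤ), (∀ n, A (u n) = A (u 0)) → (∀ n : ℕ, (n : ℝ) ≤ |(u n : ℝ)|) →
      A (u 0) = 0 := by
    intro u h1 h2
    by_contra h3
    obtain ⟨n, hn⟩ := exists_nat_gt ((∫ θ in (0 : ℝ)..2 * Real.pi, ‖f' θ‖) / ‖A (u 0)‖)
    rw [div_lt_iff₀ (norm_pos_iff.mpr h3)] at hn
    have h4 := hbound (u n)
    rw [h1 n] at h4
    have h5 := mul_le_mul_of_nonneg_right (h2 n) (norm_nonneg (A (u 0)))
    linarith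
  have hneg : ∀ k : ℤ, k < 0 → A k = 0 := by
    have hstep : ∀ k : ℤ, k < 0 → A (k - 1) = A k := by
      intro k hk
      have := (mul_eq_zero.mp (hrec k (Or.inl hk))).resolve_left (by
        have := hD (k - 1) (Or.inl (by omega))
        push_cast at this
        exact this)
      exact (sub_eq_zero.mp this).symm
    intro k hk
    refine hzero (fun n => k - n) (fun n => ?_) (fun n => ?_) |> fun h => by simpa using h
    · induction n with
      | zero => rfl
      | succ n ih =>
        rw [← ih, ← hstep (k - n) (by omega)]
        push_cast
        congr 1
        ring
    · have : (k : ℝ) < 0 := by exact_mod_cast hk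
      push_cast
      rw [abs_of_nonpos (by linarith [(Nat.cast_nonneg n : (0 : ℝ) ≤ n)])]
      linarith
  have hpos : ∀ k : ℤ, (N : ℤ) + 2 ≤ k → A k = 0 := by
    have hstep : ∀ k : ℤ, (N : ℤ) + 2 ≤ k → A (k + 1) = A k := by
      intro k hk
      have := (mul_eq_zero.mp (hrec (k + 1) (Or.inr (by omega)))).resolve_left (by
        have := hD k (Or.inr (by omega))
        push_cast
        rwa [add_sub_cancel_right])
      rw [add_sub_cancel_right] at this
      exact sub_eq_zero.mp this
    intro k hk
    refine hzero (fun n => k + n) (fun n => ?_) (fun n => ?_) |> fun h => by simpa using h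
    · induction n with
      | zero => rfl
      | succ n ih =>
        rw [← ih, ← hstep (k + n) (by omega)]
        push_cast
        congr 1
        ring
    · have : (0 : ℝ) < k := by
        have : 0 < k := by omega
        exact_mod_cast this
      push_cast
      rw [abs_of_nonneg (by positivity)]
      linarith
  refine ⟨fun k => (1 / (2 * Real.pi) : ℂ) * A k, fun θ => ?_, fun k M hM => ?_⟩
  · refine eq_sum_of_fourier_eq_zero hfc hper (n := N + 2) (fun k hk => ?_) θ
    rcases hk with hk | hk
    · exact hneg k hk
    · exact hpos k (by push_cast at hk; omega)
  · have h1 : ‖A k‖ ≤ M * |2 * Real.pi - 0| :=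
      intervalIntegral.norm_integral_le_of_norm_le_const fun θ _ => by
        rw [norm_mul, norm_expI, mul_one]
        exact hM θ
    have hpi := Real.two_pi_pos
    rw [sub_zero, abs_of_pos hpi] at h1
    have h2 : ‖(1 / (2 * Real.pi) : ℂ)‖ = 1 / (2 * Real.pi) := by
      simp [abs_of_pos Real.pi_pos]
    rw [norm_mul, h2, one_div, inv_mul_le_iff₀ hpi]
    linarith

/-! ### Taylor coefficients of the conjugacy and extension to the origin. -/

theorem iterate_dsl_succ (n : ℂ × ℂ → ℂ) (j : ℕ) : dsl^[j + 1] n = dsl (dsl^[j] n) :=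
  Function.iterate_succ_apply' _ _ _

theorem analyticAt_iterate_dsl {n : ℂ × ℂ → ℂ} {z : ℂ} (hn : AnalyticAt ℂ n (z, 0)) (j : ℕ) :
    AnalyticAt ℂ (dsl^[j] n) (z, 0) := by
  induction j with
  | zero => exact hn
  | succ j ih =>
    rw [iterate_dsl_succ]
    exact analyticAt_dsl ih ih

theorem taylor_dsl (n : ℂ × ℂ → ℂ) (N : ℕ) (p : ℂ × ℂ) :
    n p = ∑ i ∈ Finset.range N, p.2 ^ i * dsl^[i] n (p.1, 0) + p.2 ^ N * dsl^[N] n p := by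
  induction N with
  | zero => simp
  | succ N ih =>
    rw [Finset.sum_range_succ, iterate_dsl_succ]
    have := dsl_mul (dsl^[N] n) p
    rw [ih]
    linear_combination (-p.2 ^ N) * this

theorem iterate_dsl_add {n : ℂ × ℂ → ℂ} {z w : ℂ} (h : ∀ y, n (z, y) = n (w, y)) (j : ℕ) (y : ℂ) :
    dsl^[j] n (z, y) = dsl^[j] n (w, y) := by
  induction j generalizing y with
  | zero => exact h y
  | succ j ih =>
    rw [iterate_dsl_succ, dsl, dsl]
    simp only [ih]

/-- Points of the imaginary axis accumulate at each of its points, so the identity theorem applies.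
-/
theorem eventuallyEq_of_imaginary {f g : ℂ → ℂ} {θ : ℝ} (hf : AnalyticAt ℂ f (θ * Complex.I))
    (hg : AnalyticAt ℂ g (θ * Complex.I))
    (h : ∀ t : ℝ, f (t * Complex.I) = g (t * Complex.I)) : f =ᶠ[𝓝 (θ * Complex.I)] g := by
  refine (hf.frequently_eq_iff_eventually_eq hg).mp ?_
  have hc : Tendsto (fun t : ℝ => (t : ℂ) * Complex.I) (𝓝[≠] θ) (𝓝[≠] (θ * Complex.I)) := by
    refine tendsto_nhdsWithin_iff.mpr ⟨(Continuous.tendsto (by fun_prop) θ).mono_left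
      nhdsWithin_le_nhds, ?_⟩
    filter_upwards [self_mem_nhdsWithin] with t ht hcon
    apply ht
    have := mul_right_cancel₀ Complex.I_ne_zero (Set.mem_singleton_iff.mp hcon)
    exact_mod_cast this
  exact hc.frequently (Eventually.of_forall h).frequently

section
variable {B B' : ℂ × ℂ → ℂ} {lam : ℂ}

/-- The homogeneous polynomial of degree `j + 1` with value `y ^ (j + 1) * ∑ c k * exp (k ζ)` in the
chart. -/
noncomputable def homPart (lam : ℂ) (c : ℕ → ℂ) (j : ℕ) (q : ℂ × ℂ) : ℂ :=
  ∑ k ∈ Finset.range (j + 2), c k * (lam * q.1) ^ k * q.2 ^ (j + 1 - k)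

theorem homPart_chart (hl : lam ≠ 0) (c : ℕ → ℂ) (j : ℕ) (p : ℂ × ℂ) : homPart lam c j (chart lam p) =
    p.2 ^ (j + 1) * ∑ k ∈ Finset.range (j + 2), c k * Complex.exp (k * p.1) := by
  rw [homPart, Finset.mul_sum]
  refine Finset.sum_congr rfl fun k hk => ?_
  have hk' : k ≤ j + 1 := by
    have := Finset.mem_range.mp hk
    omega
  have : lam * (chart lam p).1 = Complex.exp p.1 * p.2 := by
    simp only [chart]
    field_simp
  rw [this, mul_pow, ← Complex.exp_nat_mul, show (chart lam p).2 = p.2 from rfl]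
  have h2 : p.2 ^ (j + 1) = p.2 ^ k * p.2 ^ (j + 1 - k) := by
    rw [← pow_add, Nat.add_sub_cancel' hk']
  rw [h2]
  ring

theorem analyticAt_homPart (c : ℕ → ℂ) (j : ℕ) (q : ℂ × ℂ) : AnalyticAt ℂ (homPart lam c j) q := by
  refine Finset.analyticAt_fun_sum _ fun k _ => ?_
  exact (analyticAt_const.mul ((analyticAt_const.mul analyticAt_fst).pow k)).mul
    (analyticAt_snd.pow _)

theorem homPart_zero (c : ℕ → ℂ) (j : ℕ) : homPart lam c j 0 = 0 := by
  refine Finset.sum_eq_zero fun k hk => ?_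
  rcases k with _ | k
  · simp
  · simp

/-- The Taylor coefficients in `y` of the conjugacy in the chart are trigonometric polynomials on the
loop, of the degrees that make it a power series in `(x, y)`. -/
theorem exists_coeff (hB : IsCoeff B lam) (hB' : IsCoeff B' lam) (hlam : ∀ q : ℚ, q < 0 → lam ≠ q)
    {m : ℂ × ℂ → ℂ} (hm : ∀ z : ℂ, z.re = 0 → AnalyticAt ℂ (pull lam m) (z, 0) ∧
      (∀ᶠ z' in 𝓝 z, pull lam m (z', 0) = 0) ∧
      ∀ᶠ p in 𝓝 ((z, 0) : ℂ × ℂ), pde B B' lam (pull lam m) p = 0) (j : ℕ) :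
    ∃ c : ℕ → ℂ, (∀ θ : ℝ, dsl^[j] (pull lam m) (θ * Complex.I, 0) =
      ∑ k ∈ Finset.range (j + 2), c k * expI k θ) ∧
      ∀ k M, (∀ θ : ℝ, ‖dsl^[j] (pull lam m) (θ * Complex.I, 0)‖ ≤ M) → ‖c k‖ ≤ M := by
  have hl := hB.ne_zero
  set n := pull lam m with hn
  have hre : ∀ θ : ℝ, ((θ : ℂ) * Complex.I).re = 0 := fun θ => by simp
  have hκa : ∀ (θ : ℝ) (i : ℕ), AnalyticAt ℂ (dsl^[i] n) (θ * Complex.I, 0) := fun θ i =>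
    analyticAt_iterate_dsl (hm _ (hre θ)).1 i
  induction j using Nat.strong_induction_on with
  | _ N ih =>
  rcases Nat.eq_zero_or_pos N with rfl | hN
  · refine ⟨0, fun θ => ?_, fun k M hM => ?_⟩
    · simpa using (hm _ (hre θ)).2.1.self_of_nhds
    · simpa using (norm_nonneg _).trans (hM 0)
  choose! c hc using ih
  -- The part of order less than `N`, in the chart and as a polynomial `eN` in `(x, y)`. By
  -- induction its coefficients are already trigonometric.
  let nN : ℂ × ℂ → ℂ := fun p => ∑ i ∈ Finset.range N,
    p.2 ^ i * ∑ k ∈ Finset.range (i + 2), c i k * Complex.exp (k * p.1)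
  let eN : ℂ × ℂ → ℂ := fun q => ∑ i ∈ Finset.range N, homPart lam (c i) i q
  have hsa : ∀ i (z : ℂ), AnalyticAt ℂ (fun z => ∑ k ∈ Finset.range (i + 2), c i k * Complex.exp (k * z))
      z := fun i z => Finset.analyticAt_fun_sum _ fun k _ =>
    analyticAt_const.mul (analyticAt_const.mul analyticAt_id).cexp
  have hnN : ∀ p, AnalyticAt ℂ nN p := fun p => Finset.analyticAt_fun_sum _ fun i _ =>
    (analyticAt_snd.pow i).mul (AnalyticAt.fun_comp_of_eq
      (g := fun z => ∑ k ∈ Finset.range (i + 2), c i k * Complex.exp (k * z))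
      (f := fun p : ℂ × ℂ => p.1) (x := p) (hsa i p.1) analyticAt_fst rfl)
  have heN : ∀ q, AnalyticAt ℂ eN q := fun q => Finset.analyticAt_fun_sum _ fun i _ =>
    analyticAt_homPart _ _ _
  have hen : ∀ p, p.2 * nN p = eN (chart lam p) := by
    intro p
    simp only [nN, eN]
    rw [Finset.mul_sum]
    refine Finset.sum_congr rfl fun i _ => ?_
    rw [homPart_chart hl]
    ring
  have he0 : eN 0 = 0 := Finset.sum_eq_zero fun i _ => homPart_zero _ _
  have hκc : ∀ i < N, ∀ θ : ℝ, (fun z => dsl^[i] n (z, 0)) =ᶠ[𝓝 (θ * Complex.I)]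
      fun z => ∑ k ∈ Finset.range (i + 2), c i k * Complex.exp (k * z) := by
    intro i hi θ
    refine eventuallyEq_of_imaginary (AnalyticAt.prodMk_left (hκa θ i)) (hsa i _) fun t => ?_
    rw [(hc i hi).1 t]
    refine Finset.sum_congr rfl fun k _ => ?_
    rw [expI, ← mul_assoc]
    rfl
  have hsplit : ∀ θ : ℝ, ∀ᶠ p in 𝓝 ((θ * Complex.I, 0) : ℂ × ℂ),
      n p = nN p + p.2 ^ N * dsl^[N] n p := by
    intro θ
    have h1 : ∀ᶠ z in 𝓝 (θ * Complex.I : ℂ), ∀ i ∈ Finset.range N, dsl^[i] n (z, 0) =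
        ∑ k ∈ Finset.range (i + 2), c i k * Complex.exp (k * z) :=
      (Finset.range N).eventually_all.mpr fun i hi => hκc i (Finset.mem_range.mp hi) θ
    have h2 : Tendsto (fun p : ℂ × ℂ => p.1) (𝓝 (θ * Complex.I, 0)) (𝓝 (θ * Complex.I)) :=
      continuous_fst.tendsto _
    filter_upwards [h2.eventually h1] with p hp
    rw [taylor_dsl n N p]
    congr 1
    exact Finset.sum_congr rfl fun i hi => by rw [hp i hi]
  have hnN0 : ∀ θ : ℝ, ∀ᶠ z in 𝓝 (θ * Complex.I : ℂ), nN (z, 0) = 0 := by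
    intro θ
    have hc : Tendsto (fun z : ℂ => ((z, 0) : ℂ × ℂ)) (𝓝 (θ * Complex.I)) (𝓝 (θ * Complex.I, 0)) :=
      Continuous.tendsto' (by fun_prop) _ _ rfl
    filter_upwards [hc.eventually (hsplit θ), (hm _ (hre θ)).2.1] with z h1 h2
    rw [h2] at h1
    simpa [hN.ne'] using h1.symm
  have hG : AnalyticAt ℂ (defect B B' eN) 0 := by
    refine analyticAt_defect hB.analytic ?_ (heN 0)
    simp only [he0, Prod.fst_zero, Prod.snd_zero, add_zero, sub_zero]
    exact hB'.analytic
  -- The equation is solved by `n`, so the linearized operator applied to the next coefficient is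
  -- minus the term of order `N` of `pde nN`. Since `defect` is `y ^ 2 * pde`, this is minus the
  -- homogeneous part of degree `N + 2` of an analytic germ: a polynomial of degree at most `N + 2`
  -- in `x / y`, with no negative modes.
  obtain ⟨r, hr⟩ := exists_homogeneous_limit hG (N + 2)
  have hlin : ∀ θ : ℝ, linPde lam N (dsl^[N] n) (θ * Complex.I) =
      ∑ k ∈ Finset.range (N + 3), -(r k * lam⁻¹ ^ k) * expI k θ := by
    intro θ
    obtain ⟨a1, a2, a3⟩ := hm _ (hre θ)
    have h1 := tendsto_pde_sub hB hB' N a1 (hnN _) (hκa θ N) a2 (hnN0 θ) (hsplit θ)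
    have h2 := hr (lam⁻¹ * Complex.exp (θ * Complex.I)) (-linPde lam N (dsl^[N] n) (θ * Complex.I)) (by
      refine h1.neg.congr' ?_
      filter_upwards [(tendsto_line _).eventually a3, self_mem_nhdsWithin] with y h3 h4
      have hy : y ≠ 0 := h4
      have h5 := defect_chart (B := B) (B' := B') (lam := lam) (p := (θ * Complex.I, y)) (heN _) (hnN _)
        (Eventually.of_forall hen)
      simp only [chart] at h5
      rw [h3, ← h5, pow_add]
      field_simp
      ring)
    rw [neg_eq_iff_eq_neg] at h2
    rw [h2, ← Finset.sum_neg_distrib]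
    refine Finset.sum_congr rfl fun k _ => ?_
    rw [mul_pow, ← Complex.exp_nat_mul, expI, ← mul_assoc ((k : ℕ) : ℂ)]
    push_cast
    ring
  refine exists_trigonometric (f := fun θ : ℝ => dsl^[N] n (θ * Complex.I, 0))
    (f' := fun θ : ℝ => Complex.I * fderiv ℂ (dsl^[N] n) (θ * Complex.I, 0) (1, 0)) (fun θ => ?_) ?_ ?_
    hlam hN (r := fun k => -(r k * lam⁻¹ ^ k)) fun θ => ?_
  · have h1 := deriv_fst_eq (hκa θ N)
    have h2 : HasDerivAt (fun t : ℂ => t * Complex.I) Complex.I (θ : ℂ) := by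
      simpa using (hasDerivAt_id (θ : ℂ)).mul_const Complex.I
    exact ((HasDerivAt.comp_of_eq (θ : ℂ) h1 h2 rfl).comp_ofReal).congr_deriv (mul_comm _ _)
  · refine continuous_iff_continuousAt.mpr fun θ => ?_
    have h1 := (analyticAt_fderiv_apply (hκa θ N) (1, 0)).continuousAt
    have h2 : ContinuousAt (fun θ : ℝ => ((θ * Complex.I, 0) : ℂ × ℂ)) θ := by fun_prop
    exact continuousAt_const.mul (ContinuousAt.comp (f := fun θ : ℝ => ((θ * Complex.I, 0) : ℂ × ℂ))
      (g := fun q => fderiv ℂ (dsl^[N] n) q (1, 0)) h1 h2)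
  · intro θ
    refine iterate_dsl_add (fun y => ?_) N 0
    rw [hn, pull, pull]
    simp only
    congr 3
    push_cast
    rw [add_mul, Complex.exp_add, Complex.exp_two_pi_mul_I, mul_one]
  · rw [← hlin θ, linPde]
    simp only [expI]
    push_cast
    rw [one_mul]
    have hI := Complex.I_mul_I
    linear_combination (-(1 - Complex.exp (θ * Complex.I)) * (1 + lam) *
      fderiv ℂ (dsl^[N] n) (θ * Complex.I, 0) (1, 0)) * hI

end

theorem norm_dslope_le {f : ℂ → ℂ} {δ M : ℝ} (hδ : 0 < δ) (hM : 0 < M)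
    (hd : DifferentiableOn ℂ f (Metric.ball 0 δ)) (hb : ∀ y ∈ Metric.ball (0 : ℂ) δ, ‖f y‖ ≤ M) :
    ∀ y ∈ Metric.ball (0 : ℂ) δ, ‖dslope f 0 y‖ ≤ M * (3 / δ) := by
  intro y hy
  rw [mul_div_assoc', mul_comm]
  refine Complex.norm_dslope_le_div_of_mapsTo_ball hd (fun w hw => ?_) hy
  rw [Metric.mem_closedBall, dist_eq_norm]
  calc ‖f w - f 0‖ ≤ ‖f w‖ + ‖f 0‖ := norm_sub_le _ _
    _ ≤ M + M := add_le_add (hb w hw) (hb 0 (Metric.mem_ball_self hδ))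
    _ ≤ 3 * M := by linarith

/-- Schwarz's lemma at each step, on the same disc. The geometric growth suffices for the
convergence of the resummed series. -/
theorem norm_iterate_dsl_le {n : ℂ × ℂ → ℂ} {z : ℂ} {δ : ℝ} (hδ : 0 < δ)
    (hd : DifferentiableOn ℂ (fun y => n (z, y)) (Metric.ball 0 δ))
    (hb : ∀ y ∈ Metric.ball (0 : ℂ) δ, ‖n (z, y)‖ ≤ 1) (j : ℕ) :
    DifferentiableOn ℂ (fun y => dsl^[j] n (z, y)) (Metric.ball 0 δ) ∧
      ∀ y ∈ Metric.ball (0 : ℂ) δ, ‖dsl^[j] n (z, y)‖ ≤ (3 / δ) ^ j := by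
  induction j with
  | zero => exact ⟨hd, by simpa using hb⟩
  | succ j ih =>
    rw [iterate_dsl_succ]
    refine ⟨(Complex.differentiableOn_dslope (Metric.ball_mem_nhds _ hδ)).mpr ih.1, ?_⟩
    rw [pow_succ]
    exact norm_dslope_le hδ (by positivity) ih.1 ih.2

/-- The coefficients `c j k` are bounded by the supremum of the Taylor coefficients on the circle,
hence grow at most geometrically, and the sum of the homogeneous polynomials converges near the
origin. It represents `y n` on the imaginary axis, hence near `ζ = 0`. -/
theorem exists_resummation {lam : ℂ} (hl : lam ≠ 0) {n : ℂ × ℂ → ℂ} {c : ℕ → ℕ → ℂ}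
    (hn : ∀ θ : ℝ, AnalyticAt ℂ n (θ * Complex.I, 0)) (hn0 : ∀ θ : ℝ, n (θ * Complex.I, 0) = 0)
    (hper : ∀ (θ : ℝ) (y : ℂ), n ((θ + 2 * Real.pi : ℝ) * Complex.I, y) = n (θ * Complex.I, y))
    (hc : ∀ j, (∀ θ : ℝ, dsl^[j] n (θ * Complex.I, 0) =
      ∑ k ∈ Finset.range (j + 2), c j k * expI k θ) ∧
      ∀ k M, (∀ θ : ℝ, ‖dsl^[j] n (θ * Complex.I, 0)‖ ≤ M) → ‖c j k‖ ≤ M) :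
    ∃ e : ℂ × ℂ → ℂ, AnalyticAt ℂ e 0 ∧ e 0 = 0 ∧
      ∀ᶠ p in 𝓝 (0 : ℂ × ℂ), p.2 * n p = e (chart lam p) := by
  have hcompact : IsCompact ((fun θ : ℝ => (θ : ℂ) * Complex.I) '' Set.Icc 0 (2 * Real.pi)) :=
    isCompact_Icc.image (by fun_prop)
  obtain ⟨V, -, hKV, δ', hδ', hV⟩ := exists_tube hcompact
    (P := fun p => AnalyticAt ℂ n p ∧ ‖n p‖ ≤ 1) (by
      rintro z ⟨θ, -, rfl⟩
      refine (hn θ).eventually_analyticAt.and ?_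
      have h1 := (hn θ).continuousAt.norm
      refine (h1.eventually_lt continuousAt_const ?_).mono fun _ h => h.le
      simp [hn0 θ])
  set δ := min δ' 1 with hδ
  have hδ0 : 0 < δ := lt_min hδ' one_pos
  have hδ1 : δ ≤ 1 := min_le_right _ _
  have hslice : ∀ θ : ℝ, DifferentiableOn ℂ (fun y => n (θ * Complex.I, y)) (Metric.ball 0 δ) ∧
      ∀ y ∈ Metric.ball (0 : ℂ) δ, ‖n (θ * Complex.I, y)‖ ≤ 1 := by
    intro θ
    have hP : Function.Periodic (fun θ : ℝ => fun y => n (θ * Complex.I, y)) (2 * Real.pi) := by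
      intro θ
      funext y
      exact hper θ y
    obtain ⟨t, ht, hte⟩ := hP.exists_mem_Ico₀ (by positivity) θ
    have e : ∀ y, n (θ * Complex.I, y) = n (t * Complex.I, y) := fun y => congrFun hte y
    have hm : ∀ y ∈ Metric.ball (0 : ℂ) δ, AnalyticAt ℂ n (t * Complex.I, y) ∧
        ‖n (t * Complex.I, y)‖ ≤ 1 := fun y hy =>
      hV _ (hKV ⟨t, ⟨ht.1, ht.2.le⟩, rfl⟩) y ((mem_ball_zero_iff.mp hy).trans_le (min_le_left _ _))
    simp only [e]
    exact ⟨fun y hy => (AnalyticAt.prodMk_right (hm y hy).1).differentiableAt.differentiableWithinAt,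
      fun y hy => (hm y hy).2⟩
  have hR : ∀ (θ : ℝ) (j : ℕ), ∀ y ∈ Metric.ball (0 : ℂ) δ,
      ‖dsl^[j] n (θ * Complex.I, y)‖ ≤ (3 / δ) ^ j := fun θ j =>
    (norm_iterate_dsl_le hδ0 (hslice θ).1 (hslice θ).2 j).2
  have hcR : ∀ j k, ‖c j k‖ ≤ (3 / δ) ^ j := fun j k =>
    (hc j).2 k _ fun θ => hR θ j 0 (Metric.mem_ball_self hδ0)
  -- This makes the ratio `3 / δ * s` equal to `1 / 2`. The degree `j + 1` part has `j + 2`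
  -- monomials, whence the majorant `u`.
  set s := δ / 6 with hs
  have hs0 : 0 < s := by positivity
  have hs1 : s ≤ 1 := by linarith
  have hsR : 3 / δ * s = 1 / 2 := by rw [hs]; field_simp; norm_num
  let u : ℕ → ℝ := fun j => (j + 2) * (1 / 2) ^ j
  have hu : Summable u := by
    have h1 := summable_pow_mul_geometric_of_norm_lt_one 1 (r := (1 / 2 : ℝ)) (by norm_num)
    have h2 := (summable_geometric_of_lt_one (r := (1 / 2 : ℝ)) (by norm_num) (by norm_num)).mul_left 2
    refine (h1.add h2).congr fun j => ?_
    simp only [u]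
    ring
  let A : Set ℂ := {x | ‖lam * x‖ < s}
  have hA : IsOpen A := isOpen_lt (by fun_prop) continuous_const
  have hbd : ∀ j, ∀ q ∈ A ×ˢ Metric.ball (0 : ℂ) s, ‖homPart lam (c j) j q‖ ≤ u j := by
    rintro j ⟨x, y⟩ ⟨hx, hy⟩
    have hx' : ‖lam * x‖ ≤ s := le_of_lt hx
    have hy' : ‖y‖ ≤ s := (mem_ball_zero_iff.mp hy).le
    calc ‖homPart lam (c j) j (x, y)‖ ≤ ∑ k ∈ Finset.range (j + 2), (1 / 2 : ℝ) ^ j := by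
          refine norm_sum_le_of_le _ fun k hk => ?_
          have hk' : k ≤ j + 1 := by
            have := Finset.mem_range.mp hk
            omega
          simp only [norm_mul, norm_pow]
          rw [norm_mul] at hx'
          calc ‖c j k‖ * (‖lam‖ * ‖x‖) ^ k * ‖y‖ ^ (j + 1 - k)
              ≤ (3 / δ) ^ j * s ^ k * s ^ (j + 1 - k) := by
                have := hcR j k
                gcongr
            _ = (3 / δ * s) ^ j * s := by
                rw [mul_assoc, ← pow_add, Nat.add_sub_cancel' hk', mul_pow]
                ring
            _ ≤ (1 / 2) ^ j := by
                rw [hsR]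
                exact mul_le_of_le_one_right (by positivity) hs1
      _ = u j := by simp [u]
  let e : ℂ × ℂ → ℂ := fun q => ∑' j, homPart lam (c j) j q
  have he : AnalyticOnNhd ℂ e (A ×ˢ Metric.ball (0 : ℂ) s) := by
    refine exists_analytic_limit (u := fun N q => ∑ j ∈ Finset.range N, homPart lam (c j) j q)
      hA Metric.isOpen_ball (fun N q _ => Finset.analyticAt_fun_sum _ fun i _ => analyticAt_homPart _ _ _)
      (M := ∑' j, u j) (fun q hq => tsum_of_norm_bounded hu.hasSum fun j => hbd j q hq)
      (tendstoUniformlyOn_tsum_nat hu fun j q hq => hbd j q hq)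
  have h0mem : (0 : ℂ × ℂ) ∈ A ×ˢ Metric.ball (0 : ℂ) s := ⟨by simpa [A] using hs0, Metric.mem_ball_self hs0⟩
  -- The partial sums are the Taylor polynomials of `y n`, and the remainder tends to `0` by the
  -- bound on `dsl^[N] n`.
  have hax : ∀ (θ : ℝ), ∀ y ∈ Metric.ball (0 : ℂ) s,
      y * n (θ * Complex.I, y) = e (chart lam (θ * Complex.I, y)) := by
    intro θ y hy
    have hy' : ‖y‖ < s := mem_ball_zero_iff.mp hy
    have hyδ : y ∈ Metric.ball (0 : ℂ) δ := mem_ball_zero_iff.mpr (hy'.trans (by rw [hs]; linarith))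
    have hq : chart lam (θ * Complex.I, y) ∈ A ×ˢ Metric.ball (0 : ℂ) s := by
      refine ⟨?_, hy⟩
      have : lam * (chart lam (θ * Complex.I, y)).1 = Complex.exp (θ * Complex.I) * y := by
        simp only [chart]; field_simp
      change ‖_‖ < s
      rw [this, norm_mul, Complex.norm_exp_ofReal_mul_I, one_mul]
      exact hy'
    have hsum : Tendsto (fun N => ∑ j ∈ Finset.range N, homPart lam (c j) j (chart lam (θ * Complex.I, y)))
        atTop (𝓝 (e (chart lam (θ * Complex.I, y)))) :=
      (Summable.of_norm_bounded hu fun j => hbd j _ hq).hasSum.tendsto_sum_nat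
    refine tendsto_nhds_unique ?_ hsum
    have hterm : ∀ N, ∑ j ∈ Finset.range N, homPart lam (c j) j (chart lam (θ * Complex.I, y)) =
        y * n (θ * Complex.I, y) - y ^ (N + 1) * dsl^[N] n (θ * Complex.I, y) := by
      intro N
      rw [taylor_dsl n N (θ * Complex.I, y), mul_add, Finset.mul_sum, pow_succ', mul_assoc,
        add_sub_cancel_right]
      refine Finset.sum_congr rfl fun j _ => ?_
      rw [homPart_chart hl, (hc j).1 θ, pow_succ', mul_assoc]
      congr 2
      refine Finset.sum_congr rfl fun k _ => ?_
      rw [expI, ← mul_assoc]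
      rfl
    simp only [hterm]
    have hrem : Tendsto (fun N => y ^ (N + 1) * dsl^[N] n (θ * Complex.I, y)) atTop (𝓝 0) := by
      refine squeeze_zero_norm (a := fun N : ℕ => (1 / 2 : ℝ) ^ N) (fun N => ?_)
        (tendsto_pow_atTop_nhds_zero_of_lt_one (by norm_num) (by norm_num))
      rw [norm_mul, norm_pow]
      calc ‖y‖ ^ (N + 1) * ‖dsl^[N] n (θ * Complex.I, y)‖ ≤ s ^ (N + 1) * (3 / δ) ^ N := by
            have := hR θ N y hyδ
            gcongr
        _ = (3 / δ * s) ^ N * s := by rw [mul_pow]; ring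
        _ ≤ (1 / 2) ^ N := by
            rw [hsR]
            exact mul_le_of_le_one_right (by positivity) hs1
    simpa using tendsto_const_nhds.sub hrem
  refine ⟨e, he 0 h0mem, ?_, ?_⟩
  · simp [e, homPart_zero]
  · have hch : AnalyticAt ℂ (fun p => e (chart lam p)) 0 :=
      AnalyticAt.fun_comp_of_eq (g := e) (he 0 h0mem) (analyticAt_chart lam 0) (chart_zero lam 0)
    have hn00 : AnalyticAt ℂ n 0 := by simpa [Prod.mk_zero_zero] using hn 0
    have hln : AnalyticAt ℂ (fun p : ℂ × ℂ => p.2 * n p) 0 := analyticAt_snd.mul hn00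
    obtain ⟨r, hr, hrr⟩ := Metric.eventually_nhds_iff_ball.mp
      (hch.eventually_analyticAt.and hln.eventually_analyticAt)
    have hmem : Metric.ball (0 : ℂ) r ×ˢ Metric.ball (0 : ℂ) (min r s) ∈ 𝓝 (0 : ℂ × ℂ) :=
      prod_mem_nhds (Metric.ball_mem_nhds _ hr) (Metric.ball_mem_nhds _ (lt_min hr hs0))
    filter_upwards [hmem] with p hp
    have hball : ∀ z ∈ Metric.ball (0 : ℂ) r, ((z, p.2) : ℂ × ℂ) ∈ Metric.ball (0 : ℂ × ℂ) r := by
      intro z hz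
      have : Metric.ball (0 : ℂ × ℂ) r = Metric.ball 0 r ×ˢ Metric.ball 0 r := (ball_prod_same _ _ _).symm
      rw [this]
      exact ⟨hz, Metric.ball_subset_ball (min_le_left _ _) hp.2⟩
    have h1 : AnalyticOnNhd ℂ (fun z => p.2 * n (z, p.2)) (Metric.ball 0 r) := fun z hz =>
      AnalyticAt.prodMk_left (p := (z, p.2)) (hrr _ (hball z hz)).2
    have h2 : AnalyticOnNhd ℂ (fun z => e (chart lam (z, p.2))) (Metric.ball 0 r) := fun z hz =>
      AnalyticAt.prodMk_left (p := (z, p.2)) (hrr _ (hball z hz)).1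
    have h0r := Metric.mem_ball_self (x := (0 : ℂ)) hr
    have h3 : (fun z => p.2 * n (z, p.2)) =ᶠ[𝓝 0] fun z => e (chart lam (z, p.2)) := by
      have := eventuallyEq_of_imaginary (θ := 0) (f := fun z => p.2 * n (z, p.2))
        (g := fun z => e (chart lam (z, p.2))) (by simpa using h1 0 h0r) (by simpa using h2 0 h0r)
        fun t => hax t p.2 (Metric.ball_subset_ball (min_le_right _ _) hp.2)
      simpa using this
    exact h1.eqOn_of_preconnected_of_eventuallyEq h2 (convex_ball _ _).isPreconnected h0r h3 hp.1

/-! ### Existence of the conjugacy between normal forms. -/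

/-- If `y k' a = k b`, then the quotient `b / a` at `0` is the order of `k`. -/
theorem eventually_eq_zero_or_order {k a b : ℂ → ℂ} (hk : AnalyticAt ℂ k 0) (ha : ContinuousAt a 0)
    (hb : ContinuousAt b 0) (h : ∀ᶠ y in 𝓝 0, y * deriv k y * a y = k y * b y) :
    (∀ᶠ y in 𝓝 0, k y = 0) ∨ ∃ r : ℕ, (k 0 = 0 → r ≠ 0) ∧ (r : ℂ) * a 0 = b 0 := by
  refine or_iff_not_imp_left.mpr fun hne => ?_
  -- Write `k = y ^ r u` with `u 0 ≠ 0`, cancel `y ^ r` and let `y` tend to `0`.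
  obtain ⟨r, u, hu, hu0, hku⟩ := hk.exists_eventuallyEq_pow_smul_nonzero_iff.mpr hne
  simp only [sub_zero, smul_eq_mul] at hku
  refine ⟨r, fun hk0 hr => ?_, ?_⟩
  · subst hr
    apply hu0
    simpa [hk0] using hku.self_of_nhds.symm
  have hder : ∀ᶠ y in 𝓝 0, y * deriv k y = y ^ r * (r * u y + y * deriv u y) := by
    filter_upwards [hku.eventually_nhds, hu.eventually_analyticAt] with y h1 h2
    have h3 : HasDerivAt k (r * y ^ (r - 1) * u y + y ^ r * deriv u y) y :=
      (((hasDerivAt_pow r y).mul h2.differentiableAt.hasDerivAt)).congr_of_eventuallyEq h1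
    rw [h3.deriv]
    rcases r with _ | r
    · simp
    · simp only [Nat.add_sub_cancel]
      ring
  have hev : ∀ᶠ y in 𝓝[≠] (0 : ℂ), (r * u y + y * deriv u y) * a y = u y * b y := by
    filter_upwards [nhdsWithin_le_nhds h, nhdsWithin_le_nhds hku, nhdsWithin_le_nhds hder,
      self_mem_nhdsWithin] with y h1 h2 h3 h4
    have hy : y ^ r ≠ 0 := pow_ne_zero _ h4
    rw [h3, h2] at h1
    refine mul_left_cancel₀ hy ?_
    linear_combination h1
  have hud : ContinuousAt (deriv u) 0 := hu.deriv.continuousAt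
  have huc := hu.continuousAt
  have t1 : ContinuousAt (fun y => (r * u y + y * deriv u y) * a y) 0 := by fun_prop
  have t2 : ContinuousAt (fun y => u y * b y) 0 := huc.mul hb
  have := tendsto_nhds_unique ((t1.tendsto.mono_left nhdsWithin_le_nhds).congr' hev)
    (t2.tendsto.mono_left nhdsWithin_le_nhds)
  simp only [zero_mul, add_zero] at this
  refine mul_left_cancel₀ hu0 ?_
  linear_combination this

/-- Near a point `(0, y)` with `y ≠ 0` the chart has a local inverse given by the logarithm, so `G`
vanishes on an open set, and hence on a ball around the origin by the identity theorem. -/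
theorem eventually_eq_zero_of_chart {lam : ℂ} (hl : lam ≠ 0) {G : ℂ × ℂ → ℂ} (hG : AnalyticAt ℂ G 0)
    (h : ∀ᶠ p in 𝓝 (0 : ℂ × ℂ), G (chart lam p) = 0) : ∀ᶠ q in 𝓝 (0 : ℂ × ℂ), G q = 0 := by
  obtain ⟨r, hr, hrG⟩ := Metric.eventually_nhds_iff_ball.mp hG.eventually_analyticAt
  have hc : Tendsto (fun y : ℂ => chart lam (0, y)) (𝓝 0) (𝓝 0) :=
    Continuous.tendsto' (by unfold chart; fun_prop) _ _ (by simp [chart])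
  have hl0 : Tendsto (fun y : ℂ => ((0, y) : ℂ × ℂ)) (𝓝 0) (𝓝 0) :=
    Continuous.tendsto' (by fun_prop) _ _ rfl
  obtain ⟨y, ⟨hy1, hy2⟩, hy0⟩ := (((hl0.eventually h.eventually_nhds).and
    (hc.eventually (Metric.ball_mem_nhds _ hr))).filter_mono
      (nhdsWithin_le_nhds (s := {0}ᶜ)) |>.and self_mem_nhdsWithin).exists
  have hy0 : y ≠ 0 := hy0
  have hq1 : lam * (chart lam (0, y)).1 / (chart lam (0, y)).2 = 1 := by
    simp only [chart, Complex.exp_zero]; field_simp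
  have hq2 : (chart lam (0, y)).2 ≠ 0 := hy0
  set q₀ := chart lam (0, y) with hq₀
  have hcont : ContinuousAt (fun q : ℂ × ℂ => lam * q.1 / q.2) q₀ :=
    (continuousAt_const.mul continuousAt_fst).div continuousAt_snd hq2
  have hlog : Tendsto (fun q : ℂ × ℂ => (Complex.log (lam * q.1 / q.2), q.2)) (𝓝 q₀) (𝓝 (0, y)) := by
    have h1 : ContinuousAt (fun q : ℂ × ℂ => Complex.log (lam * q.1 / q.2)) q₀ := by
      refine hcont.clog ?_
      rw [hq1]
      exact Complex.one_mem_slitPlane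
    have h2 := (h1.prodMk (continuousAt_snd (p := q₀))).tendsto
    rw [hq1, Complex.log_one] at h2
    exact h2
  have hloc : G =ᶠ[𝓝 q₀] 0 := by
    filter_upwards [hlog.eventually hy1, continuousAt_snd.eventually_ne hq2, hcont.eventually_ne
      (by rw [hq1]; exact one_ne_zero)] with q h1 h2 h3
    have : chart lam (Complex.log (lam * q.1 / q.2), q.2) = q := by
      rw [chart]
      ext
      · simp only
        rw [Complex.exp_log h3]
        field_simp
      · rfl
    rw [this] at h1
    exact h1
  have hz : AnalyticOnNhd ℂ (0 : ℂ × ℂ → ℂ) (Metric.ball 0 r) := fun q _ => analyticAt_const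
  have := AnalyticOnNhd.eqOn_of_preconnected_of_eventuallyEq hrG hz
    (convex_ball _ _).isPreconnected hy2 hloc
  filter_upwards [Metric.ball_mem_nhds _ hr] with q hq using this hq

section
variable {B B' : ℂ × ℂ → ℂ} {lam : ℂ} {ε : ℤˣ} {g : ℂ → ℂ}

/-- Since `n` vanishes on `y = 0`, the differential of `e` annihilates `(lam⁻¹ exp z, 1)` for all
small `z`; this vector and its derivative in `z` span the plane. -/
theorem fderiv_eq_zero_of_chart (hl : lam ≠ 0) {e n : ℂ × ℂ → ℂ} (he : AnalyticAt ℂ e 0)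
    (hn : AnalyticAt ℂ n 0) (hn0 : ∀ᶠ z in 𝓝 0, n (z, 0) = 0)
    (h : ∀ᶠ p in 𝓝 (0 : ℂ × ℂ), p.2 * n p = e (chart lam p)) : fderiv ℂ e 0 = 0 := by
  have hc : Tendsto (fun z : ℂ => ((z, 0) : ℂ × ℂ)) (𝓝 0) (𝓝 0) :=
    Continuous.tendsto' (by fun_prop) _ _ rfl
  have hzero : ∀ᶠ z in 𝓝 (0 : ℂ), fderiv ℂ e 0 (lam⁻¹ * Complex.exp z, 1) = 0 := by
    filter_upwards [hc.eventually h.eventually_nhds, hn0,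
      hc.eventually hn.eventually_analyticAt] with z h1 h2 h3
    have d1 : HasDerivAt (fun y => chart lam (z, y)) (lam⁻¹ * Complex.exp z, 1) 0 := by
      exact (((hasDerivAt_id (0 : ℂ)).const_mul (lam⁻¹ * Complex.exp z)).prodMk
        (hasDerivAt_id (0 : ℂ))).congr_deriv (by simp)
    have d2 := HasFDerivAt.comp_hasDerivAt_of_eq (f := fun y => chart lam (z, y)) (0 : ℂ)
      he.differentiableAt.hasFDerivAt d1 (chart_zero lam z).symm
    have d3 := (hasDerivAt_id (0 : ℂ)).mul (deriv_snd_eq h3)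
    have hcy : Tendsto (fun y : ℂ => ((z, y) : ℂ × ℂ)) (𝓝 0) (𝓝 (z, 0)) :=
      Continuous.tendsto' (by fun_prop) _ _ rfl
    have := (d2.congr_of_eventuallyEq (hcy.eventually h1)).unique d3
    simpa [h2] using this
  have d : HasDerivAt (fun z : ℂ => fderiv ℂ e 0 (lam⁻¹ * Complex.exp z, 1))
      (fderiv ℂ e 0 (lam⁻¹ * Complex.exp 0, 0)) 0 :=
    (fderiv ℂ e 0).hasFDerivAt.comp_hasDerivAt (0 : ℂ)
      (((Complex.hasDerivAt_exp 0).const_mul lam⁻¹).prodMk (hasDerivAt_const _ _))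
  have h1 := d.unique ((hasDerivAt_const (0 : ℂ) (0 : ℂ)).congr_of_eventuallyEq hzero)
  have h2 := hzero.self_of_nhds
  have e1 : fderiv ℂ e 0 (1, 0) = 0 := by
    have : ((1, 0) : ℂ × ℂ) = lam • (lam⁻¹ * Complex.exp 0, 0) := by simp [hl]
    rw [this, map_smul, h1, smul_zero]
  have e2 : fderiv ℂ e 0 (0, 1) = 0 := by
    have : ((0, 1) : ℂ × ℂ) = (lam⁻¹ * Complex.exp 0, 1) - (lam⁻¹ * Complex.exp 0, 0) := by simp
    rw [this, map_sub, h1, h2, sub_zero]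
  ext <;> simp [e1, e2]

/-- On `x = 0` zero defect becomes an equation `y k' a = k b` for `k y = e (0, y)`, with `a 0 = 1`
and `b 0 = -lam`. A nonzero `k` would have order `-lam`, a positive integer. Hence the conjugacy
fixes the axis pointwise. -/
theorem eventually_axis_eq_zero (hB' : IsCoeff B' lam) (hlam : ∀ q : ℚ, q < 0 → lam ≠ q)
    {e : ℂ × ℂ → ℂ} (he : AnalyticAt ℂ e 0) (he0 : e 0 = 0) (hde : fderiv ℂ e 0 (0, 1) = 0)
    (hG : ∀ᶠ q in 𝓝 (0 : ℂ × ℂ), defect B B' e q = 0) : ∀ᶠ y in 𝓝 0, e (0, y) = 0 := by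
  have hk : AnalyticAt ℂ (fun y => e (0, y)) 0 := AnalyticAt.prodMk_right (p := 0) he
  have hk1 : deriv (fun y => e (0, y)) 0 = 0 := by
    exact (deriv_snd_eq (p := 0) he).deriv.trans hde
  have hk0 : e (0, 0) = 0 := he0
  have hda : AnalyticAt ℂ (fun y => B' (e (0, y), y - e (0, y))) 0 :=
    AnalyticAt.fun_comp_of_eq (g := B') hB'.analytic (hk.prod (analyticAt_id.sub hk)) (by simp [hk0])
  have hc : Tendsto (fun y : ℂ => ((0, y) : ℂ × ℂ)) (𝓝 0) (𝓝 0) :=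
    Continuous.tendsto' (by fun_prop) _ _ rfl
  have hds : ContinuousAt (dslope (fun y => e (0, y)) 0) 0 :=
    continuousAt_dslope_same.mpr hk.differentiableAt
  rcases eventually_eq_zero_or_order (k := fun y => e (0, y))
    (a := fun y => 1 - dslope (fun y => e (0, y)) 0 y)
    (b := fun y => -(B' (e (0, y), y - e (0, y)) * (1 - deriv (fun y => e (0, y)) y))) hk
    (continuousAt_const.sub hds) (hda.continuousAt.mul (continuousAt_const.sub hk.deriv.continuousAt)).neg
    (by
      filter_upwards [hc.eventually hG, hc.eventually he.eventually_analyticAt] with y h1 h2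
      rcases eq_or_ne y 0 with rfl | hy
      · simp [hk0]
      have h3 : alongXY B e (0, y) = -(y * deriv (fun y => e (0, y)) y) := by
        rw [alongXY, (deriv_snd_eq (p := (0, y)) h2).deriv]
        simp
      have h4 : y * dslope (fun y => e (0, y)) 0 y = e (0, y) := by
        have := sub_smul_dslope (fun y => e (0, y)) 0 y
        simpa [hk0] using this
      rw [defect, h3] at h1
      simp only [zero_mul, zero_add] at h1
      refine mul_left_cancel₀ hy ?_
      linear_combination -h1 - y * deriv (fun y => e (0, y)) y * h4) with h | ⟨r, hr, hrl⟩
  · exact h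
  · exfalso
    have hr0 : r ≠ 0 := hr hk0
    simp only [dslope_same, hk1, hk0, sub_zero, mul_one] at hrl
    rw [show ((0, 0) : ℂ × ℂ) = 0 from rfl, hB'.map_zero] at hrl
    refine hlam (-(r : ℚ)) (by simpa using Nat.pos_of_ne_zero hr0) ?_
    push_cast
    rw [hrl, neg_neg]

/-- Two forms `y dx + x B dy` with the same sliding are conjugate, by a conjugacy that preserves the
levels of `x + y` and fixes the axis `x = 0`. -/
theorem exists_isConjugacy_std (hB : IsCoeff B lam) (hB' : IsCoeff B' lam)
    (hlam : ∀ q : ℚ, q < 0 → lam ≠ q)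
    (hg : IsSliding (stdForm B) stdLevel (fun y => (0, y)) (fun x => (x, 0)) ε g)
    (hg' : IsSliding (stdForm B') stdLevel (fun y => (0, y)) (fun x => (x, 0)) ε g) :
    ∃ Θ, IsConjugacy (stdForm B) stdLevel (stdForm B') stdLevel Θ ∧
      ∀ᶠ y in 𝓝 (0 : ℂ), Θ (0, y) = (0, y) := by
  have hl := hB.ne_zero
  obtain ⟨δ, U, H, h⟩ := exists_flowData hB
  obtain ⟨δ', U', H', h'⟩ := exists_flowData hB'
  obtain ⟨τ, hτ⟩ := exists_tangentData hB
  obtain ⟨τ', hτ'⟩ := exists_tangentData hB'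
  obtain ⟨J, hJ⟩ := h.exists_isSlidingIntegral hB hτ hg.1 (h.mono_rho_of_isSliding hB hτ hg)
  obtain ⟨J', hJ'⟩ := h'.exists_isSlidingIntegral hB' hτ' hg'.1 (h'.mono_rho_of_isSliding hB' hτ' hg')
  obtain ⟨m, hm⟩ := exists_pde_solution hB hB' hτ hτ' hJ hJ'
  choose c hc using exists_coeff hB hB' hlam hm
  have hre : ∀ θ : ℝ, ((θ : ℂ) * Complex.I).re = 0 := fun θ => by simp
  obtain ⟨e, he, he0, hen⟩ := exists_resummation hl (n := pull lam m) (c := c)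
    (fun θ => (hm _ (hre θ)).1) (fun θ => (hm _ (hre θ)).2.1.self_of_nhds) (fun θ y => by
      rw [pull, pull]
      simp only
      congr 3
      push_cast
      rw [add_mul, Complex.exp_add, Complex.exp_two_pi_mul_I, mul_one]) hc
  obtain ⟨hna, hn0, hpde⟩ := hm 0 rfl
  have hde := fderiv_eq_zero_of_chart hl he hna hn0 hen
  have hdef : AnalyticAt ℂ (defect B B' e) 0 := by
    refine analyticAt_defect hB.analytic ?_ he
    simp only [he0, Prod.fst_zero, Prod.snd_zero, add_zero, sub_zero]
    exact hB'.analytic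
  -- The equation is known only in the chart near `ζ = 0`. Once `e` is analytic at the origin, the
  -- identity theorem gives it everywhere near the origin.
  have hG : ∀ᶠ q in 𝓝 (0 : ℂ × ℂ), defect B B' e q = 0 := by
    refine eventually_eq_zero_of_chart hl hdef ?_
    have hch : Tendsto (chart lam) (𝓝 0) (𝓝 0) := by
      have := (analyticAt_chart lam 0).continuousAt.tendsto
      rwa [show chart lam 0 = 0 from chart_zero lam 0] at this
    filter_upwards [hpde, hen.eventually_nhds, hna.eventually_analyticAt,
      hch.eventually he.eventually_analyticAt] with p h1 h2 h3 h4
    rw [← defect_chart h4 h3 h2, h1, mul_zero]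
  refine ⟨_, isConjugacy_moved hB hB' he he0 hde hG, ?_⟩
  filter_upwards [eventually_axis_eq_zero hB' hlam he he0 (by simp [hde]) hG] with y hy
  simp [hy]

end

/-! ### Uniqueness of the conjugacy between normal forms. -/

theorem eventually_eq_zero_of_iterate_dsl {n : ℂ × ℂ → ℂ} (hn : AnalyticAt ℂ n 0)
    (h : ∀ N, ∀ᶠ z in 𝓝 (0 : ℂ), dsl^[N] n (z, 0) = 0) : ∀ᶠ p in 𝓝 (0 : ℂ × ℂ), n p = 0 := by
  obtain ⟨r, hr, hrn⟩ := Metric.eventually_nhds_iff_ball.mp hn.eventually_analyticAt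
  have hpr : Metric.ball (0 : ℂ × ℂ) r = Metric.ball 0 r ×ˢ Metric.ball 0 r := (ball_prod_same _ _ _).symm
  have h0r := Metric.mem_ball_self (x := (0 : ℂ)) hr
  have hna : ∀ z ∈ Metric.ball (0 : ℂ) r, ∀ y ∈ Metric.ball (0 : ℂ) r, AnalyticAt ℂ n (z, y) :=
    fun z hz y hy => hrn _ (hpr ▸ ⟨hz, hy⟩)
  have hz0 : ∀ N, ∀ z ∈ Metric.ball (0 : ℂ) r, dsl^[N] n (z, 0) = 0 := by
    intro N
    have h1 : AnalyticOnNhd ℂ (fun z => dsl^[N] n (z, 0)) (Metric.ball 0 r) := fun z hz =>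
      AnalyticAt.prodMk_left (p := (z, 0)) (analyticAt_iterate_dsl (hna z hz 0 h0r) N)
    exact h1.eqOn_zero_of_preconnected_of_eventuallyEq_zero (convex_ball _ _).isPreconnected h0r (h N)
  filter_upwards [Metric.ball_mem_nhds _ hr] with p hp
  rw [hpr] at hp
  obtain ⟨z, y⟩ := p
  obtain ⟨hz, hy⟩ := hp
  have hf : AnalyticOnNhd ℂ (fun y => n (z, y)) (Metric.ball 0 r) := fun y hy =>
    AnalyticAt.prodMk_right (p := (z, y)) (hna z hz y hy)
  refine hf.eqOn_zero_of_preconnected_of_eventuallyEq_zero (convex_ball _ _).isPreconnected h0r ?_ hy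
  by_contra hne
  obtain ⟨m, u, hu, hu0, hku⟩ := (hf 0 h0r).exists_eventuallyEq_pow_smul_nonzero_iff.mpr hne
  simp only [sub_zero, smul_eq_mul] at hku
  apply hu0
  have hd : ContinuousAt (fun y => dsl^[m + 1] n (z, y)) 0 :=
    (AnalyticAt.prodMk_right (p := (z, 0)) (analyticAt_iterate_dsl (hna z hz 0 h0r) (m + 1))).continuousAt
  have hev : ∀ᶠ y in 𝓝[≠] (0 : ℂ), u y = y * dsl^[m + 1] n (z, y) := by
    filter_upwards [nhdsWithin_le_nhds hku, self_mem_nhdsWithin] with y h1 h2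
    have h3 := taylor_dsl n (m + 1) (z, y)
    rw [Finset.sum_eq_zero (fun i _ => by simp [hz0 i z hz]), zero_add, h1] at h3
    refine mul_left_cancel₀ (pow_ne_zero m h2) ?_
    rw [h3]
    ring
  have t2 : ContinuousAt (fun y => y * dsl^[m + 1] n (z, y)) 0 := continuousAt_id.mul hd
  have := tendsto_nhds_unique ((hu.continuousAt.tendsto.mono_left nhdsWithin_le_nhds).congr' hev)
    (t2.tendsto.mono_left nhdsWithin_le_nhds)
  simpa using this

section
variable {B : ℂ × ℂ → ℂ} {lam : ℂ}

/-- On the axis `y = 0` the defect is divisible by `x²`; at `x = 0` the quotient is `-lam (1 + lam)`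
times this product. -/
theorem deriv_fst_mul_eq_zero (hB : IsCoeff B lam) {e : ℂ × ℂ → ℂ} (he : AnalyticAt ℂ e 0)
    (he0 : e 0 = 0) (hG : ∀ᶠ q in 𝓝 (0 : ℂ × ℂ), defect B B e q = 0) :
    fderiv ℂ e 0 (1, 0) * (1 + fderiv ℂ e 0 (1, 0)) = 0 := by
  have hk : AnalyticAt ℂ (fun x => e (x, 0)) 0 := AnalyticAt.prodMk_left (p := 0) he
  have hk1 : deriv (fun x => e (x, 0)) 0 = fderiv ℂ e 0 (1, 0) := (deriv_fst_eq (p := 0) he).deriv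
  have hk0 : e (0, 0) = 0 := he0
  have hBx : AnalyticAt ℂ (fun x => B (x, 0)) 0 := AnalyticAt.prodMk_left (p := 0) hB.analytic
  have hda : AnalyticAt ℂ (fun x => B (x + e (x, 0), 0 - e (x, 0))) 0 :=
    AnalyticAt.fun_comp_of_eq (g := B) hB.analytic ((analyticAt_id.add hk).prod
      (analyticAt_const.sub hk)) (by simp [hk0])
  have hc : Tendsto (fun x : ℂ => ((x, 0) : ℂ × ℂ)) (𝓝 0) (𝓝 0) :=
    Continuous.tendsto' (by fun_prop) _ _ rfl
  have hds : ContinuousAt (dslope (fun x => e (x, 0)) 0) 0 :=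
    continuousAt_dslope_same.mpr hk.differentiableAt
  have hkd := hk.deriv.continuousAt
  have hBc := hBx.continuousAt
  have hdac := hda.continuousAt
  have hL : ContinuousAt (fun x => -dslope (fun x => e (x, 0)) 0 x *
      (B (x, 0) + B (x, 0) * deriv (fun x => e (x, 0)) x) -
      (1 + dslope (fun x => e (x, 0)) 0 x) * B (x + e (x, 0), 0 - e (x, 0)) *
        (B (x, 0) * deriv (fun x => e (x, 0)) x)) 0 :=
    (hds.neg.mul (hBc.add (hBc.mul hkd))).sub (((continuousAt_const.add hds).mul hdac).mul (hBc.mul hkd))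
  have hev : ∀ᶠ x in 𝓝[≠] (0 : ℂ), -dslope (fun x => e (x, 0)) 0 x *
      (B (x, 0) + B (x, 0) * deriv (fun x => e (x, 0)) x) -
      (1 + dslope (fun x => e (x, 0)) 0 x) * B (x + e (x, 0), 0 - e (x, 0)) *
        (B (x, 0) * deriv (fun x => e (x, 0)) x) = 0 := by
    filter_upwards [nhdsWithin_le_nhds (hc.eventually hG),
      nhdsWithin_le_nhds (hc.eventually he.eventually_analyticAt), self_mem_nhdsWithin] with x h1 h2 hx
    have hx : x ≠ 0 := hx
    have h3 : alongXY B e (x, 0) = x * B (x, 0) * deriv (fun x => e (x, 0)) x := by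
      rw [alongXY, (deriv_fst_eq (p := (x, 0)) h2).deriv]
      simp
    have h4 : x * dslope (fun x => e (x, 0)) 0 x = e (x, 0) := by
      have := sub_smul_dslope (fun x => e (x, 0)) 0 x
      simpa [hk0] using this
    rw [defect, h3] at h1
    simp only at h1
    refine (mul_eq_zero.mp ?_).resolve_left (pow_ne_zero 2 hx)
    linear_combination h1 + (-(x * (B (x, 0) + B (x, 0) * deriv (fun x => e (x, 0)) x)) -
      B (x + e (x, 0), 0 - e (x, 0)) * x * (B (x, 0) * deriv (fun x => e (x, 0)) x)) * h4
  have h5 := tendsto_nhds_unique ((hL.tendsto.mono_left nhdsWithin_le_nhds).congr' hev)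
    tendsto_const_nhds
  simp only [dslope_same, hk1, Prod.mk_zero_zero, he0, add_zero, sub_zero, hB.map_zero] at h5
  refine mul_left_cancel₀ (mul_ne_zero hB.ne_zero hB.one_add_ne) ?_
  linear_combination -h5

theorem pde_zero (p : ℂ × ℂ) : pde B B lam (fun _ => 0) p = 0 := by
  simp [pde, along, chart, mul_comm, mul_left_comm]

/-- Both `n = e / y` and `0` solve the equation. If the Taylor coefficients of order less than `N`
vanish, the next one solves the homogeneous linearized equation, whose only exponent at `z = 0` is
`-1`; so it vanishes as well. -/
theorem eventually_eq_zero_of_defect (hB : IsCoeff B lam) {e : ℂ × ℂ → ℂ} (he : AnalyticAt ℂ e 0)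
    (he0 : e 0 = 0) (hde : fderiv ℂ e 0 = 0)
    (hG : ∀ᶠ q in 𝓝 (0 : ℂ × ℂ), defect B B e q = 0) : ∀ᶠ q in 𝓝 (0 : ℂ × ℂ), e q = 0 := by
  have hl := hB.ne_zero
  let n : ℂ × ℂ → ℂ := dsl fun p => e (chart lam p)
  have hea : ∀ z : ℂ, AnalyticAt ℂ (fun p => e (chart lam p)) (z, 0) := fun z =>
    AnalyticAt.fun_comp_of_eq (g := e) he (analyticAt_chart lam _) (chart_zero lam z)
  have hna : ∀ z : ℂ, AnalyticAt ℂ n (z, 0) := fun z => analyticAt_dsl (hea z) (hea z)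
  have hn : ∀ p, p.2 * n p = e (chart lam p) := by
    intro p
    rw [dsl_mul, chart_zero, he0, sub_zero]
  have hn0 : ∀ z, n (z, 0) = 0 := by
    intro z
    have d1 : HasDerivAt (fun y => chart lam (z, y)) (lam⁻¹ * Complex.exp z, 1) 0 := by
      exact (((hasDerivAt_id (0 : ℂ)).const_mul (lam⁻¹ * Complex.exp z)).prodMk
        (hasDerivAt_id (0 : ℂ))).congr_deriv (by simp)
    have d2 := HasFDerivAt.comp_hasDerivAt_of_eq (f := fun y => chart lam (z, y)) (0 : ℂ)
      he.differentiableAt.hasFDerivAt d1 (chart_zero lam z).symm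
    rw [hde] at d2
    exact (dsl_zero _ z).trans d2.deriv
  have hpde : ∀ᶠ p in 𝓝 (0 : ℂ × ℂ), pde B B lam n p = 0 := by
    have hch : Tendsto (chart lam) (𝓝 0) (𝓝 0) := by
      have := (analyticAt_chart lam 0).continuousAt.tendsto
      rwa [show chart lam 0 = 0 from chart_zero lam 0] at this
    have hpa : AnalyticAt ℂ (pde B B lam n) 0 := analyticAt_pde hB hB (hna 0)
    have h1 : (fun p : ℂ × ℂ => p.2 * pde B B lam n p) =ᶠ[𝓝 0] fun _ => 0 := by
      refine eventuallyEq_of_snd_mul (analyticAt_snd.mul hpa) analyticAt_const ?_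
      filter_upwards [hch.eventually hG, (hna 0).eventually_analyticAt,
        hch.eventually he.eventually_analyticAt] with p h1 h2 h3
      rw [← mul_assoc, ← pow_two, defect_chart h3 h2 (Eventually.of_forall hn), h1, mul_zero]
    refine eventuallyEq_of_snd_mul hpa analyticAt_const ?_
    filter_upwards [h1] with p hp using by rw [hp, mul_zero]
  have hc : Tendsto (fun z : ℂ => ((z, 0) : ℂ × ℂ)) (𝓝 0) (𝓝 0) :=
    Continuous.tendsto' (by fun_prop) _ _ rfl
  have hN : ∀ N, ∀ᶠ z in 𝓝 (0 : ℂ), dsl^[N] n (z, 0) = 0 := by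
    intro N
    induction N using Nat.strong_induction_on with
    | _ N ih =>
    have hall : ∀ᶠ z in 𝓝 (0 : ℂ), ∀ i ∈ Finset.range N, dsl^[i] n (z, 0) = 0 :=
      (Finset.range N).eventually_all.mpr fun i hi => ih i (Finset.mem_range.mp hi)
    have hsplit : ∀ᶠ p in 𝓝 (0 : ℂ × ℂ), n p = 0 + p.2 ^ N * dsl^[N] n p := by
      filter_upwards [(continuous_fst.tendsto (0 : ℂ × ℂ)).eventually hall] with p hp
      have := taylor_dsl n N p
      rwa [Finset.sum_eq_zero (fun i hi => by rw [hp i hi, mul_zero])] at this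
    have hκa := fun z => analyticAt_iterate_dsl (hna z) N
    have hka : AnalyticAt ℂ (fun z => dsl^[N] n (z, 0)) 0 := AnalyticAt.prodMk_left (p := 0) (hκa 0)
    have hlin : ∀ᶠ z in 𝓝 (0 : ℂ), linPde lam N (dsl^[N] n) z = 0 := by
      filter_upwards [hc.eventually hsplit.eventually_nhds, hc.eventually hpde.eventually_nhds]
        with z h1 h2
      refine tendsto_nhds_unique (tendsto_pde_sub hB hB N (hna z) analyticAt_const (hκa z)
        (Eventually.of_forall hn0) (Eventually.of_forall fun _ => rfl) h1) ?_
      refine tendsto_const_nhds.congr' ?_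
      filter_upwards [(tendsto_line z).eventually h2] with y hy
      rw [hy, pde_zero, sub_zero, zero_div]
    have hds : ContinuousAt (dslope Complex.exp 0) 0 :=
      continuousAt_dslope_same.mpr Complex.differentiableAt_exp
    have hexp : ContinuousAt Complex.exp 0 := Complex.continuous_exp.continuousAt
    -- A nonzero coefficient would have an order `r` with `(r + 1) (1 + lam) = 0`.
    rcases eventually_eq_zero_or_order (k := fun z => dsl^[N] n (z, 0))
      (a := fun z => -(dslope Complex.exp 0 z * (1 + lam)))
      (b := fun z => (1 + lam) + N * (1 - Complex.exp z)) hka (by fun_prop) (by fun_prop) (by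
        filter_upwards [hlin] with z hz
        have h1 : z * dslope Complex.exp 0 z = Complex.exp z - 1 := by
          have := sub_smul_dslope Complex.exp 0 z
          simpa using this
        rw [linPde, ← (deriv_fst_eq (hκa z)).deriv] at hz
        simp only at hz
        linear_combination hz - (1 + lam) * deriv (fun z => dsl^[N] n (z, 0)) z * h1) with h | ⟨r, -, hr⟩
    · exact h
    · exfalso
      simp only [dslope_same, Complex.deriv_exp, Complex.exp_zero, sub_self, mul_zero, add_zero,
        one_mul] at hr
      have h1 : ((r : ℂ) + 1) * (1 + lam) = 0 := by linear_combination -hr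
      rcases mul_eq_zero.mp h1 with h2 | h2
      · exact Nat.cast_add_one_ne_zero r h2
      · exact hB.one_add_ne h2
  refine eventually_eq_zero_of_chart hl he ?_
  filter_upwards [eventually_eq_zero_of_iterate_dsl (hna 0) hN] with p hp
  rw [← hn, hp, mul_zero]

/-- A conjugacy of a form `y dx + x B dy` with itself, that preserves the foliation by the levels of
`x + y` and fixes the axis `x = 0`, is the identity. -/
theorem eventuallyEq_id_of_isConjugacy_std (hB : IsCoeff B lam) {Θ : ℂ × ℂ → ℂ × ℂ}
    (hΘ : IsConjugacy (stdForm B) stdLevel (stdForm B) stdLevel Θ)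
    (h0 : ∀ᶠ y in 𝓝 (0 : ℂ), Θ (0, y) = (0, y)) : Θ =ᶠ[𝓝 0] id := by
  obtain ⟨⟨hΘa, hΘ0, hΘi⟩, ⟨u, -, -, hu⟩, ⟨k, -, -, hk⟩⟩ := hΘ
  have hc : Tendsto (fun y : ℂ => ((0, y) : ℂ × ℂ)) (𝓝 0) (𝓝 0) :=
    Continuous.tendsto' (by fun_prop) _ _ rfl
  -- The point `(0, y)` is fixed and has level `y`, so each level is preserved.
  have hkid : ∀ᶠ y in 𝓝 (0 : ℂ), k y = y := by
    filter_upwards [hc.eventually hk, h0] with y h1 h2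
    rw [h2] at h1
    simpa [stdLevel] using h1.symm
  have hlev : Tendsto stdLevel (𝓝 0) (𝓝 0) := by
    simpa [stdLevel] using (hasFDerivAt_stdLevel 0).continuousAt.tendsto
  let e : ℂ × ℂ → ℂ := fun q => (Θ q).1 - q.1
  have he : AnalyticAt ℂ e 0 := (AnalyticAt.fun_comp_of_eq analyticAt_fst hΘa rfl).sub analyticAt_fst
  have he0 : e 0 = 0 := by simp [e, hΘ0]
  have hΘe : Θ =ᶠ[𝓝 0] fun q => (q.1 + e q, q.2 - e q) := by
    filter_upwards [hk, hlev.eventually hkid] with q h1 h2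
    rw [h2] at h1
    simp only [stdLevel] at h1
    ext
    · simp [e]
    · simp only [e]
      linear_combination h1
  have hG : ∀ᶠ q in 𝓝 (0 : ℂ × ℂ), defect B B e q = 0 := by
    filter_upwards [hu, hΘe.eventually_nhds, he.eventually_analyticAt] with q h1 h2 h3
    rw [← stdForm_moved_field, ← (hasFDerivAt_moved h3).fderiv, ← EventuallyEq.fderiv_eq h2]
    have h4 := DFunLike.congr_fun h1 (q.1 * B q, -q.2)
    rw [h2.self_of_nhds] at h4
    simp only [ContinuousLinearMap.comp_apply, smul_apply, stdForm_apply B q] at h4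
    rw [h4]
    simp only [smul_eq_mul]
    ring
  have hdy : fderiv ℂ e 0 (0, 1) = 0 := by
    refine (deriv_snd_eq (p := 0) he).unique ((hasDerivAt_const (0 : ℂ) (0 : ℂ)).congr_of_eventuallyEq ?_)
    filter_upwards [h0] with y hy
    simp [e, hy]
  have hdx : fderiv ℂ e 0 (1, 0) = 0 := by
    rcases mul_eq_zero.mp (deriv_fst_mul_eq_zero hB he he0 hG) with h | h
    · exact h
    · exfalso
      -- The other root, derivative `-1` along `S₂`, would collapse the direction of the levels and
      -- contradict invertibility.
      have h1 : fderiv ℂ Θ 0 (1, -1) = 0 := by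
        have h2 : fderiv ℂ e 0 (1, -1) = -1 := by
          have : ((1, -1) : ℂ × ℂ) = (1, 0) - (0, 1) := by simp
          rw [this, map_sub, hdy]
          linear_combination h
        rw [hΘe.fderiv_eq, (hasFDerivAt_moved he).fderiv]
        ext <;> simp [h2]
      obtain ⟨M, hM⟩ := hΘi
      rw [← hM] at h1
      have := M.injective (h1.trans (map_zero M).symm)
      simp at this
  have hde : fderiv ℂ e 0 = 0 := by ext <;> simp [hdx, hdy]
  filter_upwards [hΘe, eventually_eq_zero_of_defect hB he he0 hde hG] with q h1 h2
  rw [h1, h2]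
  simp

end

/-! ### Germs of biholomorphisms of the plane and the groupoid of conjugacies. -/

theorem isInvertible_of_injective {L : ℂ × ℂ →L[ℂ] ℂ × ℂ} (h : ∀ v, L v = 0 → v = 0) :
    L.IsInvertible := by
  have hi : Function.Injective (L : ℂ × ℂ →ₗ[ℂ] ℂ × ℂ) :=
    (injective_iff_map_eq_zero _).mpr h
  refine ⟨(LinearEquiv.ofInjectiveEndo _ hi).toContinuousLinearEquiv, ?_⟩
  ext1 <;> rfl

theorem IsDiffeoGerm₂.hasFDerivAt {Φ : ℂ × ℂ → ℂ × ℂ} (h : IsDiffeoGerm₂ Φ) :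
    HasFDerivAt Φ (fderiv ℂ Φ 0) 0 := h.analytic.differentiableAt.hasFDerivAt

theorem IsDiffeoGerm₂.injective {Φ : ℂ × ℂ → ℂ × ℂ} (h : IsDiffeoGerm₂ Φ) {v : ℂ × ℂ}
    (hv : fderiv ℂ Φ 0 v = 0) : v = 0 := by
  obtain ⟨M, hM⟩ := h.invertible
  rw [← hM] at hv
  exact M.injective (hv.trans (_root_.map_zero M).symm)

theorem IsDiffeoGerm₂.tendsto {Φ : ℂ × ℂ → ℂ × ℂ} (h : IsDiffeoGerm₂ Φ) : Tendsto Φ (𝓝 0) (𝓝 0) := by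
  have := h.analytic.continuousAt.tendsto
  rwa [h.map_zero] at this

theorem IsDiffeoGerm₂.comp {Φ Ψ : ℂ × ℂ → ℂ × ℂ} (hΦ : IsDiffeoGerm₂ Φ) (hΨ : IsDiffeoGerm₂ Ψ) :
    IsDiffeoGerm₂ (Φ ∘ Ψ) := by
  have hd : HasFDerivAt (Φ ∘ Ψ) ((fderiv ℂ Φ 0).comp (fderiv ℂ Ψ 0)) 0 := by
    refine HasFDerivAt.comp (0 : ℂ × ℂ) ?_ hΨ.hasFDerivAt
    rw [hΨ.map_zero]
    exact hΦ.hasFDerivAt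
  refine ⟨AnalyticAt.comp_of_eq hΦ.analytic hΨ.analytic hΨ.map_zero, ?_, ?_⟩
  · simp [hΨ.map_zero, hΦ.map_zero]
  · rw [hd.fderiv]
    exact isInvertible_of_injective fun v hv => hΨ.injective (hΦ.injective hv)

open scoped ContDiff in
theorem IsDiffeoGerm₂.exists_inverse {Φ : ℂ × ℂ → ℂ × ℂ} (h : IsDiffeoGerm₂ Φ) :
    ∃ Ψ, IsDiffeoGerm₂ Ψ ∧ (∀ᶠ q in 𝓝 0, Ψ (Φ q) = q) ∧ ∀ᶠ q in 𝓝 0, Φ (Ψ q) = q := by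
  obtain ⟨M, hM⟩ := h.invertible
  have hc : ContDiffAt ℂ ω Φ 0 := h.analytic.contDiffAt
  have hf : HasFDerivAt Φ (M : ℂ × ℂ →L[ℂ] ℂ × ℂ) 0 := by
    rw [hM]
    exact h.hasFDerivAt
  have hs : HasStrictFDerivAt Φ (M : ℂ × ℂ →L[ℂ] ℂ × ℂ) 0 := hc.hasStrictFDerivAt' hf (by simp)
  let Ψ := hs.localInverse
  have hΨa : AnalyticAt ℂ Ψ 0 := by
    have := hc.to_localInverse hf (by simp)
    rw [h.map_zero] at this
    exact this.analyticAt
  have hΨΦ : ∀ᶠ q in 𝓝 0, Ψ (Φ q) = q := hs.eventually_left_inverse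
  have hΦΨ : ∀ᶠ q in 𝓝 0, Φ (Ψ q) = q := by
    have := hs.eventually_right_inverse
    rwa [h.map_zero] at this
  have hΨ0 : Ψ 0 = 0 := by
    have := hΨΦ.self_of_nhds
    rwa [h.map_zero] at this
  refine ⟨Ψ, ⟨hΨa, hΨ0, isInvertible_of_injective fun v hv => ?_⟩, hΨΦ, hΦΨ⟩
  have hd : HasFDerivAt (fun q => Φ (Ψ q)) ((fderiv ℂ Φ 0).comp (fderiv ℂ Ψ 0)) 0 := by
    refine HasFDerivAt.comp (0 : ℂ × ℂ) ?_ hΨa.differentiableAt.hasFDerivAt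
    rw [hΨ0]
    exact h.hasFDerivAt
  have h1 := hd.unique ((hasFDerivAt_id (𝕜 := ℂ) (0 : ℂ × ℂ)).congr_of_eventuallyEq hΦΨ)
  have h2 := DFunLike.congr_fun h1 v
  simp only [ContinuousLinearMap.comp_apply, hv, _root_.map_zero, ContinuousLinearMap.id_apply] at h2
  exact h2.symm

/-- The differentials of a germ and of its inverse at corresponding points are inverse. -/
theorem eventually_fderiv_comp_fderiv {Φ Ψ : ℂ × ℂ → ℂ × ℂ} (hΦ : IsDiffeoGerm₂ Φ)
    (hΨ : IsDiffeoGerm₂ Ψ) (h : ∀ᶠ q in 𝓝 0, Φ (Ψ q) = q) :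
    ∀ᶠ q in 𝓝 0, (fderiv ℂ Φ (Ψ q)).comp (fderiv ℂ Ψ q) = ContinuousLinearMap.id ℂ (ℂ × ℂ) := by
  filter_upwards [h.eventually_nhds, hΨ.analytic.eventually_analyticAt,
    hΨ.tendsto.eventually hΦ.analytic.eventually_analyticAt] with q h1 h2 h3
  exact (h3.differentiableAt.hasFDerivAt.comp q h2.differentiableAt.hasFDerivAt).unique
    ((hasFDerivAt_id q).congr_of_eventuallyEq h1)

theorem isDiffeoGerm₂_id : IsDiffeoGerm₂ id :=
  ⟨analyticAt_id, rfl, by rw [fderiv_id]; exact ⟨ContinuousLinearEquiv.refl ℂ _, rfl⟩⟩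

section
variable {ω ω' ω'' : OneForm} {f f' f'' : ℂ × ℂ → ℂ} {Φ Φ' : ℂ × ℂ → ℂ × ℂ}

theorem isConjugacy_id : IsConjugacy ω f ω f id := by
  refine ⟨isDiffeoGerm₂_id, ⟨fun _ => 1, analyticAt_const, one_ne_zero, Eventually.of_forall fun q => ?_⟩,
    id, analyticAt_id, by simp, Eventually.of_forall fun q => rfl⟩
  rw [fderiv_id, one_smul]
  rfl

theorem IsConjugacy.comp (h' : IsConjugacy ω' f' ω'' f'' Φ') (h : IsConjugacy ω f ω' f' Φ) :
    IsConjugacy ω f ω'' f'' (Φ' ∘ Φ) := by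
  obtain ⟨u, hu, hu0, hue⟩ := h.map_form
  obtain ⟨u', hu', hu0', hue'⟩ := h'.map_form
  obtain ⟨k, hk, hk0, hke⟩ := h.map_regular
  obtain ⟨k', hk', hk0', hke'⟩ := h'.map_regular
  have hkf : k (f 0) = f' 0 := by
    have := hke.self_of_nhds
    rw [h.diffeo.map_zero] at this
    exact this.symm
  have hk'' : AnalyticAt ℂ k' (k (f 0)) := by rwa [hkf]
  refine ⟨h'.diffeo.comp h.diffeo, ⟨fun q => u' (Φ q) * u q, ?_, ?_, ?_⟩, k' ∘ k, hk''.comp hk, ?_, ?_⟩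
  · exact (AnalyticAt.fun_comp_of_eq hu' h.diffeo.analytic h.diffeo.map_zero).mul hu
  · simp only [h.diffeo.map_zero]
    exact mul_ne_zero hu0' hu0
  · filter_upwards [hue, h.diffeo.tendsto.eventually hue', h.diffeo.analytic.eventually_analyticAt,
      h.diffeo.tendsto.eventually h'.diffeo.analytic.eventually_analyticAt] with q h1 h2 h3 h4
    rw [(h4.differentiableAt.hasFDerivAt.comp q h3.differentiableAt.hasFDerivAt).fderiv,
      ← ContinuousLinearMap.comp_assoc, Function.comp_apply, h2, ContinuousLinearMap.smul_comp, h1,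
      smul_smul]
  · rw [(hk''.differentiableAt.hasDerivAt.comp (f 0) hk.differentiableAt.hasDerivAt).deriv, hkf]
    exact mul_ne_zero hk0' hk0
  · filter_upwards [hke, h.diffeo.tendsto.eventually hke'] with q h1 h2
    rw [Function.comp_apply, h2, h1]
    rfl

theorem IsConjugacy.symm (h : IsConjugacy ω f ω' f' Φ) (hf : ContinuousAt f 0) {Ψ : ℂ × ℂ → ℂ × ℂ} (hΨ : IsDiffeoGerm₂ Ψ)
    (hΦΨ : ∀ᶠ q in 𝓝 0, Φ (Ψ q) = q) : IsConjugacy ω' f' ω f Ψ := by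
  obtain ⟨u, hu, hu0, hue⟩ := h.map_form
  obtain ⟨k, hk, hk0, hke⟩ := h.map_regular
  have hkf : k (f 0) = f' 0 := by
    have := hke.self_of_nhds
    rw [h.diffeo.map_zero] at this
    exact this.symm
  have huΨ : AnalyticAt ℂ (fun q => u (Ψ q)) 0 := AnalyticAt.fun_comp_of_eq hu hΨ.analytic hΨ.map_zero
  have hu0Ψ : u (Ψ 0) ≠ 0 := by rwa [hΨ.map_zero]
  have hkd : HasDerivAt (fun w => k (w + f 0) - f' 0) (deriv k (f 0)) 0 := by
    have h1 : HasDerivAt (fun w => k (w + f 0)) (deriv k (f 0)) 0 := by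
      refine HasDerivAt.comp_add_const (0 : ℂ) (f 0) ?_
      rw [zero_add]
      exact hk.differentiableAt.hasDerivAt
    exact h1.sub_const _
  have hK : IsDiffeoGerm₁ fun w => k (w + f 0) - f' 0 := by
    refine ⟨?_, by simp [hkf], by rw [hkd.deriv]; exact hk0⟩
    exact (AnalyticAt.fun_comp_of_eq hk (analyticAt_id.add analyticAt_const) (by simp)).sub
      analyticAt_const
  obtain ⟨σ, hσ, hσk, -⟩ := hK.exists_inverse
  refine ⟨hΨ, ⟨fun q => (u (Ψ q))⁻¹, huΨ.inv hu0Ψ, inv_ne_zero hu0Ψ, ?_⟩,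
    fun w => σ (w - f' 0) + f 0, ?_, ?_, ?_⟩
  · filter_upwards [eventually_fderiv_comp_fderiv h.diffeo hΨ hΦΨ, hΨ.tendsto.eventually hue, hΦΨ,
      huΨ.continuousAt.eventually_ne hu0Ψ] with q h1 h2 h3 h4
    rw [h3] at h2
    have h5 := congrArg (fun L => L.comp (fderiv ℂ Ψ q)) h2
    simp only [ContinuousLinearMap.comp_assoc, h1, ContinuousLinearMap.comp_id,
      ContinuousLinearMap.smul_comp] at h5
    rw [h5, smul_smul, inv_mul_cancel₀ h4, one_smul]
  · exact (AnalyticAt.fun_comp_of_eq hσ.analytic (analyticAt_id.sub analyticAt_const) (by simp)).add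
      analyticAt_const
  · have h1 : HasDerivAt (fun w => σ (w - f' 0) + f 0) (deriv σ 0) (f' 0) := by
      refine HasDerivAt.add_const (f 0) (HasDerivAt.comp_sub_const (f' 0) (f' 0) ?_)
      rw [sub_self]
      exact hσ.hasDerivAt
    rw [h1.deriv]
    exact hσ.deriv_ne
  · have ht : Tendsto (fun q => f (Ψ q) - f 0) (𝓝 0) (𝓝 0) := by
      have := (hf.tendsto.comp hΨ.tendsto).sub_const (f 0)
      rwa [sub_self] at this
    filter_upwards [ht.eventually hσk, hΨ.tendsto.eventually hke, hΦΨ] with q h1 h2 h3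
    rw [sub_add_cancel, ← h2, h3] at h1
    rw [h1, sub_add_cancel]

end

/-! ### Transport of tangent curves, holonomies and slidings by a conjugacy. -/

theorem wedge_comp (α β : ℂ × ℂ →L[ℂ] ℂ) (A : ℂ × ℂ →L[ℂ] ℂ × ℂ) :
    wedge (α.comp A) (β.comp A) =
      wedge α β * ((A (1, 0)).1 * (A (0, 1)).2 - (A (0, 1)).1 * (A (1, 0)).2) := by
  have hlin : ∀ (γ : ℂ × ℂ →L[ℂ] ℂ) (v : ℂ × ℂ), γ v = v.1 * γ (1, 0) + v.2 * γ (0, 1) := by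
    intro γ v
    rw [← smul_eq_mul, ← smul_eq_mul, ← map_smul, ← map_smul, ← map_add]
    simp
  simp only [wedge, ContinuousLinearMap.comp_apply]
  rw [hlin α (A (1, 0)), hlin α (A (0, 1)), hlin β (A (1, 0)), hlin β (A (0, 1))]
  ring

theorem wedge_smul (a b : ℂ) (α β : ℂ × ℂ →L[ℂ] ℂ) : wedge (a • α) (b • β) = a * b * wedge α β := by
  simp only [wedge, smul_apply, smul_eq_mul]
  ring

theorem IsSmoothCurve.tendsto {c : ℂ → ℂ × ℂ} (h : IsSmoothCurve c) : Tendsto c (𝓝 0) (𝓝 0) := by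
  have := h.analytic.continuousAt.tendsto
  rwa [h.map_zero] at this

theorem IsSmoothCurve.hasDerivAt {c : ℂ → ℂ × ℂ} (h : IsSmoothCurve c) :
    HasDerivAt c (deriv c 0) 0 := h.analytic.differentiableAt.hasDerivAt

theorem IsDiffeoGerm₂.hasDerivAt_comp {Φ : ℂ × ℂ → ℂ × ℂ} (hΦ : IsDiffeoGerm₂ Φ) {c : ℂ → ℂ × ℂ}
    (h : IsSmoothCurve c) : HasDerivAt (Φ ∘ c) (fderiv ℂ Φ 0 (deriv c 0)) 0 :=
  HasFDerivAt.comp_hasDerivAt_of_eq (0 : ℂ) hΦ.hasFDerivAt h.hasDerivAt h.map_zero.symm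

theorem IsDiffeoGerm₂.isSmoothCurve_comp {Φ : ℂ × ℂ → ℂ × ℂ} (hΦ : IsDiffeoGerm₂ Φ) {c : ℂ → ℂ × ℂ}
    (h : IsSmoothCurve c) : IsSmoothCurve (Φ ∘ c) := by
  refine ⟨AnalyticAt.comp_of_eq hΦ.analytic h.analytic h.map_zero, ?_, fun h0 => ?_⟩
  · simp [h.map_zero, hΦ.map_zero]
  · rw [(hΦ.hasDerivAt_comp h).deriv] at h0
    exact h.deriv_ne (hΦ.injective h0)

/-- A germ vanishing at the origin is a combination of the coordinates. -/
theorem exists_hadamard {F : ℂ × ℂ → ℂ} (hF : AnalyticAt ℂ F 0) (h0 : F 0 = 0) :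
    ∃ a b : ℂ × ℂ → ℂ, AnalyticAt ℂ a 0 ∧ AnalyticAt ℂ b 0 ∧ (∀ q, F q = q.1 * a q + q.2 * b q) ∧
      ∀ v, fderiv ℂ F 0 v = v.1 * a 0 + v.2 * b 0 := by
  have hG : AnalyticAt ℂ (fun q : ℂ × ℂ => F (q.2, q.1)) 0 :=
    AnalyticAt.fun_comp_of_eq hF (analyticAt_snd.prod analyticAt_fst) rfl
  have hd1 : AnalyticAt ℂ (dsl fun q : ℂ × ℂ => F (q.2, q.1)) 0 := analyticAt_dsl hG hG
  have ha : AnalyticAt ℂ (fun q : ℂ × ℂ => (dsl fun q : ℂ × ℂ => F (q.2, q.1)) (0, q.1)) 0 :=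
    AnalyticAt.fun_comp_of_eq (g := dsl fun q : ℂ × ℂ => F (q.2, q.1)) hd1
      (analyticAt_const.prod analyticAt_fst) rfl
  have hb : AnalyticAt ℂ (dsl F) 0 := analyticAt_dsl hF hF
  have he : ∀ q : ℂ × ℂ, F q = q.1 * (dsl fun q : ℂ × ℂ => F (q.2, q.1)) (0, q.1) + q.2 * dsl F q := by
    intro q
    have h1 := dsl_mul F q
    have h2 := dsl_mul (fun q : ℂ × ℂ => F (q.2, q.1)) (0, q.1)
    simp only at h2
    rw [h1, h2, Prod.mk_zero_zero, h0]
    ring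
  refine ⟨_, _, ha, hb, he, fun v => ?_⟩
  have h1 := (hasFDerivAt_fst (𝕜 := ℂ) (p := (0 : ℂ × ℂ))).mul ha.differentiableAt.hasFDerivAt
  have h2 := (hasFDerivAt_snd (𝕜 := ℂ) (p := (0 : ℂ × ℂ))).mul hb.differentiableAt.hasFDerivAt
  have h3 := (h1.add h2).congr_of_eventuallyEq (Eventually.of_forall he)
  rw [h3.fderiv]
  simp [mul_comm]

section
variable {ω ω' : OneForm} {f f' : ℂ × ℂ → ℂ} {s₁ s₂ s₁' s₂' t : ℂ → ℂ × ℂ} {Φ : ℂ × ℂ → ℂ × ℂ}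
  {ε : ℤˣ} {g g' h φ : ℂ → ℂ}

theorem IsTangentCurve.map (ht : IsTangentCurve ω f t) (hΦ : IsConjugacy ω f ω' f' Φ)
    (hf : AnalyticAt ℂ f 0) (hf' : AnalyticAt ℂ f' 0) : IsTangentCurve ω' f' (Φ ∘ t) := by
  obtain ⟨u, -, -, hue⟩ := hΦ.map_form
  obtain ⟨k, hk, -, hke⟩ := hΦ.map_regular
  obtain ⟨Ψ, hΨ, hΨΦ, hΦΨ⟩ := hΦ.diffeo.exists_inverse
  refine ⟨hΦ.diffeo.isSmoothCurve_comp ht.smooth, ?_⟩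
  have hev : ∀ᶠ q in 𝓝 (0 : ℂ × ℂ), wedge (ω q) (fderiv ℂ f q) = 0 →
      wedge (ω' (Φ q)) (fderiv ℂ f' (Φ q)) = 0 := by
    filter_upwards [hue, hke.eventually_nhds, hf.eventually_analyticAt,
      hf.continuousAt.eventually hk.eventually_analyticAt,
      hΦ.diffeo.tendsto.eventually hf'.eventually_analyticAt,
      hΦ.diffeo.analytic.eventually_analyticAt, hΨΦ, hΦ.diffeo.tendsto.eventually
        (eventually_fderiv_comp_fderiv hΦ.diffeo hΨ hΦΨ)] with q h1 h2 h3 h4 h5 h6 h7 h8 h0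
    rw [h7] at h8
    have h9 : (fderiv ℂ f' (Φ q)).comp (fderiv ℂ Φ q) = deriv k (f q) • fderiv ℂ f q :=
      (h5.differentiableAt.hasFDerivAt.comp q h6.differentiableAt.hasFDerivAt).unique
        ((h4.differentiableAt.hasDerivAt.comp_hasFDerivAt q
          h3.differentiableAt.hasFDerivAt).congr_of_eventuallyEq h2)
    -- The differential of `Φ` is invertible, so forms at `Φ q` are recovered from their pull-backs;
    -- the wedge product changes only by scalar factors.
    have key : ∀ α : ℂ × ℂ →L[ℂ] ℂ, α = (α.comp (fderiv ℂ Φ q)).comp (fderiv ℂ Ψ (Φ q)) := by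
      intro α
      rw [ContinuousLinearMap.comp_assoc, h8, ContinuousLinearMap.comp_id]
    rw [key (ω' (Φ q)), key (fderiv ℂ f' (Φ q)), h1, h9, wedge_comp, wedge_smul, h0, mul_zero, zero_mul]
  filter_upwards [ht.tangent, ht.smooth.tendsto.eventually hev] with z h1 h2 using h2 h1

/-- A biholomorphism lifts to the blowing-up, so the image of the lifted path is a lifted path. On
the exceptional line it acts by its differential, which respects the two separatrix directions;
hence the loop keeps its form and its sense `ε`. -/
theorem IsHolonomy.map (hh : IsHolonomy ω s₁ s₂ t ε h) (hΦ : IsDiffeoGerm₂ Φ)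
    (hform : ∃ u : ℂ × ℂ → ℂ, ∀ᶠ q in 𝓝 (0 : ℂ × ℂ), (ω' (Φ q)).comp (fderiv ℂ Φ q) = u q • ω q)
    (ht : IsSmoothCurve t) {μ₁ μ₂ : ℂ} (hμ₁ : μ₁ ≠ 0) (hμ₂ : μ₂ ≠ 0)
    (h₁ : fderiv ℂ Φ 0 (deriv s₁ 0) = μ₁ • deriv s₁' 0)
    (h₂ : fderiv ℂ Φ 0 (deriv s₂ 0) = μ₂ • deriv s₂' 0) : IsHolonomy ω' s₁' s₂' (Φ ∘ t) ε h := by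
  obtain ⟨hd, α, β, r, K, hα, hβ, hr, ht0, hKc, hKne, hK0, hK⟩ := hh
  obtain ⟨u, hue⟩ := hform
  obtain ⟨Ψ, hΨ, hΨΦ, -⟩ := hΦ.exists_inverse
  obtain ⟨a, b, ha, hb, hab, hab'⟩ := exists_hadamard
    (AnalyticAt.fun_comp_of_eq analyticAt_fst hΦ.analytic rfl) (by simp [hΦ.map_zero])
  obtain ⟨c, d, hc, hdd, hcd, hcd'⟩ := exists_hadamard
    (AnalyticAt.fun_comp_of_eq analyticAt_snd hΦ.analytic rfl) (by simp [hΦ.map_zero])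
  have hN0 : ∀ v, fderiv ℂ Φ 0 v = (v.1 * a 0 + v.2 * b 0, v.1 * c 0 + v.2 * d 0) := by
    intro v
    rw [← hab', ← hcd']
    have e1 := (hasFDerivAt_fst (𝕜 := ℂ) (p := Φ 0)).comp (0 : ℂ × ℂ) hΦ.hasFDerivAt
    have e2 := (hasFDerivAt_snd (𝕜 := ℂ) (p := Φ 0)).comp (0 : ℂ × ℂ) hΦ.hasFDerivAt
    ext
    · exact (DFunLike.congr_fun e1.fderiv v).symm
    · exact (DFunLike.congr_fun e2.fderiv v).symm
  -- The lift of `Φ` to the blowing-up: `Φ (z k) = z N z k`, by Hadamard's decomposition of the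
  -- components, with `N 0` the differential at the origin.
  let N : ℂ → ℂ × ℂ → ℂ × ℂ := fun z k =>
    (k.1 * a (z • k) + k.2 * b (z • k), k.1 * c (z • k) + k.2 * d (z • k))
  have hN : ∀ z k, z • N z k = Φ (z • k) := by
    intro z k
    ext
    · change z * (k.1 * a (z • k) + k.2 * b (z • k)) = _
      rw [hab (z • k), Prod.smul_fst, Prod.smul_snd, smul_eq_mul, smul_eq_mul]
      ring
    · change z * (k.1 * c (z • k) + k.2 * d (z • k)) = _
      rw [hcd (z • k), Prod.smul_fst, Prod.smul_snd, smul_eq_mul, smul_eq_mul]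
      ring
  have hNz : ∀ k, N 0 k = fderiv ℂ Φ 0 k := by
    intro k
    rw [hN0]
    simp only [N, zero_smul]
  obtain ⟨ρ, hρ, hball⟩ := Metric.eventually_nhds_iff_ball.mp (hue.and
    (hΦ.analytic.eventually_analyticAt.and (hΨΦ.and (ha.eventually_analyticAt.and
      (hb.eventually_analyticAt.and (hc.eventually_analyticAt.and hdd.eventually_analyticAt))))))
  have hsub : Set.Icc (0 : ℝ) 1 ×ˢ Metric.closedBall (0 : ℂ) (r / 2) ⊆
      Set.Icc (0 : ℝ) 1 ×ˢ Metric.ball (0 : ℂ) r :=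
    Set.prod_mono le_rfl (Metric.closedBall_subset_ball (by linarith))
  obtain ⟨C, hC⟩ := (isCompact_Icc.prod (isCompact_closedBall (0 : ℂ) (r / 2))).exists_bound_of_continuousOn
    (hKc.mono hsub)
  have hC0 : 0 < |C| + 1 := by positivity
  -- Small enough for all the points of the paths to lie in the ball of radius `ρ` where the
  -- identities for `Φ` hold.
  set r' := min (r / 2) (ρ / (|C| + 1)) with hr'
  have hr'0 : 0 < r' := lt_min (by positivity) (by positivity)
  have hz_r : ∀ z ∈ Metric.ball (0 : ℂ) r', z ∈ Metric.ball (0 : ℂ) r := fun z hz =>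
    Metric.ball_subset_ball ((min_le_left _ _).trans (by linarith)) hz
  have hmem : ∀ θ ∈ Set.Icc (0 : ℝ) 1, ∀ z ∈ Metric.ball (0 : ℂ) r',
      z • K θ z ∈ Metric.ball (0 : ℂ × ℂ) ρ := by
    intro θ hθ z hz
    have hz' : ‖z‖ < r' := mem_ball_zero_iff.mp hz
    have h1 : ‖K θ z‖ ≤ |C| + 1 := (hC (θ, z) ⟨hθ, Metric.ball_subset_closedBall
      (Metric.ball_subset_ball (min_le_left _ _) hz)⟩).trans ((le_abs_self C).trans (by linarith))
    rw [mem_ball_zero_iff, norm_smul]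
    calc ‖z‖ * ‖K θ z‖ ≤ ‖z‖ * (|C| + 1) := by gcongr
      _ < ρ := by
        rw [← lt_div_iff₀ hC0]
        exact hz'.trans_le (min_le_right _ _)
  refine ⟨hd, α * μ₁, β * μ₂, r', fun θ z => N z (K θ z), mul_ne_zero hα hμ₁, mul_ne_zero hβ hμ₂,
    hr'0, ?_, ?_, ?_, ?_, ?_⟩
  · rw [(hΦ.hasDerivAt_comp ht).deriv, ht0, map_add, map_smul, map_smul, h₁, h₂, smul_smul, smul_smul]
  · have hKc' : ContinuousOn (Function.uncurry K) (Set.Icc 0 1 ×ˢ Metric.ball 0 r') :=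
      hKc.mono (Set.prod_mono le_rfl fun z hz => hz_r z hz)
    have hzK : ContinuousOn (fun p : ℝ × ℂ => p.2 • Function.uncurry K p)
        (Set.Icc 0 1 ×ˢ Metric.ball 0 r') := continuousOn_snd.smul hKc'
    have hm : Set.MapsTo (fun p : ℝ × ℂ => p.2 • Function.uncurry K p)
        (Set.Icc 0 1 ×ˢ Metric.ball 0 r') (Metric.ball (0 : ℂ × ℂ) ρ) := fun p hp => hmem p.1 hp.1 p.2 hp.2
    have hco : ∀ G : ℂ × ℂ → ℂ, (∀ q ∈ Metric.ball (0 : ℂ × ℂ) ρ, AnalyticAt ℂ G q) →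
        ContinuousOn (fun p : ℝ × ℂ => G (p.2 • Function.uncurry K p))
          (Set.Icc 0 1 ×ˢ Metric.ball 0 r') := fun G hG =>
      ContinuousOn.comp (fun q hq => (hG q hq).continuousAt.continuousWithinAt) hzK hm
    have ca := hco a fun q hq => (hball q hq).2.2.2.1
    have cb := hco b fun q hq => (hball q hq).2.2.2.2.1
    have cc := hco c fun q hq => (hball q hq).2.2.2.2.2.1
    have cd := hco d fun q hq => (hball q hq).2.2.2.2.2.2
    exact ((hKc'.fst.mul ca).add (hKc'.snd.mul cb)).prodMk ((hKc'.fst.mul cc).add (hKc'.snd.mul cd))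
  · intro θ hθ z hz h0
    have hk := hKne θ hθ z (hz_r z hz)
    replace h0 : N z (K θ z) = 0 := h0
    rcases eq_or_ne z 0 with rfl | hz0
    · rw [hNz] at h0
      exact hk (hΦ.injective h0)
    · have h1 := hN z (K θ z)
      rw [h0, smul_zero] at h1
      have h2 := (hball _ (hmem θ hθ z hz)).2.2.1
      rw [← h1, hΨ.map_zero] at h2
      exact (smul_ne_zero hz0 hk) h2.symm
  · intro θ hθ
    obtain ⟨κ, hκ⟩ := hK0 θ hθ
    refine ⟨κ, ?_⟩
    change N 0 (K θ 0) = _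
    rw [hNz, hκ, map_smul, map_add, map_smul, map_smul, h₁, h₂, smul_smul, smul_smul, mul_assoc]
  · intro z hz
    obtain ⟨e1, e2, e3⟩ := hK z (hz_r z hz)
    refine ⟨(hN _ _).trans (congrArg Φ e1), (hN _ _).trans (congrArg Φ e2), fun θ hθ => ?_⟩
    obtain ⟨w, hw, hw0⟩ := e3 θ hθ
    obtain ⟨h3, h4, -⟩ := hball _ (hmem θ hθ z hz)
    refine ⟨fderiv ℂ Φ (z • K θ z) w, ?_, ?_⟩
    · simp only [hN]
      exact (h4.differentiableAt.hasFDerivAt.restrictScalars ℝ).comp_hasDerivWithinAt θ hw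
    · change ω' (z • N z (K θ z)) _ = 0
      rw [hN, ← ContinuousLinearMap.comp_apply, h3, smul_apply, hw0, smul_zero]

/-- The image tangent curve `Φ ∘ t` keeps the same holonomy `h`, and the projection becomes `φ ∘ p`.
-/
theorem IsSliding.map (hs : IsSliding ω f s₁ s₂ ε g) (hΦ : IsConjugacy ω f ω' f' Φ)
    (hf : AnalyticAt ℂ f 0) (hf' : AnalyticAt ℂ f' 0) (hs₁ : IsSmoothCurve s₁)
    (hs₁' : IsSmoothCurve s₁') (hφ : IsDiffeoGerm₁ φ) (hr : RestrictsTo Φ s₁ s₁' φ) {μ : ℂ} (hμ : μ ≠ 0)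
    (h₂ : fderiv ℂ Φ 0 (deriv s₂ 0) = μ • deriv s₂' 0) (hg' : IsDiffeoGerm₁ g')
    (hgg' : g' ∘ φ =ᶠ[𝓝 0] φ ∘ g) : IsSliding ω' f' s₁' s₂' ε g' := by
  obtain ⟨hg, t, h, p, ht, hh, ⟨hp, hpl⟩, hgp⟩ := hs
  obtain ⟨u, -, -, hue⟩ := hΦ.map_form
  obtain ⟨k, -, -, hke⟩ := hΦ.map_regular
  have h₁ : fderiv ℂ Φ 0 (deriv s₁ 0) = deriv φ 0 • deriv s₁' 0 :=
    (hΦ.diffeo.hasDerivAt_comp hs₁).unique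
      ((HasDerivAt.scomp_of_eq (0 : ℂ) hs₁'.hasDerivAt hφ.hasDerivAt
        hφ.map_zero.symm).congr_of_eventuallyEq hr)
  refine ⟨hg', Φ ∘ t, h, φ ∘ p, ht.map hΦ hf hf', hh.map hΦ.diffeo ⟨u, hue⟩ ht.smooth hφ.deriv_ne hμ h₁ h₂,
    ⟨hφ.comp hp, ?_⟩, ?_⟩
  · filter_upwards [hpl, ht.smooth.tendsto.eventually hke,
      (hs₁.tendsto.comp hp.tendsto).eventually hke, hp.tendsto.eventually hr] with z h1 h2 h3 h4
    simp only [Function.comp_apply] at *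
    rw [h2, h1, ← h3, h4]
  · filter_upwards [hgp, hp.tendsto.eventually hgg'] with z h1 h2
    simp only [Function.comp_apply] at *
    rw [h2, h1]

end

/-! ### Linear parts, separatrix directions and the normal form. -/

section
variable {ω ω' : OneForm} {f f' : ℂ × ℂ → ℂ} {s₁ s₂ s₁' s₂' s : ℂ → ℂ × ℂ} {Φ : ℂ × ℂ → ℂ × ℂ}
  {φ : ℂ → ℂ}

/-- The linear part at the origin of the pull-back of a form. -/
theorem hasFDerivAt_pullback (hω : AnalyticAt ℂ ω 0) (hω0 : ω 0 = 0) (hΦ : AnalyticAt ℂ Φ 0)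
    (hΦ0 : Φ 0 = 0) (w : ℂ × ℂ) :
    HasFDerivAt (fun q => ω (Φ q) (fderiv ℂ Φ q w))
      (((fderiv ℂ ω 0).flip (fderiv ℂ Φ 0 w)).comp (fderiv ℂ Φ 0)) 0 := by
  have h1 : HasFDerivAt (fun q => ω (Φ q)) ((fderiv ℂ ω 0).comp (fderiv ℂ Φ 0)) 0 := by
    refine HasFDerivAt.comp (0 : ℂ × ℂ) ?_ hΦ.differentiableAt.hasFDerivAt
    rw [hΦ0]
    exact hω.differentiableAt.hasFDerivAt
  have h2 : HasFDerivAt (fun q => fderiv ℂ Φ q w) (fderiv ℂ (fun q => fderiv ℂ Φ q w) 0) 0 :=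
    (hΦ.fderiv.differentiableAt.clm_apply (differentiableAt_const w)).hasFDerivAt
  refine (h1.clm_apply h2).congr_fderiv ?_
  refine ContinuousLinearMap.ext fun v => ?_
  simp [hΦ0, hω0]

/-- Differentiate the invariance at the origin. The tangent direction is isotropic for the linear
part of `ω`, seen as a bilinear form. -/
theorem IsSeparatrix.residue (hs : IsSeparatrix ω s) (hω : AnalyticAt ℂ ω 0) (hω0 : ω 0 = 0) :
    fderiv ℂ ω 0 (deriv s 0) (deriv s 0) = 0 := by
  have h1 : HasDerivAt (fun z => ω (s z)) (fderiv ℂ ω 0 (deriv s 0)) 0 :=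
    HasFDerivAt.comp_hasDerivAt_of_eq (0 : ℂ) hω.differentiableAt.hasFDerivAt hs.smooth.hasDerivAt
      hs.smooth.map_zero.symm
  have h2 := h1.clm_apply hs.smooth.analytic.deriv.differentiableAt.hasDerivAt
  have h3 := h2.unique ((hasDerivAt_const (0 : ℂ) (0 : ℂ)).congr_of_eventuallyEq hs.invariant)
  simpa [hs.smooth.map_zero, hω0] using h3

theorem exists_smul_add_smul {a b : ℂ × ℂ} (h : LinearIndependent ℂ ![a, b]) (v : ℂ × ℂ) :
    ∃ x y : ℂ, v = x • a + y • b := by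
  have h1 := h.span_eq_top_of_card_eq_finrank' (by simp)
  have h2 : v ∈ Submodule.span ℂ (Set.range ![a, b]) := h1 ▸ Submodule.mem_top
  rw [Matrix.range_cons, Matrix.range_cons, Matrix.range_empty, Set.union_empty, Set.singleton_union,
    Submodule.mem_span_pair] at h2
  obtain ⟨x, y, h⟩ := h2
  exact ⟨x, y, h.symm⟩

/-- The quadratic form of the linear part is `(l₁ + l₂) x y`, with `l₁ + l₂ ≠ 0`, so the isotropic
lines are the axes and the separatrices are tangent to them. The labelling is unknown, but
exchanging the axes inverts `l₂ / l₁`, which preserves the hypothesis. -/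
theorem IsPair.residues (hP : IsPair ω f s₁ s₂) :
    fderiv ℂ ω 0 (deriv s₁ 0) (deriv s₂ 0) ≠ 0 ∧ -csIndex ω s₁ s₂ ≠ 0 ∧
      ∀ q : ℚ, q < 0 → -csIndex ω s₁ s₂ ≠ q := by
  obtain ⟨a, b, l₁, l₂, hab, hl₁, hl₂, hq, hlin⟩ := hP.reduced.linear_part
  have r₁ := hP.sep₁.residue hP.reduced.analytic hP.reduced.map_zero
  have r₂ := hP.sep₂.residue hP.reduced.analytic hP.reduced.map_zero
  obtain ⟨x, y, hv⟩ := exists_smul_add_smul hab (deriv s₁ 0)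
  obtain ⟨x', y', hv'⟩ := exists_smul_add_smul hab (deriv s₂ 0)
  have hsum : l₁ + l₂ ≠ 0 := by
    intro h
    refine hq (-1) (by norm_num) ?_
    rw [div_eq_iff hl₁]
    push_cast
    linear_combination h
  have hv0 := hP.sep₁.smooth.deriv_ne
  have hv0' := hP.sep₂.smooth.deriv_ne
  have hdet : x * y' - y * x' ≠ 0 := by
    intro h0
    have h1 := LinearIndependent.pair_iff.mp hP.distinct
    rw [hv, hv'] at h1
    by_cases hx : x = 0 ∧ y = 0
    · rw [hv, hx.1, hx.2] at hv0
      simp at hv0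
    · have e1 := h1 x' (-x) (by
        rw [smul_add, smul_add, smul_smul, smul_smul, smul_smul, smul_smul, mul_comm x' x, neg_mul,
          neg_mul, neg_smul, neg_smul, show x' * y = x * y' by linear_combination -h0]
        abel)
      have e2 := h1 y' (-y) (by
        rw [smul_add, smul_add, smul_smul, smul_smul, smul_smul, smul_smul, mul_comm y' y, neg_mul,
          neg_mul, neg_smul, neg_smul, show y' * x = y * x' by linear_combination h0]
        abel)
      exact hx ⟨neg_eq_zero.mp e1.2, neg_eq_zero.mp e2.2⟩
  rw [hv, hlin] at r₁
  rw [hv', hlin] at r₂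
  have r₁' : y * x = 0 := by
    refine (mul_eq_zero.mp ?_).resolve_left hsum
    linear_combination r₁
  have r₂' : y' * x' = 0 := by
    refine (mul_eq_zero.mp ?_).resolve_left hsum
    linear_combination r₂
  have e12 : fderiv ℂ ω 0 (deriv s₁ 0) (deriv s₂ 0) = l₁ * y * x' + l₂ * x * y' := by rw [hv, hv', hlin]
  have e21 : fderiv ℂ ω 0 (deriv s₂ 0) (deriv s₁ 0) = l₁ * y' * x + l₂ * x' * y := by rw [hv, hv', hlin]
  rw [csIndex, neg_neg, e12, e21]
  rcases mul_eq_zero.mp r₁' with hy | hx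
  · subst hy
    have hx : x ≠ 0 := by rintro rfl; simp at hdet
    have hy' : y' ≠ 0 := by rintro rfl; simp at hdet
    have : (l₁ * y' * x + l₂ * x' * 0) / (l₁ * 0 * x' + l₂ * x * y') = l₁ / l₂ := by
      field_simp
      ring
    rw [this]
    refine ⟨by simp [hl₂, hx, hy'], div_ne_zero hl₁ hl₂, fun q hq0 h => hq q⁻¹ (inv_lt_zero.mpr hq0) ?_⟩
    rw [← inv_div, h]
    push_cast
    rfl
  · subst hx
    have hy : y ≠ 0 := by rintro rfl; simp at hdet
    have hx' : x' ≠ 0 := by rintro rfl; simp at hdet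
    have : (l₁ * y' * 0 + l₂ * x' * y) / (l₁ * y * x' + l₂ * 0 * y') = l₂ / l₁ := by
      field_simp
      ring
    rw [this]
    exact ⟨by simp [hl₁, hx', hy], div_ne_zero hl₂ hl₁, hq⟩

/-- The parameter on `S₁` of the leaf of `f` through a point. -/
theorem exists_leafParameter (hf : AnalyticAt ℂ f 0) (hs : IsSmoothCurve s)
    (ht : fderiv ℂ f 0 (deriv s 0) ≠ 0) :
    ∃ F : ℂ × ℂ → ℂ, AnalyticAt ℂ F 0 ∧ F 0 = 0 ∧ (∀ᶠ z in 𝓝 0, F (s z) = z) ∧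
      (∀ᶠ q in 𝓝 0, f (s (F q)) = f q) ∧
      ∀ v, fderiv ℂ F 0 v * fderiv ℂ f 0 (deriv s 0) = fderiv ℂ f 0 v := by
  have hd : HasDerivAt (fun z => f (s z)) (fderiv ℂ f 0 (deriv s 0)) 0 :=
    HasFDerivAt.comp_hasDerivAt_of_eq (0 : ℂ) hf.differentiableAt.hasFDerivAt hs.hasDerivAt
      hs.map_zero.symm
  have hψ : IsDiffeoGerm₁ fun z => f (s z) - f 0 := by
    refine ⟨(AnalyticAt.fun_comp_of_eq hf hs.analytic hs.map_zero).sub analyticAt_const, ?_, ?_⟩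
    · simp [hs.map_zero]
    · rw [(hd.sub_const _).deriv]
      exact ht
  obtain ⟨σ, hσ, h1, h2⟩ := hψ.exists_inverse
  have hFa : AnalyticAt ℂ (fun q => σ (f q - f 0)) 0 :=
    AnalyticAt.fun_comp_of_eq (g := σ) (f := fun q => f q - f 0) (x := 0) (y := 0) hσ.analytic
      (hf.sub analyticAt_const) (by simp)
  have ht0 : Tendsto (fun q => f q - f 0) (𝓝 0) (𝓝 0) := by
    have := hf.continuousAt.tendsto.sub_const (f 0)
    rwa [sub_self] at this
  have h3 : ∀ᶠ q in 𝓝 0, f (s (σ (f q - f 0))) = f q := by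
    filter_upwards [ht0.eventually h2] with q hq
    linear_combination hq
  refine ⟨_, hFa, by simp [hσ.map_zero], h1, h3, fun v => ?_⟩
  have h4 := HasDerivAt.comp_hasFDerivAt_of_eq (0 : ℂ × ℂ) hd hFa.differentiableAt.hasFDerivAt
    (by simp [hσ.map_zero])
  have h5 := h4.unique (hf.differentiableAt.hasFDerivAt.congr_of_eventuallyEq h3)
  have h6 := DFunLike.congr_fun h5 v
  simp only [smul_apply, smul_eq_mul] at h6
  rw [mul_comm]
  exact h6

end

theorem exists_div_snd {P : ℂ × ℂ → ℂ} (hP : AnalyticAt ℂ P 0) (h0 : ∀ᶠ x in 𝓝 0, P (x, 0) = 0) :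
    ∃ p : ℂ × ℂ → ℂ, AnalyticAt ℂ p 0 ∧ (∀ᶠ q in 𝓝 0, P q = q.2 * p q) ∧ p 0 = fderiv ℂ P 0 (0, 1) := by
  refine ⟨dsl P, analyticAt_dsl hP hP, ?_, ?_⟩
  · filter_upwards [(continuous_fst.tendsto (0 : ℂ × ℂ)).eventually h0] with q hq
    rw [dsl_mul, hq, sub_zero]
  · exact (dsl_zero P 0).trans (deriv_snd_eq (p := 0) hP).deriv

theorem exists_div_fst {P : ℂ × ℂ → ℂ} (hP : AnalyticAt ℂ P 0) (h0 : ∀ᶠ y in 𝓝 0, P (0, y) = 0) :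
    ∃ p : ℂ × ℂ → ℂ, AnalyticAt ℂ p 0 ∧ (∀ᶠ q in 𝓝 0, P q = q.1 * p q) ∧ p 0 = fderiv ℂ P 0 (1, 0) := by
  have hsw : AnalyticAt ℂ (fun q : ℂ × ℂ => P (q.2, q.1)) 0 :=
    AnalyticAt.fun_comp_of_eq hP (analyticAt_snd.prod analyticAt_fst) rfl
  obtain ⟨p, hp, hPp, hp0⟩ := exists_div_snd hsw h0
  have hs : Tendsto (fun q : ℂ × ℂ => (q.2, q.1)) (𝓝 0) (𝓝 0) :=
    Continuous.tendsto' (by fun_prop) _ _ rfl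
  refine ⟨fun q => p (q.2, q.1), AnalyticAt.fun_comp_of_eq hp (analyticAt_snd.prod analyticAt_fst) rfl,
    hs.eventually hPp, hp0.trans ?_⟩
  exact (deriv_snd_eq (p := 0) hsw).unique (deriv_fst_eq (p := 0) hP)

section
variable {ω : OneForm} {f : ℂ × ℂ → ℂ} {s₁ s₂ : ℂ → ℂ × ℂ}

/-- Coordinates in which the separatrices are the axes and the leaves of the regular foliation are
the levels of `x + y`. -/
theorem IsPair.exists_coordinates (hP : IsPair ω f s₁ s₂) : ∃ (Ψ : ℂ × ℂ → ℂ × ℂ) (σ : ℂ → ℂ),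
    IsDiffeoGerm₂ Ψ ∧ IsDiffeoGerm₁ σ ∧ (∀ᶠ y in 𝓝 0, Ψ (0, y) = s₁ y) ∧
      (∀ᶠ x in 𝓝 0, Ψ (x, 0) = s₂ (σ x)) ∧ ∀ᶠ q in 𝓝 0, f (Ψ q) = f (s₁ (stdLevel q)) := by
  have hs₁ := hP.sep₁.smooth
  have hs₂ := hP.sep₂.smooth
  obtain ⟨F, hF, hF0, hFs, hfF, hFd⟩ := exists_leafParameter hP.regular.analytic hs₁ hP.transverse₁
  have hFa : fderiv ℂ F 0 (deriv s₁ 0) = 1 :=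
    mul_right_cancel₀ hP.transverse₁ ((hFd _).trans (one_mul _).symm)
  have hFb : fderiv ℂ F 0 (deriv s₂ 0) ≠ 0 := fun h => hP.transverse₂ (by rw [← hFd, h, zero_mul])
  let Ψ₀ : ℂ × ℂ → ℂ × ℂ := fun q => s₁ q.2 + s₂ q.1
  have hΨ₀a : AnalyticAt ℂ Ψ₀ 0 := (AnalyticAt.fun_comp_of_eq hs₁.analytic analyticAt_snd rfl).add
    (AnalyticAt.fun_comp_of_eq hs₂.analytic analyticAt_fst rfl)
  have hΨ₀0 : Ψ₀ 0 = 0 := by simp [Ψ₀, hs₁.map_zero, hs₂.map_zero]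
  have hΨ₀d : ∀ v, fderiv ℂ Ψ₀ 0 v = v.2 • deriv s₁ 0 + v.1 • deriv s₂ 0 := by
    have h1 := HasFDerivAt.comp (f := fun q : ℂ × ℂ => q.2) (0 : ℂ × ℂ) hs₁.hasDerivAt.hasFDerivAt
      hasFDerivAt_snd
    have h2 := HasFDerivAt.comp (f := fun q : ℂ × ℂ => q.1) (0 : ℂ × ℂ) hs₂.hasDerivAt.hasFDerivAt
      hasFDerivAt_fst
    have h3 : HasFDerivAt Ψ₀ _ 0 := h1.add h2
    intro v
    rw [h3.fderiv]
    simp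
  have hΨ₀ : IsDiffeoGerm₂ Ψ₀ := by
    refine ⟨hΨ₀a, hΨ₀0, isInvertible_of_injective fun v hv => ?_⟩
    rw [hΨ₀d] at hv
    have := LinearIndependent.pair_iff.mp hP.distinct _ _ hv
    exact Prod.ext this.2 this.1
  -- Starting from coordinates whose axes are the separatrices, take `F - y` as new abscissa, so
  -- that the leaf parameter `F` becomes `x + y`. As `F (s₁ y) = y`, the axis `x = 0` is kept.
  let χ : ℂ × ℂ → ℂ × ℂ := fun q => (F (Ψ₀ q) - q.2, q.2)
  have hFΨ : AnalyticAt ℂ (fun q => F (Ψ₀ q)) 0 := AnalyticAt.fun_comp_of_eq hF hΨ₀a hΨ₀0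
  have hχd : ∀ v, fderiv ℂ χ 0 v = (v.1 * fderiv ℂ F 0 (deriv s₂ 0), v.2) := by
    have h0 : HasFDerivAt F (fderiv ℂ F 0) (Ψ₀ 0) := by
      rw [hΨ₀0]
      exact hF.differentiableAt.hasFDerivAt
    have h1 := h0.comp (0 : ℂ × ℂ) hΨ₀.hasFDerivAt
    have h2 : HasFDerivAt χ _ 0 := (h1.sub hasFDerivAt_snd).prodMk hasFDerivAt_snd
    intro v
    rw [h2.fderiv]
    simp [hΨ₀d, hFa]
  have hχ : IsDiffeoGerm₂ χ := by
    refine ⟨(hFΨ.sub analyticAt_snd).prod analyticAt_snd, by simp [χ, hΨ₀0, hF0],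
      isInvertible_of_injective fun v hv => ?_⟩
    rw [hχd, Prod.mk_eq_zero] at hv
    exact Prod.ext ((mul_eq_zero.mp hv.1).resolve_right hFb) hv.2
  obtain ⟨χ', hχ', h1, h2⟩ := hχ.exists_inverse
  have hν : IsDiffeoGerm₁ fun x => F (s₂ x) := by
    have hd : HasDerivAt (fun x => F (s₂ x)) (fderiv ℂ F 0 (deriv s₂ 0)) 0 :=
      HasFDerivAt.comp_hasDerivAt_of_eq (0 : ℂ) hF.differentiableAt.hasFDerivAt hs₂.hasDerivAt
        hs₂.map_zero.symm
    exact ⟨AnalyticAt.fun_comp_of_eq hF hs₂.analytic hs₂.map_zero, by simp [hs₂.map_zero, hF0],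
      by rw [hd.deriv]; exact hFb⟩
  obtain ⟨σ, hσ, -, hσν⟩ := hν.exists_inverse
  have c1 : Tendsto (fun y : ℂ => ((0, y) : ℂ × ℂ)) (𝓝 0) (𝓝 0) :=
    Continuous.tendsto' (by fun_prop) _ _ rfl
  have c2 : Tendsto (fun x : ℂ => ((x, 0) : ℂ × ℂ)) (𝓝 0) (𝓝 0) :=
    Continuous.tendsto' (by fun_prop) _ _ rfl
  refine ⟨Ψ₀ ∘ χ', σ, hΨ₀.comp hχ', hσ, ?_, ?_, ?_⟩
  · filter_upwards [c1.eventually h1, hFs] with y h3 h4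
    have h5 : Ψ₀ (0, y) = s₁ y := by simp [Ψ₀, hs₂.map_zero]
    have h6 : χ (0, y) = (0, y) := by simp [χ, h5, h4]
    rw [h6] at h3
    rw [Function.comp_apply, h3, h5]
  · filter_upwards [hσ.tendsto.eventually (c2.eventually h1), hσν] with x h3 h4
    have h5 : Ψ₀ (σ x, 0) = s₂ (σ x) := by simp [Ψ₀, hs₁.map_zero]
    have h6 : χ (σ x, 0) = (x, 0) := by simp [χ, h5, h4]
    rw [h6] at h3
    rw [Function.comp_apply, h3, h5]
  · filter_upwards [h2, (hΨ₀.comp hχ').tendsto.eventually hfF] with q h3 h4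
    have h5 : F (Ψ₀ (χ' q)) - (χ' q).2 = q.1 := congrArg Prod.fst h3
    have h6 : (χ' q).2 = q.2 := (congrArg Prod.snd h3 : (χ (χ' q)).2 = q.2)
    rw [← h4, stdLevel, ← h5, ← h6, sub_add_cancel]
    rfl

/-- The normal form `y dx + x B dy`, `x + y` of a pair of foliations. -/
theorem IsPair.exists_normalForm (hP : IsPair ω f s₁ s₂) : ∃ (B : ℂ × ℂ → ℂ) (Ψ : ℂ × ℂ → ℂ × ℂ),
    IsCoeff B (-csIndex ω s₁ s₂) ∧ IsConjugacy (stdForm B) stdLevel ω f Ψ ∧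
      (∀ᶠ y in 𝓝 0, Ψ (0, y) = s₁ y) ∧ ∃ μ : ℂ, μ ≠ 0 ∧ fderiv ℂ Ψ 0 (1, 0) = μ • deriv s₂ 0 := by
  have hs₁ := hP.sep₁.smooth
  have hs₂ := hP.sep₂.smooth
  have hω := hP.reduced.analytic
  have hω0 := hP.reduced.map_zero
  obtain ⟨hres, hcs0, hcs⟩ := hP.residues
  obtain ⟨Ψ, σ, hΨ, hσ, hΨ₁, hΨ₂, hΨf⟩ := hP.exists_coordinates
  have c1 : Tendsto (fun y : ℂ => ((0, y) : ℂ × ℂ)) (𝓝 0) (𝓝 0) :=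
    Continuous.tendsto' (by fun_prop) _ _ rfl
  have c2 : Tendsto (fun x : ℂ => ((x, 0) : ℂ × ℂ)) (𝓝 0) (𝓝 0) :=
    Continuous.tendsto' (by fun_prop) _ _ rfl
  have hd1 : ∀ᶠ y in 𝓝 (0 : ℂ), fderiv ℂ Ψ (0, y) (0, 1) = deriv s₁ y := by
    filter_upwards [hΨ₁.eventually_nhds, c1.eventually hΨ.analytic.eventually_analyticAt,
      hs₁.analytic.eventually_analyticAt] with y h1 h2 h3
    have h4 : HasDerivAt (fun y => Ψ (0, y)) (fderiv ℂ Ψ (0, y) (0, 1)) y :=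
      h2.differentiableAt.hasFDerivAt.comp_hasDerivAt y ((hasDerivAt_const y (0 : ℂ)).prodMk (hasDerivAt_id y))
    exact h4.unique (h3.differentiableAt.hasDerivAt.congr_of_eventuallyEq h1)
  have hd2 : ∀ᶠ x in 𝓝 (0 : ℂ), fderiv ℂ Ψ (x, 0) (1, 0) = deriv σ x • deriv s₂ (σ x) := by
    filter_upwards [hΨ₂.eventually_nhds, c2.eventually hΨ.analytic.eventually_analyticAt,
      hσ.tendsto.eventually hs₂.analytic.eventually_analyticAt, hσ.analytic.eventually_analyticAt]
      with x h1 h2 h3 h4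
    have h5 : HasDerivAt (fun x => Ψ (x, 0)) (fderiv ℂ Ψ (x, 0) (1, 0)) x :=
      h2.differentiableAt.hasFDerivAt.comp_hasDerivAt x ((hasDerivAt_id x).prodMk (hasDerivAt_const x (0 : ℂ)))
    exact h5.unique ((HasDerivAt.scomp x h3.differentiableAt.hasDerivAt
      h4.differentiableAt.hasDerivAt).congr_of_eventuallyEq h1)
  have e1 : fderiv ℂ Ψ 0 (0, 1) = deriv s₁ 0 := hd1.self_of_nhds
  have e2 : fderiv ℂ Ψ 0 (1, 0) = deriv σ 0 • deriv s₂ 0 := by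
    have := hd2.self_of_nhds
    rwa [hσ.map_zero] at this
  have han : ∀ w, AnalyticAt ℂ (fun q => ω (Ψ q) (fderiv ℂ Ψ q w)) 0 := fun w =>
    ((ContinuousLinearMap.id ℂ (ℂ × ℂ →L[ℂ] ℂ)).analyticAt_bilinear _).fun_comp
      ((AnalyticAt.fun_comp_of_eq hω hΨ.analytic hΨ.map_zero).prod
        (((ContinuousLinearMap.apply ℂ (ℂ × ℂ) w).analyticAt _).fun_comp hΨ.analytic.fderiv))
  have hPx : ∀ᶠ x in 𝓝 (0 : ℂ), ω (Ψ (x, 0)) (fderiv ℂ Ψ (x, 0) (1, 0)) = 0 := by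
    filter_upwards [hd2, hΨ₂, hσ.tendsto.eventually hP.sep₂.invariant] with x h1 h2 h3
    rw [h1, h2, map_smul, h3, smul_zero]
  have hQy : ∀ᶠ y in 𝓝 (0 : ℂ), ω (Ψ (0, y)) (fderiv ℂ Ψ (0, y) (0, 1)) = 0 := by
    filter_upwards [hd1, hΨ₁, hP.sep₁.invariant] with y h1 h2 h3
    rw [h1, h2, h3]
  -- Invariance of the axes makes the pulled-back form `y p dx + x r dy`. The values of `p` and `r`
  -- at the origin are read off the linear part of `ω`; they give the unit `p` and `B = r / p`.
  obtain ⟨p, hp, hPp, hp0⟩ := exists_div_snd (han (1, 0)) hPx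
  obtain ⟨r, hr, hQr, hr0⟩ := exists_div_fst (han (0, 1)) hQy
  have hpb := fun w => (hasFDerivAt_pullback hω hω0 hΨ.analytic hΨ.map_zero w).fderiv
  rw [hpb] at hp0 hr0
  simp only [ContinuousLinearMap.comp_apply, ContinuousLinearMap.flip_apply, e1, e2, map_smul,
    smul_apply, smul_eq_mul] at hp0 hr0
  have hσ0 := hσ.deriv_ne
  have hp0' : p 0 ≠ 0 := by
    rw [hp0]
    exact mul_ne_zero hσ0 hres
  refine ⟨fun q => r q / p q, Ψ, ⟨hr.div hp hp0', ?_, hcs0, fun h => ?_⟩, ⟨hΨ, ⟨p, hp, hp0', ?_⟩,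
    fun z => f (s₁ z), ?_, ?_, hΨf⟩, hΨ₁, deriv σ 0, hσ0, e2⟩
  · simp only [hp0, hr0, csIndex, neg_neg]
    field_simp
  · refine hcs (-1) (by norm_num) ?_
    push_cast
    linear_combination h
  · filter_upwards [hPp, hQr, hp.continuousAt.eventually_ne hp0'] with q h1 h2 h3
    ext
    · simpa [stdForm_apply, mul_comm] using h1
    · have : (ω (Ψ q)) (fderiv ℂ Ψ q (0, 1)) = p q * (q.1 * (r q / p q)) := by
        rw [h2]
        field_simp
      simpa [stdForm_apply] using this
  · rw [show stdLevel 0 = 0 by simp [stdLevel]]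
    exact AnalyticAt.fun_comp_of_eq hP.regular.analytic hs₁.analytic hs₁.map_zero
  · have hd : HasDerivAt (fun z => f (s₁ z)) (fderiv ℂ f 0 (deriv s₁ 0)) 0 :=
      HasFDerivAt.comp_hasDerivAt_of_eq (0 : ℂ) hP.regular.analytic.differentiableAt.hasFDerivAt
        hs₁.hasDerivAt hs₁.map_zero.symm
    rw [show stdLevel 0 = 0 by simp [stdLevel], hd.deriv]
    exact hP.transverse₁

end

/-! ### The sliding as a complete invariant. -/

section
variable {ω ω' : OneForm} {f f' : ℂ × ℂ → ℂ} {s₁ s₂ s₁' s₂' s : ℂ → ℂ × ℂ} {Φ Ψ : ℂ × ℂ → ℂ × ℂ}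
  {B : ℂ × ℂ → ℂ} {lam : ℂ} {ε : ℤˣ} {g g' φ : ℂ → ℂ}

theorem isSmoothCurve_axis : IsSmoothCurve fun y : ℂ => ((0, y) : ℂ × ℂ) :=
  ⟨analyticAt_const.prod analyticAt_id, rfl, by rw [deriv_axis_snd]; simp⟩

theorem analyticAt_stdLevel : AnalyticAt ℂ stdLevel 0 := analyticAt_fst.add analyticAt_snd

theorem fderiv_inverse_apply (hΦ : IsDiffeoGerm₂ Φ) (hΨ : IsDiffeoGerm₂ Ψ)
    (h : ∀ᶠ q in 𝓝 0, Ψ (Φ q) = q) {v w : ℂ × ℂ} {μ : ℂ} (hμ : μ ≠ 0)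
    (hv : fderiv ℂ Φ 0 v = μ • w) : fderiv ℂ Ψ 0 w = μ⁻¹ • v := by
  have h1 := (eventually_fderiv_comp_fderiv hΨ hΦ h).self_of_nhds
  rw [hΦ.map_zero] at h1
  have h2 := DFunLike.congr_fun h1 v
  rw [ContinuousLinearMap.comp_apply, hv, map_smul, ContinuousLinearMap.id_apply] at h2
  rw [← h2, smul_smul, inv_mul_cancel₀ hμ, one_smul]

theorem isSliding_iff_of_isConjugacy (hΦ : IsConjugacy ω f ω' f' Φ) (hf : AnalyticAt ℂ f 0)
    (hf' : AnalyticAt ℂ f' 0) (hs₁ : IsSmoothCurve s₁) (hs₁' : IsSmoothCurve s₁')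
    (hr : RestrictsTo Φ s₁ s₁' id) {μ : ℂ} (hμ : μ ≠ 0)
    (h₂ : fderiv ℂ Φ 0 (deriv s₂ 0) = μ • deriv s₂' 0) :
    IsSliding ω f s₁ s₂ ε g ↔ IsSliding ω' f' s₁' s₂' ε g := by
  refine ⟨fun h => h.map hΦ hf hf' hs₁ hs₁' isDiffeoGerm₁_id hr hμ h₂ h.1 (EventuallyEq.refl _ _),
    fun h => ?_⟩
  obtain ⟨Ψ, hΨ, h1, h2⟩ := hΦ.diffeo.exists_inverse
  refine h.map (hΦ.symm hf.continuousAt hΨ h2) hf' hf hs₁' hs₁ isDiffeoGerm₁_id ?_ (inv_ne_zero hμ)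
    (fderiv_inverse_apply hΦ.diffeo hΨ h1 hμ h₂) h.1 (EventuallyEq.refl _ _)
  filter_upwards [hr, hs₁.tendsto.eventually h1] with z h3 h4
  exact (congrArg Ψ h3).symm.trans h4

theorem isSliding_std_iff (hP : IsPair ω f s₁ s₂) (hΨ : IsConjugacy (stdForm B) stdLevel ω f Ψ)
    (h1 : ∀ᶠ y in 𝓝 0, Ψ (0, y) = s₁ y) {μ : ℂ} (hμ : μ ≠ 0)
    (h2 : fderiv ℂ Ψ 0 (1, 0) = μ • deriv s₂ 0) :
    IsSliding (stdForm B) stdLevel (fun y => (0, y)) (fun x => (x, 0)) ε g ↔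
      IsSliding ω f s₁ s₂ ε g :=
  isSliding_iff_of_isConjugacy hΨ analyticAt_stdLevel hP.regular.analytic isSmoothCurve_axis
    hP.sep₁.smooth h1 hμ (by rw [deriv_axis_fst, h2])

theorem IsPair.exists_isSliding (hP : IsPair ω f s₁ s₂) (ε : ℤˣ) : ∃ g, IsSliding ω f s₁ s₂ ε g := by
  obtain ⟨B, Ψ, hB, hΨ, h1, μ, hμ, h2⟩ := hP.exists_normalForm
  obtain ⟨δ, U, H, h⟩ := exists_flowData hB
  obtain ⟨τ, hτ⟩ := exists_tangentData hB
  obtain ⟨g, hg, hgρ⟩ := h.exists_mono_rho hB hτ ε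
  exact ⟨g, (isSliding_std_iff hP hΨ h1 hμ h2).mp (h.isSliding hB hτ hg hgρ)⟩

/-- In the normal form both slidings have the same image under the injective germ `mono ∘ rho`. -/
theorem IsPair.isSliding_unique (hP : IsPair ω f s₁ s₂) (hg : IsSliding ω f s₁ s₂ ε g)
    (hg' : IsSliding ω f s₁ s₂ ε g') : g =ᶠ[𝓝 0] g' := by
  obtain ⟨B, Ψ, hB, hΨ, h1, μ, hμ, h2⟩ := hP.exists_normalForm
  obtain ⟨δ, U, H, h⟩ := exists_flowData hB
  obtain ⟨τ, hτ⟩ := exists_tangentData hB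
  have e1 := h.mono_rho_of_isSliding hB hτ ((isSliding_std_iff hP hΨ h1 hμ h2).mpr hg)
  have e2 := h.mono_rho_of_isSliding hB hτ ((isSliding_std_iff hP hΨ h1 hμ h2).mpr hg')
  refine ((isDiffeoGerm_mono h ε).comp (isDiffeoGerm_rho hB hτ h)).eventually_injective
    hg.1.tendsto hg'.1.tendsto ?_
  filter_upwards [e1, e2] with c h3 h4
  exact h3.trans h4.symm

/-- A conjugacy that sends `S₁` to `S₁'` sends the direction of `S₂` to that of `S₂'`. -/
theorem IsConjugacy.fderiv_separatrix (hΦ : IsConjugacy ω f ω' f' Φ) (hP : IsPair ω f s₁ s₂)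
    (hP' : IsPair ω' f' s₁' s₂') {ν : ℂ} (hν : ν ≠ 0)
    (h₁ : fderiv ℂ Φ 0 (deriv s₁ 0) = ν • deriv s₁' 0) :
    ∃ μ : ℂ, μ ≠ 0 ∧ fderiv ℂ Φ 0 (deriv s₂ 0) = μ • deriv s₂' 0 := by
  obtain ⟨u, hu, -, hue⟩ := hΦ.map_form
  have hω0 := hP.reduced.map_zero
  have hpb : ∀ v w, fderiv ℂ ω' 0 (fderiv ℂ Φ 0 v) (fderiv ℂ Φ 0 w) = u 0 * fderiv ℂ ω 0 v w := by
    intro v w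
    have e1 := hasFDerivAt_pullback hP'.reduced.analytic hP'.reduced.map_zero hΦ.diffeo.analytic
      hΦ.diffeo.map_zero w
    have e2 := hu.differentiableAt.hasFDerivAt.mul
      (hP.reduced.analytic.differentiableAt.hasFDerivAt.clm_apply (hasFDerivAt_const w (0 : ℂ × ℂ)))
    have e3 := e1.unique (e2.congr_of_eventuallyEq (hue.mono fun q hq => by
      simpa using DFunLike.congr_fun hq w))
    simpa [hω0] using DFunLike.congr_fun e3 v
  obtain ⟨x, y, hxy⟩ := exists_smul_add_smul hP'.distinct (fderiv ℂ Φ 0 (deriv s₂ 0))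
  have r₁ := hP'.sep₁.residue hP'.reduced.analytic hP'.reduced.map_zero
  have r₂ := hP'.sep₂.residue hP'.reduced.analytic hP'.reduced.map_zero
  have r := hpb (deriv s₂ 0) (deriv s₂ 0)
  rw [hP.sep₂.residue hP.reduced.analytic hω0, mul_zero, hxy] at r
  simp only [map_add, map_smul, add_apply, smul_apply, smul_eq_mul, r₁, r₂] at r
  obtain ⟨hres, -, hcs⟩ := hP'.residues
  have hsum : fderiv ℂ ω' 0 (deriv s₁' 0) (deriv s₂' 0) +
      fderiv ℂ ω' 0 (deriv s₂' 0) (deriv s₁' 0) ≠ 0 := by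
    intro h
    refine hcs (-1) (by norm_num) ?_
    rw [csIndex, neg_neg, div_eq_iff hres]
    push_cast
    linear_combination h
  -- The image of the direction of `S₂` is isotropic for the second linear part, so it is the
  -- direction of `S₁'` or of `S₂'`. The first is already the image of that of `S₁`.
  have hxy0 : x * y = 0 := by
    refine (mul_eq_zero.mp ?_).resolve_right hsum
    linear_combination r
  have hy : y ≠ 0 := by
    rintro rfl
    have h3 : fderiv ℂ Φ 0 (x • deriv s₁ 0 + (-ν) • deriv s₂ 0) = 0 := by
      rw [map_add, map_smul, map_smul, h₁, hxy, zero_smul, add_zero, smul_smul, smul_smul, ← add_smul]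
      rw [show x * ν + -ν * x = 0 by ring, zero_smul]
    exact hν (neg_eq_zero.mp (LinearIndependent.pair_iff.mp hP.distinct _ _ (hΦ.diffeo.injective h3)).2)
  refine ⟨y, hy, ?_⟩
  rw [hxy, (mul_eq_zero.mp hxy0).resolve_right hy, zero_smul, zero_add]

theorem fderiv_of_restrictsTo (hΦ : IsDiffeoGerm₂ Φ) (hs : IsSmoothCurve s₁) (hs' : IsSmoothCurve s₁')
    (hφ : AnalyticAt ℂ φ 0) (hφ0 : φ 0 = 0) (hr : RestrictsTo Φ s₁ s₁' φ) :
    fderiv ℂ Φ 0 (deriv s₁ 0) = deriv φ 0 • deriv s₁' 0 :=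
  (hΦ.hasDerivAt_comp hs).unique ((HasDerivAt.scomp_of_eq (0 : ℂ) hs'.hasDerivAt
    hφ.differentiableAt.hasDerivAt hφ0.symm).congr_of_eventuallyEq hr)

/-- The leaf parameter of the second regular foliation is a coordinate on `S₁'`, so the restriction
is read by composing with it. It is invertible because `Φ` is. -/
theorem exists_restriction (hΦ : IsConjugacy ω f ω' f' Φ) (hP : IsPair ω f s₁ s₂)
    (hP' : IsPair ω' f' s₁' s₂') (hm : MapsCurve Φ s₁ s₁') :
    ∃ φ, IsDiffeoGerm₁ φ ∧ RestrictsTo Φ s₁ s₁' φ := by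
  have hs₁ := hP.sep₁.smooth
  obtain ⟨F, hF, hF0, hFs, -⟩ :=
    exists_leafParameter hP'.regular.analytic hP'.sep₁.smooth hP'.transverse₁
  have hc := hΦ.diffeo.isSmoothCurve_comp hs₁
  have hφa : AnalyticAt ℂ (fun z => F ((Φ ∘ s₁) z)) 0 :=
    AnalyticAt.fun_comp_of_eq hF hc.analytic hc.map_zero
  have hφ0 : F ((Φ ∘ s₁) 0) = 0 := by rw [hc.map_zero, hF0]
  have hr : RestrictsTo Φ s₁ s₁' fun z => F ((Φ ∘ s₁) z) := by
    filter_upwards [hm _ hFs] with z hz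
    obtain ⟨y, hy, hyz⟩ := hz
    have hy : F (s₁' y) = y := hy
    rw [Function.comp_apply, ← hyz, hy]
  refine ⟨_, ⟨hφa, hφ0, fun h0 => ?_⟩, hr⟩
  have h1 := fderiv_of_restrictsTo hΦ.diffeo hs₁ hP'.sep₁.smooth hφa hφ0 hr
  rw [h0, zero_smul] at h1
  exact hs₁.deriv_ne (hΦ.diffeo.injective h1)

/-- The sliding is an invariant of the pair of foliations. -/
theorem semiconj_of_isConjugacy (hΦ : IsConjugacy ω f ω' f' Φ) (hP : IsPair ω f s₁ s₂)
    (hP' : IsPair ω' f' s₁' s₂') (hφ : IsDiffeoGerm₁ φ) (hr : RestrictsTo Φ s₁ s₁' φ)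
    (hg : IsSliding ω f s₁ s₂ ε g) (hg' : IsSliding ω' f' s₁' s₂' ε g') :
    φ ∘ g =ᶠ[𝓝 0] g' ∘ φ := by
  obtain ⟨μ, hμ, h₂⟩ := hΦ.fderiv_separatrix hP hP' hφ.deriv_ne
    (fderiv_of_restrictsTo hΦ.diffeo hP.sep₁.smooth hP'.sep₁.smooth hφ.analytic hφ.map_zero hr)
  obtain ⟨ψ, hψ, h1, -⟩ := hφ.exists_inverse
  -- The germ `φ ∘ g ∘ φ⁻¹` is a sliding of the second pair by transport, so it equals `g'` by
  -- uniqueness.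
  have hG : (φ ∘ g ∘ ψ) ∘ φ =ᶠ[𝓝 0] φ ∘ g := by
    filter_upwards [h1] with z hz
    simp only [Function.comp_apply, hz]
  have h3 := hg.map hΦ hP.regular.analytic hP'.regular.analytic hP.sep₁.smooth hP'.sep₁.smooth hφ hr hμ
    h₂ (hφ.comp (hg.1.comp hψ)) hG
  exact hG.symm.trans ((hP'.isSliding_unique h3 hg').comp_tendsto hφ.tendsto)

theorem IsSmoothCurve.comp (hs : IsSmoothCurve s) (hφ : IsDiffeoGerm₁ φ) :
    IsSmoothCurve (s ∘ φ) ∧ deriv (s ∘ φ) 0 = deriv φ 0 • deriv s 0 := by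
  have hd : HasDerivAt (s ∘ φ) (deriv φ 0 • deriv s 0) 0 :=
    HasDerivAt.scomp_of_eq (0 : ℂ) hs.hasDerivAt hφ.hasDerivAt hφ.map_zero.symm
  refine ⟨⟨AnalyticAt.comp_of_eq hs.analytic hφ.analytic hφ.map_zero, ?_, ?_⟩, hd.deriv⟩
  · simp [hφ.map_zero, hs.map_zero]
  · rw [hd.deriv]
    exact smul_ne_zero hφ.deriv_ne hs.deriv_ne

theorem IsPair.reparam (hP : IsPair ω f s₁ s₂) (hφ : IsDiffeoGerm₁ φ) : IsPair ω f (s₁ ∘ φ) s₂ := by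
  obtain ⟨h1, h2⟩ := hP.sep₁.smooth.comp hφ
  refine ⟨hP.reduced, hP.regular, ⟨h1, ?_⟩, hP.sep₂, ?_, ?_, hP.transverse₂⟩
  · filter_upwards [hφ.tendsto.eventually hP.sep₁.invariant, hφ.analytic.eventually_analyticAt,
      hφ.tendsto.eventually hP.sep₁.smooth.analytic.eventually_analyticAt] with z h3 h4 h5
    rw [(HasDerivAt.scomp z h5.differentiableAt.hasDerivAt h4.differentiableAt.hasDerivAt).deriv,
      map_smul, Function.comp_apply, h3, smul_zero]
  · rw [h2, LinearIndependent.pair_iff]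
    intro x y hxy
    rw [smul_smul] at hxy
    obtain ⟨h3, h4⟩ := LinearIndependent.pair_iff.mp hP.distinct _ _ hxy
    exact ⟨(mul_eq_zero.mp h3).resolve_right hφ.deriv_ne, h4⟩
  · rw [h2, map_smul]
    exact smul_ne_zero hφ.deriv_ne hP.transverse₁

theorem csIndex_reparam (hs : IsSmoothCurve s₁) (hφ : IsDiffeoGerm₁ φ) :
    csIndex ω (s₁ ∘ φ) s₂ = csIndex ω s₁ s₂ := by
  rw [csIndex, csIndex, (hs.comp hφ).2, map_smul, map_smul, smul_apply, smul_eq_mul, smul_eq_mul,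
    mul_div_mul_left _ _ hφ.deriv_ne]

/-- The identity of the plane, regarded as a conjugacy, restricts to the inverse of `φ` between the
two parametrizations. -/
theorem IsSliding.reparam (hP : IsPair ω f s₁ s₂) (hg : IsSliding ω f s₁ s₂ ε g)
    (hφ : IsDiffeoGerm₁ φ) (hg' : IsDiffeoGerm₁ g') (h : φ ∘ g' =ᶠ[𝓝 0] g ∘ φ) :
    IsSliding ω f (s₁ ∘ φ) s₂ ε g' := by
  obtain ⟨ψ, hψ, h1, h2⟩ := hφ.exists_inverse
  refine hg.map isConjugacy_id hP.regular.analytic hP.regular.analytic hP.sep₁.smooth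
    (hP.sep₁.smooth.comp hφ).1 hψ ?_ one_ne_zero (by simp) hg' ?_
  · filter_upwards [h2] with z hz
    simp [hz]
  · filter_upwards [h2, hψ.tendsto.eventually h, (hg'.comp hψ).tendsto.eventually h1] with z e1 e2 e3
    simp only [Function.comp_apply] at *
    rw [← e3, e2, e1]

theorem exists_isConjugacy_of_isSliding (hP : IsPair ω f s₁ s₂) (hP' : IsPair ω' f' s₁' s₂')
    (hcs : csIndex ω s₁ s₂ = csIndex ω' s₁' s₂') (hg : IsSliding ω f s₁ s₂ ε g)
    (hg' : IsSliding ω' f' s₁' s₂' ε g) : ∃ Φ, IsConjugacy ω f ω' f' Φ ∧ RestrictsTo Φ s₁ s₁' id := by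
  obtain ⟨B, Ψ, hB, hΨ, h1, μ, hμ, h2⟩ := hP.exists_normalForm
  obtain ⟨B', Ψ', hB', hΨ', h1', μ', hμ', h2'⟩ := hP'.exists_normalForm
  rw [← hcs] at hB'
  obtain ⟨Θ, hΘ, hΘ0⟩ := exists_isConjugacy_std hB hB' hP.residues.2.2
    ((isSliding_std_iff hP hΨ h1 hμ h2).mpr hg) ((isSliding_std_iff hP' hΨ' h1' hμ' h2').mpr hg')
  obtain ⟨X, hX, hXΨ, hΨX⟩ := hΨ.diffeo.exists_inverse
  refine ⟨(Ψ' ∘ Θ) ∘ X, (hΨ'.comp hΘ).comp (hΨ.symm analyticAt_stdLevel.continuousAt hX hΨX), ?_⟩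
  filter_upwards [h1, h1', hΘ0, isSmoothCurve_axis.tendsto.eventually hXΨ] with y e1 e2 e3 e4
  rw [← e1, Function.comp_apply, e4, Function.comp_apply, e3, e2]
  rfl

/-- In the normal form of the first pair, `Ψ⁻¹ ∘ Φ` is a self-conjugacy that fixes the axis `x = 0`.
-/
theorem IsConjugacy.unique (hP : IsPair ω f s₁ s₂) (hΦ : IsConjugacy ω f ω' f' Φ)
    (hΨ : IsConjugacy ω f ω' f' Ψ) (h : ∀ᶠ z in 𝓝 0, Φ (s₁ z) = Ψ (s₁ z)) : Φ =ᶠ[𝓝 0] Ψ := by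
  obtain ⟨B, Λ, hB, hΛ, h1, -⟩ := hP.exists_normalForm
  obtain ⟨X, hX, hXΛ, hΛX⟩ := hΛ.diffeo.exists_inverse
  obtain ⟨Y, hY, hYΨ, hΨY⟩ := hΨ.diffeo.exists_inverse
  have hself := ((hΛ.symm analyticAt_stdLevel.continuousAt hX hΛX).comp
    ((hΨ.symm hP.regular.analytic.continuousAt hY hΨY).comp hΦ)).comp hΛ
  have hid := eventuallyEq_id_of_isConjugacy_std hB hself (by
    filter_upwards [h1, h, hP.sep₁.smooth.tendsto.eventually hYΨ,
      isSmoothCurve_axis.tendsto.eventually hXΛ] with y e1 e2 e3 e4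
    simp only [Function.comp_apply]
    rw [e1, e2, e3, ← e1, e4])
  have hev : ∀ᶠ q in 𝓝 0, Φ (Λ q) = Ψ (Λ q) := by
    have hYΦ := (hY.comp hΦ.diffeo).tendsto
    filter_upwards [hid, hΛ.diffeo.tendsto.eventually (hYΦ.eventually hΛX),
      (hΦ.diffeo.comp hΛ.diffeo).tendsto.eventually hΨY] with q e1 e2 e3
    simp only [Function.comp_apply, id] at e1 e2 e3
    rw [e1] at e2
    exact e3.symm.trans (congrArg Ψ e2.symm)
  filter_upwards [hX.tendsto.eventually hev, hΛX] with q e1 e2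
  rwa [e2] at e1

end

end Sliding

theorem mainTheorem6
    (ω ω' : OneForm) (f f' : ℂ × ℂ → ℂ) (s₁ s₂ s₁' s₂' : ℂ → ℂ × ℂ)
    (hP : IsPair ω f s₁ s₂) (hP' : IsPair ω' f' s₁' s₂') (ε : ℤˣ) :
    (∃ g : ℂ → ℂ, IsSliding ω f s₁ s₂ ε g ∧
      ∀ g₀ : ℂ → ℂ, IsSliding ω f s₁ s₂ ε g₀ → g₀ =ᶠ[𝓝 0] g) ∧
    ∀ g g' : ℂ → ℂ, IsSliding ω f s₁ s₂ ε g → IsSliding ω' f' s₁' s₂' ε g' →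
      (∀ Φ : ℂ × ℂ → ℂ × ℂ, IsConjugacy ω f ω' f' Φ → MapsCurve Φ s₁ s₁' →
        ∃ φ : ℂ → ℂ, IsDiffeoGerm₁ φ ∧ RestrictsTo Φ s₁ s₁' φ ∧ φ ∘ g =ᶠ[𝓝 0] g' ∘ φ) ∧
      (csIndex ω s₁ s₂ = csIndex ω' s₁' s₂' →
        ∀ φ : ℂ → ℂ, IsDiffeoGerm₁ φ → φ ∘ g =ᶠ[𝓝 0] g' ∘ φ →
          (∃ Φ : ℂ × ℂ → ℂ × ℂ, IsConjugacy ω f ω' f' Φ ∧ RestrictsTo Φ s₁ s₁' φ) ∧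
          ∀ Φ Ψ : ℂ × ℂ → ℂ × ℂ,
            IsConjugacy ω f ω' f' Φ → RestrictsTo Φ s₁ s₁' φ →
            IsConjugacy ω f ω' f' Ψ → RestrictsTo Ψ s₁ s₁' φ → Φ =ᶠ[𝓝 0] Ψ) := by
  refine ⟨?_, fun g g' hg hg' => ⟨fun Φ hΦ hm => ?_, fun hcs φ hφ hφg => ⟨?_, ?_⟩⟩⟩
  · obtain ⟨g, hg⟩ := hP.exists_isSliding ε
    exact ⟨g, hg, fun g₀ hg₀ => hP.isSliding_unique hg₀ hg⟩
  · obtain ⟨φ, hφ, hr⟩ := exists_restriction hΦ hP hP' hm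
    exact ⟨φ, hφ, hr, semiconj_of_isConjugacy hΦ hP hP' hφ hr hg hg'⟩
  -- With `S₁'` parametrized by `s₁' ∘ φ`, both pairs have the same sliding `g`, and a conjugacy
  -- that is the identity in the parameters restricts to `φ` in the original ones.
  · exact exists_isConjugacy_of_isSliding hP (hP'.reparam hφ)
      (hcs.trans (csIndex_reparam hP'.sep₁.smooth hφ).symm) hg (hg'.reparam hP' hφ hg.1 hφg)
  · intro Φ Ψ hΦ hΦr hΨ hΨr
    exact IsConjugacy.unique hP hΦ hΨ (EventuallyEq.trans hΦr (EventuallyEq.symm hΨr))
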